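/- Let $M\ge 0$ and $Q\in\mathbb{R}$ with $|Q|>M$, let $m\ge 0$, $q\in\mathbb{R}$, and put $A(r)=\bigl(1-\tfrac{2M}{r}+\tfrac{Q^2}{r^2}\bigr)^{1/2}$ for $r>0$. Let $\mathscr{H}=\mathscr{H}^{(0)}\oplus\mathscr{H}^{(1)}$ with $\mathscr{H}^{(0)}=\mathbb{C}$ and $\mathscr{H}^{(1)}=L^2\bigl((0,\infty)\times\mathbb{S}^2,\mathbb{C}^4,A^{-1}r^2\,dr\,d^2\omega\bigr)$, $d^2\omega=\sin\vartheta\,d\vartheta\,d\varphi$, and write $\Psi=(\Psi^{(0)},\Psi^{(1)})$. Spinor components refer to the spin basis $b$ of the spherical orthonormal frame; they arise from the components in the (globally smooth) Cartesian spin basis by multiplication with $\mathrm{diag}(W,W)$, $$W=\frac{1}{\sqrt2}\begin{bmatrix} i e^{i(\vartheta+\varphi)/2}& e^{i(\vartheta-\varphi)/2}\\ i e^{i(-\vartheta+\varphi)/2}&-e^{i(-\vartheta-\varphi)/2}\end{bmatrix}=[w_1\;w_2].$$ With $\beta=\mathrm{diag}(1,1,-1,-1)$ and $\alpha^i=\begin{pmatrix}0&\sigma_i\\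 \sigma_i&0\end{pmatrix}$, the Dirac Hamiltonian is $$H_1=-i\alpha^1A^2\bigl(\partial_r+\tfrac1r+\tfrac{A'}{2A}\bigr)-i\alpha^2\tfrac{A}{r}\bigl(\partial_\vartheta+\tfrac12\cot\vartheta\bigr)-i\alpha^3\tfrac{A}{r\sin\vartheta}\partial_\varphi+mA\beta+\tfrac{qQ}{r}.$$ Let $C_c^\infty$ denote the smooth compactly supported spinor fields on $(0,\infty)\times\mathbb{S}^2\cong\mathbb{R}^3\setminus\{0\}$ (smooth in the Cartesian spin basis). Let $\mathscr{A}$ be the set of $(m_j,\kappa_j)$ with $\kappa_j\in\mathbb{Z}\setminus\{0\}$, $m_j+\frac12\in\mathbb{Z}$, $|m_j|\le j:=|\kappa_j|-\frac12$, and let $$\Phi^+_{m_j,\mp(j+\frac12)}=\begin{pmatrix} i\Psi^{m_j}_{j\mp\frac12}\\0\end{pmatrix},\qquad \Phi^-_{m_j,\mp(j+\frac12)}=\begin{pmatrix}0\\ \Psi^{m_j}_{j\pm\frac12}\end{pmatrix},$$ $$\Psi^{m_j}_{j-\frac12}=\sqrt{\tfrac{j+m_j}{2j}}\,Y^{m_j-\frac12}_{j-\frac12}w_1+\sqrt{\tfrac{j-m_j}{2j}}\,Y^{m_j+\frac12}_{j-\frac12}w_2,\qquad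 \Psi^{m_j}_{j+\frac12}=\sqrt{\tfrac{j+1-m_j}{2j+2}}\,Y^{m_j-\frac12}_{j+\frac12}w_1-\sqrt{\tfrac{j+1+m_j}{2j+2}}\,Y^{m_j+\frac12}_{j+\frac12}w_2,$$ where $Y_\ell^m$ are the spherical harmonics with the Condon–Shortley phase; the $\Phi^\pm_{m_j\kappa_j}$ form an orthonormal basis of $L^2(\mathbb{S}^2,\mathbb{C}^4)$. **Theorem.** For every $(\widetilde m_j,\widetilde\kappa_j)\in\mathscr{A}$, $g\in\mathbb{C}\setminus\{0\}$ and $a_1,a_2,a_3,a_4\in\mathbb{R}$ with $a_1a_4-a_2a_3=1$, there is a self-adjoint operator $H$ with domain $D\subset\mathscr{H}$ such that: 1. For every $\Psi\in D$ there are uniquely determined short-distance coefficients $c_-\in\mathbb{C}$ and $c_{+m_j\kappa_j}\in\mathbb{C}$ ($(m_j,\kappa_j)\in\mathscr{A}$) such that, as $r\to0$, $$\Psi^{(1)}(r,\omega)=\frac{c_-}{|Q|^{1/2}}r^{-1/2}\Phi^-_{\widetilde m_j\widetilde\kappa_j}(\omega)+\sum_{(m_j,\kappa_j)\in\mathscr{A}}\frac{c_{+m_j\kappa_j}}{|Q|^{1/2}}r^{-1/2}\Phi^+_{m_j\kappa_j}(\omega)+\mathcal{O}(r^{1/2})$$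 in the sense of distributions on $\mathbb{S}^2$. That is, for some $N\in\mathbb{N}$, $C$ and $r_0>0$, the remainder $\rho(r,\cdot)$, with coefficients $\rho^\pm_{m_j\kappa_j}(r)$ relative to the basis $\Phi^\pm_{m_j\kappa_j}$, satisfies $\sum_{(m_j,\kappa_j)\in\mathscr{A}}|\kappa_j|^{-2N}\bigl(|\rho^+_{m_j\kappa_j}(r)|^2+|\rho^-_{m_j\kappa_j}(r)|^2\bigr)\le C\,r$ for almost every $r\in(0,r_0)$. 2. Every $\Psi\in D$ satisfies the interior-boundary condition $a_1c_-+a_2c_{+\widetilde m_j\widetilde\kappa_j}=g\,\Psi^{(0)}$. 3. For every $\psi\in C_c^\infty$, $(0,\psi)\in D$ and $H(0,\psi)=(0,H_1\psi)$. 4. For every $\Psi\in D$, $(H\Psi)^{(0)}=g^*\bigl(a_3c_-+a_4c_{+\widetilde m_j\widetilde\kappa_j}\bigr)$. 5. $H$ is not block diagonal in the decomposition $\mathscr{H}^{(0)}\oplus\mathscr{H}^{(1)}$. -/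

import Mathlib

open MeasureTheory Complex

namespace SRN

noncomputable section

/-- Dirac spin space `ℂ⁴` with its standard Hermitian inner product. -/
abbrev Spinor : Type := EuclideanSpace ℂ (Fin 4)

/-! ### Geometry and Hilbert space -/

/-- `A(r) = √(1 - 2M/r + Q²/r²)`. -/
def A (M Q r : ℝ) : ℝ := Real.sqrt (1 - 2 * M / r + Q ^ 2 / r ^ 2)

/-- The radial measure `A(r)⁻¹ r² dr` on `(0,∞)`. -/
def radialMeasure (M Q : ℝ) : Measure ℝ :=
  (volume.restrict (Set.Ioi 0)).withDensity fun r => ENNReal.ofReal ((A M Q r)⁻¹ * r ^ 2)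

/-- The surface measure `d²ω = sin ϑ dϑ dφ` of the unit sphere in the coordinates
`(ϑ, φ) ∈ (0, π) × (0, 2π)`, which cover the sphere up to a null set. -/
def sphereMeasure : Measure (ℝ × ℝ) :=
  (volume.restrict (Set.Ioo 0 Real.pi ×ˢ Set.Ioo 0 (2 * Real.pi))).withDensity
    fun ω => ENNReal.ofReal (Real.sin ω.1)

/-- The measure `A⁻¹ r² dr d²ω`; points are written `(r, (ϑ, φ))`. -/
def spaceMeasure (M Q : ℝ) : Measure (ℝ × (ℝ × ℝ)) :=
  (radialMeasure M Q).prod sphereMeasure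

/-- One-particle Hilbert space `L²((0,∞) × S², ℂ⁴, A⁻¹ r² dr d²ω)`; the four components are
relative to the spin basis belonging to the spherical orthonormal frame. -/
abbrev OneParticle (M Q : ℝ) : Type := Lp Spinor 2 (spaceMeasure M Q)

/-- The mini-Fock space `ℂ ⊕ L²`, an orthogonal sum of Hilbert spaces. -/
abbrev Fock (M Q : ℝ) : Type := WithLp 2 (ℂ × OneParticle M Q)

/-! ### Dirac matrices and the Dirac Hamiltonian -/

/-- `α¹ = γ⁰γ¹`, with blocks `0, σ₁; σ₁, 0`. -/
def alpha1 : Matrix (Fin 4) (Fin 4) ℂ :=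
  !![0, 0, 0, 1; 0, 0, 1, 0; 0, 1, 0, 0; 1, 0, 0, 0]

/-- `α² = γ⁰γ²`, with blocks `0, σ₂; σ₂, 0`. -/
def alpha2 : Matrix (Fin 4) (Fin 4) ℂ :=
  !![0, 0, 0, -I; 0, 0, I, 0; 0, -I, 0, 0; I, 0, 0, 0]

/-- `α³ = γ⁰γ³`, with blocks `0, σ₃; σ₃, 0`. -/
def alpha3 : Matrix (Fin 4) (Fin 4) ℂ :=
  !![0, 0, 1, 0; 0, 0, 0, -1; 1, 0, 0, 0; 0, -1, 0, 0]

/-- `β = γ⁰ = diag(1, 1, -1, -1)`. -/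
def beta : Matrix (Fin 4) (Fin 4) ℂ :=
  !![1, 0, 0, 0; 0, 1, 0, 0; 0, 0, -1, 0; 0, 0, 0, -1]

/-- A matrix acting on a spinor. -/
def act (B : Matrix (Fin 4) (Fin 4) ℂ) (v : Spinor) : Spinor := Matrix.toEuclideanLin B v

/-- The Dirac Hamiltonian of a particle of mass `m` and charge `q`, relative to the spin basis
of the spherical orthonormal frame, as a differential expression at `(r, (ϑ, φ))`:
`-i α¹ A² (∂_r + 1/r + A'/(2A)) - i α² (A/r) (∂_ϑ + (cot ϑ)/2) - i α³ A/(r sin ϑ) ∂_φ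
 + m A β + qQ/r`. -/
def diracH (M Q m q : ℝ) (ψ : ℝ × (ℝ × ℝ) → Spinor) (p : ℝ × (ℝ × ℝ)) : Spinor :=
  let r := p.1
  let θ := p.2.1
  let φ := p.2.2
  let a := A M Q r
  (-I * (a : ℂ) ^ 2) • act alpha1
      (deriv (fun s => ψ (s, (θ, φ))) r + (r⁻¹ + deriv (A M Q) r / (2 * a)) • ψ p)
    + (-I * ((a / r : ℝ) : ℂ)) • act alpha2
      (deriv (fun s => ψ (r, (s, φ))) θ + (Real.cot θ / 2) • ψ p)
    + (-I * ((a / (r * Real.sin θ) : ℝ) : ℂ)) • act alpha3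
      (deriv (fun s => ψ (r, (θ, s))) φ)
    + (m * a) • act beta (ψ p)
    + (q * Q / r) • ψ p

/-! ### Change of spin basis and test spinors -/

/-- Passage from components relative to the (global, smooth) Cartesian spin basis to components
relative to the spherical one: multiplication by `diag(W, W)`, where
`W = 2^(-1/2) [ i e^{i(ϑ+φ)/2}, e^{i(ϑ-φ)/2} ; i e^{i(-ϑ+φ)/2}, -e^{i(-ϑ-φ)/2} ]`. -/
def toSpherical (ω : ℝ × ℝ) (v : Spinor) : Spinor :=
  let s : ℂ := ((Real.sqrt 2)⁻¹ : ℝ)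
  let w11 := s * (I * exp (I * (ω.1 + ω.2) / 2))
  let w12 := s * exp (I * (ω.1 - ω.2) / 2)
  let w21 := s * (I * exp (I * (-ω.1 + ω.2) / 2))
  let w22 := -(s * exp (I * (-ω.1 - ω.2) / 2))
  !₂[w11 * v 0 + w12 * v 1, w21 * v 0 + w22 * v 1,
     w11 * v 2 + w12 * v 3, w21 * v 2 + w22 * v 3]

/-- The point of `ℝ³` with spherical coordinates `(r, (ϑ, φ))`. -/
def cartesian (p : ℝ × (ℝ × ℝ)) : EuclideanSpace ℝ (Fin 3) :=
  !₂[p.1 * Real.sin p.2.1 * Real.cos p.2.2, p.1 * Real.sin p.2.1 * Real.sin p.2.2,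
     p.1 * Real.cos p.2.1]

/-- A smooth spinor field with compact support in `ℝ³ ∖ {0} ≅ (0,∞) × S²`, given by its
components in the Cartesian spin basis. -/
structure IsTestSpinor (χ : EuclideanSpace ℝ (Fin 3) → Spinor) : Prop where
  smooth : ContDiff ℝ (⊤ : ℕ∞) χ
  compact : HasCompactSupport χ
  away : (0 : EuclideanSpace ℝ (Fin 3)) ∉ tsupport χ

/-- A spinor field on `ℝ³ ∖ {0}` in spherical coordinates and in the spherical spin basis. -/
def sphericalField (χ : EuclideanSpace ℝ (Fin 3) → Spinor) (p : ℝ × (ℝ × ℝ)) : Spinor :=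
  toSpherical p.2 (χ (cartesian p))

/-! ### Spinor spherical harmonics -/

/-- The spherical harmonic `Y_ℓ^m(ϑ, φ)`, `-ℓ ≤ m ≤ ℓ`, with the Condon-Shortley phase, where the
associated Legendre function is given by the Rodrigues formula
`(1-x²)^{m/2} (2^ℓ ℓ!)⁻¹ (d/dx)^{ℓ+m} (x²-1)^ℓ` at `x = cos ϑ`. -/
def sphericalY (l : ℕ) (m : ℤ) (ω : ℝ × ℝ) : ℂ :=
  (((-1) ^ m * Real.sqrt ((2 * l + 1) / (4 * Real.pi)
      * (((l - m).toNat.factorial : ℝ) / ((l + m).toNat.factorial : ℝ)))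
    * (Real.sin ω.1 ^ m / (2 ^ l * (l.factorial : ℝ))
      * (Polynomial.derivative^[(l + m).toNat]
          ((Polynomial.X ^ 2 - 1 : Polynomial ℝ) ^ l)).eval (Real.cos ω.1)) : ℝ) : ℂ)
  * exp (I * m * ω.2)

/-- The index set `𝒜` of pairs `(m_j, κ_j)`: `κ_j` is a nonzero integer, `m_j + 1/2` is an integer
(here `n`), and `|m_j| ≤ |κ_j| - 1/2`. -/
@[ext] structure AngIndex where
  n : ℤ
  kappa : ℤ
  kappa_ne : kappa ≠ 0
  bound : |(n : ℝ) - 1 / 2| ≤ |(kappa : ℝ)| - 1 / 2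

/-- `m_j`. -/
def AngIndex.mj (σ : AngIndex) : ℝ := (σ.n : ℝ) - 1 / 2

/-- `j = |κ_j| - 1/2`. -/
def AngIndex.j (σ : AngIndex) : ℝ := |(σ.kappa : ℝ)| - 1 / 2

/-- The two Cartesian components of `Ψ_{j-1/2}^{m_j}`; note `j - 1/2 = |κ_j| - 1`,
`m_j - 1/2 = n - 1` and `m_j + 1/2 = n`. (Where the index of `Y` is out of range, its coefficient
is zero.) -/
def psiLow (σ : AngIndex) (ω : ℝ × ℝ) : ℂ × ℂ :=
  ((Real.sqrt ((σ.j + σ.mj) / (2 * σ.j)) : ℂ) * sphericalY (σ.kappa.natAbs - 1) (σ.n - 1) ω,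
   (Real.sqrt ((σ.j - σ.mj) / (2 * σ.j)) : ℂ) * sphericalY (σ.kappa.natAbs - 1) σ.n ω)

/-- The two Cartesian components of `Ψ_{j+1/2}^{m_j}`; note `j + 1/2 = |κ_j|`. -/
def psiHigh (σ : AngIndex) (ω : ℝ × ℝ) : ℂ × ℂ :=
  ((Real.sqrt ((σ.j + 1 - σ.mj) / (2 * σ.j + 2)) : ℂ) * sphericalY σ.kappa.natAbs (σ.n - 1) ω,
   -((Real.sqrt ((σ.j + 1 + σ.mj) / (2 * σ.j + 2)) : ℂ) * sphericalY σ.kappa.natAbs σ.n ω))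

/-- `Φ⁺_{m_j κ_j}`, in the spherical spin basis: upper components `i Ψ_{j-1/2}^{m_j}` if
`κ_j = -(j+1/2)` and `i Ψ_{j+1/2}^{m_j}` if `κ_j = j+1/2`, lower components zero. -/
def PhiPlus (σ : AngIndex) (ω : ℝ × ℝ) : Spinor :=
  let u := if σ.kappa < 0 then psiLow σ ω else psiHigh σ ω
  toSpherical ω !₂[I * u.1, I * u.2, 0, 0]

/-- `Φ⁻_{m_j κ_j}`, in the spherical spin basis: lower components `Ψ_{j+1/2}^{m_j}` if
`κ_j = -(j+1/2)` and `Ψ_{j-1/2}^{m_j}` if `κ_j = j+1/2`, upper components zero. -/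
def PhiMinus (σ : AngIndex) (ω : ℝ × ℝ) : Spinor :=
  let u := if σ.kappa < 0 then psiHigh σ ω else psiLow σ ω
  toSpherical ω !₂[0, 0, u.1, u.2]

/-! ### Short-distance asymptotics -/

/-- The `L²(S²)` inner product `⟨Φ, ψ(r, ·)⟩`. -/
def angCoeff (Φ : ℝ × ℝ → Spinor) (ψ : ℝ × (ℝ × ℝ) → Spinor) (r : ℝ) : ℂ :=
  ∫ ω, inner ℂ (Φ ω) (ψ (r, ω)) ∂sphereMeasure

open scoped Classical in
/-- The asymptotic expansion
`ψ(r,ω) = c₋ |Q|^{-1/2} r^{-1/2} Φ⁻_{σ₀}(ω) + ∑_σ c₊σ |Q|^{-1/2} r^{-1/2} Φ⁺_σ(ω) + O(r^{1/2})`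
as `r → 0`, in the sense of distributions on the sphere. That is, the remainder is `O(r^{1/2})` in
a Sobolev space `H^{-N}(S²)` for some `N`, whose squared norm is the sum of the squared absolute
values of the coefficients relative to the orthonormal basis `Φ^±_{m_j κ_j}` with the weight
`|κ_j|^{-2N}`. Sums of nonnegative terms over all indices are bounded through their finite partial
sums; an `L²` function has a restriction to the sphere of radius `r` for almost every `r`. -/
def HasShortDistance (M Q : ℝ) (σ₀ : AngIndex) (ψ : OneParticle M Q)
    (cMinus : ℂ) (cPlus : AngIndex → ℂ) : Prop :=
  ∃ N : ℕ, ∃ C r₀ : ℝ, 0 < r₀ ∧ ∀ᵐ r ∂(volume.restrict (Set.Ioo (0 : ℝ) r₀)),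
    ∀ s : Finset AngIndex,
      ∑ σ ∈ s,
        (‖angCoeff (PhiPlus σ) ψ r
            - cPlus σ / ((Real.sqrt |Q| * Real.sqrt r : ℝ) : ℂ)‖ ^ 2
          + ‖angCoeff (PhiMinus σ) ψ r
            - (if σ = σ₀ then cMinus else 0) / ((Real.sqrt |Q| * Real.sqrt r : ℝ) : ℂ)‖ ^ 2)
        / |(σ.kappa : ℝ)| ^ (2 * N)
      ≤ C * r

/-! ### Block-diagonal operators -/

/-- An operator in `ℂ ⊕ L²` is block diagonal if it is the direct sum `F₀ ⊕ F₁` of operators in the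
two summands: its domain is `dom F₀ × dom F₁`, and it acts as `(x, y) ↦ (F₀ x, F₁ y)`. -/
def IsBlockDiagonal {M Q : ℝ} (H : Fock M Q →ₗ.[ℂ] Fock M Q) : Prop :=
  ∃ (F₀ : ℂ →ₗ.[ℂ] ℂ) (F₁ : OneParticle M Q →ₗ.[ℂ] OneParticle M Q),
    (∀ Ψ : Fock M Q, Ψ ∈ H.domain ↔ Ψ.fst ∈ F₀.domain ∧ Ψ.snd ∈ F₁.domain) ∧
    ∀ (Ψ : H.domain) (x : F₀.domain) (y : F₁.domain),
      (x : ℂ) = (Ψ : Fock M Q).fst → (y : OneParticle M Q) = (Ψ : Fock M Q).snd →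
        (H Ψ).fst = F₀ x ∧ (H Ψ).snd = F₁ y

end

end SRN

/-!
The angular part of the Dirac operator is diagonalized by the spinor harmonics, the remaining radial
operators are regular at `r = 0` because `|Q| > M`, and the interior-boundary condition is a
Lagrangian condition on the boundary values at `r = 0`.

**Angular decomposition.** The spherical harmonics are orthonormal by the ladder relations of the
raising and lowering operators (`spherePair_sphericalY`), and complete because Fourier series in `φ`
and polynomials in `cos ϑ` are (`ae_eq_zero_of_spherePair_sphericalY`). Hence the `Φ^±_σ` form an
orthonormal basis, and a field decomposes into channel functions in `L²((0,∞), dr)` (`chan`,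
`isHilbertSum_embed`), where the square root of the radial density is absorbed into the function.
The operator `1 + σ·L` has eigenvalue `-κ` on the spinor harmonics, and `x̂·σ` exchanges `κ` and
`-κ` (`spinPair_spinHarm_angK`, `sigmaR_spinHarm`).

**Radial equations.** For `|Q| > M` the function `ρ(r) = r A(r) = √(r² - 2Mr + Q²)` is bounded below
by a positive constant, so with `τ = ∫₀^r dt/ρ(t)` the radial equations of a channel can be
integrated from `r = 0` on. This gives the relation `HalfRel` for each of the two components; its
constants of integration are the short-distance coefficients `p` of `Φ⁺` and `n` of `Φ⁻`. Two
solutions of these equations have boundary form `n̄₁ p₂ - p̄₁ n₂` at `r = 0`, and there is no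
contribution from infinity, where the boundary form has a limit and is integrable
(`green_identity`).

**Self-adjointness.** The graph `ibcGraph` requires `n = 0` in all channels but `σ₀`, and in `σ₀`
the interior-boundary condition together with the formula for the zero-particle component of the
image. As `a₁a₄ - a₂a₃ = 1`, the boundary form in the channel `σ₀` is cancelled exactly by the
zero-particle sector, so the graph is symmetric (`ibcGraph_le_adjoint`). Conversely, an element of
the adjoint, tested with fields whose amplitudes are constant near `r = 0`, satisfies the radial
equations weakly and, by the values at `r = 0` of the test functions, the boundary conditions
(`adjoint_le_ibcGraph`). The graph is thus its own adjoint. It is single-valued, hence so is its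
adjoint, which makes the domain dense: `ibcHamiltonian` is self-adjoint.

**Asymptotics.** The amplitude of a solution at `r` is bounded by its average over an interval of
length `1/|κ|` at distance `1/|κ|`, over which the exponentials `e^{±κτ}` vary only by a bounded
factor; so all constants are polynomial in `κ` (`exists_amp_estimate`). Summation over the channels
by Parseval's identity gives the short-distance expansion with remainder `O(r^{1/2})` in the sense
of distributions on the sphere (`hasShortDistance_of_chanRel`). Its coefficients are unique since a
multiple of `r^{-1/2}` is not `O(r^{1/2})` (`HasShortDistance.unique`).

**Test spinors and off-diagonality.** In the Cartesian spin basis the Dirac operator is `-i (x̂·σ)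
(A² (∂_r + …) - (A/r) (1 + σ·L))` on each half of the spinor (`diracH_sphericalField`). Test spinors
therefore satisfy the radial equations in each channel, and they vanish near `r = 0`
(`chanRel_of_isTestSpinor`). If the Hamiltonian were block diagonal, its domain would contain a
vector with nonzero zero-particle component and zero field, which violates the interior-boundary
condition as `g ≠ 0` (`not_isBlockDiagonal_ibcHamiltonian`).
-/

open MeasureTheory Complex

namespace SRN

noncomputable section

/-! ### Ladder relations for spherical harmonics -/

open Polynomial in
theorem iterate_derivative_ode_zero (l : ℕ) :
    (1 - X ^ 2) * derivative ((X ^ 2 - 1 : ℝ[X]) ^ l)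
      = C (-2 * l : ℝ) * X * (X ^ 2 - 1 : ℝ[X]) ^ l := by
  rcases l with _ | l
  · simp
  · simp only [derivative_pow, derivative_sub, derivative_one]
    simp only [map_mul, map_neg, Polynomial.C_ofNat, map_natCast, Nat.cast_add, Nat.cast_one,
      map_add, map_one]
    simp
    ring

open Polynomial in
/-- The Legendre-type differential equation satisfied by the iterated derivatives of
`(X² - 1)^l`. -/
theorem iterate_derivative_ode (l k : ℕ) :
    (1 - X ^ 2) * derivative^[k + 2] ((X ^ 2 - 1 : ℝ[X]) ^ l)
      = C (2 * (k + 1) - 2 * l : ℝ) * X * derivative^[k + 1] ((X ^ 2 - 1 : ℝ[X]) ^ l)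
        + C ((k + 1) * (k - 2 * l) : ℝ) * derivative^[k] ((X ^ 2 - 1 : ℝ[X]) ^ l) := by
  have h0 := iterate_derivative_ode_zero l
  induction k with
  | zero =>
    have h := congrArg derivative h0
    simp only [derivative_mul, derivative_sub, derivative_one, derivative_X_pow, derivative_C,
      derivative_X] at h
    simp only [Function.iterate_succ_apply', Function.iterate_zero_apply]
    simp only [map_mul, map_neg, Polynomial.C_ofNat, map_natCast, map_sub, map_add, map_one,
      Nat.cast_zero, map_zero] at h ⊢
    norm_num at h ⊢
    linear_combination h
  | succ k ih =>
    have h := congrArg derivative ih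
    simp only [derivative_mul, derivative_sub, derivative_one, derivative_X_pow, derivative_C,
      derivative_X, derivative_add, ← Function.iterate_succ_apply' derivative] at h
    simp only [map_mul, Polynomial.C_ofNat, map_natCast, map_sub, map_add, map_one,
      Nat.cast_zero, map_zero, Nat.cast_succ] at h ⊢
    norm_num at h ⊢
    linear_combination h

/-- The function `c (sin ϑ)^m p(cos ϑ) e^{imφ}` on the sphere. -/
def zonal (c : ℝ) (m : ℤ) (p : Polynomial ℝ) (ω : ℝ × ℝ) : ℂ :=
  ((c * (Real.sin ω.1 ^ m * p.eval (Real.cos ω.1)) : ℝ) : ℂ) * exp (I * m * ω.2)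

/-- The partial derivative `∂_ϑ`. -/
def dTheta (f : ℝ × ℝ → ℂ) (ω : ℝ × ℝ) : ℂ := deriv (fun s => f (s, ω.2)) ω.1

/-- The partial derivative `∂_φ`. -/
def dPhi (f : ℝ × ℝ → ℂ) (ω : ℝ × ℝ) : ℂ := deriv (fun s => f (ω.1, s)) ω.2

/-- The raising operator `L₊ = e^{iφ}(∂_ϑ + i cot ϑ ∂_φ)` of angular momentum. -/
def raising (f : ℝ × ℝ → ℂ) (ω : ℝ × ℝ) : ℂ :=
  exp (I * ω.2) * (dTheta f ω + I * (Real.cos ω.1 / Real.sin ω.1 : ℝ) * dPhi f ω)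

/-- The lowering operator `L₋ = e^{-iφ}(-∂_ϑ + i cot ϑ ∂_φ)` of angular momentum. -/
def lowering (f : ℝ × ℝ → ℂ) (ω : ℝ × ℝ) : ℂ :=
  exp (-(I * ω.2)) * (-dTheta f ω + I * (Real.cos ω.1 / Real.sin ω.1 : ℝ) * dPhi f ω)

theorem dPhi_zonal (c : ℝ) (m : ℤ) (p : Polynomial ℝ) (ω : ℝ × ℝ) :
    dPhi (zonal c m p) ω = I * m * zonal c m p ω := by
  unfold dPhi zonal
  have h : HasDerivAt (fun s : ℝ => exp (I * m * s)) (exp (I * m * ω.2) * (I * m * 1)) ω.2 :=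
    (((hasDerivAt_id _).ofReal_comp).const_mul (I * m)).cexp
  refine (h.const_mul
    ((c * (Real.sin ω.1 ^ m * p.eval (Real.cos ω.1)) : ℝ) : ℂ)).deriv.trans ?_
  ring

theorem dTheta_zonal (c : ℝ) (m : ℤ) (p : Polynomial ℝ) (ω : ℝ × ℝ) (h : Real.sin ω.1 ≠ 0) :
    dTheta (zonal c m p) ω =
      ((c * (m * Real.sin ω.1 ^ (m - 1) * Real.cos ω.1 * p.eval (Real.cos ω.1)
        - Real.sin ω.1 ^ (m + 1) * p.derivative.eval (Real.cos ω.1)) : ℝ) : ℂ)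
        * exp (I * m * ω.2) := by
  unfold dTheta zonal
  have h1 : HasDerivAt (fun s : ℝ => Real.sin s ^ m)
      (m * Real.sin ω.1 ^ (m - 1) * Real.cos ω.1) ω.1 :=
    (hasDerivAt_zpow m _ (Or.inl h)).comp ω.1 (Real.hasDerivAt_sin ω.1)
  have h2 : HasDerivAt (fun s : ℝ => p.eval (Real.cos s))
      (p.derivative.eval (Real.cos ω.1) * (-Real.sin ω.1)) ω.1 :=
    (p.hasDerivAt _).comp ω.1 (Real.hasDerivAt_cos ω.1)
  have h3 := (((h1.mul h2).const_mul c).ofReal_comp).mul_const (exp (I * m * ω.2))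
  refine h3.deriv.trans ?_
  congr 3
  rw [zpow_add_one₀ h]
  ring

theorem raising_zonal (c : ℝ) (m : ℤ) (p : Polynomial ℝ) (ω : ℝ × ℝ) (h : Real.sin ω.1 ≠ 0) :
    raising (zonal c m p) ω = zonal (-c) (m + 1) p.derivative ω := by
  unfold raising
  rw [dTheta_zonal _ _ _ _ h, dPhi_zonal]
  unfold zonal
  have hE : exp (I * ((m + 1 : ℤ) : ℂ) * ω.2) = exp (I * ω.2) * exp (I * m * ω.2) := by
    rw [← Complex.exp_add]; push_cast; ring_nf
  rw [hE]
  have hc : (Real.sin ω.1 : ℂ) ≠ 0 := by exact_mod_cast h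
  rw [zpow_sub_one₀ h, zpow_add_one₀ h]
  push_cast
  push_cast at hc
  field_simp
  rw [Complex.I_sq]
  ring

theorem lowering_zonal (c : ℝ) (m : ℤ) (p : Polynomial ℝ) (ω : ℝ × ℝ) (h : Real.sin ω.1 ≠ 0) :
    lowering (zonal c m p) ω = zonal c (m - 1)
      ((1 - Polynomial.X ^ 2) * p.derivative - Polynomial.C (2 * m : ℝ) * Polynomial.X * p) ω := by
  unfold lowering
  rw [dTheta_zonal _ _ _ _ h, dPhi_zonal]
  unfold zonal
  have hE : exp (I * ((m - 1 : ℤ) : ℂ) * ω.2) = exp (-(I * ω.2)) * exp (I * m * ω.2) := by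
    rw [← Complex.exp_add]; push_cast; ring_nf
  rw [hE]
  have hc : (Real.sin ω.1 : ℂ) ≠ 0 := by exact_mod_cast h
  rw [zpow_sub_one₀ h, zpow_add_one₀ h]
  simp only [Polynomial.eval_sub, Polynomial.eval_mul, Polynomial.eval_one, Polynomial.eval_pow,
    Polynomial.eval_X, Polynomial.eval_C]
  rw [← Real.sin_sq_add_cos_sq ω.1]
  push_cast
  push_cast at hc
  field_simp
  rw [Complex.I_sq]
  ring

theorem zonal_C_mul (c d : ℝ) (m : ℤ) (p : Polynomial ℝ) (ω : ℝ × ℝ) :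
    zonal c m (Polynomial.C d * p) ω = zonal (c * d) m p ω := by
  simp [zonal]; ring

theorem zonal_scale (c d : ℝ) (m : ℤ) (p : Polynomial ℝ) (ω : ℝ × ℝ) :
    zonal (d * c) m p ω = d * zonal c m p ω := by
  simp [zonal]; ring

/-- The normalization constant of `Y_ℓ^m`, including the prefactor of the Rodrigues formula. -/
def yNorm (l : ℕ) (m : ℤ) : ℝ :=
  (-1) ^ m * Real.sqrt ((2 * l + 1) / (4 * Real.pi)
      * (((l - m).toNat.factorial : ℝ) / ((l + m).toNat.factorial : ℝ)))
    / (2 ^ l * (l.factorial : ℝ))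

theorem sphericalY_eq_zonal (l : ℕ) (m : ℤ) :
    sphericalY l m = zonal (yNorm l m) m
      (Polynomial.derivative^[(l + m).toNat] ((Polynomial.X ^ 2 - 1 : Polynomial ℝ) ^ l)) := by
  funext ω
  unfold sphericalY zonal yNorm
  congr 2
  ring

theorem dPhi_sphericalY (l : ℕ) (m : ℤ) (ω : ℝ × ℝ) :
    dPhi (sphericalY l m) ω = I * m * sphericalY l m ω := by
  rw [sphericalY_eq_zonal, dPhi_zonal]

theorem yNorm_succ (l : ℕ) (m : ℤ) (h1 : -(l : ℤ) ≤ m) (h2 : m < l) :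
    yNorm l m = -(Real.sqrt ((l - m) * (l + m + 1)) * yNorm l (m + 1)) := by
  obtain ⟨k, hk⟩ : ∃ k : ℕ, (l : ℤ) + m = k := ⟨((l : ℤ) + m).toNat, by omega⟩
  obtain ⟨j, hj⟩ : ∃ j : ℕ, (l : ℤ) - m = j + 1 := ⟨((l : ℤ) - m - 1).toNat, by omega⟩
  have e1 : ((l : ℤ) - m).toNat = j + 1 := by omega
  have e2 : ((l : ℤ) + m).toNat = k := by omega
  have e3 : ((l : ℤ) - (m + 1)).toNat = j := by omega
  have e4 : ((l : ℤ) + (m + 1)).toNat = k + 1 := by omega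
  have r1 : (l : ℝ) - m = j + 1 := by exact_mod_cast hj
  have r2 : (l : ℝ) + m = k := by exact_mod_cast hk
  unfold yNorm
  rw [e1, e2, e3, e4, r1, r2, zpow_add_one₀ (by norm_num)]
  have : Real.sqrt (((j : ℝ) + 1) * (k + 1)) * Real.sqrt ((2 * l + 1) / (4 * Real.pi)
      * ((j.factorial : ℝ) / ((k + 1).factorial : ℝ)))
      = Real.sqrt ((2 * l + 1) / (4 * Real.pi)
      * (((j + 1).factorial : ℝ) / (k.factorial : ℝ))) := by
    rw [← Real.sqrt_mul (by positivity)]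
    congr 1
    rw [Nat.factorial_succ, Nat.factorial_succ]
    push_cast
    have := Nat.factorial_ne_zero k
    field_simp
  rw [← this]
  ring

/-- `L₊ Y_ℓ^m = √((ℓ-m)(ℓ+m+1)) Y_ℓ^{m+1}`. -/
theorem raising_sphericalY (l : ℕ) (m : ℤ) (h1 : -(l : ℤ) ≤ m) (h2 : m ≤ l) (ω : ℝ × ℝ)
    (h : Real.sin ω.1 ≠ 0) :
    raising (sphericalY l m) ω
      = (Real.sqrt ((l - m) * (l + m + 1)) : ℝ) * sphericalY l (m + 1) ω := by
  rw [sphericalY_eq_zonal, sphericalY_eq_zonal, raising_zonal _ _ _ _ h, ← zonal_scale,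
    ← Function.iterate_succ_apply' Polynomial.derivative]
  have e : ((l : ℤ) + (m + 1)).toNat = ((l : ℤ) + m).toNat + 1 := by omega
  rw [e]
  rcases h2.lt_or_eq with h2 | rfl
  · rw [yNorm_succ l m h1 h2, neg_neg]
  · have hz : (Polynomial.derivative^[((l : ℤ) + l).toNat + 1])
        ((Polynomial.X ^ 2 - 1 : Polynomial ℝ) ^ l) = 0 := by
      apply Polynomial.iterate_derivative_eq_zero
      have : ((Polynomial.X ^ 2 - 1 : Polynomial ℝ) ^ l).natDegree ≤ l * 2 := by
        refine Polynomial.natDegree_pow_le.trans (Nat.mul_le_mul_left _ ?_)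
        compute_degree
      omega
    rw [Nat.succ_eq_add_one, hz]
    simp [zonal]

/-- `L₋ Y_ℓ^m = √((ℓ+m)(ℓ-m+1)) Y_ℓ^{m-1}`. -/
theorem lowering_sphericalY (l : ℕ) (m : ℤ) (h1 : -(l : ℤ) ≤ m) (h2 : m ≤ l) (ω : ℝ × ℝ)
    (h : Real.sin ω.1 ≠ 0) :
    lowering (sphericalY l m) ω
      = (Real.sqrt ((l + m) * (l - m + 1)) : ℝ) * sphericalY l (m - 1) ω := by
  rw [sphericalY_eq_zonal, sphericalY_eq_zonal, lowering_zonal _ _ _ _ h, ← zonal_scale]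
  rcases h1.lt_or_eq with h1 | rfl
  · obtain ⟨k, hk⟩ : ∃ k : ℕ, (l : ℤ) + m = k + 1 := ⟨((l : ℤ) + m - 1).toNat, by omega⟩
    have e1 : ((l : ℤ) + m).toNat = k + 1 := by omega
    have e2 : ((l : ℤ) + (m - 1)).toNat = k := by omega
    have r2 : (m : ℝ) = k + 1 - l := by
      have : (m : ℤ) = k + 1 - l := by omega
      rw [this]; push_cast; ring
    rw [e1, e2, ← Function.iterate_succ_apply' Polynomial.derivative]
    have hpoly : (1 - Polynomial.X ^ 2) * Polynomial.derivative^[(k + 1).succ]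
          ((Polynomial.X ^ 2 - 1 : Polynomial ℝ) ^ l) - Polynomial.C (2 * m : ℝ) * Polynomial.X
          * Polynomial.derivative^[k + 1] ((Polynomial.X ^ 2 - 1 : Polynomial ℝ) ^ l)
        = Polynomial.C (-((l + m) * (l - m + 1)) : ℝ)
          * Polynomial.derivative^[k] ((Polynomial.X ^ 2 - 1 : Polynomial ℝ) ^ l) := by
      have := iterate_derivative_ode l k
      rw [Nat.succ_eq_add_one, show k + 1 + 1 = k + 2 by ring, this, r2]
      simp only [map_mul, map_neg, Polynomial.C_ofNat, map_natCast, map_sub, map_add, map_one]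
      ring
    rw [hpoly, zonal_C_mul]
    have hn := yNorm_succ l (m - 1) (by omega) (by omega)
    rw [sub_add_cancel] at hn
    push_cast at hn
    rw [show ((l : ℝ) - (m - 1)) * (l + (m - 1) + 1) = (l + m) * (l - m + 1) by ring] at hn
    rw [hn]
    have hnn : (0 : ℝ) ≤ (l + m) * (l - m + 1) := by
      have a1 : (0 : ℝ) ≤ l + m := by exact_mod_cast (by omega : (0 : ℤ) ≤ l + m)
      have a2 : (0 : ℝ) ≤ l - m := by exact_mod_cast (by omega : (0 : ℤ) ≤ l - m)
      positivity
    congr 1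
    nth_rw 1 [← Real.mul_self_sqrt hnn]
    ring
  · have e1 : ((l : ℤ) + -(l : ℤ)).toNat = 0 := by omega
    rw [e1, Function.iterate_zero_apply, iterate_derivative_ode_zero]
    simp only [zonal]
    push_cast
    simp

/-! ### Integration by parts on the sphere -/

/-- The open coordinate rectangle that carries `sphereMeasure`. -/
def angRect : Set (ℝ × ℝ) := Set.Ioo 0 Real.pi ×ˢ Set.Ioo 0 (2 * Real.pi)

theorem measurableSet_angRect : MeasurableSet angRect := measurableSet_Ioo.prod measurableSet_Ioo

theorem sin_pos_of_mem_angRect {ω : ℝ × ℝ} (h : ω ∈ angRect) : 0 < Real.sin ω.1 :=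
  Real.sin_pos_of_pos_of_lt_pi h.1.1 h.1.2

theorem ae_mem_angRect : ∀ᵐ ω ∂sphereMeasure, ω ∈ angRect := by
  have h : ∀ᵐ ω ∂(volume.restrict angRect), ω ∈ angRect := ae_restrict_mem measurableSet_angRect
  exact (withDensity_absolutelyContinuous _ _).ae_le h

theorem integral_sphereMeasure {E : Type*} [NormedAddCommGroup E] [NormedSpace ℝ E]
    (F : ℝ × ℝ → E) :
    ∫ ω, F ω ∂sphereMeasure = ∫ ω in angRect, Real.sin ω.1 • F ω := by
  unfold sphereMeasure
  rw [integral_withDensity_eq_integral_toReal_smul (by fun_prop) (by simp)]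
  refine setIntegral_congr_fun measurableSet_angRect fun ω hω => ?_
  simp only [ENNReal.toReal_ofReal (sin_pos_of_mem_angRect hω).le]

theorem integrableOn_angRect_of_continuous {E : Type*} [NormedAddCommGroup E] [NormedSpace ℝ E]
    {F : ℝ × ℝ → E} (hF : Continuous F) : IntegrableOn F angRect := by
  have : IntegrableOn F (Set.Icc 0 Real.pi ×ˢ Set.Icc 0 (2 * Real.pi)) :=
    hF.continuousOn.integrableOn_compact (isCompact_Icc.prod isCompact_Icc)
  exact this.mono_set (Set.prod_mono Set.Ioo_subset_Icc_self Set.Ioo_subset_Icc_self)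

instance : IsFiniteMeasure sphereMeasure := by
  refine isFiniteMeasure_withDensity_ofReal (f := fun ω : ℝ × ℝ => Real.sin ω.1) ?_
  exact (integrableOn_angRect_of_continuous (by fun_prop)).2

/-- `C¹` functions of `(ϑ, φ)` that are `2π`-periodic in `φ`. -/
structure AngSmooth (f : ℝ × ℝ → ℂ) : Prop where
  contDiff : ContDiff ℝ 1 f
  periodic : ∀ θ φ, f (θ, φ + 2 * Real.pi) = f (θ, φ)

theorem hasDerivAt_dTheta {f : ℝ × ℝ → ℂ} (hf : ContDiff ℝ 1 f) (ω : ℝ × ℝ) :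
    HasDerivAt (fun s => f (s, ω.2)) (dTheta f ω) ω.1 := by
  have h : Differentiable ℝ (fun s : ℝ => f (s, ω.2)) :=
    (hf.differentiable one_ne_zero).comp (by fun_prop)
  exact (h ω.1).hasDerivAt

theorem hasDerivAt_dPhi {f : ℝ × ℝ → ℂ} (hf : ContDiff ℝ 1 f) (ω : ℝ × ℝ) :
    HasDerivAt (fun s => f (ω.1, s)) (dPhi f ω) ω.2 := by
  have h : Differentiable ℝ (fun s : ℝ => f (ω.1, s)) :=
    (hf.differentiable one_ne_zero).comp (by fun_prop)
  exact (h ω.2).hasDerivAt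

theorem dTheta_eq_fderiv {f : ℝ × ℝ → ℂ} (hf : ContDiff ℝ 1 f) (ω : ℝ × ℝ) :
    dTheta f ω = fderiv ℝ f ω (1, 0) := by
  have h := (hf.differentiable one_ne_zero ω).hasFDerivAt.comp_hasDerivAt ω.1
    (f := fun s : ℝ => (s, ω.2)) ((hasDerivAt_id ω.1).prodMk (hasDerivAt_const _ _))
  exact h.deriv

theorem dPhi_eq_fderiv {f : ℝ × ℝ → ℂ} (hf : ContDiff ℝ 1 f) (ω : ℝ × ℝ) :
    dPhi f ω = fderiv ℝ f ω (0, 1) := by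
  have h := (hf.differentiable one_ne_zero ω).hasFDerivAt.comp_hasDerivAt ω.2
    (f := fun s : ℝ => (ω.1, s)) ((hasDerivAt_const _ _).prodMk (hasDerivAt_id ω.2))
  exact h.deriv

theorem continuous_dTheta {f : ℝ × ℝ → ℂ} (hf : ContDiff ℝ 1 f) : Continuous (dTheta f) := by
  have h := hf.continuous_fderiv one_ne_zero
  have : dTheta f = fun ω => fderiv ℝ f ω (1, 0) := funext (dTheta_eq_fderiv hf)
  rw [this]
  fun_prop

theorem continuous_dPhi {f : ℝ × ℝ → ℂ} (hf : ContDiff ℝ 1 f) : Continuous (dPhi f) := by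
  have h := hf.continuous_fderiv one_ne_zero
  have : dPhi f = fun ω => fderiv ℝ f ω (0, 1) := funext (dPhi_eq_fderiv hf)
  rw [this]
  fun_prop

/-- The divergence theorem on the coordinate rectangle, for a vector field whose `ϑ`-component
vanishes at the poles and whose `φ`-component is periodic. -/
theorem integral_divergence_angRect {F G : ℝ × ℝ → ℂ} (hF : ContDiff ℝ 1 F) (hG : ContDiff ℝ 1 G)
    (h0 : ∀ φ, F (0, φ) = 0) (h1 : ∀ φ, F (Real.pi, φ) = 0)
    (hp : ∀ θ, G (θ, 2 * Real.pi) = G (θ, 0)) :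
    ∫ ω in angRect, (dTheta F ω + dPhi G ω) = 0 := by
  have hle : ((0 : ℝ), (0 : ℝ)) ≤ (Real.pi, 2 * Real.pi) :=
    ⟨Real.pi_pos.le, Real.two_pi_pos.le⟩
  have h := integral_divergence_prod_Icc_of_hasFDerivAt_of_le F G (fderiv ℝ F) (fderiv ℝ G)
    ((0 : ℝ), (0 : ℝ)) (Real.pi, 2 * Real.pi) hle hF.continuous.continuousOn
    hG.continuous.continuousOn (fun ω _ => (hF.differentiable one_ne_zero ω).hasFDerivAt)
    (fun ω _ => (hG.differentiable one_ne_zero ω).hasFDerivAt) ?_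
  · have e : (fun ω => dTheta F ω + dPhi G ω)
        = fun ω => fderiv ℝ F ω (1, 0) + fderiv ℝ G ω (0, 1) :=
      funext fun ω => by rw [dTheta_eq_fderiv hF, dPhi_eq_fderiv hG]
    rw [e]
    have hae : angRect =ᵐ[volume] Set.Icc ((0 : ℝ), (0 : ℝ)) (Real.pi, 2 * Real.pi) := by
      rw [← Set.Icc_prod_Icc]
      exact Measure.set_prod_ae_eq Ioo_ae_eq_Icc Ioo_ae_eq_Icc
    rw [setIntegral_congr_set hae, h]
    simp [h0, h1, hp]
  · refine ContinuousOn.integrableOn_compact isCompact_Icc ?_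
    have h1 := hF.continuous_fderiv one_ne_zero
    have h2 := hG.continuous_fderiv one_ne_zero
    exact Continuous.continuousOn (by fun_prop)

/-- The `L²` pairing of scalar functions on the sphere, antilinear in the first argument. -/
def spherePair (y f : ℝ × ℝ → ℂ) : ℂ := ∫ ω, (starRingEnd ℂ) (y ω) * f ω ∂sphereMeasure

theorem spherePair_congr {y y' f f' : ℝ × ℝ → ℂ} (hy : ∀ ω ∈ angRect, y ω = y' ω)
    (hf : ∀ ω ∈ angRect, f ω = f' ω) : spherePair y f = spherePair y' f' := by
  refine integral_congr_ae ?_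
  filter_upwards [ae_mem_angRect] with ω hω
  rw [hy ω hω, hf ω hω]

/-- The raising operator is adjoint to the lowering operator. Periodicity removes the boundary terms
in `φ`; those in `ϑ` vanish because of the factor `sin ϑ` of the measure. -/
theorem spherePair_raising {y f : ℝ × ℝ → ℂ} (hy : AngSmooth y) (hf : AngSmooth f) :
    spherePair y (raising f) = spherePair (lowering y) f := by
  have cy := hy.contDiff
  have cf := hf.contDiff
  have cyb : ContDiff ℝ 1 (fun ω => (starRingEnd ℂ) (y ω)) :=
    (Complex.conjCLE.contDiff).comp cy
  have hcs : ContDiff ℝ 1 (fun ω : ℝ × ℝ => (Real.sin ω.1 : ℂ)) :=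
    Complex.ofRealCLM.contDiff.comp (Real.contDiff_sin.comp contDiff_fst)
  have hcc : ContDiff ℝ 1 (fun ω : ℝ × ℝ => (Real.cos ω.1 : ℂ)) :=
    Complex.ofRealCLM.contDiff.comp (Real.contDiff_cos.comp contDiff_fst)
  have hce : ContDiff ℝ 1 (fun ω : ℝ × ℝ => exp (I * ω.2)) :=
    (contDiff_const.mul (Complex.ofRealCLM.contDiff.comp contDiff_snd)).cexp
  set F : ℝ × ℝ → ℂ := fun ω => Real.sin ω.1 * exp (I * ω.2) * ((starRingEnd ℂ) (y ω) * f ω)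
    with hF
  set G : ℝ × ℝ → ℂ := fun ω => I * Real.cos ω.1 * exp (I * ω.2) * ((starRingEnd ℂ) (y ω) * f ω)
    with hG
  have cF : ContDiff ℝ 1 F := (hcs.mul hce).mul (cyb.mul cf)
  have cG : ContDiff ℝ 1 G := ((contDiff_const.mul hcc).mul hce).mul (cyb.mul cf)
  have key := integral_divergence_angRect cF cG (by simp [hF]) (by simp [hF]) (by
    intro θ
    have h1 := hy.periodic θ 0
    have h2 := hf.periodic θ 0
    rw [zero_add] at h1 h2
    simp only [hG, h1, h2]
    congr 2
    push_cast
    rw [show I * (2 * (Real.pi : ℂ)) = 2 * Real.pi * I by ring, Complex.exp_two_pi_mul_I]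
    simp)
  have cty := continuous_dTheta cy
  have cpy := continuous_dPhi cy
  have ctf := continuous_dTheta cf
  have cpf := continuous_dPhi cf
  have i1 : IntegrableOn (fun ω : ℝ × ℝ => (starRingEnd ℂ) (y ω) * (exp (I * ω.2) *
      (Real.sin ω.1 * dTheta f ω + I * Real.cos ω.1 * dPhi f ω))) angRect := by
    refine integrableOn_angRect_of_continuous ?_
    have := cyb.continuous
    fun_prop
  have i2 : IntegrableOn (fun ω : ℝ × ℝ => (starRingEnd ℂ) (exp (-(I * ω.2)) *
      (-(Real.sin ω.1 * dTheta y ω) + I * Real.cos ω.1 * dPhi y ω)) * f ω) angRect := by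
    refine integrableOn_angRect_of_continuous ?_
    have := cf.continuous
    have hst : Continuous (starRingEnd ℂ) := Complex.continuous_conj
    fun_prop
  unfold spherePair
  rw [integral_sphereMeasure, integral_sphereMeasure]
  have e1 : ∫ ω in angRect, Real.sin ω.1 • ((starRingEnd ℂ) (y ω) * raising f ω)
      = ∫ ω in angRect, (starRingEnd ℂ) (y ω) * (exp (I * ω.2) *
      (Real.sin ω.1 * dTheta f ω + I * Real.cos ω.1 * dPhi f ω)) := by
    refine setIntegral_congr_fun measurableSet_angRect fun ω hω => ?_
    have hs : (Real.sin ω.1 : ℂ) ≠ 0 := by exact_mod_cast (sin_pos_of_mem_angRect hω).ne'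
    simp only [raising, Complex.real_smul, Complex.ofReal_div]
    field_simp
  have e2 : ∫ ω in angRect, Real.sin ω.1 • ((starRingEnd ℂ) (lowering y ω) * f ω)
      = ∫ ω in angRect, (starRingEnd ℂ) (exp (-(I * ω.2)) *
      (-(Real.sin ω.1 * dTheta y ω) + I * Real.cos ω.1 * dPhi y ω)) * f ω := by
    refine setIntegral_congr_fun measurableSet_angRect fun ω hω => ?_
    have hs : (Real.sin ω.1 : ℂ) ≠ 0 := by exact_mod_cast (sin_pos_of_mem_angRect hω).ne'
    simp only [lowering, Complex.real_smul, Complex.ofReal_div, map_mul, map_add, map_neg,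
      Complex.conj_ofReal, map_div₀]
    field_simp
  rw [e1, e2, ← sub_eq_zero, ← integral_sub i1 i2, ← key]
  refine setIntegral_congr_fun measurableSet_angRect fun ω hω => ?_
  have d1 : dTheta F ω = (Real.cos ω.1 : ℂ) * exp (I * ω.2) * ((starRingEnd ℂ) (y ω) * f ω)
      + Real.sin ω.1 * exp (I * ω.2) *
        ((starRingEnd ℂ) (dTheta y ω) * f ω + (starRingEnd ℂ) (y ω) * dTheta f ω) := by
    have a1 := ((Real.hasDerivAt_sin ω.1).ofReal_comp.mul_const (exp (I * ω.2))).mul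
      ((hasDerivAt_dTheta cy ω).star.mul (hasDerivAt_dTheta cf ω))
    exact a1.deriv
  have d2 : dPhi G ω = I * Real.cos ω.1 * (exp (I * ω.2) * (I * 1))
        * ((starRingEnd ℂ) (y ω) * f ω)
      + I * Real.cos ω.1 * exp (I * ω.2) *
        ((starRingEnd ℂ) (dPhi y ω) * f ω + (starRingEnd ℂ) (y ω) * dPhi f ω) := by
    have a0 : HasDerivAt (fun s : ℝ => exp (I * s)) (exp (I * ω.2) * (I * 1)) ω.2 :=
      (((hasDerivAt_id _).ofReal_comp).const_mul I).cexp
    have a1 := (a0.const_mul (I * Real.cos ω.1)).mul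
      ((hasDerivAt_dPhi cy ω).star.mul (hasDerivAt_dPhi cf ω))
    exact a1.deriv
  simp only [d1, d2, map_mul, map_add, map_neg, Complex.conj_ofReal, ← Complex.exp_conj,
    Complex.conj_I]
  rw [show -(-I * (ω.2 : ℂ)) = I * ω.2 by ring]
  linear_combination (-(Real.cos ω.1 : ℂ) * exp (I * ω.2) * ((starRingEnd ℂ) (y ω) * f ω))
    * Complex.I_sq

theorem spherePair_conj_symm (y f : ℝ × ℝ → ℂ) :
    (starRingEnd ℂ) (spherePair y f) = spherePair f y := by
  unfold spherePair
  rw [← integral_conj]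
  refine integral_congr_ae (Filter.Eventually.of_forall fun ω => ?_)
  simp [mul_comm]

theorem spherePair_lowering {y f : ℝ × ℝ → ℂ} (hy : AngSmooth y) (hf : AngSmooth f) :
    spherePair y (lowering f) = spherePair (raising y) f := by
  rw [← spherePair_conj_symm, ← spherePair_raising hf hy, spherePair_conj_symm]

theorem spherePair_dPhi {y f : ℝ × ℝ → ℂ} (hy : AngSmooth y) (hf : AngSmooth f) :
    spherePair y (dPhi f) = -spherePair (dPhi y) f := by
  have cy := hy.contDiff
  have cf := hf.contDiff
  have cyb : ContDiff ℝ 1 (fun ω => (starRingEnd ℂ) (y ω)) :=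
    (Complex.conjCLE.contDiff).comp cy
  have hcs : ContDiff ℝ 1 (fun ω : ℝ × ℝ => (Real.sin ω.1 : ℂ)) :=
    Complex.ofRealCLM.contDiff.comp (Real.contDiff_sin.comp contDiff_fst)
  have cG : ContDiff ℝ 1 fun ω : ℝ × ℝ => Real.sin ω.1 * ((starRingEnd ℂ) (y ω) * f ω) :=
    hcs.mul (cyb.mul cf)
  have key := integral_divergence_angRect (F := fun _ => 0) contDiff_const cG (by simp) (by simp)
    (by
      intro θ
      have h1 := hy.periodic θ 0
      have h2 := hf.periodic θ 0
      rw [zero_add] at h1 h2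
      simp only [h1, h2])
  have cpy := continuous_dPhi cy
  have cpf := continuous_dPhi cf
  have i1 : IntegrableOn (fun ω : ℝ × ℝ => Real.sin ω.1 • ((starRingEnd ℂ) (y ω) * dPhi f ω))
      angRect := by
    refine integrableOn_angRect_of_continuous ?_
    have := cyb.continuous
    fun_prop
  have i2 : IntegrableOn (fun ω : ℝ × ℝ => Real.sin ω.1 • ((starRingEnd ℂ) (dPhi y ω) * f ω))
      angRect := by
    refine integrableOn_angRect_of_continuous ?_
    have := cf.continuous
    have hst : Continuous (starRingEnd ℂ) := Complex.continuous_conj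
    fun_prop
  unfold spherePair
  rw [integral_sphereMeasure, integral_sphereMeasure, ← add_eq_zero_iff_eq_neg,
    ← integral_add i1 i2, ← key]
  refine setIntegral_congr_fun measurableSet_angRect fun ω hω => ?_
  have d1 : dTheta (fun _ : ℝ × ℝ => (0 : ℂ)) ω = 0 := by simp [dTheta]
  have a1 := ((hasDerivAt_dPhi cy ω).star.mul (hasDerivAt_dPhi cf ω)).const_mul
    (Real.sin ω.1 : ℂ)
  have d2 : dPhi (fun ω : ℝ × ℝ => Real.sin ω.1 * ((starRingEnd ℂ) (y ω) * f ω)) ω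
      = Real.sin ω.1 * ((starRingEnd ℂ) (dPhi y ω) * f ω + (starRingEnd ℂ) (y ω) * dPhi f ω) :=
    a1.deriv
  simp only [d1, d2, Complex.real_smul]
  ring

/-! ### Orthonormality of the spherical harmonics -/

/-- The function `(sin ϑ)^a q(cos ϑ) e^{imφ}`, smooth on all of `ℝ²`. -/
def smoothZonal (a : ℕ) (m : ℤ) (q : Polynomial ℝ) (ω : ℝ × ℝ) : ℂ :=
  ((Real.sin ω.1 ^ a * q.eval (Real.cos ω.1) : ℝ) : ℂ) * exp (I * m * ω.2)

theorem angSmooth_smoothZonal (a : ℕ) (m : ℤ) (q : Polynomial ℝ) :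
    AngSmooth (smoothZonal a m q) where
  contDiff := by
    have hq : ContDiff ℝ 1 (fun x => q.eval x) := by
      simp only [Polynomial.eval_eq_sum_range]
      fun_prop
    have h1 : ContDiff ℝ 1 (fun ω : ℝ × ℝ => Real.sin ω.1 ^ a * q.eval (Real.cos ω.1)) :=
      ((Real.contDiff_sin.comp contDiff_fst).pow a).mul
        (hq.comp (Real.contDiff_cos.comp contDiff_fst))
    exact (Complex.ofRealCLM.contDiff.comp h1).mul
      (contDiff_const.mul (Complex.ofRealCLM.contDiff.comp contDiff_snd)).cexp
  periodic θ φ := by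
    simp only [smoothZonal]
    congr 1
    push_cast
    rw [show I * (m : ℂ) * (φ + 2 * Real.pi) = I * m * φ + m * (2 * Real.pi * I) by ring,
      Complex.exp_periodic.int_mul m]

theorem yNorm_ne_zero (l : ℕ) (m : ℤ) : yNorm l m ≠ 0 := by
  unfold yNorm
  have h1 : ((-1 : ℝ)) ^ m ≠ 0 := zpow_ne_zero _ (by norm_num)
  have h2 : Real.sqrt ((2 * l + 1) / (4 * Real.pi)
      * (((l - m).toNat.factorial : ℝ) / ((l + m).toNat.factorial : ℝ))) ≠ 0 := by
    have := Real.pi_pos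
    have := Nat.factorial_pos ((l : ℤ) - m).toNat
    have := Nat.factorial_pos ((l : ℤ) + m).toNat
    positivity
  have := Nat.factorial_pos l
  positivity

open Polynomial in
theorem degree_X_sq_sub_one_pow (l : ℕ) : ((X ^ 2 - 1 : ℝ[X]) ^ l).natDegree = 2 * l := by
  have : (X ^ 2 - 1 : ℝ[X]).natDegree = 2 := by compute_degree!
  rw [natDegree_pow, this, mul_comm]

open Polynomial in
theorem degree_iterate_derivative_real (k : ℕ) :
    ∀ p : ℝ[X], (k : ℕ) ≤ p.natDegree → p ≠ 0 →
      derivative^[k] p ≠ 0 ∧ (derivative^[k] p).natDegree = p.natDegree - k := by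
  induction k with
  | zero => intro p _ h; simpa using h
  | succ k ih =>
    intro p hp h0
    obtain ⟨h1, h2⟩ := ih p (by omega) h0
    rw [Function.iterate_succ_apply']
    have hd : 0 < (derivative^[k] p).natDegree := by omega
    refine ⟨fun h => ?_, ?_⟩
    · have := derivative_eq_zero.mp h
      omega
    · rw [natDegree_derivative, h2]
      omega

/-- On the coordinate strip, `Y_ℓ^m` agrees with a smooth function
`(sin ϑ)^{|m|} q(cos ϑ) e^{imφ}` with `deg q = ℓ - |m|`. -/
theorem exists_smoothZonal_eq (l : ℕ) (m : ℤ) (h1 : -(l : ℤ) ≤ m) (h2 : m ≤ l) :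
    ∃ q : Polynomial ℝ, q ≠ 0 ∧ q.natDegree = l - m.natAbs ∧
      ∀ ω : ℝ × ℝ, Real.sin ω.1 ≠ 0 → sphericalY l m ω = smoothZonal m.natAbs m q ω := by
  have hw0 : ((Polynomial.X ^ 2 - 1 : Polynomial ℝ) ^ l) ≠ 0 := by
    refine pow_ne_zero _ fun h => ?_
    have := congrArg (Polynomial.eval 0) h
    simp at this
  have hd := degree_iterate_derivative_real ((l : ℤ) + m).toNat _
    (by rw [degree_X_sq_sub_one_pow]; omega) hw0
  rw [degree_X_sq_sub_one_pow] at hd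
  rcases le_or_gt 0 m with hm | hm
  · refine ⟨Polynomial.C (yNorm l m) * Polynomial.derivative^[((l : ℤ) + m).toNat]
      ((Polynomial.X ^ 2 - 1 : Polynomial ℝ) ^ l), ?_, ?_, ?_⟩
    · exact mul_ne_zero (Polynomial.C_ne_zero.mpr (yNorm_ne_zero l m)) hd.1
    · rw [Polynomial.natDegree_C_mul (yNorm_ne_zero l m), hd.2]
      omega
    · intro ω _
      rw [sphericalY_eq_zonal]
      simp only [zonal, smoothZonal, Polynomial.eval_mul, Polynomial.eval_C]
      have : Real.sin ω.1 ^ m = Real.sin ω.1 ^ m.natAbs := by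
        rw [← zpow_natCast, Int.natAbs_of_nonneg hm]
      rw [this]
      congr 2
      ring
  · obtain ⟨q, hq⟩ := Polynomial.pow_sub_dvd_iterate_derivative_pow
      (Polynomial.X ^ 2 - 1 : Polynomial ℝ) l ((l : ℤ) + m).toNat
    have e1 : l - ((l : ℤ) + m).toNat = m.natAbs := by omega
    rw [e1] at hq
    have hq0 : q ≠ 0 := by
      rintro rfl
      rw [mul_zero] at hq
      exact hd.1 hq
    have hm0 : ((Polynomial.X ^ 2 - 1 : Polynomial ℝ) ^ m.natAbs) ≠ 0 := by
      refine pow_ne_zero _ fun h => ?_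
      have := congrArg (Polynomial.eval 0) h
      simp at this
    have hc : yNorm l m * (-1) ^ m.natAbs ≠ 0 :=
      mul_ne_zero (yNorm_ne_zero l m) (pow_ne_zero _ (by norm_num))
    refine ⟨Polynomial.C (yNorm l m * (-1) ^ m.natAbs) * q, ?_, ?_, ?_⟩
    · exact mul_ne_zero (Polynomial.C_ne_zero.mpr hc) hq0
    · rw [Polynomial.natDegree_C_mul hc]
      have h3 := congrArg Polynomial.natDegree hq
      rw [hd.2, Polynomial.natDegree_mul hm0 hq0, degree_X_sq_sub_one_pow] at h3
      omega
    · intro ω hs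
      rw [sphericalY_eq_zonal, hq]
      simp only [zonal, smoothZonal, Polynomial.eval_mul, Polynomial.eval_C, Polynomial.eval_pow,
        Polynomial.eval_sub, Polynomial.eval_X, Polynomial.eval_one]
      have h4 : Real.sin ω.1 ^ m = (Real.sin ω.1 ^ m.natAbs)⁻¹ := by
        rw [← zpow_natCast, ← zpow_neg]
        congr 1
        omega
      have h5 : Real.cos ω.1 ^ 2 - 1 = -1 * (Real.sin ω.1 * Real.sin ω.1) := by
        have := Real.sin_sq_add_cos_sq ω.1
        linear_combination this
      rw [h4, h5, mul_pow, mul_pow]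
      congr 2
      field_simp

theorem dTheta_congr {f g : ℝ × ℝ → ℂ} (h : ∀ ω : ℝ × ℝ, Real.sin ω.1 ≠ 0 → f ω = g ω)
    (ω : ℝ × ℝ) (hω : Real.sin ω.1 ≠ 0) : dTheta f ω = dTheta g ω := by
  refine Filter.EventuallyEq.deriv_eq ?_
  have : ∀ᶠ s in nhds ω.1, Real.sin s ≠ 0 :=
    Real.continuous_sin.continuousAt.eventually_ne hω
  filter_upwards [this] with s hs using h _ hs

theorem dPhi_congr {f g : ℝ × ℝ → ℂ} (h : ∀ ω : ℝ × ℝ, Real.sin ω.1 ≠ 0 → f ω = g ω)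
    (ω : ℝ × ℝ) (hω : Real.sin ω.1 ≠ 0) : dPhi f ω = dPhi g ω := by
  refine Filter.EventuallyEq.deriv_eq (Filter.Eventually.of_forall fun s => ?_)
  exact h _ hω

theorem raising_congr {f g : ℝ × ℝ → ℂ} (h : ∀ ω : ℝ × ℝ, Real.sin ω.1 ≠ 0 → f ω = g ω)
    (ω : ℝ × ℝ) (hω : Real.sin ω.1 ≠ 0) : raising f ω = raising g ω := by
  simp only [raising, dTheta_congr h ω hω, dPhi_congr h ω hω]

theorem lowering_congr {f g : ℝ × ℝ → ℂ} (h : ∀ ω : ℝ × ℝ, Real.sin ω.1 ≠ 0 → f ω = g ω)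
    (ω : ℝ × ℝ) (hω : Real.sin ω.1 ≠ 0) : lowering f ω = lowering g ω := by
  simp only [lowering, dTheta_congr h ω hω, dPhi_congr h ω hω]

/-- A smooth representative of `Y_ℓ^m`, free of the singular factor `(sin ϑ)^m` for `m < 0`. -/
theorem exists_angSmooth_eq (l : ℕ) (m : ℤ) (h1 : -(l : ℤ) ≤ m) (h2 : m ≤ l) :
    ∃ y, AngSmooth y ∧ ∀ ω : ℝ × ℝ, Real.sin ω.1 ≠ 0 → sphericalY l m ω = y ω := by
  obtain ⟨q, -, -, hq⟩ := exists_smoothZonal_eq l m h1 h2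
  exact ⟨_, angSmooth_smoothZonal _ _ _, hq⟩

theorem spherePair_congr' {y y' f f' : ℝ × ℝ → ℂ}
    (hy : ∀ ω : ℝ × ℝ, Real.sin ω.1 ≠ 0 → y ω = y' ω)
    (hf : ∀ ω : ℝ × ℝ, Real.sin ω.1 ≠ 0 → f ω = f' ω) : spherePair y f = spherePair y' f' :=
  spherePair_congr (fun ω hω => hy ω (sin_pos_of_mem_angRect hω).ne')
    (fun ω hω => hf ω (sin_pos_of_mem_angRect hω).ne')

theorem spherePair_const_mul_left (c : ℂ) (y f : ℝ × ℝ → ℂ) :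
    spherePair (fun ω => c * y ω) f = (starRingEnd ℂ) c * spherePair y f := by
  unfold spherePair
  rw [← integral_const_mul]
  simp [mul_assoc]

theorem spherePair_const_mul_right (c : ℂ) (y f : ℝ × ℝ → ℂ) :
    spherePair y (fun ω => c * f ω) = c * spherePair y f := by
  unfold spherePair
  rw [← integral_const_mul]
  congr 1
  funext ω
  ring

theorem spherePair_sphericalY_raising (l : ℕ) (m : ℤ) (h1 : -(l : ℤ) ≤ m) (h2 : m ≤ l)
    {f : ℝ × ℝ → ℂ} (hf : AngSmooth f) :
    spherePair (sphericalY l m) (raising f)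
      = (Real.sqrt ((l + m) * (l - m + 1)) : ℝ) * spherePair (sphericalY l (m - 1)) f := by
  obtain ⟨y, hy, hy'⟩ := exists_angSmooth_eq l m h1 h2
  rw [spherePair_congr' hy' (fun ω _ => rfl), spherePair_raising hy hf,
    ← spherePair_congr' (lowering_congr hy') (fun ω _ => rfl),
    spherePair_congr' (lowering_sphericalY l m h1 h2) (fun ω _ => rfl), spherePair_const_mul_left,
    Complex.conj_ofReal]

theorem spherePair_sphericalY_lowering (l : ℕ) (m : ℤ) (h1 : -(l : ℤ) ≤ m) (h2 : m ≤ l)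
    {f : ℝ × ℝ → ℂ} (hf : AngSmooth f) :
    spherePair (sphericalY l m) (lowering f)
      = (Real.sqrt ((l - m) * (l + m + 1)) : ℝ) * spherePair (sphericalY l (m + 1)) f := by
  obtain ⟨y, hy, hy'⟩ := exists_angSmooth_eq l m h1 h2
  rw [spherePair_congr' hy' (fun ω _ => rfl), spherePair_lowering hy hf,
    ← spherePair_congr' (raising_congr hy') (fun ω _ => rfl),
    spherePair_congr' (raising_sphericalY l m h1 h2) (fun ω _ => rfl), spherePair_const_mul_left,
    Complex.conj_ofReal]

theorem spherePair_sphericalY_dPhi (l : ℕ) (m : ℤ) (h1 : -(l : ℤ) ≤ m) (h2 : m ≤ l)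
    {f : ℝ × ℝ → ℂ} (hf : AngSmooth f) :
    spherePair (sphericalY l m) (dPhi f) = I * m * spherePair (sphericalY l m) f := by
  obtain ⟨y, hy, hy'⟩ := exists_angSmooth_eq l m h1 h2
  rw [spherePair_congr' hy' (fun ω _ => rfl), spherePair_dPhi hy hf,
    ← spherePair_congr' (dPhi_congr hy') (fun ω _ => rfl),
    spherePair_congr' (fun ω _ => dPhi_sphericalY l m ω) (fun ω _ => rfl),
    spherePair_const_mul_left, spherePair_congr' hy' (fun ω _ => rfl)]
  simp

/-- Harmonics of different weight are orthogonal, being eigenfunctions of the symmetric operator `-i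
∂_φ` for different eigenvalues. -/
theorem spherePair_sphericalY_eq_zero_of_ne (l l' : ℕ) (m m' : ℤ) (h1 : -(l : ℤ) ≤ m)
    (h2 : m ≤ l) (h1' : -(l' : ℤ) ≤ m') (h2' : m' ≤ l') (hm : m ≠ m') :
    spherePair (sphericalY l m) (sphericalY l' m') = 0 := by
  obtain ⟨f, hf, hf'⟩ := exists_angSmooth_eq l' m' h1' h2'
  have h := spherePair_sphericalY_dPhi l m h1 h2 hf
  rw [← spherePair_congr' (fun ω _ => rfl) (dPhi_congr hf'),
    ← spherePair_congr' (fun ω _ => rfl) hf',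
    spherePair_congr' (fun ω _ => rfl) (fun ω _ => dPhi_sphericalY l' m' ω),
    spherePair_const_mul_right, mul_assoc, mul_assoc] at h
  have h3 := mul_left_cancel₀ Complex.I_ne_zero h
  rw [← sub_eq_zero, ← sub_mul] at h3
  rcases mul_eq_zero.mp h3 with h4 | h4
  · exact absurd (by exact_mod_cast (sub_eq_zero.mp h4).symm) hm
  · exact h4

/-- Harmonics of equal weight and different degree are orthogonal: moving the raising and lowering
operators from one argument to the other multiplies the pairing by `(l - m)(l + m + 1)` on one side
and by `(l' - m)(l' + m + 1)` on the other. -/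
theorem spherePair_sphericalY_eq_zero_of_lt (l l' : ℕ) (m : ℤ) (h1' : -(l' : ℤ) ≤ m)
    (h2' : m ≤ l') (hl : l' < l) :
    spherePair (sphericalY l m) (sphericalY l' m) = 0 := by
  obtain ⟨f, hf, hf'⟩ := exists_angSmooth_eq l' m h1' h2'
  have a1 := spherePair_sphericalY_raising l (m + 1) (by omega) (by omega) hf
  rw [← spherePair_congr' (fun ω _ => rfl) (raising_congr hf'),
    ← spherePair_congr' (fun ω _ => rfl) hf', add_sub_cancel_right,
    spherePair_congr' (fun ω _ => rfl) (raising_sphericalY l' m h1' h2'),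
    spherePair_const_mul_right] at a1
  push_cast at a1
  rw [show ((l : ℝ) + (m + 1)) * (l - (m + 1) + 1) = (l - m) * (l + m + 1) by ring] at a1
  have p1 : (0 : ℝ) < l - m := by exact_mod_cast (by omega : (0 : ℤ) < l - m)
  have p2 : (0 : ℝ) ≤ l + m := by exact_mod_cast (by omega : (0 : ℤ) ≤ l + m)
  have p3 : (0 : ℝ) ≤ l' - m := by exact_mod_cast (by omega : (0 : ℤ) ≤ l' - m)
  have p4 : (0 : ℝ) ≤ l' + m := by exact_mod_cast (by omega : (0 : ℤ) ≤ l' + m)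
  have q1 : (0 : ℝ) < (l - m) * (l + m + 1) := by positivity
  have q2 : (0 : ℝ) ≤ (l' - m) * (l' + m + 1) := by positivity
  rcases h2'.lt_or_eq with h2' | rfl
  · obtain ⟨g, hg, hg'⟩ := exists_angSmooth_eq l' (m + 1) (by omega) (by omega)
    have a2 := spherePair_sphericalY_lowering l m (by omega) (by omega) hg
    rw [← spherePair_congr' (fun ω _ => rfl) (lowering_congr hg'),
      ← spherePair_congr' (fun ω _ => rfl) hg',
      spherePair_congr' (fun ω _ => rfl) (lowering_sphericalY l' (m + 1) (by omega) (by omega)),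
      spherePair_const_mul_right, add_sub_cancel_right] at a2
    push_cast at a2
    rw [show ((l' : ℝ) + (m + 1)) * (l' - (m + 1) + 1) = (l' - m) * (l' + m + 1) by ring] at a2
    have s1 : ((Real.sqrt ((l - m) * (l + m + 1)) : ℝ) : ℂ) ^ 2 = ((l - m) * (l + m + 1) : ℝ) := by
      rw [← Complex.ofReal_pow, Real.sq_sqrt q1.le]
    have s2 : ((Real.sqrt ((l' - m) * (l' + m + 1)) : ℝ) : ℂ) ^ 2
        = ((l' - m) * (l' + m + 1) : ℝ) := by
      rw [← Complex.ofReal_pow, Real.sq_sqrt q2]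
    have h3 : ((((l : ℝ) - m) * (l + m + 1) - (l' - m) * (l' + m + 1) : ℝ) : ℂ)
        * spherePair (sphericalY l m) (sphericalY l' m) = 0 := by
      rw [Complex.ofReal_sub, ← s1, ← s2]
      linear_combination (-(Real.sqrt ((l - m) * (l + m + 1)) : ℂ)) * a1
        - (Real.sqrt ((l' - m) * (l' + m + 1)) : ℂ) * a2
    refine (mul_eq_zero.mp h3).resolve_left (Complex.ofReal_ne_zero.mpr ?_)
    have hlt : (l' : ℝ) < l := by exact_mod_cast hl
    have : ((l : ℝ) - m) * (l + m + 1) - (l' - m) * (l' + m + 1) = (l - l') * (l + l' + 1) := by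
      ring
    rw [this]
    have : (0 : ℝ) < l - l' := by linarith
    positivity
  · push_cast at a1
    rw [sub_self, zero_mul, Real.sqrt_zero, Complex.ofReal_zero, zero_mul] at a1
    refine (mul_eq_zero.mp a1.symm).resolve_left (Complex.ofReal_ne_zero.mpr ?_)
    push_cast at q1
    exact (Real.sqrt_pos.mpr q1).ne'

theorem integral_sin_pow_odd_eq (l : ℕ) :
    ∫ x in (0 : ℝ)..Real.pi, Real.sin x ^ (2 * l + 1)
      = 2 * (2 ^ l * l.factorial) ^ 2 / ((2 * l + 1).factorial : ℝ) := by
  rw [integral_sin_pow_odd]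
  induction l with
  | zero => simp
  | succ l ih =>
    rw [Finset.prod_range_succ, ← mul_assoc, ih, show 2 * (l + 1) + 1 = 2 * l + 1 + 1 + 1 by ring,
      Nat.factorial_succ (2 * l + 1 + 1), Nat.factorial_succ (2 * l + 1), Nat.factorial_succ l]
    have := Nat.factorial_pos (2 * l + 1)
    push_cast
    field_simp
    ring

/-- Normalization at the lowest weight, where `|Y|²` is a multiple of a power of `sin ϑ`. -/
theorem spherePair_sphericalY_bottom (l : ℕ) :
    spherePair (sphericalY l (-l)) (sphericalY l (-l)) = 1 := by
  have h : ∀ ω ∈ angRect, Real.sin ω.1 • ((starRingEnd ℂ) (sphericalY l (-l) ω)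
      * sphericalY l (-l) ω) = ((yNorm l (-l) ^ 2 * Real.sin ω.1 ^ (2 * l + 1) : ℝ) : ℂ) := by
    intro ω hω
    have hs := sin_pos_of_mem_angRect hω
    rw [← Complex.normSq_eq_conj_mul_self, sphericalY_eq_zonal]
    have e : ((l : ℤ) + -(l : ℤ)).toNat = 0 := by omega
    rw [e, Function.iterate_zero_apply]
    unfold zonal
    rw [Complex.normSq_mul, Complex.normSq_ofReal, Complex.normSq_eq_norm_sq (exp _),
      Complex.norm_exp]
    have h5 : Real.cos ω.1 ^ 2 - 1 = -1 * (Real.sin ω.1 * Real.sin ω.1) := by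
      have := Real.sin_sq_add_cos_sq ω.1
      linear_combination this
    simp only [Polynomial.eval_pow, Polynomial.eval_sub, Polynomial.eval_X, Polynomial.eval_one]
    rw [h5, zpow_neg, zpow_natCast, Complex.real_smul, ← Complex.ofReal_mul]
    congr 1
    have e2 : (I * ((-(l : ℤ) : ℤ) : ℂ) * (ω.2 : ℂ)).re = 0 := by simp
    rw [e2, Real.exp_zero, mul_pow, mul_pow]
    have e3 : ((-1 : ℝ) ^ l) * (-1) ^ l = 1 := by rw [← mul_pow]; simp
    field_simp
    linear_combination (yNorm l (-l) ^ 2 * Real.sin ω.1 ^ (2 * l) * Real.sin ω.1) * e3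
  have hrect : ∫ ω in angRect, yNorm l (-l) ^ 2 * Real.sin ω.1 ^ (2 * l + 1) = 1 := by
    have h1 : ∫ ω in angRect, yNorm l (-l) ^ 2 * Real.sin ω.1 ^ (2 * l + 1)
        = (∫ x in Set.Ioo 0 Real.pi, yNorm l (-l) ^ 2 * Real.sin x ^ (2 * l + 1))
          * ∫ y in Set.Ioo 0 (2 * Real.pi), (1 : ℝ) := by
      rw [angRect, Measure.volume_eq_prod, ← setIntegral_prod_mul]
      simp
    have h2 : ∫ x in Set.Ioo 0 Real.pi, Real.sin x ^ (2 * l + 1)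
        = ∫ x in (0 : ℝ)..Real.pi, Real.sin x ^ (2 * l + 1) := by
      rw [intervalIntegral.integral_of_le Real.pi_pos.le, integral_Ioc_eq_integral_Ioo]
    rw [h1, integral_const_mul, h2, integral_sin_pow_odd_eq]
    have h3 : ∫ y in Set.Ioo 0 (2 * Real.pi), (1 : ℝ) = 2 * Real.pi := by
      simp [Real.pi_pos.le]
    rw [h3]
    unfold yNorm
    have e1 : ((l : ℤ) - -(l : ℤ)).toNat = 2 * l := by omega
    have e : ((l : ℤ) + -(l : ℤ)).toNat = 0 := by omega
    rw [e1, e, div_pow, mul_pow, Real.sq_sqrt (by positivity), Nat.factorial_succ (2 * l)]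
    have e3 : (((-1 : ℝ)) ^ (-(l : ℤ))) ^ 2 = 1 := by
      rw [← zpow_natCast, ← zpow_mul, mul_comm, zpow_mul]; simp
    rw [e3]
    have := Nat.factorial_pos l
    have := Nat.factorial_pos (2 * l)
    have := Real.pi_pos
    push_cast
    field_simp
    simp
    ring
  unfold spherePair
  rw [integral_sphereMeasure, setIntegral_congr_fun measurableSet_angRect h,
    integral_complex_ofReal,
    hrect, Complex.ofReal_one]

/-- Normalization at an arbitrary weight, by the raising operator from the lowest one. -/
theorem spherePair_sphericalY_self (l : ℕ) (m : ℤ) (h1 : -(l : ℤ) ≤ m) (h2 : m ≤ l) :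
    spherePair (sphericalY l m) (sphericalY l m) = 1 := by
  obtain ⟨k, rfl⟩ : ∃ k : ℕ, m = -(l : ℤ) + k := ⟨(m + l).toNat, by omega⟩
  clear h1
  induction k with
  | zero => simpa using spherePair_sphericalY_bottom l
  | succ k ih =>
    have ih := ih (by push_cast at h2; omega)
    push_cast at h2 ⊢
    rw [← add_assoc]
    generalize hm : -(l : ℤ) + k = m at ih
    obtain ⟨f, hf, hf'⟩ := exists_angSmooth_eq l m (by omega) (by omega)
    have a1 := spherePair_sphericalY_raising l (m + 1) (by omega) (by omega) hf
    rw [← spherePair_congr' (fun ω _ => rfl) (raising_congr hf'),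
      ← spherePair_congr' (fun ω _ => rfl) hf', add_sub_cancel_right,
      spherePair_congr' (fun ω _ => rfl) (raising_sphericalY l m (by omega) (by omega)),
      spherePair_const_mul_right, ih] at a1
    push_cast at a1
    rw [show ((l : ℝ) + (m + 1)) * (l - (m + 1) + 1) = (l - m) * (l + m + 1) by ring] at a1
    refine mul_left_cancel₀ ?_ a1
    rw [Complex.ofReal_ne_zero]
    have p1 : (0 : ℝ) < l - m := by exact_mod_cast (by omega : (0 : ℤ) < l - m)
    have p2 : (0 : ℝ) ≤ l + m := by exact_mod_cast (by omega : (0 : ℤ) ≤ l + m)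
    have q1 : (0 : ℝ) < (l - m) * (l + m + 1) := by positivity
    exact (Real.sqrt_pos.mpr q1).ne'

/-- Orthonormality of the spherical harmonics. -/
theorem spherePair_sphericalY (l l' : ℕ) (m m' : ℤ) (h1 : -(l : ℤ) ≤ m)
    (h2 : m ≤ l) (h1' : -(l' : ℤ) ≤ m') (h2' : m' ≤ l') :
    spherePair (sphericalY l m) (sphericalY l' m') = if l = l' ∧ m = m' then 1 else 0 := by
  split_ifs with h
  · obtain ⟨rfl, rfl⟩ := h
    exact spherePair_sphericalY_self l m h1 h2
  · by_cases hm : m = m'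
    · subst hm
      rcases lt_trichotomy l l' with hl | hl | hl
      · rw [← spherePair_conj_symm, spherePair_sphericalY_eq_zero_of_lt l' l m h1 h2 hl, map_zero]
      · exact absurd ⟨hl, rfl⟩ h
      · exact spherePair_sphericalY_eq_zero_of_lt l l' m h1' h2' hl
    · exact spherePair_sphericalY_eq_zero_of_ne l l' m m' h1 h2 h1' h2' hm

/-! ### Completeness of the spherical harmonics -/

/-- An integrable function on `(0, π)` orthogonal to all polynomials in `cos ϑ` vanishes. -/
theorem ae_eq_zero_of_integral_polynomial_cos {h : ℝ → ℂ} (hi : IntegrableOn h (Set.Ioo 0 Real.pi))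
    (h0 : ∀ p : Polynomial ℝ, ∫ θ in Set.Ioo 0 Real.pi, (p.eval (Real.cos θ) : ℝ) • h θ = 0) :
    ∀ᵐ θ ∂(volume.restrict (Set.Ioo 0 Real.pi)), h θ = 0 := by
  rw [ae_restrict_iff' measurableSet_Ioo]
  refine isOpen_Ioo.ae_eq_zero_of_integral_contDiff_smul_eq_zero hi.locallyIntegrableOn ?_
  intro g hg _ hgs
  have e1 : ∫ θ, g θ • h θ = ∫ θ in Set.Ioo 0 Real.pi, g θ • h θ := by
    symm
    refine setIntegral_eq_integral_of_forall_compl_eq_zero fun θ hθ => ?_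
    have : g θ = 0 := image_eq_zero_of_notMem_tsupport fun hh => hθ (hgs hh)
    rw [this, zero_smul]
  rw [e1, ← norm_eq_zero]
  set K := ∫ θ in Set.Ioo 0 Real.pi, ‖h θ‖ with hK
  have hK0 : 0 ≤ K := integral_nonneg fun _ => norm_nonneg _
  refine le_antisymm (le_of_forall_pos_le_add fun ε hε => ?_) (norm_nonneg _)
  obtain ⟨p, hp⟩ := exists_polynomial_near_of_continuousOn (-1) 1 (fun x => g (Real.arccos x))
    (hg.continuous.comp Real.continuous_arccos).continuousOn (ε / (K + 1)) (by positivity)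
  have hgm : AEStronglyMeasurable g (volume.restrict (Set.Ioo 0 Real.pi)) :=
    hg.continuous.aestronglyMeasurable
  have hpc : Continuous fun θ => p.eval (Real.cos θ) := p.continuous.comp Real.continuous_cos
  have hb : ∀ θ ∈ Set.Ioo 0 Real.pi, |p.eval (Real.cos θ) - g θ| ≤ ε / (K + 1) := by
    intro θ hθ
    have := hp (Real.cos θ) ⟨Real.neg_one_le_cos θ, Real.cos_le_one θ⟩
    rw [Real.arccos_cos hθ.1.le hθ.2.le] at this
    exact this.le
  have hd : IntegrableOn (fun θ => (p.eval (Real.cos θ) - g θ) • h θ) (Set.Ioo 0 Real.pi) := by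
    refine Integrable.bdd_smul hi (ε / (K + 1)) (hpc.sub hg.continuous).aestronglyMeasurable ?_
    filter_upwards [ae_restrict_mem measurableSet_Ioo] with θ hθ using hb θ hθ
  have hpi : IntegrableOn (fun θ => (p.eval (Real.cos θ)) • h θ) (Set.Ioo 0 Real.pi) := by
    have : IntegrableOn (fun θ => (p.eval (Real.cos θ)) • h θ) (Set.Icc 0 Real.pi) :=
      ((integrableOn_Icc_iff_integrableOn_Ioo (b := Real.pi)).mpr hi).continuousOn_smul
        hpc.continuousOn isCompact_Icc
    exact this.mono_set Set.Ioo_subset_Icc_self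
  have e2 : ∫ θ in Set.Ioo 0 Real.pi, g θ • h θ
      = -∫ θ in Set.Ioo 0 Real.pi, (p.eval (Real.cos θ) - g θ) • h θ := by
    have : ∀ θ, g θ • h θ = p.eval (Real.cos θ) • h θ - (p.eval (Real.cos θ) - g θ) • h θ := by
      intro θ; rw [sub_smul]; abel
    simp_rw [this]
    rw [integral_sub hpi hd, h0 p, zero_sub]
  rw [e2, norm_neg, zero_add]
  calc ‖∫ θ in Set.Ioo 0 Real.pi, (p.eval (Real.cos θ) - g θ) • h θ‖
      ≤ ∫ θ in Set.Ioo 0 Real.pi, ε / (K + 1) * ‖h θ‖ := by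
        refine norm_integral_le_of_norm_le (hi.norm.const_mul _) ?_
        filter_upwards [ae_restrict_mem measurableSet_Ioo] with θ hθ
        rw [norm_smul]
        exact mul_le_mul_of_nonneg_right (hb θ hθ) (norm_nonneg _)
    _ = ε / (K + 1) * K := integral_const_mul _ _
    _ ≤ ε := by
        rw [div_mul_eq_mul_div, div_le_iff₀ (by positivity)]
        nlinarith

/-- A submodule of polynomials that contains one polynomial of each degree is everything. -/
theorem mem_of_forall_exists_natDegree (S : Submodule ℝ (Polynomial ℝ))
    (h : ∀ d : ℕ, ∃ q ∈ S, q ≠ 0 ∧ q.natDegree = d) (p : Polynomial ℝ) : p ∈ S := by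
  choose q hq h0 hd using h
  let T : Polynomial.Sequence ℝ := ⟨q, fun i => by
    rw [Polynomial.degree_eq_natDegree (h0 i), hd i]⟩
  have hT := T.span fun i => (IsUnit.mk0 _ (Polynomial.leadingCoeff_ne_zero.mpr (h0 i)))
  have hle : Submodule.span ℝ (Set.range T) ≤ S := by
    rw [Submodule.span_le]
    rintro _ ⟨i, rfl⟩
    exact hq i
  rw [hT] at hle
  exact hle trivial

/-- Completeness of the exponentials on `(0, 2π)`. -/
theorem ae_eq_zero_of_integral_exp {f : ℝ → ℂ}
    (hf : MemLp f 2 (volume.restrict (Set.Ioo 0 (2 * Real.pi))))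
    (h0 : ∀ m : ℤ, ∫ φ in Set.Ioo 0 (2 * Real.pi), exp (-(I * m * φ)) * f φ = 0) :
    f =ᵐ[volume.restrict (Set.Ioo 0 (2 * Real.pi))] 0 := by
  have hr : volume.restrict (Set.Ioo 0 (2 * Real.pi)) = volume.restrict (Set.Ioc 0 (2 * Real.pi)) :=
    Measure.restrict_congr_set Ioo_ae_eq_Ioc
  rw [hr] at hf
  have hp := hasSum_sq_fourierCoeffOn Real.two_pi_pos hf
  have hc : ∀ m, fourierCoeffOn Real.two_pi_pos f m = 0 := by
    intro m
    rw [fourierCoeffOn_eq_integral, intervalIntegral.integral_of_le Real.two_pi_pos.le, ← hr]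
    have : ∀ x : ℝ, fourier (-m) (x : AddCircle (2 * Real.pi - 0)) • f x
        = exp (-(I * m * x)) * f x := by
      intro x
      rw [fourier_coe_apply, smul_eq_mul]
      congr 2
      have : (Real.pi : ℂ) ≠ 0 := by exact_mod_cast Real.pi_ne_zero
      push_cast
      field_simp
      ring
    simp_rw [this, h0 m, smul_zero]
  simp only [hc, norm_zero, ne_eq, OfNat.ofNat_ne_zero, not_false_eq_true, zero_pow] at hp
  have h1 := hp.unique hasSum_zero
  rw [smul_eq_mul, mul_eq_zero, intervalIntegral.integral_of_le Real.two_pi_pos.le] at h1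
  have h2 := h1.resolve_left (inv_ne_zero (by rw [sub_zero]; exact Real.two_pi_pos.ne'))
  rw [integral_eq_zero_iff_of_nonneg (fun _ => by positivity) hf.integrable_norm_pow'] at h2
  rw [hr]
  filter_upwards [h2] with x hx
  simpa using hx

theorem ae_prod_eq_zero {α β E : Type*} [MeasurableSpace α] [MeasurableSpace β]
    [NormedAddCommGroup E] {μ : Measure α} {ν : Measure β} [SFinite ν] {f : α × β → E}
    (hf : AEStronglyMeasurable f (μ.prod ν)) (h : ∀ᵐ x ∂μ, ∀ᵐ y ∂ν, f (x, y) = 0) :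
    f =ᵐ[μ.prod ν] 0 := by
  have hm : MeasurableSet {z | hf.mk f z = 0} :=
    hf.stronglyMeasurable_mk.measurableSet_eq_fun stronglyMeasurable_zero
  have h2 : ∀ᵐ z ∂μ.prod ν, hf.mk f z = 0 := by
    rw [Measure.ae_prod_iff_ae_ae hm]
    filter_upwards [h, Measure.ae_ae_of_ae_prod hf.ae_eq_mk] with x h1 h3
    filter_upwards [h1, h3] with y h4 h5
    rw [← h5, h4]
  filter_upwards [hf.ae_eq_mk, h2] with z h3 h4
  rw [h3, h4, Pi.zero_apply]

theorem sphereMeasure_restrict : volume.restrict angRect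
    = (volume.restrict (Set.Ioo 0 Real.pi)).prod (volume.restrict (Set.Ioo 0 (2 * Real.pi))) := by
  rw [Measure.prod_restrict, ← Measure.volume_eq_prod]
  rfl

theorem ae_sphereMeasure_iff {P : ℝ × ℝ → Prop} :
    (∀ᵐ ω ∂sphereMeasure, P ω) ↔ ∀ᵐ ω ∂(volume.restrict angRect), P ω := by
  refine ⟨fun h => ?_, fun h => (withDensity_absolutelyContinuous _ _).ae_le h⟩
  unfold sphereMeasure at h
  rw [ae_withDensity_iff (by fun_prop)] at h
  filter_upwards [h, ae_restrict_mem measurableSet_angRect] with ω h1 h2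
  exact h1 (by simpa using sin_pos_of_mem_angRect h2)

/-- Completeness of the spherical harmonics in `L²(S²)`. -/
theorem ae_eq_zero_of_spherePair_sphericalY {f : ℝ × ℝ → ℂ} (hf : MemLp f 2 sphereMeasure)
    (h : ∀ (l : ℕ) (m : ℤ), -(l : ℤ) ≤ m → m ≤ l → spherePair (sphericalY l m) f = 0) :
    f =ᵐ[sphereMeasure] 0 := by
  set μ := volume.restrict (Set.Ioo 0 Real.pi) with hμ
  set ν := volume.restrict (Set.Ioo 0 (2 * Real.pi)) with hν
  have hprod : volume.restrict angRect = μ.prod ν := sphereMeasure_restrict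
  have hfi : Integrable f sphereMeasure := hf.integrable one_le_two
  have hsm : Measurable fun ω : ℝ × ℝ => ENNReal.ofReal (Real.sin ω.1) := by fun_prop
  have htr : ∀ {E : Type} [NormedAddCommGroup E] [NormedSpace ℝ E] (g : ℝ × ℝ → E),
      Integrable g sphereMeasure → Integrable (fun ω => Real.sin ω.1 • g ω) (μ.prod ν) := by
    intro E _ _ g hg
    unfold sphereMeasure at hg
    rw [integrable_withDensity_iff_integrable_smul' hsm (by simp)] at hg
    rw [← hprod]
    refine hg.congr ?_
    filter_upwards [ae_restrict_mem measurableSet_angRect] with ω hω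
    rw [ENNReal.toReal_ofReal (sin_pos_of_mem_angRect hω).le]
  have hfs := htr f hfi
  -- the Fourier coefficients in `φ`, weighted by `sin ϑ`
  have hcoef : ∀ m : ℤ, ∀ᵐ θ ∂μ, ∫ φ, exp (-(I * m * φ)) * (Real.sin θ • f (θ, φ)) ∂ν = 0 := by
    intro m
    have hint : Integrable (fun ω : ℝ × ℝ => exp (-(I * m * ω.2)) * (Real.sin ω.1 • f ω))
        (μ.prod ν) := by
      refine Integrable.bdd_mul hfs (c := 1) (by fun_prop) (Filter.Eventually.of_forall fun ω => ?_)
      rw [Complex.norm_exp]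
      simp
    have hfm := hint.integral_prod_left
    have hfm' : IntegrableOn (fun θ => Real.sin θ ^ m.natAbs •
        ∫ φ, exp (-(I * m * φ)) * (Real.sin θ • f (θ, φ)) ∂ν) (Set.Ioo 0 Real.pi) := by
      refine Integrable.bdd_smul hfm 1
        (by fun_prop : Continuous fun θ => Real.sin θ ^ m.natAbs).aestronglyMeasurable
        (Filter.Eventually.of_forall fun θ => ?_)
      rw [norm_pow]
      exact pow_le_one₀ (norm_nonneg _) (Real.abs_sin_le_one θ)
    -- for each weight `m`, the polynomials whose harmonic-like function is orthogonal to `f`; the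
    -- spherical harmonics supply one of each degree, so these are all polynomials
    let S : Submodule ℝ (Polynomial ℝ) :=
      { carrier := {p | spherePair (smoothZonal m.natAbs m p) f = 0}
        zero_mem' := by simp [spherePair, smoothZonal]
        add_mem' := by
          intro p q hp hq
          have hi : ∀ p : Polynomial ℝ, Integrable
              (fun ω => (starRingEnd ℂ) (smoothZonal m.natAbs m p ω) * f ω) sphereMeasure := by
            intro p
            have hc : Continuous (smoothZonal m.natAbs m p) :=
              (angSmooth_smoothZonal m.natAbs m p).contDiff.continuous
            obtain ⟨C, hC⟩ := (isCompact_Icc.prod isCompact_Icc :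
              IsCompact (Set.Icc 0 Real.pi ×ˢ Set.Icc 0 (2 * Real.pi))).exists_bound_of_continuousOn
                hc.continuousOn
            refine Integrable.bdd_mul hfi (c := C)
              (Complex.continuous_conj.comp hc).aestronglyMeasurable ?_
            filter_upwards [ae_mem_angRect] with ω hω
            rw [RCLike.norm_conj]
            exact hC ω ⟨Set.Ioo_subset_Icc_self hω.1, Set.Ioo_subset_Icc_self hω.2⟩
          have : spherePair (smoothZonal m.natAbs m (p + q)) f
              = spherePair (smoothZonal m.natAbs m p) f
                + spherePair (smoothZonal m.natAbs m q) f := by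
            unfold spherePair
            rw [← integral_add (hi p) (hi q)]
            congr 1
            funext ω
            simp only [smoothZonal, Polynomial.eval_add, map_mul, Complex.conj_ofReal]
            push_cast
            ring
          change spherePair _ f = 0 at hp hq ⊢
          rw [this, hp, hq, add_zero]
        smul_mem' := by
          intro c p hp
          change spherePair _ f = 0 at hp ⊢
          have : smoothZonal m.natAbs m (c • p)
              = fun ω => (c : ℂ) * smoothZonal m.natAbs m p ω := by
            funext ω
            simp only [smoothZonal, Polynomial.eval_smul, smul_eq_mul]
            push_cast
            ring
          rw [this, spherePair_const_mul_left, hp, mul_zero] }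
    have hS : ∀ p : Polynomial ℝ, spherePair (smoothZonal m.natAbs m p) f = 0 := by
      refine mem_of_forall_exists_natDegree S fun d => ?_
      obtain ⟨q, hq0, hqd, hq⟩ := exists_smoothZonal_eq (d + m.natAbs) m (by omega) (by omega)
      refine ⟨q, ?_, hq0, by omega⟩
      change spherePair _ f = 0
      rw [← spherePair_congr' hq (fun ω _ => rfl)]
      exact h _ _ (by omega) (by omega)
    have hz := ae_eq_zero_of_integral_polynomial_cos hfm' (by
      intro p
      have h1 := hS p
      unfold spherePair at h1
      rw [integral_sphereMeasure, hprod] at h1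
      have hint2 : Integrable (fun ω : ℝ × ℝ => Real.sin ω.1 •
          ((starRingEnd ℂ) (smoothZonal m.natAbs m p ω) * f ω)) (μ.prod ν) := by
        have hc : Continuous (smoothZonal m.natAbs m p) :=
          (angSmooth_smoothZonal m.natAbs m p).contDiff.continuous
        obtain ⟨C, hC⟩ := (isCompact_Icc.prod isCompact_Icc :
          IsCompact (Set.Icc 0 Real.pi ×ˢ Set.Icc 0 (2 * Real.pi))).exists_bound_of_continuousOn
            hc.continuousOn
        refine htr _ (Integrable.bdd_mul hfi (c := C)
          (Complex.continuous_conj.comp hc).aestronglyMeasurable ?_)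
        filter_upwards [ae_mem_angRect] with ω hω
        rw [RCLike.norm_conj]
        exact hC ω ⟨Set.Ioo_subset_Icc_self hω.1, Set.Ioo_subset_Icc_self hω.2⟩
      rw [integral_prod _ hint2] at h1
      rw [← h1]
      refine integral_congr_ae (Filter.Eventually.of_forall fun θ => ?_)
      simp only
      rw [smul_smul, ← integral_smul]
      refine integral_congr_ae (Filter.Eventually.of_forall fun φ => ?_)
      simp only [smoothZonal, map_mul, Complex.conj_ofReal, ← Complex.exp_conj, Complex.conj_I,
        Complex.real_smul, map_intCast]
      rw [show -I * (m : ℂ) * (φ : ℂ) = -(I * m * φ) by ring]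
      push_cast
      ring)
    filter_upwards [hz, ae_restrict_mem measurableSet_Ioo] with θ h1 h2
    exact (smul_eq_zero.mp h1).resolve_left
      (pow_ne_zero _ (Real.sin_pos_of_pos_of_lt_pi h2.1 h2.2).ne')
  have hmeas : AEStronglyMeasurable f (μ.prod ν) := by
    have := hfs.aestronglyMeasurable
    have h2 : AEStronglyMeasurable (fun ω : ℝ × ℝ => (Real.sin ω.1)⁻¹ • (Real.sin ω.1 • f ω))
        (μ.prod ν) := by
      have hm : Measurable fun ω : ℝ × ℝ => (Real.sin ω.1)⁻¹ := by fun_prop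
      exact hm.aestronglyMeasurable.smul this
    refine h2.congr ?_
    rw [← hprod]
    filter_upwards [ae_restrict_mem measurableSet_angRect] with ω hω
    rw [inv_smul_smul₀ (sin_pos_of_mem_angRect hω).ne']
  have hsq := htr _ hf.integrable_norm_pow'
  have hae : ∀ᵐ θ ∂μ, ∀ᵐ φ ∂ν, f (θ, φ) = 0 := by
    filter_upwards [ae_all_iff.mpr hcoef, hmeas.prodMk_left, hsq.prod_right_ae,
      ae_restrict_mem measurableSet_Ioo] with θ h1 h2 h3 h4
    have hs := (Real.sin_pos_of_pos_of_lt_pi h4.1 h4.2).ne'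
    refine ae_eq_zero_of_integral_exp ?_ ?_
    · rw [memLp_two_iff_integrable_sq_norm h2]
      refine (h3.smul (Real.sin θ)⁻¹).congr (Filter.Eventually.of_forall fun φ => ?_)
      simp only [Pi.smul_apply, smul_smul, inv_mul_cancel₀ hs, one_smul]
    · intro m
      have := h1 m
      simp_rw [mul_smul_comm] at this
      rw [integral_smul] at this
      exact (smul_eq_zero.mp this).resolve_left hs
  change ∀ᵐ ω ∂sphereMeasure, f ω = 0
  rw [ae_sphereMeasure_iff, hprod]
  exact ae_prod_eq_zero hmeas hae

/-! ### Spinor spherical harmonics -/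

namespace AngIndex

theorem natAbs_pos (σ : AngIndex) : 0 < σ.kappa.natAbs := Int.natAbs_pos.mpr σ.kappa_ne

theorem n_bounds (σ : AngIndex) : 1 - (σ.kappa.natAbs : ℤ) ≤ σ.n ∧ σ.n ≤ σ.kappa.natAbs := by
  have h := abs_le.mp σ.bound
  have e : |(σ.kappa : ℝ)| = ((σ.kappa.natAbs : ℤ) : ℝ) := by
    rw [Int.natCast_natAbs, Int.cast_abs]
  rw [e] at h
  constructor
  · have : ((1 - (σ.kappa.natAbs : ℤ) : ℤ) : ℝ) ≤ σ.n := by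
      push_cast at h ⊢
      linarith [h.1]
    exact_mod_cast this
  · have : (σ.n : ℝ) ≤ ((σ.kappa.natAbs : ℤ) : ℝ) := by linarith [h.2]
    exact_mod_cast this

theorem abs_kappa (σ : AngIndex) : |(σ.kappa : ℝ)| = (σ.kappa.natAbs : ℝ) := by
  rw [← Int.cast_abs, ← Int.natCast_natAbs, Int.cast_natCast]

/-- An index from the integers `n = m_j + 1/2` and `κ_j`. -/
def mk' (n κ : ℤ) (h0 : κ ≠ 0) (h1 : 1 - (κ.natAbs : ℤ) ≤ n) (h2 : n ≤ κ.natAbs) : AngIndex where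
  n := n
  kappa := κ
  kappa_ne := h0
  bound := by
    have e : |(κ : ℝ)| = ((κ.natAbs : ℤ) : ℝ) := by rw [Int.natCast_natAbs, Int.cast_abs]
    have a1 : ((1 - (κ.natAbs : ℤ) : ℤ) : ℝ) ≤ n := by exact_mod_cast h1
    have a2 : (n : ℝ) ≤ ((κ.natAbs : ℤ) : ℝ) := by exact_mod_cast h2
    push_cast at a1
    rw [e, abs_le]
    constructor
    · push_cast; linarith
    · linarith

/-- The index `(m_j, -κ_j)`. -/
def neg (σ : AngIndex) : AngIndex :=
  mk' σ.n (-σ.kappa) (neg_ne_zero.mpr σ.kappa_ne) (by rw [Int.natAbs_neg]; exact σ.n_bounds.1)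
    (by rw [Int.natAbs_neg]; exact σ.n_bounds.2)

theorem neg_neg (σ : AngIndex) : σ.neg.neg = σ := by
  ext <;> simp [neg, mk']

theorem neg_injective : Function.Injective neg := Function.LeftInverse.injective neg_neg

/-- The orbital angular momentum `ℓ` of the upper components of `Φ⁺`. -/
def ell (σ : AngIndex) : ℕ := if σ.kappa < 0 then σ.kappa.natAbs - 1 else σ.kappa.natAbs

/-- The first Clebsch–Gordan coefficient of the upper components of `Φ⁺`. -/
def c1 (σ : AngIndex) : ℝ :=
  if σ.kappa < 0 then Real.sqrt ((σ.ell + σ.n) / (2 * σ.ell + 1))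
  else Real.sqrt ((σ.ell + 1 - σ.n) / (2 * σ.ell + 1))

/-- The second Clebsch–Gordan coefficient of the upper components of `Φ⁺`. -/
def c2 (σ : AngIndex) : ℝ :=
  if σ.kappa < 0 then Real.sqrt ((σ.ell + 1 - σ.n) / (2 * σ.ell + 1))
  else -Real.sqrt ((σ.ell + σ.n) / (2 * σ.ell + 1))

theorem ell_n_bounds (σ : AngIndex) : -(σ.ell : ℤ) ≤ σ.n ∧ σ.n ≤ σ.ell + 1 := by
  have h := σ.n_bounds
  have := σ.natAbs_pos
  unfold ell
  split_ifs <;> omega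

theorem ell_add_nonneg (σ : AngIndex) : (0 : ℝ) ≤ σ.ell + σ.n := by
  exact_mod_cast (by have := σ.ell_n_bounds; omega : (0 : ℤ) ≤ σ.ell + σ.n)

theorem ell_sub_nonneg (σ : AngIndex) : (0 : ℝ) ≤ σ.ell + 1 - σ.n := by
  exact_mod_cast (by have := σ.ell_n_bounds; omega : (0 : ℤ) ≤ σ.ell + 1 - σ.n)

theorem c1_eq_zero_or (σ : AngIndex) : σ.c1 = 0 ∨ -(σ.ell : ℤ) ≤ σ.n - 1 ∧ σ.n - 1 ≤ σ.ell := by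
  have h := σ.n_bounds
  have h' := σ.ell_n_bounds
  by_cases h1 : -(σ.ell : ℤ) ≤ σ.n - 1
  · exact Or.inr ⟨h1, by omega⟩
  · left
    have hn : σ.n = -(σ.ell : ℤ) := by omega
    have hk : σ.kappa < 0 := by
      by_contra hk
      simp only [ell, if_neg hk] at *
      omega
    rw [c1, if_pos hk, hn]
    simp

theorem c2_eq_zero_or (σ : AngIndex) : σ.c2 = 0 ∨ -(σ.ell : ℤ) ≤ σ.n ∧ σ.n ≤ σ.ell := by
  have h := σ.n_bounds
  have h' := σ.ell_n_bounds
  by_cases h1 : σ.n ≤ (σ.ell : ℤ)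
  · exact Or.inr ⟨h'.1, h1⟩
  · left
    have hn : σ.n = (σ.ell : ℤ) + 1 := by omega
    have hk : σ.kappa < 0 := by
      by_contra hk
      simp only [ell, if_neg hk] at *
      omega
    rw [c2, if_pos hk, hn]
    simp

theorem c1_sq_add_c2_sq (σ : AngIndex) : σ.c1 * σ.c1 + σ.c2 * σ.c2 = 1 := by
  have h1 := σ.ell_add_nonneg
  have h2 := σ.ell_sub_nonneg
  have h3 : (0 : ℝ) < 2 * σ.ell + 1 := by positivity
  unfold c1 c2
  split_ifs
  · rw [Real.mul_self_sqrt (by positivity), Real.mul_self_sqrt (by positivity)]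
    field_simp
    ring
  · rw [neg_mul_neg, Real.mul_self_sqrt (by positivity), Real.mul_self_sqrt (by positivity)]
    field_simp
    ring

theorem c1_mul_add_c2_mul {σ τ : AngIndex} (hl : σ.ell = τ.ell) (hn : σ.n = τ.n) (h : σ ≠ τ) :
    σ.c1 * τ.c1 + σ.c2 * τ.c2 = 0 := by
  have hk : σ.kappa ≠ τ.kappa := fun hk => h (AngIndex.ext hn hk)
  have p1 := σ.natAbs_pos
  have p2 := τ.natAbs_pos
  have hl' := hl
  unfold ell at hl'
  unfold c1 c2
  rw [hl, hn]
  split_ifs at * with g1 g2 g2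
  · omega
  · ring
  · ring
  · omega

/-- The first component of the statement that the spinor harmonic is an eigenvector of `1 + σ·L`
with eigenvalue `-κ`, in terms of its coefficients. -/
theorem c1_ladder (σ : AngIndex) :
    σ.c1 * σ.n + σ.c2 * Real.sqrt ((σ.ell + σ.n) * (σ.ell + 1 - σ.n)) = -σ.kappa * σ.c1 := by
  have h1 := σ.ell_add_nonneg
  have h2 := σ.ell_sub_nonneg
  have h3 := σ.natAbs_pos
  unfold c1 c2
  rw [Real.sqrt_mul h1, Real.sqrt_div h1, Real.sqrt_div h2]
  split_ifs with hk
  · have hl : (σ.kappa : ℝ) = -(σ.ell + 1) := by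
      have : σ.kappa = -((σ.ell : ℤ) + 1) := by simp only [ell, if_pos hk]; omega
      rw [this]; push_cast; ring
    rw [hl]
    linear_combination (Real.sqrt (σ.ell + σ.n) / Real.sqrt (2 * σ.ell + 1)) * Real.mul_self_sqrt h2
  · have hl : (σ.kappa : ℝ) = σ.ell := by
      have : σ.kappa = (σ.ell : ℤ) := by simp only [ell, if_neg hk]; omega
      rw [this]; push_cast; ring
    rw [hl]
    linear_combination (-Real.sqrt (σ.ell + 1 - σ.n) / Real.sqrt (2 * σ.ell + 1))
      * Real.mul_self_sqrt h1

/-- The second component of the same eigenvector statement. -/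
theorem c2_ladder (σ : AngIndex) :
    σ.c2 * (1 - σ.n) + σ.c1 * Real.sqrt ((σ.ell + σ.n) * (σ.ell + 1 - σ.n)) = -σ.kappa * σ.c2 := by
  have h1 := σ.ell_add_nonneg
  have h2 := σ.ell_sub_nonneg
  have h3 := σ.natAbs_pos
  unfold c1 c2
  rw [Real.sqrt_mul h1, Real.sqrt_div h1, Real.sqrt_div h2]
  split_ifs with hk
  · have hl : (σ.kappa : ℝ) = -(σ.ell + 1) := by
      have : σ.kappa = -((σ.ell : ℤ) + 1) := by simp only [ell, if_pos hk]; omega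
      rw [this]; push_cast; ring
    rw [hl]
    linear_combination (Real.sqrt (σ.ell + 1 - σ.n) / Real.sqrt (2 * σ.ell + 1))
      * Real.mul_self_sqrt h1
  · have hl : (σ.kappa : ℝ) = σ.ell := by
      have : σ.kappa = (σ.ell : ℤ) := by simp only [ell, if_neg hk]; omega
      rw [this]; push_cast; ring
    rw [hl]
    linear_combination (Real.sqrt (σ.ell + σ.n) / Real.sqrt (2 * σ.ell + 1)) * Real.mul_self_sqrt h2

end AngIndex

/-- The two-component spinor harmonic in the upper components of `Φ⁺_σ`. -/
def spinHarm (σ : AngIndex) (ω : ℝ × ℝ) : ℂ × ℂ :=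
  (σ.c1 * sphericalY σ.ell (σ.n - 1) ω, σ.c2 * sphericalY σ.ell σ.n ω)

theorem spinHarm_eq (σ : AngIndex) (ω : ℝ × ℝ) :
    spinHarm σ ω = if σ.kappa < 0 then psiLow σ ω else psiHigh σ ω := by
  have h3 := σ.natAbs_pos
  unfold spinHarm psiLow psiHigh AngIndex.c1 AngIndex.c2 AngIndex.j AngIndex.mj
  rw [σ.abs_kappa]
  split_ifs with hk
  · have hl : (σ.kappa.natAbs : ℝ) = σ.ell + 1 := by
      have : σ.kappa.natAbs = σ.ell + 1 := by simp only [AngIndex.ell, if_pos hk]; omega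
      exact_mod_cast this
    have hl2 : σ.kappa.natAbs - 1 = σ.ell := by simp only [AngIndex.ell, if_pos hk]
    rw [hl2, hl, show ((σ.ell : ℝ) + 1 - 1 / 2 + (σ.n - 1 / 2)) = σ.ell + σ.n by ring,
      show ((σ.ell : ℝ) + 1 - 1 / 2 - (σ.n - 1 / 2)) = σ.ell + 1 - σ.n by ring,
      show (2 * ((σ.ell : ℝ) + 1 - 1 / 2)) = 2 * σ.ell + 1 by ring]
  · have hl2 : σ.kappa.natAbs = σ.ell := by simp only [AngIndex.ell, if_neg hk]
    rw [hl2, show ((σ.ell : ℝ) - 1 / 2 + 1 + (σ.n - 1 / 2)) = σ.ell + σ.n by ring,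
      show ((σ.ell : ℝ) - 1 / 2 + 1 - (σ.n - 1 / 2)) = σ.ell + 1 - σ.n by ring,
      show (2 * ((σ.ell : ℝ) - 1 / 2) + 2) = 2 * σ.ell + 1 by ring]
    push_cast
    simp

theorem phiPlus_eq (σ : AngIndex) (ω : ℝ × ℝ) :
    PhiPlus σ ω = toSpherical ω !₂[I * (spinHarm σ ω).1, I * (spinHarm σ ω).2, 0, 0] := by
  rw [spinHarm_eq]
  rfl

/-- The lower components of `Φ⁻_σ` form the spinor harmonic of the opposite sign of `κ`. -/
theorem phiMinus_eq (σ : AngIndex) (ω : ℝ × ℝ) :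
    PhiMinus σ ω = toSpherical ω !₂[0, 0, (spinHarm σ.neg ω).1, (spinHarm σ.neg ω).2] := by
  have h : spinHarm σ.neg ω = if σ.kappa < 0 then psiHigh σ ω else psiLow σ ω := by
    rw [spinHarm_eq]
    have hk := σ.kappa_ne
    have e1 : psiLow σ.neg ω = psiLow σ ω := by
      simp [psiLow, AngIndex.neg, AngIndex.mk', AngIndex.j, AngIndex.mj]
    have e2 : psiHigh σ.neg ω = psiHigh σ ω := by
      simp [psiHigh, AngIndex.neg, AngIndex.mk', AngIndex.j, AngIndex.mj]
    have e3 : σ.neg.kappa = -σ.kappa := rfl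
    rw [e1, e2, e3]
    by_cases h1 : σ.kappa < 0
    · rw [if_neg (by omega), if_pos h1]
    · rw [if_pos (by omega), if_neg h1]
  rw [h]
  rfl

/-- The `L²` pairing of two-component spinors on the sphere. -/
def spinPair (u v : ℝ × ℝ → ℂ × ℂ) : ℂ :=
  spherePair (fun ω => (u ω).1) (fun ω => (v ω).1)
    + spherePair (fun ω => (u ω).2) (fun ω => (v ω).2)

theorem spherePair_ofReal_mul_left (c : ℝ) (y f : ℝ × ℝ → ℂ) :
    spherePair (fun ω => (c : ℂ) * y ω) f = c * spherePair y f := by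
  rw [spherePair_const_mul_left, Complex.conj_ofReal]

theorem spinPair_spinHarm_left (σ : AngIndex) (v : ℝ × ℝ → ℂ × ℂ) :
    spinPair (spinHarm σ) v = σ.c1 * spherePair (sphericalY σ.ell (σ.n - 1)) (fun ω => (v ω).1)
      + σ.c2 * spherePair (sphericalY σ.ell σ.n) (fun ω => (v ω).2) := by
  simp only [spinPair, spinHarm, spherePair_ofReal_mul_left]

/-- Orthonormality of the spinor harmonics. -/
theorem spinPair_spinHarm (σ τ : AngIndex) [Decidable (σ = τ)] :
    spinPair (spinHarm σ) (spinHarm τ) = if σ = τ then 1 else 0 := by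
  rw [spinPair_spinHarm_left]
  simp only [spinHarm, spherePair_const_mul_right]
  have h1 : (σ.c1 : ℂ) * (τ.c1 * spherePair (sphericalY σ.ell (σ.n - 1))
      (sphericalY τ.ell (τ.n - 1)))
        = if σ.ell = τ.ell ∧ σ.n = τ.n then (σ.c1 * τ.c1 : ℂ) else 0 := by
    rcases σ.c1_eq_zero_or with h | ⟨a1, a2⟩
    · simp [h]
    rcases τ.c1_eq_zero_or with h | ⟨b1, b2⟩
    · simp [h]
    rw [spherePair_sphericalY _ _ _ _ a1 a2 b1 b2]
    simp only [sub_left_inj]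
    split_ifs <;> ring
  have h2 : (σ.c2 : ℂ) * (τ.c2 * spherePair (sphericalY σ.ell σ.n)
      (sphericalY τ.ell τ.n)) = if σ.ell = τ.ell ∧ σ.n = τ.n then (σ.c2 * τ.c2 : ℂ) else 0 := by
    rcases σ.c2_eq_zero_or with h | ⟨a1, a2⟩
    · simp [h]
    rcases τ.c2_eq_zero_or with h | ⟨b1, b2⟩
    · simp [h]
    rw [spherePair_sphericalY _ _ _ _ a1 a2 b1 b2]
    split_ifs <;> ring
  rw [h1, h2]
  by_cases h : σ = τ
  · subst h
    simp only [and_self, if_true]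
    exact_mod_cast σ.c1_sq_add_c2_sq
  · rw [if_neg h]
    split_ifs with hc
    · exact_mod_cast AngIndex.c1_mul_add_c2_mul hc.1 hc.2 h
    · simp

/-- Completeness of the spinor harmonics. -/
theorem ae_eq_zero_of_spinPair_spinHarm {v : ℝ × ℝ → ℂ × ℂ}
    (h1 : MemLp (fun ω => (v ω).1) 2 sphereMeasure) (h2 : MemLp (fun ω => (v ω).2) 2 sphereMeasure)
    (h : ∀ σ, spinPair (spinHarm σ) v = 0) : v =ᵐ[sphereMeasure] 0 := by
  simp only [spinPair_spinHarm_left] at h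
  have hlow : ∀ (l : ℕ) (n : ℤ), -(l : ℤ) ≤ n → n ≤ l + 1 →
      (Real.sqrt ((l + n) / (2 * l + 1)) : ℂ)
        * spherePair (sphericalY l (n - 1)) (fun ω => (v ω).1)
      + (Real.sqrt ((l + 1 - n) / (2 * l + 1)) : ℂ)
        * spherePair (sphericalY l n) (fun ω => (v ω).2) = 0 := by
    intro l n a b
    obtain ⟨σ, hn, hκ⟩ : ∃ σ : AngIndex, σ.n = n ∧ σ.kappa = -((l : ℤ) + 1) :=
      ⟨AngIndex.mk' n (-((l : ℤ) + 1)) (by omega) (by omega) (by omega), rfl, rfl⟩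
    have hκ0 : σ.kappa < 0 := by omega
    have he : σ.ell = l := by rw [AngIndex.ell, if_pos hκ0]; omega
    have := h σ
    rwa [AngIndex.c1, AngIndex.c2, if_pos hκ0, if_pos hκ0, he, hn] at this
  have hhigh : ∀ (l : ℕ) (n : ℤ), 1 - (l : ℤ) ≤ n → n ≤ l →
      (Real.sqrt ((l + 1 - n) / (2 * l + 1)) : ℂ)
        * spherePair (sphericalY l (n - 1)) (fun ω => (v ω).1)
      - (Real.sqrt ((l + n) / (2 * l + 1)) : ℂ)
        * spherePair (sphericalY l n) (fun ω => (v ω).2) = 0 := by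
    intro l n a b
    obtain ⟨σ, hn, hκ⟩ : ∃ σ : AngIndex, σ.n = n ∧ σ.kappa = l :=
      ⟨AngIndex.mk' n l (by omega) (by omega) (by omega), rfl, rfl⟩
    have hκ0 : ¬ σ.kappa < 0 := by omega
    have he : σ.ell = l := by rw [AngIndex.ell, if_neg hκ0]; omega
    have := h σ
    rw [AngIndex.c1, AngIndex.c2, if_neg hκ0, if_neg hκ0, he, hn] at this
    push_cast at this
    rw [neg_mul, ← sub_eq_add_neg] at this
    exact this
  have hsq1 : ∀ (l : ℕ) (n : ℤ), -(l : ℤ) ≤ n → n ≤ l + 1 →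
      (Real.sqrt ((l + n) / (2 * l + 1)) : ℂ) * Real.sqrt ((l + n) / (2 * l + 1))
        + (Real.sqrt ((l + 1 - n) / (2 * l + 1)) : ℂ) * Real.sqrt ((l + 1 - n) / (2 * l + 1))
        = 1 := by
    intro l n a b
    have p1 : (0 : ℝ) ≤ l + n := by exact_mod_cast (by omega : (0 : ℤ) ≤ l + n)
    have p2 : (0 : ℝ) ≤ l + 1 - n := by exact_mod_cast (by omega : (0 : ℤ) ≤ l + 1 - n)
    rw [← Complex.ofReal_mul, ← Complex.ofReal_mul, ← Complex.ofReal_add,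
      Real.mul_self_sqrt (by positivity), Real.mul_self_sqrt (by positivity), ← Complex.ofReal_one]
    congr 1
    field_simp
    ring
  have hv1 : (fun ω => (v ω).1) =ᵐ[sphereMeasure] 0 := by
    refine ae_eq_zero_of_spherePair_sphericalY h1 fun l m a b => ?_
    have k1 := hlow l (m + 1) (by omega) (by omega)
    have k3 := hsq1 l (m + 1) (by omega) (by omega)
    rw [add_sub_cancel_right] at k1
    rcases b.lt_or_eq with b | rfl
    · have k2 := hhigh l (m + 1) (by omega) (by omega)
      rw [add_sub_cancel_right] at k2
      linear_combination (Real.sqrt ((l + (m + 1 : ℤ)) / (2 * l + 1)) : ℂ) * k1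
        + (Real.sqrt ((l + 1 - (m + 1 : ℤ)) / (2 * l + 1)) : ℂ) * k2
        - spherePair (sphericalY l m) (fun ω => (v ω).1) * k3
    · have e0 : Real.sqrt ((l + 1 - ((l : ℤ) + 1 : ℤ)) / (2 * l + 1)) = 0 := by
        push_cast; simp
      rw [e0] at k1 k3
      simp only [Complex.ofReal_zero] at k1 k3
      linear_combination (Real.sqrt ((l + ((l : ℤ) + 1 : ℤ)) / (2 * l + 1)) : ℂ) * k1
        - spherePair (sphericalY l l) (fun ω => (v ω).1) * k3
  have hv2 : (fun ω => (v ω).2) =ᵐ[sphereMeasure] 0 := by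
    refine ae_eq_zero_of_spherePair_sphericalY h2 fun l m a b => ?_
    have k1 := hlow l m (by omega) (by omega)
    have k3 := hsq1 l m (by omega) (by omega)
    rcases a.lt_or_eq with a | rfl
    · have k2 := hhigh l m (by omega) (by omega)
      linear_combination (Real.sqrt ((l + 1 - m) / (2 * l + 1)) : ℂ) * k1
        - (Real.sqrt ((l + m) / (2 * l + 1)) : ℂ) * k2
        - spherePair (sphericalY l m) (fun ω => (v ω).2) * k3
    · have e0 : Real.sqrt ((l + (-(l : ℤ) : ℤ)) / (2 * l + 1)) = 0 := by
        push_cast; simp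
      rw [e0] at k1 k3
      simp only [Complex.ofReal_zero] at k1 k3
      linear_combination (Real.sqrt ((l + 1 - (-(l : ℤ) : ℤ)) / (2 * l + 1)) : ℂ) * k1
        - spherePair (sphericalY l (-l)) (fun ω => (v ω).2) * k3
  filter_upwards [hv1, hv2] with ω k1 k2
  exact Prod.ext k1 k2

/-! ### The angular Dirac operator on spinor harmonics -/

/-- The matrix `σ_r = x̂ · σ` acting on a two-component spinor. -/
def sigmaR (ω : ℝ × ℝ) (v : ℂ × ℂ) : ℂ × ℂ :=
  (Real.cos ω.1 * v.1 + Real.sin ω.1 * exp (-(I * ω.2)) * v.2,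
   Real.sin ω.1 * exp (I * ω.2) * v.1 - Real.cos ω.1 * v.2)

theorem sigmaR_sigmaR (ω : ℝ × ℝ) (v : ℂ × ℂ) : sigmaR ω (sigmaR ω v) = v := by
  have h1 : exp (-(I * ω.2)) * exp (I * ω.2) = 1 := by rw [← Complex.exp_add]; simp
  have h2 : (Real.sin ω.1 : ℂ) ^ 2 + (Real.cos ω.1 : ℂ) ^ 2 = 1 := by
    exact_mod_cast Real.sin_sq_add_cos_sq ω.1
  ext
  · simp only [sigmaR]
    linear_combination v.1 * (Real.sin ω.1 : ℂ) ^ 2 * h1 + v.1 * h2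
  · simp only [sigmaR]
    linear_combination v.2 * (Real.sin ω.1 : ℂ) ^ 2 * h1 + v.2 * h2

open Polynomial in
theorem iterate_derivative_succ_pow (l k : ℕ) :
    derivative^[k + 1] ((X ^ 2 - 1 : ℝ[X]) ^ (l + 1))
      = C (2 * (l + 1) : ℝ) * (X * derivative^[k] ((X ^ 2 - 1 : ℝ[X]) ^ l)
        + C (k : ℝ) * derivative^[k - 1] ((X ^ 2 - 1 : ℝ[X]) ^ l)) := by
  have h : derivative ((X ^ 2 - 1 : ℝ[X]) ^ (l + 1))
      = C (2 * (l + 1) : ℝ) * (X * (X ^ 2 - 1 : ℝ[X]) ^ l) := by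
    simp only [derivative_pow, derivative_sub, derivative_one]
    simp only [map_mul, Polynomial.C_ofNat, map_natCast, map_add, map_one]
    simp
    ring
  rw [Function.iterate_succ_apply, h, iterate_derivative_C_mul, mul_comm X,
    iterate_derivative_mul_X]
  simp only [nsmul_eq_mul, map_natCast]
  ring

open Polynomial in
/-- The contiguous relation of the associated Legendre functions that expresses degree `l + 1`
through degree `l` and the neighbouring weights. -/
theorem iterate_derivative_contiguous (l k : ℕ) :
    C (k : ℝ) * X * derivative^[k - 1] ((X ^ 2 - 1 : ℝ[X]) ^ l)
        - (1 - X ^ 2) * derivative^[k] ((X ^ 2 - 1 : ℝ[X]) ^ l)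
      = C ((2 * l + 2 - k) / (2 * (l + 1)) : ℝ)
        * derivative^[k] ((X ^ 2 - 1 : ℝ[X]) ^ (l + 1)) := by
  rcases k with _ | _ | k
  · simp only [Function.iterate_zero_apply, Nat.cast_zero, map_zero]
    have : ((2 * (l : ℝ) + 2 - 0) / (2 * (l + 1))) = 1 := by field_simp; ring
    rw [this, map_one]
    ring
  · rw [iterate_derivative_succ_pow, ← mul_assoc, ← C_mul]
    have : ((2 * (l : ℝ) + 2 - ((0 + 1 : ℕ) : ℝ)) / (2 * (l + 1)) * (2 * (l + 1))) = 2 * l + 1 := by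
      push_cast; field_simp; ring
    rw [this]
    have h := iterate_derivative_ode_zero l
    simp only [zero_add, Function.iterate_zero_apply, Function.iterate_one, Nat.cast_one, map_one,
      Nat.cast_zero, map_zero, Nat.sub_self]
    rw [h]
    simp only [map_mul, map_neg, Polynomial.C_ofNat, map_natCast, map_add, map_one]
    ring
  · rw [iterate_derivative_succ_pow, ← mul_assoc, ← C_mul]
    have : ((2 * (l : ℝ) + 2 - ((k + 1 + 1 : ℕ) : ℝ)) / (2 * (l + 1)) * (2 * (l + 1)))
        = 2 * l - k := by
      push_cast; field_simp; ring
    rw [this]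
    have h := iterate_derivative_ode l k
    simp only [Nat.add_sub_cancel]
    rw [h]
    simp only [map_mul, Polynomial.C_ofNat, map_natCast, map_add, map_one, map_sub,
      Nat.cast_add, Nat.cast_one]
    ring

/-- The common normalization constant of the contiguous relations. -/
def contigNorm (l : ℕ) (n : ℤ) : ℝ :=
  -(-1) ^ n * Real.sqrt (1 / (4 * Real.pi)
      * (((l + 1 - n).toNat.factorial : ℝ) / ((l + n).toNat.factorial : ℝ)))
    / (2 ^ l * (l.factorial : ℝ))

theorem sqrt_div_mul_yNorm (l : ℕ) (m : ℤ) {x y : ℝ} (hx : 0 ≤ x)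
    (h : x * (((l - m).toNat.factorial : ℝ) / ((l + m).toNat.factorial : ℝ)) = y) :
    Real.sqrt (x / (2 * l + 1)) * yNorm l m
      = (-1) ^ m * Real.sqrt (1 / (4 * Real.pi) * y) / (2 ^ l * (l.factorial : ℝ)) := by
  unfold yNorm
  have := Real.pi_pos
  rw [← mul_div_assoc, mul_left_comm, ← Real.sqrt_mul (by positivity), ← h]
  congr 3
  field_simp

theorem mul_sqrt_eq_sqrt {a u : ℝ} (ha : 0 ≤ a) : a * Real.sqrt u = Real.sqrt (u * a ^ 2) := by
  rw [Real.sqrt_mul' _ (by positivity), Real.sqrt_sq ha, mul_comm]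

/-- The coefficients `c1`, `c2` times the normalizations of the spherical harmonics, for both signs
of `κ`, all proportional to `contigNorm`; this reduces the action of `x̂·σ` on the spinor harmonics
to polynomial identities. -/
theorem contig_c1 (l : ℕ) (n : ℤ) (h1 : -(l : ℤ) ≤ n) (h2 : n ≤ l + 1) :
    Real.sqrt ((l + n) / (2 * l + 1)) * yNorm l (n - 1) = (l + n) * contigNorm l n := by
  obtain ⟨k, hk⟩ : ∃ k : ℕ, (l : ℤ) + n = k := ⟨((l : ℤ) + n).toNat, by omega⟩
  have rk : (l : ℝ) + n = k := by exact_mod_cast hk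
  have e1 : ((l : ℤ) + n).toNat = k := by omega
  have e2 : ((l : ℤ) + (n - 1)).toNat = k - 1 := by omega
  have e3 : ((l : ℤ) - (n - 1)).toNat = ((l : ℤ) + 1 - n).toNat := by omega
  rw [rk]
  rcases k with _ | k
  · simp
  rw [sqrt_div_mul_yNorm l (n - 1)
    (y := (((l : ℤ) + 1 - n).toNat.factorial / (k + 1).factorial) * ((k + 1 : ℕ) : ℝ) ^ 2)
    (by positivity)]
  · unfold contigNorm
    rw [e1, zpow_sub_one₀ (by norm_num), ← mul_assoc (1 / (4 * Real.pi)), ← mul_sqrt_eq_sqrt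
      (by positivity)]
    norm_num
    ring
  · rw [e2, e3, Nat.add_sub_cancel, Nat.factorial_succ]
    have := Nat.factorial_pos k
    push_cast
    field_simp

theorem contig_c2 (l : ℕ) (n : ℤ) (h2 : n ≤ l) :
    Real.sqrt ((l + 1 - n) / (2 * l + 1)) * yNorm l n = -contigNorm l n := by
  obtain ⟨k, hk⟩ : ∃ k : ℕ, (l : ℤ) - n = k := ⟨((l : ℤ) - n).toNat, by omega⟩
  have rk : (l : ℝ) + 1 - n = k + 1 := by
    have : (l : ℝ) - n = k := by exact_mod_cast hk
    linarith
  have e1 : ((l : ℤ) + 1 - n).toNat = k + 1 := by omega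
  have e2 : ((l : ℤ) - n).toNat = k := by omega
  rw [rk, sqrt_div_mul_yNorm l n
    (y := ((k + 1).factorial / ((l : ℤ) + n).toNat.factorial)) (by positivity)]
  · unfold contigNorm
    rw [e1]
    ring
  · rw [e2, Nat.factorial_succ]
    push_cast
    field_simp

theorem contig_c1' (l : ℕ) (n : ℤ) (h2 : n ≤ l + 1) :
    Real.sqrt (((l + 1 : ℕ) + 1 - n) / (2 * (l + 1 : ℕ) + 1)) * yNorm (l + 1) (n - 1)
      = (l + 2 - n) / (2 * (l + 1)) * contigNorm l n := by
  obtain ⟨k, hk⟩ : ∃ k : ℕ, (l : ℤ) + 1 - n = k := ⟨((l : ℤ) + 1 - n).toNat, by omega⟩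
  have rk : (l : ℝ) + 1 - n = k := by exact_mod_cast hk
  have rk1 : ((l + 1 : ℕ) : ℝ) + 1 - n = k + 1 := by push_cast; linarith
  have rk2 : (l : ℝ) + 2 - n = k + 1 := by linarith
  have e1 : ((l : ℤ) + 1 - n).toNat = k := by omega
  have e2 : (((l + 1 : ℕ) : ℤ) - (n - 1)).toNat = k + 1 := by omega
  have e3 : (((l + 1 : ℕ) : ℤ) + (n - 1)).toNat = ((l : ℤ) + n).toNat := by omega
  rw [rk1, rk2, sqrt_div_mul_yNorm (l + 1) (n - 1)
    (y := (k.factorial / ((l : ℤ) + n).toNat.factorial) * ((k : ℝ) + 1) ^ 2)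
    (by positivity)]
  · unfold contigNorm
    rw [e1, zpow_sub_one₀ (by norm_num), ← mul_assoc (1 / (4 * Real.pi)), ← mul_sqrt_eq_sqrt
      (by positivity), Nat.factorial_succ]
    have := Nat.factorial_pos l
    push_cast
    field_simp
    ring
  · rw [e2, e3, Nat.factorial_succ]
    push_cast
    field_simp

theorem contig_c2' (l : ℕ) (n : ℤ) (h1 : -(l : ℤ) ≤ n) (h2 : n ≤ l + 1) :
    Real.sqrt (((l + 1 : ℕ) + n) / (2 * (l + 1 : ℕ) + 1)) * yNorm (l + 1) n
      = -(contigNorm l n / (2 * (l + 1))) := by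
  obtain ⟨k, hk⟩ : ∃ k : ℕ, (l : ℤ) + n = k := ⟨((l : ℤ) + n).toNat, by omega⟩
  have rk : (l : ℝ) + n = k := by exact_mod_cast hk
  have rk1 : ((l + 1 : ℕ) : ℝ) + n = k + 1 := by push_cast; linarith
  have e1 : ((l : ℤ) + n).toNat = k := by omega
  have e2 : (((l + 1 : ℕ) : ℤ) - n).toNat = ((l : ℤ) + 1 - n).toNat := by omega
  have e3 : (((l + 1 : ℕ) : ℤ) + n).toNat = k + 1 := by omega
  rw [rk1, sqrt_div_mul_yNorm (l + 1) n
    (y := (((l : ℤ) + 1 - n).toNat.factorial / k.factorial)) (by positivity)]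
  · unfold contigNorm
    rw [e1, Nat.factorial_succ]
    have := Nat.factorial_pos l
    push_cast
    field_simp
    ring
  · rw [e2, e3, Nat.factorial_succ]
    push_cast
    field_simp

theorem cos_mul_zonal (c d : ℝ) (m : ℤ) (p : Polynomial ℝ) (ω : ℝ × ℝ) :
    Real.cos ω.1 * (d * zonal c m p ω) = zonal (d * c) m (Polynomial.X * p) ω := by
  simp [zonal]; ring

theorem sin_exp_mul_zonal (c d : ℝ) (m : ℤ) (p : Polynomial ℝ) (ω : ℝ × ℝ)
    (h : Real.sin ω.1 ≠ 0) :
    Real.sin ω.1 * exp (I * ω.2) * (d * zonal c (m - 1) p ω) = zonal (d * c) m p ω := by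
  have hE : exp (I * (m : ℂ) * ω.2) = exp (I * ω.2) * exp (I * ((m - 1 : ℤ) : ℂ) * ω.2) := by
    rw [← Complex.exp_add]; push_cast; ring_nf
  unfold zonal
  rw [hE, zpow_sub_one₀ h]
  have hc : (Real.sin ω.1 : ℂ) ≠ 0 := by exact_mod_cast h
  push_cast at hc ⊢
  field_simp

theorem sin_exp_neg_mul_zonal (c d : ℝ) (m : ℤ) (p : Polynomial ℝ) (ω : ℝ × ℝ)
    (h : Real.sin ω.1 ≠ 0) :
    Real.sin ω.1 * exp (-(I * ω.2)) * (d * zonal c m p ω)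
      = zonal (d * c) (m - 1) ((1 - Polynomial.X ^ 2) * p) ω := by
  have hE : exp (I * ((m - 1 : ℤ) : ℂ) * ω.2) = exp (-(I * ω.2)) * exp (I * (m : ℂ) * ω.2) := by
    rw [← Complex.exp_add]; push_cast; ring_nf
  unfold zonal
  rw [hE, zpow_sub_one₀ h]
  have hc : (Real.sin ω.1 : ℂ) ≠ 0 := by exact_mod_cast h
  simp only [Polynomial.eval_sub, Polynomial.eval_mul, Polynomial.eval_one, Polynomial.eval_pow,
    Polynomial.eval_X]
  rw [← Real.sin_sq_add_cos_sq ω.1]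
  push_cast at hc ⊢
  field_simp
  ring

theorem zonal_add (c : ℝ) (m : ℤ) (p q : Polynomial ℝ) (ω : ℝ × ℝ) :
    zonal c m (p + q) ω = zonal c m p ω + zonal c m q ω := by
  simp [zonal]; ring

theorem zonal_eq_mul (c d : ℝ) (m : ℤ) (p : Polynomial ℝ) (ω : ℝ × ℝ) :
    zonal (c * d) m p ω = zonal c m (Polynomial.C d * p) ω := by
  simp [zonal]; ring

theorem sigmaR_spinHarm_of_neg (σ : AngIndex) (hκ : σ.kappa < 0) (ω : ℝ × ℝ)
    (h : Real.sin ω.1 ≠ 0) : sigmaR ω (spinHarm σ ω) = spinHarm σ.neg ω := by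
  have hb := σ.ell_n_bounds
  have hp := σ.natAbs_pos
  have hnk : ¬ σ.neg.kappa < 0 := by
    have : σ.neg.kappa = -σ.kappa := rfl
    omega
  have hnn : σ.neg.n = σ.n := rfl
  have hle : σ.neg.ell = σ.ell + 1 := by
    have : σ.neg.kappa = -σ.kappa := rfl
    rw [AngIndex.ell, AngIndex.ell, if_pos hκ, if_neg hnk, this, Int.natAbs_neg]
    omega
  obtain ⟨k, hk⟩ : ∃ k : ℕ, (σ.ell : ℤ) + σ.n = k := ⟨((σ.ell : ℤ) + σ.n).toNat, by omega⟩
  have rk : (σ.ell : ℝ) + σ.n = k := by exact_mod_cast hk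
  have t1 : ((σ.ell : ℤ) + (σ.n - 1)).toNat = k - 1 := by omega
  have t2 : ((σ.ell : ℤ) + σ.n).toNat = k := by omega
  have t3 : (((σ.ell + 1 : ℕ) : ℤ) + (σ.n - 1)).toNat = k := by omega
  have t4 : (((σ.ell + 1 : ℕ) : ℤ) + σ.n).toNat = k + 1 := by omega
  have q1 := contig_c1 σ.ell σ.n hb.1 hb.2
  have q3 := contig_c1' σ.ell σ.n hb.2
  have q4 := contig_c2' σ.ell σ.n hb.1 hb.2
  -- at the top weight `n = ℓ + 1` both sides vanish, the derivative being of too high an order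
  have q2 : ∀ (m : ℤ) (p : Polynomial ℝ),
      zonal (Real.sqrt ((σ.ell + 1 - σ.n) / (2 * σ.ell + 1)) * yNorm σ.ell σ.n) m
        (p * Polynomial.derivative^[k] ((Polynomial.X ^ 2 - 1 : Polynomial ℝ) ^ σ.ell)) ω
      = zonal (-contigNorm σ.ell σ.n) m
        (p * Polynomial.derivative^[k] ((Polynomial.X ^ 2 - 1 : Polynomial ℝ) ^ σ.ell)) ω := by
    intro m p
    rcases hb.2.lt_or_eq with hlt | heq
    · rw [contig_c2 σ.ell σ.n (by omega)]
    · have hz : (Polynomial.derivative^[k])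
          ((Polynomial.X ^ 2 - 1 : Polynomial ℝ) ^ σ.ell) = 0 := by
        apply Polynomial.iterate_derivative_eq_zero
        rw [degree_X_sq_sub_one_pow]
        omega
      rw [hz]
      simp [zonal]
  unfold spinHarm AngIndex.c1 AngIndex.c2
  rw [if_pos hκ, if_pos hκ, if_neg hnk, if_neg hnk, hle, hnn]
  unfold sigmaR
  simp only [sphericalY_eq_zonal, t1, t2, t3, t4]
  refine Prod.ext ?_ ?_
  · simp only
    rw [cos_mul_zonal, sin_exp_neg_mul_zonal _ _ _ _ _ h, ← zonal_scale, q2, q1, q3,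
      show ((σ.ell : ℝ) + 2 - σ.n) / (2 * (σ.ell + 1)) = (2 * σ.ell + 2 - k) / (2 * (σ.ell + 1)) by
        rw [← rk]; ring, rk, mul_comm _ (contigNorm _ _), zonal_eq_mul,
      mul_comm _ (contigNorm _ _), zonal_eq_mul, ← iterate_derivative_contiguous,
      show -contigNorm σ.ell σ.n = contigNorm σ.ell σ.n * (-1) by ring, zonal_eq_mul, ← zonal_add]
    congr 1
    simp only [map_neg, map_one]
    ring
  · simp only [Complex.ofReal_neg, neg_mul]
    rw [cos_mul_zonal, sin_exp_mul_zonal _ _ _ _ _ h, ← zonal_scale, q2, q1, q4,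
      iterate_derivative_succ_pow,
      rk, mul_comm _ (contigNorm _ _), zonal_eq_mul, div_eq_mul_inv, ← mul_neg, zonal_eq_mul,
      show -contigNorm σ.ell σ.n = contigNorm σ.ell σ.n * (-1) by ring, zonal_eq_mul,
      ← mul_assoc (Polynomial.C (-_)) (Polynomial.C _), ← Polynomial.C_mul]
    have h0 : (-(2 * ((σ.ell : ℝ) + 1))⁻¹ * (2 * (σ.ell + 1))) = -1 := by field_simp
    rw [h0]
    simp only [zonal, map_neg, map_one, Polynomial.eval_mul, Polynomial.eval_add,
      Polynomial.eval_neg, Polynomial.eval_one]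
    push_cast
    ring

/-- `σ_r` interchanges the upper and the lower spinor harmonic of the same index. -/
theorem sigmaR_spinHarm (σ : AngIndex) (ω : ℝ × ℝ) (h : Real.sin ω.1 ≠ 0) :
    sigmaR ω (spinHarm σ ω) = spinHarm σ.neg ω := by
  by_cases hκ : σ.kappa < 0
  · exact sigmaR_spinHarm_of_neg σ hκ ω h
  · have h2 : σ.neg.kappa < 0 := by
      have h3 : σ.neg.kappa = -σ.kappa := rfl
      have := σ.kappa_ne
      omega
    have := sigmaR_spinHarm_of_neg σ.neg h2 ω h
    rw [AngIndex.neg_neg] at this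
    rw [← this, sigmaR_sigmaR]

/-- The operator `1 + σ · L` on two-component spinors. -/
def angK (v : ℝ × ℝ → ℂ × ℂ) (ω : ℝ × ℝ) : ℂ × ℂ :=
  ((v ω).1 - I * dPhi (fun ω => (v ω).1) ω + lowering (fun ω => (v ω).2) ω,
   (v ω).2 + I * dPhi (fun ω => (v ω).2) ω + raising (fun ω => (v ω).1) ω)

theorem integrable_sphereMeasure {E : Type*} [NormedAddCommGroup E] [NormedSpace ℝ E]
    {F : ℝ × ℝ → E} (h : IntegrableOn (fun ω => Real.sin ω.1 • F ω) angRect) :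
    Integrable F sphereMeasure := by
  unfold sphereMeasure
  rw [integrable_withDensity_iff_integrable_smul' (by fun_prop) (by simp)]
  refine h.congr ?_
  filter_upwards [ae_restrict_mem measurableSet_angRect] with ω hω
  rw [ENNReal.toReal_ofReal (sin_pos_of_mem_angRect hω).le]

theorem integrable_conj_mul {y f : ℝ × ℝ → ℂ} (hy : Continuous y) (hf : Continuous f) :
    Integrable (fun ω => (starRingEnd ℂ) (y ω) * f ω) sphereMeasure := by
  refine integrable_sphereMeasure (integrableOn_angRect_of_continuous ?_)
  have hst : Continuous (starRingEnd ℂ) := Complex.continuous_conj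
  fun_prop

theorem integrable_conj_mul_raising {y f : ℝ × ℝ → ℂ} (hy : Continuous y)
    (hf : ContDiff ℝ 1 f) :
    Integrable (fun ω => (starRingEnd ℂ) (y ω) * raising f ω) sphereMeasure := by
  have hst : Continuous (starRingEnd ℂ) := Complex.continuous_conj
  have c1 := continuous_dTheta hf
  have c2 := continuous_dPhi hf
  have hi : IntegrableOn (fun ω : ℝ × ℝ => (starRingEnd ℂ) (y ω) * (exp (I * ω.2) *
      (Real.sin ω.1 * dTheta f ω + I * Real.cos ω.1 * dPhi f ω))) angRect :=
    integrableOn_angRect_of_continuous (by fun_prop)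
  refine integrable_sphereMeasure (hi.congr_fun (fun ω hω => ?_) measurableSet_angRect)
  have hs : (Real.sin ω.1 : ℂ) ≠ 0 := by exact_mod_cast (sin_pos_of_mem_angRect hω).ne'
  simp only [raising, Complex.real_smul, Complex.ofReal_div]
  field_simp

theorem integrable_conj_mul_lowering {y f : ℝ × ℝ → ℂ} (hy : Continuous y)
    (hf : ContDiff ℝ 1 f) :
    Integrable (fun ω => (starRingEnd ℂ) (y ω) * lowering f ω) sphereMeasure := by
  have hst : Continuous (starRingEnd ℂ) := Complex.continuous_conj
  have c1 := continuous_dTheta hf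
  have c2 := continuous_dPhi hf
  have hi : IntegrableOn (fun ω : ℝ × ℝ => (starRingEnd ℂ) (y ω) * (exp (-(I * ω.2)) *
      (-(Real.sin ω.1 * dTheta f ω) + I * Real.cos ω.1 * dPhi f ω))) angRect :=
    integrableOn_angRect_of_continuous (by fun_prop)
  refine integrable_sphereMeasure (hi.congr_fun (fun ω hω => ?_) measurableSet_angRect)
  have hs : (Real.sin ω.1 : ℂ) ≠ 0 := by exact_mod_cast (sin_pos_of_mem_angRect hω).ne'
  simp only [lowering, Complex.real_smul, Complex.ofReal_div]
  field_simp

/-- The spinor harmonic of index `σ` is an eigenvector of `1 + σ · L`, with eigenvalue `-κ`;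
in weak form. -/
theorem spinPair_spinHarm_angK (σ : AngIndex) {v : ℝ × ℝ → ℂ × ℂ}
    (h1 : AngSmooth fun ω => (v ω).1) (h2 : AngSmooth fun ω => (v ω).2) :
    spinPair (spinHarm σ) (angK v) = -σ.kappa * spinPair (spinHarm σ) v := by
  rw [spinPair_spinHarm_left, spinPair_spinHarm_left]
  simp only [angK]
  set v1 : ℝ × ℝ → ℂ := fun ω => (v ω).1
  set v2 : ℝ × ℝ → ℂ := fun ω => (v ω).2
  have e1 : (σ.c1 : ℂ) * spherePair (sphericalY σ.ell (σ.n - 1))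
        (fun ω => v1 ω - I * dPhi v1 ω + lowering v2 ω)
      = σ.c1 * (σ.n * spherePair (sphericalY σ.ell (σ.n - 1)) v1
        + (Real.sqrt ((σ.ell + σ.n) * (σ.ell + 1 - σ.n)) : ℝ)
          * spherePair (sphericalY σ.ell σ.n) v2) := by
    rcases σ.c1_eq_zero_or with h | ⟨a1, a2⟩
    · simp [h]
    congr 1
    obtain ⟨y, hy, hy'⟩ := exists_angSmooth_eq σ.ell (σ.n - 1) a1 a2
    have hs : spherePair (sphericalY σ.ell (σ.n - 1))
        (fun ω => v1 ω - I * dPhi v1 ω + lowering v2 ω)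
        = spherePair (sphericalY σ.ell (σ.n - 1)) v1
          - I * spherePair (sphericalY σ.ell (σ.n - 1)) (dPhi v1)
          + spherePair (sphericalY σ.ell (σ.n - 1)) (lowering v2) := by
      rw [← spherePair_const_mul_right]
      simp only [spherePair_congr' hy' (fun _ _ => rfl)]
      have cy := hy.contDiff.continuous
      have j1 := integrable_conj_mul cy h1.contDiff.continuous
      have j2 : Integrable (fun ω => (starRingEnd ℂ) (y ω) * (I * dPhi v1 ω)) sphereMeasure :=
        integrable_conj_mul cy (continuous_const.mul (continuous_dPhi h1.contDiff))
      have j3 := integrable_conj_mul_lowering cy h2.contDiff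
      have j12 : Integrable (fun ω => (starRingEnd ℂ) (y ω) * v1 ω
          - (starRingEnd ℂ) (y ω) * (I * dPhi v1 ω)) sphereMeasure := j1.sub j2
      unfold spherePair
      beta_reduce
      rw [← integral_sub j1 j2]
      rw [← integral_add j12 j3]
      congr 1
      funext ω
      ring
    rw [hs, spherePair_sphericalY_dPhi _ _ a1 a2 h1, spherePair_sphericalY_lowering _ _ a1 a2 h2,
      sub_add_cancel]
    push_cast
    rw [show ((σ.ell : ℝ) - (σ.n - 1)) * (σ.ell + (σ.n - 1) + 1)
      = (σ.ell + σ.n) * (σ.ell + 1 - σ.n) by ring]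
    linear_combination (-((σ.n : ℂ) - 1) * spherePair (sphericalY σ.ell (σ.n - 1)) v1) * I_sq
  have e2 : (σ.c2 : ℂ) * spherePair (sphericalY σ.ell σ.n)
        (fun ω => v2 ω + I * dPhi v2 ω + raising v1 ω)
      = σ.c2 * ((1 - σ.n) * spherePair (sphericalY σ.ell σ.n) v2
        + (Real.sqrt ((σ.ell + σ.n) * (σ.ell + 1 - σ.n)) : ℝ)
          * spherePair (sphericalY σ.ell (σ.n - 1)) v1) := by
    rcases σ.c2_eq_zero_or with h | ⟨a1, a2⟩
    · simp [h]
    congr 1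
    obtain ⟨y, hy, hy'⟩ := exists_angSmooth_eq σ.ell σ.n a1 a2
    have hs : spherePair (sphericalY σ.ell σ.n)
        (fun ω => v2 ω + I * dPhi v2 ω + raising v1 ω)
        = spherePair (sphericalY σ.ell σ.n) v2
          + I * spherePair (sphericalY σ.ell σ.n) (dPhi v2)
          + spherePair (sphericalY σ.ell σ.n) (raising v1) := by
      rw [← spherePair_const_mul_right]
      simp only [spherePair_congr' hy' (fun _ _ => rfl)]
      have cy := hy.contDiff.continuous
      have j1 := integrable_conj_mul cy h2.contDiff.continuous
      have j2 : Integrable (fun ω => (starRingEnd ℂ) (y ω) * (I * dPhi v2 ω)) sphereMeasure :=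
        integrable_conj_mul cy (continuous_const.mul (continuous_dPhi h2.contDiff))
      have j3 := integrable_conj_mul_raising cy h1.contDiff
      have j12 : Integrable (fun ω => (starRingEnd ℂ) (y ω) * v2 ω
          + (starRingEnd ℂ) (y ω) * (I * dPhi v2 ω)) sphereMeasure := j1.add j2
      unfold spherePair
      beta_reduce
      rw [← integral_add j1 j2]
      rw [← integral_add j12 j3]
      congr 1
      funext ω
      ring
    rw [hs, spherePair_sphericalY_dPhi _ _ a1 a2 h2, spherePair_sphericalY_raising _ _ a1 a2 h1]
    rw [show ((σ.ell : ℝ) + σ.n) * (σ.ell - σ.n + 1)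
      = (σ.ell + σ.n) * (σ.ell + 1 - σ.n) by ring]
    linear_combination ((σ.n : ℂ) * spherePair (sphericalY σ.ell σ.n) v2) * I_sq
  rw [e1, e2]
  have l1 := congrArg (fun x : ℝ => (x : ℂ)) σ.c1_ladder
  have l2 := congrArg (fun x : ℝ => (x : ℂ)) σ.c2_ladder
  push_cast at l1 l2
  linear_combination spherePair (sphericalY σ.ell (σ.n - 1)) v1 * l1
    + spherePair (sphericalY σ.ell σ.n) v2 * l2

/-! ### The unitary change of spin basis -/

/-- The inverse of `toSpherical`: multiplication by `diag(W*, W*)`. -/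
def fromSpherical (ω : ℝ × ℝ) (v : Spinor) : Spinor :=
  let s : ℂ := ((Real.sqrt 2)⁻¹ : ℝ)
  let w11 := s * (-I * exp (-(I * (ω.1 + ω.2) / 2)))
  let w12 := s * exp (-(I * (ω.1 - ω.2) / 2))
  let w21 := s * (-I * exp (-(I * (-ω.1 + ω.2) / 2)))
  let w22 := -(s * exp (-(I * (-ω.1 - ω.2) / 2)))
  !₂[w11 * v 0 + w21 * v 1, w12 * v 0 + w22 * v 1,
     w11 * v 2 + w21 * v 3, w12 * v 2 + w22 * v 3]

theorem inner_spinor (v w : Spinor) : inner ℂ v w = (starRingEnd ℂ) (v 0) * w 0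
    + (starRingEnd ℂ) (v 1) * w 1 + (starRingEnd ℂ) (v 2) * w 2 + (starRingEnd ℂ) (v 3) * w 3 := by
  simp only [PiLp.inner_apply, Fin.sum_univ_four, RCLike.inner_apply, mul_comm]

theorem conj_exp_I_mul (x : ℂ) (hx : (starRingEnd ℂ) x = x) :
    (starRingEnd ℂ) (exp (I * x / 2)) = exp (-(I * x / 2)) := by
  rw [← Complex.exp_conj]
  congr 1
  simp only [map_div₀, map_mul, Complex.conj_I, hx, map_ofNat]
  ring

theorem inner_toSpherical (ω : ℝ × ℝ) (v w : Spinor) :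
    inner ℂ (toSpherical ω v) w = inner ℂ v (fromSpherical ω w) := by
  simp only [inner_spinor, toSpherical, fromSpherical]
  simp only [Matrix.cons_val, map_add, map_mul, map_neg, Complex.conj_ofReal,
    Complex.conj_I]
  rw [conj_exp_I_mul _ (by simp), conj_exp_I_mul _ (by simp), conj_exp_I_mul _ (by simp),
    conj_exp_I_mul _ (by simp)]
  ring

theorem inv_sqrt_two_sq : (((Real.sqrt 2)⁻¹ : ℝ) : ℂ) * (((Real.sqrt 2)⁻¹ : ℝ) : ℂ) = 1 / 2 := by
  rw [← Complex.ofReal_mul, ← mul_inv, Real.mul_self_sqrt (by norm_num)]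
  norm_num

theorem fromSpherical_toSpherical (ω : ℝ × ℝ) (v : Spinor) :
    fromSpherical ω (toSpherical ω v) = v := by
  have hs := inv_sqrt_two_sq
  have e1 : exp (-(I * ((ω.1 : ℂ) + ω.2) / 2)) * exp (I * (ω.1 + ω.2) / 2) = 1 := by
    rw [← Complex.exp_add]; simp
  have e2 : exp (-(I * (-(ω.1 : ℂ) + ω.2) / 2)) * exp (I * (-ω.1 + ω.2) / 2) = 1 := by
    rw [← Complex.exp_add]; simp
  have e3 : exp (-(I * ((ω.1 : ℂ) - ω.2) / 2)) * exp (I * (ω.1 - ω.2) / 2) = 1 := by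
    rw [← Complex.exp_add]; simp
  have e4 : exp (-(I * (-(ω.1 : ℂ) - ω.2) / 2)) * exp (I * (-ω.1 - ω.2) / 2) = 1 := by
    rw [← Complex.exp_add]; simp
  have e5 : exp (-(I * ((ω.1 : ℂ) + ω.2) / 2)) * exp (I * (ω.1 - ω.2) / 2)
      = exp (-(I * (-(ω.1 : ℂ) + ω.2) / 2)) * exp (I * (-ω.1 - ω.2) / 2) := by
    rw [← Complex.exp_add, ← Complex.exp_add]; ring_nf
  have e6 : exp (-(I * ((ω.1 : ℂ) - ω.2) / 2)) * exp (I * (ω.1 + ω.2) / 2)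
      = exp (-(I * (-(ω.1 : ℂ) - ω.2) / 2)) * exp (I * (-ω.1 + ω.2) / 2) := by
    rw [← Complex.exp_add, ← Complex.exp_add]; ring_nf
  ext i
  simp only [toSpherical, fromSpherical]
  generalize (((Real.sqrt 2)⁻¹ : ℝ) : ℂ) = s at *
  generalize exp (-(I * ((ω.1 : ℂ) + ω.2) / 2)) = a' at *
  generalize exp (I * ((ω.1 : ℂ) + ω.2) / 2) = a at *
  generalize exp (-(I * (-(ω.1 : ℂ) + ω.2) / 2)) = b' at *
  generalize exp (I * (-(ω.1 : ℂ) + ω.2) / 2) = b at *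
  generalize exp (-(I * ((ω.1 : ℂ) - ω.2) / 2)) = c' at *
  generalize exp (I * ((ω.1 : ℂ) - ω.2) / 2) = c at *
  generalize exp (-(I * (-(ω.1 : ℂ) - ω.2) / 2)) = d' at *
  generalize exp (I * (-(ω.1 : ℂ) - ω.2) / 2) = d at *
  have hI := Complex.I_sq
  fin_cases i
  · simp [Matrix.cons_val]
    linear_combination (-s * s * v 0 * (a' * a + b' * b)) * hI + s * s * v 0 * (e1 + e2)
      - I * s * s * v 1 * e5 + 2 * v 0 * hs
  · simp [Matrix.cons_val]
    linear_combination s * s * v 1 * (e3 + e4) + I * s * s * v 0 * e6 + 2 * v 1 * hs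
  · simp [Matrix.cons_val]
    linear_combination (-s * s * v 2 * (a' * a + b' * b)) * hI + s * s * v 2 * (e1 + e2)
      - I * s * s * v 3 * e5 + 2 * v 2 * hs
  · simp [Matrix.cons_val]
    linear_combination s * s * v 3 * (e3 + e4) + I * s * s * v 2 * e6 + 2 * v 3 * hs

theorem toSpherical_fromSpherical (ω : ℝ × ℝ) (v : Spinor) :
    toSpherical ω (fromSpherical ω v) = v := by
  have hs := inv_sqrt_two_sq
  have e1 : exp (-(I * ((ω.1 : ℂ) + ω.2) / 2)) * exp (I * (ω.1 + ω.2) / 2) = 1 := by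
    rw [← Complex.exp_add]; simp
  have e2 : exp (-(I * (-(ω.1 : ℂ) + ω.2) / 2)) * exp (I * (-ω.1 + ω.2) / 2) = 1 := by
    rw [← Complex.exp_add]; simp
  have e3 : exp (-(I * ((ω.1 : ℂ) - ω.2) / 2)) * exp (I * (ω.1 - ω.2) / 2) = 1 := by
    rw [← Complex.exp_add]; simp
  have e4 : exp (-(I * (-(ω.1 : ℂ) - ω.2) / 2)) * exp (I * (-ω.1 - ω.2) / 2) = 1 := by
    rw [← Complex.exp_add]; simp
  have e5 : exp (-(I * (-(ω.1 : ℂ) + ω.2) / 2)) * exp (I * ((ω.1 : ℂ) + ω.2) / 2)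
      = exp (-(I * (-(ω.1 : ℂ) - ω.2) / 2)) * exp (I * ((ω.1 : ℂ) - ω.2) / 2) := by
    rw [← Complex.exp_add, ← Complex.exp_add]; ring_nf
  have e6 : exp (-(I * ((ω.1 : ℂ) + ω.2) / 2)) * exp (I * (-(ω.1 : ℂ) + ω.2) / 2)
      = exp (-(I * ((ω.1 : ℂ) - ω.2) / 2)) * exp (I * (-(ω.1 : ℂ) - ω.2) / 2) := by
    rw [← Complex.exp_add, ← Complex.exp_add]; ring_nf
  ext i
  simp only [toSpherical, fromSpherical]
  generalize (((Real.sqrt 2)⁻¹ : ℝ) : ℂ) = s at *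
  generalize exp (-(I * ((ω.1 : ℂ) + ω.2) / 2)) = a' at *
  generalize exp (I * ((ω.1 : ℂ) + ω.2) / 2) = a at *
  generalize exp (-(I * (-(ω.1 : ℂ) + ω.2) / 2)) = b' at *
  generalize exp (I * (-(ω.1 : ℂ) + ω.2) / 2) = b at *
  generalize exp (-(I * ((ω.1 : ℂ) - ω.2) / 2)) = c' at *
  generalize exp (I * ((ω.1 : ℂ) - ω.2) / 2) = c at *
  generalize exp (-(I * (-(ω.1 : ℂ) - ω.2) / 2)) = d' at *
  generalize exp (I * (-(ω.1 : ℂ) - ω.2) / 2) = d at *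
  have hI := Complex.I_sq
  fin_cases i
  · simp [Matrix.cons_val]
    linear_combination (-s * s * (v 0 * (a' * a) + v 1 * (b' * a))) * hI
      + s * s * v 0 * (e1 + e3) + s * s * v 1 * e5 + 2 * v 0 * hs
  · simp [Matrix.cons_val]
    linear_combination (-s * s * (v 0 * (a' * b) + v 1 * (b' * b))) * hI
      + s * s * v 1 * (e2 + e4) + s * s * v 0 * e6 + 2 * v 1 * hs
  · simp [Matrix.cons_val]
    linear_combination (-s * s * (v 2 * (a' * a) + v 3 * (b' * a))) * hI
      + s * s * v 2 * (e1 + e3) + s * s * v 3 * e5 + 2 * v 2 * hs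
  · simp [Matrix.cons_val]
    linear_combination (-s * s * (v 2 * (a' * b) + v 3 * (b' * b))) * hI
      + s * s * v 3 * (e2 + e4) + s * s * v 2 * e6 + 2 * v 3 * hs

theorem norm_toSpherical (ω : ℝ × ℝ) (v : Spinor) : ‖toSpherical ω v‖ = ‖v‖ := by
  have h : inner ℂ (toSpherical ω v) (toSpherical ω v) = inner ℂ v v := by
    rw [inner_toSpherical, fromSpherical_toSpherical]
  rw [inner_self_eq_norm_sq_to_K, inner_self_eq_norm_sq_to_K] at h
  have h2 : ‖toSpherical ω v‖ ^ 2 = ‖v‖ ^ 2 := by exact_mod_cast h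
  exact (pow_left_inj₀ (norm_nonneg _) (norm_nonneg _) two_ne_zero).mp h2

theorem norm_fromSpherical (ω : ℝ × ℝ) (v : Spinor) : ‖fromSpherical ω v‖ = ‖v‖ := by
  rw [← norm_toSpherical ω, toSpherical_fromSpherical]

theorem measurable_sphericalY (l : ℕ) (m : ℤ) : Measurable (sphericalY l m) := by
  unfold sphericalY
  have h1 : Measurable fun ω : ℝ × ℝ => Real.sin ω.1 ^ m :=
    (Real.measurable_sin.comp measurable_fst).pow_const m
  have h2 : Measurable fun ω : ℝ × ℝ => (Polynomial.derivative^[(l + m).toNat]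
          ((Polynomial.X ^ 2 - 1 : Polynomial ℝ) ^ l)).eval (Real.cos ω.1) :=
    (Polynomial.continuous _).measurable.comp (Real.measurable_cos.comp measurable_fst)
  fun_prop

theorem continuous_toSpherical : Continuous fun p : (ℝ × ℝ) × Spinor => toSpherical p.1 p.2 := by
  unfold toSpherical
  refine (PiLp.continuous_toLp 2 _).comp (continuous_pi fun i => ?_)
  fin_cases i <;> simp <;> fun_prop

theorem continuous_fromSpherical :
    Continuous fun p : (ℝ × ℝ) × Spinor => fromSpherical p.1 p.2 := by
  unfold fromSpherical
  refine (PiLp.continuous_toLp 2 _).comp (continuous_pi fun i => ?_)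
  fin_cases i <;> simp <;> fun_prop

/-! ### The orthonormal basis of the sphere -/

instance : Countable AngIndex :=
  Function.Injective.countable (f := fun σ : AngIndex => (σ.n, σ.kappa)) fun _ _ h =>
    AngIndex.ext (congrArg Prod.fst h) (congrArg Prod.snd h)

/-- The family `Φ^±_σ`, indexed by `σ` and the sign (`true` for `+`). -/
def basisField (i : AngIndex × Bool) : ℝ × ℝ → Spinor :=
  if i.2 then PhiPlus i.1 else PhiMinus i.1

/-- The components of `Φ^±_σ` relative to the Cartesian spin basis. -/
def cartField (i : AngIndex × Bool) (ω : ℝ × ℝ) : Spinor :=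
  if i.2 then !₂[I * (spinHarm i.1 ω).1, I * (spinHarm i.1 ω).2, 0, 0]
  else !₂[0, 0, (spinHarm i.1.neg ω).1, (spinHarm i.1.neg ω).2]

theorem basisField_eq (i : AngIndex × Bool) (ω : ℝ × ℝ) :
    basisField i ω = toSpherical ω (cartField i ω) := by
  unfold basisField cartField
  split_ifs
  · exact phiPlus_eq _ _
  · exact phiMinus_eq _ _

theorem measurable_spinHarm (σ : AngIndex) : Measurable (spinHarm σ) := by
  unfold spinHarm
  have h1 := measurable_sphericalY σ.ell (σ.n - 1)
  have h2 := measurable_sphericalY σ.ell σ.n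
  fun_prop

theorem measurable_cartField (i : AngIndex × Bool) : Measurable (cartField i) := by
  have h1 := measurable_spinHarm i.1
  have h2 := measurable_spinHarm i.1.neg
  unfold cartField
  split_ifs
  · refine (PiLp.continuous_toLp 2 _).measurable.comp (measurable_pi_lambda _ fun j => ?_)
    fin_cases j
    · exact h1.fst.const_mul I
    · exact h1.snd.const_mul I
    · exact measurable_const
    · exact measurable_const
  · refine (PiLp.continuous_toLp 2 _).measurable.comp (measurable_pi_lambda _ fun j => ?_)
    fin_cases j
    · exact measurable_const
    · exact measurable_const
    · exact h2.fst
    · exact h2.snd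

theorem measurable_toSpherical : Measurable fun p : (ℝ × ℝ) × Spinor => toSpherical p.1 p.2 :=
  continuous_toSpherical.measurable

theorem measurable_basisField (i : AngIndex × Bool) : Measurable (basisField i) := by
  have h : Measurable fun ω => (ω, cartField i ω) := measurable_id.prodMk (measurable_cartField i)
  have h2 := measurable_toSpherical.comp h
  convert h2 using 1
  exact funext (basisField_eq i)

theorem exists_angSmooth_spinHarm (σ : AngIndex) : ∃ u : ℝ × ℝ → ℂ × ℂ,
    AngSmooth (fun ω => (u ω).1) ∧ AngSmooth (fun ω => (u ω).2) ∧
      ∀ ω : ℝ × ℝ, Real.sin ω.1 ≠ 0 → spinHarm σ ω = u ω := by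
  have h1 : ∃ y, AngSmooth y ∧ ∀ ω : ℝ × ℝ, Real.sin ω.1 ≠ 0 →
      σ.c1 * sphericalY σ.ell (σ.n - 1) ω = y ω := by
    rcases σ.c1_eq_zero_or with h | ⟨a, b⟩
    · exact ⟨fun _ => 0, ⟨contDiff_const, by simp⟩, by simp [h]⟩
    · obtain ⟨y, hy, hy'⟩ := exists_angSmooth_eq _ _ a b
      exact ⟨fun ω => σ.c1 * y ω, ⟨contDiff_const.mul hy.contDiff, fun θ φ => by rw [hy.periodic]⟩,
        fun ω hω => by rw [hy' ω hω]⟩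
  have h2 : ∃ y, AngSmooth y ∧ ∀ ω : ℝ × ℝ, Real.sin ω.1 ≠ 0 →
      σ.c2 * sphericalY σ.ell σ.n ω = y ω := by
    rcases σ.c2_eq_zero_or with h | ⟨a, b⟩
    · exact ⟨fun _ => 0, ⟨contDiff_const, by simp⟩, by simp [h]⟩
    · obtain ⟨y, hy, hy'⟩ := exists_angSmooth_eq _ _ a b
      exact ⟨fun ω => σ.c2 * y ω, ⟨contDiff_const.mul hy.contDiff, fun θ φ => by rw [hy.periodic]⟩,
        fun ω hω => by rw [hy' ω hω]⟩
  obtain ⟨y1, a1, b1⟩ := h1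
  obtain ⟨y2, a2, b2⟩ := h2
  exact ⟨fun ω => (y1 ω, y2 ω), a1, a2, fun ω hω => Prod.ext (b1 ω hω) (b2 ω hω)⟩

theorem exists_bound_spinHarm (σ : AngIndex) : ∃ C : ℝ, ∀ ω ∈ angRect, ‖spinHarm σ ω‖ ≤ C := by
  obtain ⟨u, h1, h2, hu⟩ := exists_angSmooth_spinHarm σ
  have hc : Continuous u := h1.contDiff.continuous.prodMk h2.contDiff.continuous
  obtain ⟨C, hC⟩ := (isCompact_Icc.prod isCompact_Icc :
    IsCompact (Set.Icc 0 Real.pi ×ˢ Set.Icc 0 (2 * Real.pi))).exists_bound_of_continuousOn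
      hc.continuousOn
  refine ⟨C, fun ω hω => ?_⟩
  rw [hu ω (sin_pos_of_mem_angRect hω).ne']
  exact hC ω ⟨Set.Ioo_subset_Icc_self hω.1, Set.Ioo_subset_Icc_self hω.2⟩

theorem norm_spinor_le (v : Spinor) : ‖v‖ ≤ ‖v 0‖ + ‖v 1‖ + ‖v 2‖ + ‖v 3‖ := by
  rw [EuclideanSpace.norm_eq, Fin.sum_univ_four]
  refine Real.sqrt_le_iff.mpr ⟨by positivity, ?_⟩
  have := norm_nonneg (v 0)
  have := norm_nonneg (v 1)
  have := norm_nonneg (v 2)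
  have := norm_nonneg (v 3)
  have : 0 ≤ ‖v 0‖ * ‖v 1‖ + ‖v 0‖ * ‖v 2‖ + ‖v 0‖ * ‖v 3‖ + ‖v 1‖ * ‖v 2‖ + ‖v 1‖ * ‖v 3‖
    + ‖v 2‖ * ‖v 3‖ := by positivity
  nlinarith

theorem exists_bound_basisField (i : AngIndex × Bool) :
    ∃ C : ℝ, ∀ ω ∈ angRect, ‖basisField i ω‖ ≤ C := by
  obtain ⟨C1, h1⟩ := exists_bound_spinHarm i.1
  obtain ⟨C2, h2⟩ := exists_bound_spinHarm i.1.neg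
  refine ⟨C1 + C1 + (C2 + C2), fun ω hω => ?_⟩
  rw [basisField_eq, norm_toSpherical]
  refine (norm_spinor_le _).trans ?_
  have k1 := h1 ω hω
  have k2 := h2 ω hω
  have a1 := norm_fst_le (spinHarm i.1 ω)
  have a2 := norm_snd_le (spinHarm i.1 ω)
  have a3 := norm_fst_le (spinHarm i.1.neg ω)
  have a4 := norm_snd_le (spinHarm i.1.neg ω)
  have b1 := norm_nonneg (spinHarm i.1 ω)
  have b2 := norm_nonneg (spinHarm i.1.neg ω)
  unfold cartField
  split_ifs
  · simp [Matrix.cons_val]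
    linarith
  · simp [Matrix.cons_val]
    linarith

theorem memLp_basisField (i : AngIndex × Bool) : MemLp (basisField i) 2 sphereMeasure := by
  obtain ⟨C, hC⟩ := exists_bound_basisField i
  refine MemLp.of_bound (measurable_basisField i).aestronglyMeasurable C ?_
  filter_upwards [ae_mem_angRect] with ω hω using hC ω hω

/-- The angular coefficients in terms of Cartesian spinor components. -/
theorem integral_inner_basisField (i : AngIndex × Bool) (w : ℝ × ℝ → Spinor)
    (hw : ∀ j, Integrable (fun ω => (fromSpherical ω (w ω)) j) sphereMeasure) :
    ∫ ω, inner ℂ (basisField i ω) (w ω) ∂sphereMeasure =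
      if i.2 then -I * spinPair (spinHarm i.1)
        (fun ω => (fromSpherical ω (w ω) 0, fromSpherical ω (w ω) 1))
      else spinPair (spinHarm i.1.neg)
        (fun ω => (fromSpherical ω (w ω) 2, fromSpherical ω (w ω) 3)) := by
  have hint : ∀ (σ : AngIndex) (j : Fin 4),
      Integrable (fun ω => (starRingEnd ℂ) (spinHarm σ ω).1 * fromSpherical ω (w ω) j)
        sphereMeasure ∧
      Integrable (fun ω => (starRingEnd ℂ) (spinHarm σ ω).2 * fromSpherical ω (w ω) j)
        sphereMeasure := by
    intro σ j
    obtain ⟨C, hC⟩ := exists_bound_spinHarm σ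
    have hm := measurable_spinHarm σ
    constructor
    · refine Integrable.bdd_mul (hw j) (c := C)
        (Complex.continuous_conj.measurable.comp hm.fst).aestronglyMeasurable ?_
      filter_upwards [ae_mem_angRect] with ω hω
      rw [RCLike.norm_conj]
      exact (norm_fst_le _).trans (hC ω hω)
    · refine Integrable.bdd_mul (hw j) (c := C)
        (Complex.continuous_conj.measurable.comp hm.snd).aestronglyMeasurable ?_
      filter_upwards [ae_mem_angRect] with ω hω
      rw [RCLike.norm_conj]
      exact (norm_snd_le _).trans (hC ω hω)
  simp_rw [basisField_eq, inner_toSpherical, inner_spinor]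
  unfold cartField spinPair spherePair
  split_ifs
  · rw [← integral_add (hint i.1 0).1 (hint i.1 1).2, ← integral_const_mul]
    congr 1
    funext ω
    simp [Matrix.cons_val]
    ring
  · rw [← integral_add (hint i.1.neg 2).1 (hint i.1.neg 3).2]
    congr 1
    funext ω
    simp [Matrix.cons_val]

theorem integrable_spinHarm (σ : AngIndex) : Integrable (spinHarm σ) sphereMeasure := by
  obtain ⟨C, hC⟩ := exists_bound_spinHarm σ
  refine Integrable.of_bound (measurable_spinHarm σ).aestronglyMeasurable C ?_
  filter_upwards [ae_mem_angRect] with ω hω using hC ω hω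

/-- Orthonormality of the `Φ^±_σ`. -/
theorem integral_inner_basisField_basisField (i j : AngIndex × Bool) [Decidable (i = j)] :
    ∫ ω, inner ℂ (basisField i ω) (basisField j ω) ∂sphereMeasure = if i = j then 1 else 0 := by
  classical
  have e : ∀ ω, fromSpherical ω (basisField j ω) = cartField j ω := fun ω => by
    rw [basisField_eq, fromSpherical_toSpherical]
  rw [integral_inner_basisField]
  · simp only [e]
    obtain ⟨σ, s⟩ := i
    obtain ⟨τ, t⟩ := j
    have hz : ∀ ρ : AngIndex, spinPair (spinHarm ρ) (fun _ => (0, 0)) = 0 := by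
      intro ρ; simp [spinPair, spherePair]
    cases s <;> cases t
    · simp only [cartField, Bool.false_eq_true, if_false]
      simp only [Matrix.cons_val]
      have := spinPair_spinHarm σ.neg τ.neg
      rw [show (fun ω => ((spinHarm τ.neg ω).1, (spinHarm τ.neg ω).2)) = spinHarm τ.neg from rfl,
        this]
      simp [AngIndex.neg_injective.eq_iff]
    · simp only [cartField, Bool.false_eq_true, if_false, if_true]
      simp only [Matrix.cons_val, hz]
      simp
    · simp only [cartField, Bool.false_eq_true, if_false, if_true]
      simp only [Matrix.cons_val, hz]
      simp
    · simp only [cartField, if_true]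
      simp only [Matrix.cons_val]
      have h1 := spinPair_spinHarm σ τ
      have h2 : spinPair (spinHarm σ) (fun ω => (I * (spinHarm τ ω).1, I * (spinHarm τ ω).2))
          = I * spinPair (spinHarm σ) (spinHarm τ) := by
        simp only [spinPair, spherePair_const_mul_right, mul_add]
      rw [h2, h1]
      simp
  · intro k
    simp only [e]
    have a1 := integrable_spinHarm j.1
    have a2 := integrable_spinHarm j.1.neg
    unfold cartField
    split_ifs
    · fin_cases k
      · simpa using a1.fst.const_mul I
      · simpa using a1.snd.const_mul I
      · simp
      · simp
    · fin_cases k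
      · simp
      · simp
      · simpa using a2.fst
      · simpa using a2.snd

/-- Completeness of the `Φ^±_σ`. -/
theorem ae_eq_zero_of_integral_inner_basisField {w : ℝ × ℝ → Spinor} (hw : MemLp w 2 sphereMeasure)
    (h : ∀ i, ∫ ω, inner ℂ (basisField i ω) (w ω) ∂sphereMeasure = 0) :
    w =ᵐ[sphereMeasure] 0 := by
  have hm : AEStronglyMeasurable (fun ω => fromSpherical ω (w ω)) sphereMeasure :=
    Continuous.comp_aestronglyMeasurable (f := fun ω => (ω, w ω))
      (g := fun p : (ℝ × ℝ) × Spinor => fromSpherical p.1 p.2) continuous_fromSpherical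
      (aestronglyMeasurable_id.prodMk hw.aestronglyMeasurable)
  have hL : MemLp (fun ω => fromSpherical ω (w ω)) 2 sphereMeasure :=
    hw.of_le hm (Filter.Eventually.of_forall fun ω => (norm_fromSpherical _ _).le)
  have hLj : ∀ j, MemLp (fun ω => fromSpherical ω (w ω) j) 2 sphereMeasure := fun j =>
    hL.of_le ((EuclideanSpace.proj (𝕜 := ℂ) j).continuous.comp_aestronglyMeasurable hm)
      (Filter.Eventually.of_forall fun ω => PiLp.norm_apply_le _ j)
  have hi : ∀ j, Integrable (fun ω => fromSpherical ω (w ω) j) sphereMeasure :=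
    fun j => (hLj j).integrable one_le_two
  have k1 := ae_eq_zero_of_spinPair_spinHarm
    (v := fun ω => (fromSpherical ω (w ω) 0, fromSpherical ω (w ω) 1)) (hLj 0) (hLj 1) (by
      intro σ
      have := h (σ, true)
      rw [integral_inner_basisField _ _ hi] at this
      simpa using this)
  have k2 := ae_eq_zero_of_spinPair_spinHarm
    (v := fun ω => (fromSpherical ω (w ω) 2, fromSpherical ω (w ω) 3)) (hLj 2) (hLj 3) (by
      intro σ
      have := h (σ.neg, false)
      rw [integral_inner_basisField _ _ hi] at this
      simpa [AngIndex.neg_neg] using this)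
  filter_upwards [k1, k2] with ω a1 a2
  simp only [Pi.zero_apply, Prod.mk_eq_zero] at a1 a2
  have : fromSpherical ω (w ω) = 0 := by
    ext j
    fin_cases j
    · exact a1.1
    · exact a1.2
    · exact a2.1
    · exact a2.2
  rw [Pi.zero_apply, ← norm_eq_zero, ← norm_fromSpherical ω, this, norm_zero]

/-! ### Radial geometry -/

/-- `ρ(r) = r A(r) = √(r² - 2Mr + Q²)`, which is smooth and positive on all of `ℝ`. -/
def rho (M Q r : ℝ) : ℝ := Real.sqrt (r ^ 2 - 2 * M * r + Q ^ 2)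

section radial

variable (M Q : ℝ) [hMQ : Fact (M ^ 2 < Q ^ 2)]

theorem rho_arg_pos (r : ℝ) : 0 < r ^ 2 - 2 * M * r + Q ^ 2 := by
  nlinarith [hMQ.out, sq_nonneg (r - M)]

theorem rho_pos (r : ℝ) : 0 < rho M Q r := Real.sqrt_pos.mpr (rho_arg_pos M Q r)

theorem contDiff_rho : ContDiff ℝ 1 (rho M Q) := by
  unfold rho
  exact ContDiff.sqrt (by fun_prop) fun r => (rho_arg_pos M Q r).ne'

theorem continuous_rho : Continuous (rho M Q) := (contDiff_rho M Q).continuous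

omit hMQ in
theorem A_eq {r : ℝ} (hr : 0 < r) : A M Q r = rho M Q r / r := by
  unfold A rho
  rw [show 1 - 2 * M / r + Q ^ 2 / r ^ 2 = (r ^ 2 - 2 * M * r + Q ^ 2) / r ^ 2 by
    field_simp, Real.sqrt_div' _ (sq_nonneg r), Real.sqrt_sq hr.le]

theorem A_pos {r : ℝ} (hr : 0 < r) : 0 < A M Q r := by
  rw [A_eq M Q hr]
  exact div_pos (rho_pos M Q r) hr

omit hMQ in
theorem measurable_A : Measurable (A M Q) := by
  unfold A
  fun_prop

/-- The square root of the density of the radial measure. -/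
def rwt (r : ℝ) : ℝ := Real.sqrt ((A M Q r)⁻¹ * r ^ 2)

omit hMQ in
theorem measurable_rwt : Measurable (rwt M Q) := by
  unfold rwt
  have := measurable_A M Q
  fun_prop

theorem rwt_pos {r : ℝ} (hr : 0 < r) : 0 < rwt M Q r := by
  have := A_pos M Q hr
  exact Real.sqrt_pos.mpr (by positivity)

theorem rwt_sq {r : ℝ} (hr : 0 < r) : rwt M Q r ^ 2 = (A M Q r)⁻¹ * r ^ 2 := by
  have := A_pos M Q hr
  exact Real.sq_sqrt (by positivity)

/-- Lebesgue measure on the half-line. -/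
abbrev halfLine : Measure ℝ := volume.restrict (Set.Ioi 0)

/-- The radial Hilbert space `L²((0,∞), dr)`. -/
abbrev Radial : Type := Lp ℂ 2 halfLine

theorem ae_halfLine_pos : ∀ᵐ r ∂halfLine, 0 < r := ae_restrict_mem measurableSet_Ioi

omit hMQ in
theorem radialMeasure_ac : radialMeasure M Q ≪ halfLine := withDensity_absolutelyContinuous _ _

theorem halfLine_ac : halfLine ≪ radialMeasure M Q := by
  refine withDensity_absolutelyContinuous' ?_ ?_
  · have := measurable_A M Q
    fun_prop
  · filter_upwards [ae_halfLine_pos] with r hr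
    have := A_pos M Q hr
    have h : 0 < (A M Q r)⁻¹ * r ^ 2 := by positivity
    simp [h]

instance : SFinite (radialMeasure M Q) := by unfold radialMeasure; infer_instance

theorem integrable_radialMeasure_iff {E : Type*} [NormedAddCommGroup E] [NormedSpace ℝ E]
    {f : ℝ → E} :
    Integrable f (radialMeasure M Q) ↔ Integrable (fun r => rwt M Q r ^ 2 • f r) halfLine := by
  have h := measurable_A M Q
  unfold radialMeasure
  rw [integrable_withDensity_iff_integrable_smul' (by fun_prop) (by simp)]
  refine integrable_congr ?_
  filter_upwards [ae_halfLine_pos] with r hr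
  have := A_pos M Q hr
  rw [rwt_sq M Q hr, ENNReal.toReal_ofReal (by positivity)]

theorem integral_radialMeasure {E : Type*} [NormedAddCommGroup E] [NormedSpace ℝ E] (f : ℝ → E) :
    ∫ r, f r ∂radialMeasure M Q = ∫ r, rwt M Q r ^ 2 • f r ∂halfLine := by
  have h := measurable_A M Q
  unfold radialMeasure
  rw [integral_withDensity_eq_integral_toReal_smul (by fun_prop) (by simp)]
  refine integral_congr_ae ?_
  filter_upwards [ae_halfLine_pos] with r hr
  have := A_pos M Q hr
  rw [rwt_sq M Q hr, ENNReal.toReal_ofReal (by positivity)]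

/-! ### Decomposition into angular channels -/

/-- The field `(r, ω) ↦ (A⁻¹ r²)^{-1/2} u(r) Φ_i(ω)`. -/
def channelField (i : AngIndex × Bool) (u : ℝ → ℂ) (p : ℝ × (ℝ × ℝ)) : Spinor :=
  (((rwt M Q p.1)⁻¹ : ℝ) * u p.1 : ℂ) • basisField i p.2

omit hMQ in
theorem aestronglyMeasurable_channelField (i : AngIndex × Bool) {u : ℝ → ℂ}
    (hu : AEStronglyMeasurable u halfLine) :
    AEStronglyMeasurable (channelField M Q i u) (spaceMeasure M Q) := by
  have h1 : AEStronglyMeasurable (fun r => (((rwt M Q r)⁻¹ : ℝ) * u r : ℂ))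
      (radialMeasure M Q) := by
    refine AEStronglyMeasurable.mul ?_ (hu.mono_ac (radialMeasure_ac M Q))
    exact (Complex.measurable_ofReal.comp (measurable_rwt M Q).inv).aestronglyMeasurable
  exact h1.comp_fst.smul (measurable_basisField i).aestronglyMeasurable.comp_snd

theorem memLp_channelField (i : AngIndex × Bool) {u : ℝ → ℂ} (hu : MemLp u 2 halfLine) :
    MemLp (channelField M Q i u) 2 (spaceMeasure M Q) := by
  rw [memLp_two_iff_integrable_sq_norm
    (aestronglyMeasurable_channelField M Q i hu.aestronglyMeasurable)]
  have h1 : Integrable (fun r => ‖((rwt M Q r)⁻¹ : ℝ) * u r‖ ^ 2) (radialMeasure M Q) := by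
    rw [integrable_radialMeasure_iff]
    refine (memLp_two_iff_integrable_sq_norm hu.aestronglyMeasurable).mp hu |>.congr ?_
    filter_upwards [ae_halfLine_pos] with r hr
    have := rwt_pos M Q hr
    rw [norm_mul, Complex.norm_real, Real.norm_of_nonneg (by positivity), smul_eq_mul]
    field_simp
  have h2 : Integrable (fun ω => ‖basisField i ω‖ ^ 2) sphereMeasure :=
    (memLp_two_iff_integrable_sq_norm (memLp_basisField i).aestronglyMeasurable).mp
      (memLp_basisField i)
  refine (h1.mul_prod h2).congr (Filter.Eventually.of_forall fun p => ?_)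
  simp only [channelField, norm_smul, mul_pow]

theorem inner_channelField (i j : AngIndex × Bool) [Decidable (i = j)] (u w : ℝ → ℂ) :
    ∫ p, inner ℂ (channelField M Q i u p) (channelField M Q j w p) ∂spaceMeasure M Q
      = if i = j then ∫ r, inner ℂ (u r) (w r) ∂halfLine else 0 := by
  have h : ∀ p : ℝ × (ℝ × ℝ), inner ℂ (channelField M Q i u p) (channelField M Q j w p)
      = (((rwt M Q p.1)⁻¹ : ℝ) * ((rwt M Q p.1)⁻¹ : ℝ) * inner ℂ (u p.1) (w p.1) : ℂ)
        * inner ℂ (basisField i p.2) (basisField j p.2) := by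
    intro p
    simp only [channelField, inner_smul_left, inner_smul_right, map_mul, Complex.conj_ofReal,
      RCLike.inner_apply]
    ring
  simp_rw [h]
  unfold spaceMeasure
  rw [integral_prod_mul (μ := radialMeasure M Q) (ν := sphereMeasure)
    (fun r => (((rwt M Q r)⁻¹ : ℝ) * ((rwt M Q r)⁻¹ : ℝ) * inner ℂ (u r) (w r) : ℂ))
    (fun ω => inner ℂ (basisField i ω) (basisField j ω)),
    integral_inner_basisField_basisField, integral_radialMeasure]
  split_ifs
  · rw [mul_one]
    refine integral_congr_ae ?_
    filter_upwards [ae_halfLine_pos] with r hr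
    have := Complex.ofReal_ne_zero.mpr (rwt_pos M Q hr).ne'
    rw [Complex.real_smul]
    push_cast
    field_simp
  · rw [mul_zero]

/-- The embedding of the radial Hilbert space as the channel of `Φ_i`. -/
def embed (i : AngIndex × Bool) : Radial →ₗᵢ[ℂ] OneParticle M Q :=
  LinearMap.isometryOfInner
    { toFun := fun u => (memLp_channelField M Q i (Lp.memLp u)).toLp _
      map_add' := fun u w => by
        rw [← MemLp.toLp_add]
        refine MemLp.toLp_congr _ _ ?_
        have h := (Measure.quasiMeasurePreserving_fst (μ := radialMeasure M Q)
          (ν := sphereMeasure)).ae (radialMeasure_ac M Q (Lp.coeFn_add u w))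
        filter_upwards [h] with p hp
        simp only [Pi.add_apply, channelField, hp, mul_add, add_smul]
      map_smul' := fun c u => by
        rw [RingHom.id_apply, ← MemLp.toLp_const_smul]
        refine MemLp.toLp_congr _ _ ?_
        have h := (Measure.quasiMeasurePreserving_fst (μ := radialMeasure M Q)
          (ν := sphereMeasure)).ae (radialMeasure_ac M Q (Lp.coeFn_smul c u))
        filter_upwards [h] with p hp
        simp only [Pi.smul_apply, channelField, hp, smul_eq_mul, smul_smul]
        ring_nf }
    (fun u w => by
      rw [L2.inner_def, L2.inner_def]
      have h1 := (memLp_channelField M Q i (Lp.memLp u)).coeFn_toLp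
      have h2 := (memLp_channelField M Q i (Lp.memLp w)).coeFn_toLp
      classical
      rw [← (inner_channelField M Q i i u w).trans (if_pos rfl)]
      refine integral_congr_ae ?_
      filter_upwards [h1, h2] with p a b
      simp only [LinearMap.coe_mk, AddHom.coe_mk]
      rw [a, b])

theorem embed_ae (i : AngIndex × Bool) (u : Radial) :
    embed M Q i u =ᵐ[spaceMeasure M Q] channelField M Q i u :=
  (memLp_channelField M Q i (Lp.memLp u)).coeFn_toLp

theorem inner_embed_embed {i j : AngIndex × Bool} (hij : i ≠ j) (u w : Radial) :
    inner ℂ (embed M Q i u) (embed M Q j w) = 0 := by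
  classical
  rw [L2.inner_def, ← (inner_channelField M Q i j u w).trans (if_neg hij)]
  refine integral_congr_ae ?_
  filter_upwards [embed_ae M Q i u, embed_ae M Q j w] with p a b
  rw [a, b]

/-- The radial function of a field in the channel of `Φ_i`. -/
def chan (i : AngIndex × Bool) : OneParticle M Q →L[ℂ] Radial :=
  ContinuousLinearMap.adjoint (embed M Q i).toContinuousLinearMap

theorem inner_chan (i : AngIndex × Bool) (u : Radial) (ψ : OneParticle M Q) :
    inner ℂ u (chan M Q i ψ) = inner ℂ (embed M Q i u) ψ :=
  ContinuousLinearMap.adjoint_inner_right _ _ _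

theorem chan_embed (i j : AngIndex × Bool) [Decidable (i = j)] (u : Radial) :
    chan M Q i (embed M Q j u) = if i = j then u else 0 := by
  refine ext_inner_left ℂ fun w => ?_
  rw [inner_chan]
  split_ifs with h
  · subst h
    exact (embed M Q i).inner_map_map w u
  · rw [inner_embed_embed M Q h, inner_zero_right]

theorem integrable_and_inner_embed (i : AngIndex × Bool) (u : Radial) (ψ : OneParticle M Q) :
    Integrable (fun r => (starRingEnd ℂ) (u r) * (rwt M Q r * angCoeff (basisField i) ψ r))
      halfLine ∧
    inner ℂ (embed M Q i u) ψ
      = ∫ r, (starRingEnd ℂ) (u r) * (rwt M Q r * angCoeff (basisField i) ψ r) ∂halfLine := by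
  have h1 : Integrable (fun p => inner ℂ (channelField M Q i u p) (ψ p)) (spaceMeasure M Q) := by
    refine (L2.integrable_inner (𝕜 := ℂ) (embed M Q i u) ψ).congr ?_
    filter_upwards [embed_ae M Q i u] with p a
    rw [a]
  have h2 : ∀ r, ∫ ω, inner ℂ (channelField M Q i u (r, ω)) (ψ (r, ω)) ∂sphereMeasure
      = ((rwt M Q r)⁻¹ : ℝ) * (starRingEnd ℂ) (u r) * angCoeff (basisField i) ψ r := by
    intro r
    simp only [channelField, inner_smul_left, map_mul, Complex.conj_ofReal]
    rw [integral_const_mul]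
    rfl
  have h4 : (fun r => rwt M Q r ^ 2 • (((rwt M Q r)⁻¹ : ℝ) * (starRingEnd ℂ) (u r)
      * angCoeff (basisField i) ψ r : ℂ)) =ᵐ[halfLine]
      fun r => (starRingEnd ℂ) (u r) * (rwt M Q r * angCoeff (basisField i) ψ r) := by
    filter_upwards [ae_halfLine_pos] with r hr
    have := Complex.ofReal_ne_zero.mpr (rwt_pos M Q hr).ne'
    rw [Complex.real_smul]
    push_cast
    field_simp
  constructor
  · have h3 : Integrable (fun r => ∫ ω, inner ℂ (channelField M Q i u (r, ω)) (ψ (r, ω))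
        ∂sphereMeasure) (radialMeasure M Q) := h1.integral_prod_left
    simp_rw [h2] at h3
    rw [integrable_radialMeasure_iff] at h3
    exact h3.congr h4
  · have h5 : inner ℂ (embed M Q i u) ψ
        = ∫ p, inner ℂ (channelField M Q i u p) (ψ p) ∂spaceMeasure M Q := by
      rw [L2.inner_def]
      refine integral_congr_ae ?_
      filter_upwards [embed_ae M Q i u] with p a
      rw [a]
    rw [h5]
    have h6 := integral_prod (μ := radialMeasure M Q) (ν := sphereMeasure) _ h1
    simp only [h2] at h6
    refine h6.trans ?_
    rw [integral_radialMeasure]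
    exact integral_congr_ae h4

/-- The channel functions are, up to the square root of the radial density, the angular
coefficients. -/
theorem chan_ae (i : AngIndex × Bool) (ψ : OneParticle M Q) :
    chan M Q i ψ =ᵐ[halfLine] fun r => rwt M Q r * angCoeff (basisField i) ψ r := by
  have key : ∀ s, MeasurableSet s → halfLine s < ⊤ →
      IntegrableOn (fun r => rwt M Q r * angCoeff (basisField i) ψ r) s halfLine ∧
      ∫ r in s, chan M Q i ψ r ∂halfLine
        = ∫ r in s, rwt M Q r * angCoeff (basisField i) ψ r ∂halfLine := by
    intro s hs hs'
    set u : Radial := indicatorConstLp 2 hs hs'.ne (1 : ℂ) with hu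
    have e : ∀ F : ℝ → ℂ, (fun r => (starRingEnd ℂ) (u r) * F r) =ᵐ[halfLine] s.indicator F := by
      intro F
      filter_upwards [indicatorConstLp_coeFn (p := 2) (hs := hs) (hμs := hs'.ne) (c := (1 : ℂ))]
        with r hr
      rw [hu, hr]
      by_cases h : r ∈ s <;> simp [h]
    obtain ⟨h1, h2⟩ := integrable_and_inner_embed M Q i u ψ
    have h3 := h1.congr (e _)
    rw [integrable_indicator_iff hs] at h3
    refine ⟨h3, ?_⟩
    rw [← inner_chan, L2.inner_def, integral_congr_ae (e _), integral_indicator hs] at h2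
    rw [← h2, ← integral_indicator hs]
    refine integral_congr_ae ?_
    filter_upwards [e (chan M Q i ψ)] with r hr
    rw [RCLike.inner_apply, mul_comm, ← hr]
  refine ae_eq_of_forall_setIntegral_eq_of_sigmaFinite ?_ (fun s hs hs' => (key s hs hs').1)
    (fun s hs hs' => (key s hs hs').2)
  intro s hs hs'
  have : IsFiniteMeasure (halfLine.restrict s) := ⟨by rwa [Measure.restrict_apply_univ]⟩
  exact ((Lp.memLp (chan M Q i ψ)).restrict s).integrable one_le_two

omit hMQ in
theorem ae_memLp_section (ψ : OneParticle M Q) :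
    ∀ᵐ r ∂radialMeasure M Q, MemLp (fun ω => ψ (r, ω)) 2 sphereMeasure := by
  have hm : AEStronglyMeasurable ψ ((radialMeasure M Q).prod sphereMeasure) :=
    (Lp.memLp ψ).aestronglyMeasurable
  have h := (memLp_two_iff_integrable_sq_norm hm).mp (Lp.memLp ψ)
  filter_upwards [h.prod_right_ae, hm.prodMk_left] with r h1 h2
  exact (memLp_two_iff_integrable_sq_norm h2).mpr h1

/-- A field all of whose channel functions vanish is zero. -/
theorem eq_zero_of_chan_eq_zero (ψ : OneParticle M Q) (h : ∀ i, chan M Q i ψ = 0) : ψ = 0 := by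
  have h1 : ∀ᵐ r ∂radialMeasure M Q, ∀ i, angCoeff (basisField i) ψ r = 0 := by
    refine radialMeasure_ac M Q (ae_all_iff.mpr fun i => ?_)
    filter_upwards [chan_ae M Q i ψ, ae_halfLine_pos, Lp.coeFn_zero ℂ 2 halfLine] with r a b c
    rw [h i, c, Pi.zero_apply] at a
    exact (mul_eq_zero.mp a.symm).resolve_left (Complex.ofReal_ne_zero.mpr (rwt_pos M Q b).ne')
  have h2 : ∀ᵐ r ∂radialMeasure M Q, ∀ᵐ ω ∂sphereMeasure, ψ (r, ω) = 0 := by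
    filter_upwards [h1, ae_memLp_section M Q ψ] with r a b
    exact ae_eq_zero_of_integral_inner_basisField b a
  have hm : AEStronglyMeasurable ψ ((radialMeasure M Q).prod sphereMeasure) :=
    (Lp.memLp ψ).aestronglyMeasurable
  exact (Lp.eq_zero_iff_ae_eq_zero).mpr (ae_prod_eq_zero hm h2)

theorem isHilbertSum_embed : IsHilbertSum ℂ (fun _ : AngIndex × Bool => Radial) (embed M Q) := by
  refine IsHilbertSum.mk (fun i j hij u w => inner_embed_embed M Q hij u w) ?_
  rw [top_le_iff, Submodule.topologicalClosure_eq_top_iff, Submodule.eq_bot_iff]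
  intro ψ hψ
  refine eq_zero_of_chan_eq_zero M Q ψ fun i => ?_
  refine ext_inner_left ℂ fun u => ?_
  rw [inner_chan, inner_zero_right]
  exact (Submodule.mem_orthogonal _ _).mp hψ _
    (Submodule.mem_iSup_of_mem i (LinearMap.mem_range_self _ u))

/-- Parseval's identity for the decomposition into channels. -/
theorem hasSum_inner_chan (ψ η : OneParticle M Q) :
    HasSum (fun i => inner ℂ (chan M Q i ψ) (chan M Q i η)) (inner ℂ ψ η) := by
  classical
  set W := (isHilbertSum_embed M Q).linearIsometryEquiv with hW
  have h : ∀ (ψ : OneParticle M Q) i, W ψ i = chan M Q i ψ := by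
    intro ψ i
    refine ext_inner_left ℂ fun u => ?_
    rw [inner_chan, ← lp.inner_single_left i u (W ψ), ← W.symm.inner_map_map,
      W.symm_apply_apply, hW, (isHilbertSum_embed M Q).linearIsometryEquiv_symm_apply_single]
  have := lp.hasSum_inner (𝕜 := ℂ) (W ψ) (W η)
  rw [W.inner_map_map] at this
  simpa only [h] using this

theorem hasSum_norm_chan (ψ : OneParticle M Q) :
    HasSum (fun i => ‖chan M Q i ψ‖ ^ 2) (‖ψ‖ ^ 2) := by
  have h := hasSum_inner_chan M Q ψ ψ
  simp only [inner_self_eq_norm_sq_to_K] at h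
  exact_mod_cast h

end radial

/-! ### Products of primitives -/

theorem absolutelyContinuousOnInterval_primitive {p : ℝ → ℂ} {a b : ℝ}
    (hp : IntervalIntegrable p volume a b) :
    AbsolutelyContinuousOnInterval (fun x => ∫ t in a..x, p t) a b := by
  have h := hp.norm.absolutelyContinuousOnInterval_intervalIntegral (Set.left_mem_uIcc)
  unfold AbsolutelyContinuousOnInterval at h ⊢
  refine squeeze_zero' (Filter.Eventually.of_forall fun E => Finset.sum_nonneg fun _ _ =>
    dist_nonneg) ?_ h
  filter_upwards [Filter.mem_inf_of_right (Filter.mem_principal_self _)] with E hE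
  refine Finset.sum_le_sum fun i hi => ?_
  obtain ⟨h1, h2⟩ := hE.1 i hi
  have i1 : ∀ {x}, x ∈ Set.uIcc a b → IntervalIntegrable p volume a x := fun hx =>
    hp.mono_set (Set.uIcc_subset_uIcc Set.left_mem_uIcc hx)
  rw [dist_comm, dist_comm (∫ v in a..(E.2 i).1, ‖p v‖), dist_eq_norm, Real.dist_eq,
    intervalIntegral.integral_interval_sub_left (i1 h2) (i1 h1),
    intervalIntegral.integral_interval_sub_left (i1 h2).norm (i1 h1).norm]
  exact intervalIntegral.norm_integral_le_abs_integral_norm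

/-- Integration by parts for two primitives of integrable functions. -/
theorem primitive_mul_primitive {p s : ℝ → ℂ} {R : ℝ} (c d : ℂ)
    (hp : IntervalIntegrable p volume 0 R) (hs : IntervalIntegrable s volume 0 R) :
    (c + ∫ t in 0..R, p t) * (d + ∫ t in 0..R, s t) = c * d
      + ∫ r in 0..R, (p r * (d + ∫ t in 0..r, s t) + (c + ∫ t in 0..r, p t) * s r) := by
  have aP := absolutelyContinuousOnInterval_primitive hp
  have aS := absolutelyContinuousOnInterval_primitive hs
  have aC : ∀ e : ℂ, AbsolutelyContinuousOnInterval (fun _ : ℝ => e) 0 R := fun e =>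
    ((LipschitzWith.const e).lipschitzOnWith (s := Set.uIcc 0 R)).absolutelyContinuousOnInterval
  have aF : AbsolutelyContinuousOnInterval (fun r => c + ∫ t in 0..r, p t) 0 R :=
    (aC c).fun_add aP
  have aG : AbsolutelyContinuousOnInterval (fun r => d + ∫ t in 0..r, s t) 0 R :=
    (aC d).fun_add aS
  have hi : IntervalIntegrable (fun r => p r * (d + ∫ t in 0..r, s t)
      + (c + ∫ t in 0..r, p t) * s r) volume 0 R :=
    (hp.mul_continuousOn aG.continuousOn).add (hs.continuousOn_mul aF.continuousOn)
  have aI := absolutelyContinuousOnInterval_primitive hi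
  have aFG : AbsolutelyContinuousOnInterval
      (fun r => (c + ∫ t in 0..r, p t) * (d + ∫ t in 0..r, s t)) 0 R := aF.fun_smul aG
  obtain ⟨C, hC⟩ := (aFG.fun_sub aI).const_of_ae_hasDerivAt_zero (by
    filter_upwards [hp.ae_hasDerivAt_integral, hs.ae_hasDerivAt_integral,
      hi.ae_hasDerivAt_integral] with x h1 h2 h3 hx
    have k1 := (h1 hx 0 Set.left_mem_uIcc).const_add c
    have k2 := (h2 hx 0 Set.left_mem_uIcc).const_add d
    have k3 := h3 hx 0 Set.left_mem_uIcc
    have k4 := (k1.fun_mul k2).fun_sub k3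
    rwa [sub_self] at k4)
  have e1 := hC 0 Set.left_mem_uIcc
  have e2 := hC R Set.right_mem_uIcc
  simp only [intervalIntegral.integral_same, add_zero, sub_zero] at e1
  rw [← e1] at e2
  linear_combination e2

theorem conj_intervalIntegral (p : ℝ → ℂ) (a b : ℝ) :
    (starRingEnd ℂ) (∫ t in a..b, p t) = ∫ t in a..b, (starRingEnd ℂ) (p t) := by
  simp only [intervalIntegral, map_sub, integral_conj]

/-! ### The radial equations -/

section radial

variable (M Q : ℝ)

/-- The tortoise-like coordinate `τ(r) = ∫₀^r dt / ρ(t)`. -/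
def tau (r : ℝ) : ℝ := ∫ t in (0 : ℝ)..r, (rho M Q t)⁻¹

/-- `b(r) = r / ρ(r) = A(r)⁻¹`. -/
def bfun (r : ℝ) : ℝ := r / rho M Q r

/-- The primitive `c + ∫₀^r e^{κτ} h`. -/
def primit (κ : ℝ) (c : ℂ) (h : ℝ → ℂ) (r : ℝ) : ℂ :=
  c + ∫ t in (0 : ℝ)..r, (Real.exp (κ * tau M Q t) : ℂ) * h t

/-- `f = b e^{-κτ} (c + ∫₀^r e^{κτ} h)`: this is the integrated form of the differential equation
`((ρ r)^{1/2} φ)' + (κ/ρ) (ρ r)^{1/2} φ = h`, for `f` the channel function of `φ`, with `c` the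
value of `(ρ r)^{1/2} φ` at `r = 0`. -/
def HalfRel (κ : ℝ) (c : ℂ) (f h : ℝ → ℂ) : Prop :=
  f =ᵐ[halfLine] fun r => (bfun M Q r : ℂ) * Real.exp (-(κ * tau M Q r)) * primit M Q κ c h r

/-- The source `b y + (m - qQ/ρ) g` of the equation for the upper component. -/
def srcU (m q : ℝ) (g y : ℝ → ℂ) (r : ℝ) : ℂ :=
  bfun M Q r * y r + ((m - q * Q / rho M Q r : ℝ) : ℂ) * g r

/-- The source `(m + qQ/ρ) f - b x` of the equation for the lower component. -/
def srcL (m q : ℝ) (f x : ℝ → ℂ) (r : ℝ) : ℂ :=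
  ((m + q * Q / rho M Q r : ℝ) : ℂ) * f r - bfun M Q r * x r

variable [hMQ : Fact (M ^ 2 < Q ^ 2)]

theorem continuous_rho_inv : Continuous fun r => (rho M Q r)⁻¹ :=
  (continuous_rho M Q).inv₀ fun r => (rho_pos M Q r).ne'

theorem hasDerivAt_tau (r : ℝ) : HasDerivAt (tau M Q) (rho M Q r)⁻¹ r :=
  intervalIntegral.integral_hasDerivAt_right
    ((continuous_rho_inv M Q).intervalIntegrable _ _)
    (continuous_rho_inv M Q).stronglyMeasurable.stronglyMeasurableAtFilter
    (continuous_rho_inv M Q).continuousAt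

theorem continuous_tau : Continuous (tau M Q) :=
  continuous_iff_continuousAt.mpr fun r => (hasDerivAt_tau M Q r).continuousAt

omit hMQ in
theorem tau_zero : tau M Q 0 = 0 := intervalIntegral.integral_same

theorem continuous_bfun : Continuous (bfun M Q) :=
  continuous_id.div (continuous_rho M Q) fun r => (rho_pos M Q r).ne'

theorem bfun_pos {r : ℝ} (hr : 0 < r) : 0 < bfun M Q r := div_pos hr (rho_pos M Q r)

/-- `ρ` is bounded below. -/
theorem exists_rho_lower : ∃ c : ℝ, 0 < c ∧ ∀ r, c ≤ rho M Q r := by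
  refine ⟨Real.sqrt (Q ^ 2 - M ^ 2), Real.sqrt_pos.mpr (by linarith [hMQ.out]), fun r => ?_⟩
  exact Real.sqrt_le_sqrt (by nlinarith [sq_nonneg (r - M)])

omit hMQ in
theorem tendsto_bfun : Filter.Tendsto (bfun M Q) Filter.atTop (nhds 1) := by
  have h1 : Filter.Tendsto (fun r : ℝ => Real.sqrt (1 - 2 * M / r + Q ^ 2 / r ^ 2)) Filter.atTop
      (nhds (Real.sqrt (1 - 0 + 0))) := by
    refine (Real.continuous_sqrt.tendsto _).comp ((tendsto_const_nhds.sub ?_).add ?_)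
    · exact Filter.Tendsto.const_div_atTop Filter.tendsto_id _
    · exact Filter.Tendsto.const_div_atTop (Filter.tendsto_pow_atTop two_ne_zero) _
  have h2 := h1.inv₀ (by simp)
  simp only [sub_zero, add_zero, Real.sqrt_one, inv_one] at h2
  refine h2.congr' ?_
  filter_upwards [Filter.eventually_gt_atTop 0] with r hr
  have := A_eq M Q hr
  unfold A at this
  rw [this, inv_div]
  rfl

/-- `b` is bounded on the half-line. -/
theorem exists_bfun_bound : ∃ C : ℝ, ∀ r, 0 < r → |bfun M Q r| ≤ C := by
  obtain ⟨R, hR⟩ := Filter.eventually_atTop.mp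
    ((tendsto_bfun M Q).eventually (Metric.ball_mem_nhds 1 one_pos))
  obtain ⟨C, hC⟩ := (isCompact_Icc (a := 0) (b := R)).exists_bound_of_continuousOn
    (continuous_bfun M Q).continuousOn
  refine ⟨max C 2, fun r hr => ?_⟩
  rcases le_total r R with h | h
  · exact (hC r ⟨hr.le, h⟩).trans (le_max_left _ _)
  · have := hR r h
    change dist _ _ < _ at this
    rw [Real.dist_eq, abs_lt] at this
    refine le_trans ?_ (le_max_right _ _)
    rw [abs_le]
    constructor <;> linarith [this.1, this.2]

theorem memLp_bounded_mul {w : ℝ → ℝ} (hw : Continuous w) {C : ℝ}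
    (hC : ∀ r, 0 < r → |w r| ≤ C) {f : ℝ → ℂ} (hf : MemLp f 2 halfLine) :
    MemLp (fun r => (w r : ℂ) * f r) 2 halfLine := by
  refine MemLp.of_le_mul (c := C) hf ((Complex.continuous_ofReal.comp
    hw).aestronglyMeasurable.mul hf.aestronglyMeasurable) ?_
  filter_upwards [ae_halfLine_pos] with r hr
  rw [norm_mul, Complex.norm_real]
  exact mul_le_mul_of_nonneg_right (hC r hr) (norm_nonneg _)

theorem exists_coef_bound (m q : ℝ) : ∃ C : ℝ, ∀ r, |m + q * Q / rho M Q r| ≤ C := by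
  obtain ⟨c, hc, h⟩ := exists_rho_lower M Q
  refine ⟨|m| + |q * Q| / c, fun r => (abs_add_le _ _).trans ?_⟩
  rw [abs_div, abs_of_pos (rho_pos M Q r)]
  gcongr
  exact h r

theorem continuous_coef (m q : ℝ) : Continuous fun r => m + q * Q / rho M Q r :=
  continuous_const.add (continuous_const.div (continuous_rho M Q) fun r => (rho_pos M Q r).ne')

theorem memLp_srcL (m q : ℝ) {f x : ℝ → ℂ} (hf : MemLp f 2 halfLine) (hx : MemLp x 2 halfLine) :
    MemLp (srcL M Q m q f x) 2 halfLine := by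
  obtain ⟨C, hC⟩ := exists_coef_bound M Q m q
  obtain ⟨D, hD⟩ := exists_bfun_bound M Q
  exact (memLp_bounded_mul (continuous_coef M Q m q) (fun r _ => hC r) hf).sub
    (memLp_bounded_mul (continuous_bfun M Q) hD hx)

omit hMQ in
theorem srcU_eq (m q : ℝ) (g y : ℝ → ℂ) :
    srcU M Q m q g y = srcL M Q m (-q) g (fun r => -y r) := by
  funext r
  unfold srcU srcL
  push_cast
  ring

theorem memLp_srcU (m q : ℝ) {g y : ℝ → ℂ} (hg : MemLp g 2 halfLine) (hy : MemLp y 2 halfLine) :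
    MemLp (srcU M Q m q g y) 2 halfLine := by
  rw [srcU_eq]
  exact memLp_srcL M Q m (-q) hg hy.neg

omit hMQ in
theorem integrableOn_Ioc_of_memLp {h : ℝ → ℂ} (hh : MemLp h 2 halfLine) (R : ℝ) :
    IntegrableOn h (Set.Ioc 0 R) := by
  have h1 : MemLp h 2 (volume.restrict (Set.Ioc 0 R)) := by
    have := hh.restrict (Set.Ioc 0 R)
    rwa [Measure.restrict_restrict measurableSet_Ioc,
      Set.inter_eq_left.mpr Set.Ioc_subset_Ioi_self] at this
  exact h1.integrable one_le_two

theorem intervalIntegrable_exp_mul (κ : ℝ) {h : ℝ → ℂ} (hh : MemLp h 2 halfLine) {R : ℝ}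
    (hR : 0 ≤ R) :
    IntervalIntegrable (fun t => (Real.exp (κ * tau M Q t) : ℂ) * h t) volume 0 R := by
  have h1 : IntervalIntegrable h volume 0 R :=
    (intervalIntegrable_iff_integrableOn_Ioc_of_le hR).mpr (integrableOn_Ioc_of_memLp hh R)
  have := continuous_tau M Q
  exact h1.continuousOn_mul (by fun_prop)

theorem conj_mul_primit (κ : ℝ) (c d : ℂ) {h k : ℝ → ℂ} (hh : MemLp h 2 halfLine)
    (hk : MemLp k 2 halfLine) {R : ℝ} (hR : 0 ≤ R) :
    (starRingEnd ℂ) (primit M Q κ c h R) * primit M Q (-κ) d k R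
        = (starRingEnd ℂ) c * d + ∫ r in 0..R,
          ((Real.exp (κ * tau M Q r) : ℂ) * (starRingEnd ℂ) (h r) * primit M Q (-κ) d k r
          + (starRingEnd ℂ) (primit M Q κ c h r) * ((Real.exp (-κ * tau M Q r) : ℂ) * k r)) ∧
      IntervalIntegrable (fun r =>
        ((Real.exp (κ * tau M Q r) : ℂ) * (starRingEnd ℂ) (h r) * primit M Q (-κ) d k r
          + (starRingEnd ℂ) (primit M Q κ c h r) * ((Real.exp (-κ * tau M Q r) : ℂ) * k r)))
        volume 0 R := by
  have i1 : IntervalIntegrable (fun t => (Real.exp (κ * tau M Q t) : ℂ) * (starRingEnd ℂ) (h t))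
      volume 0 R := intervalIntegrable_exp_mul M Q κ hh.star hR
  have i2 := intervalIntegrable_exp_mul M Q (-κ) hk hR
  have e := primitive_mul_primitive ((starRingEnd ℂ) c) d i1 i2
  have c1 := (absolutelyContinuousOnInterval_primitive i1).continuousOn
  have c2 := (absolutelyContinuousOnInterval_primitive i2).continuousOn
  have e3 : ∀ r, (starRingEnd ℂ) (primit M Q κ c h r) = (starRingEnd ℂ) c
      + ∫ t in (0 : ℝ)..r, (Real.exp (κ * tau M Q t) : ℂ) * (starRingEnd ℂ) (h t) := by
    intro r
    simp only [primit, map_add, conj_intervalIntegral, map_mul, Complex.conj_ofReal]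
  simp only [e3]
  exact ⟨e, (i1.mul_continuousOn (continuousOn_const.add c2)).add
        (i2.continuousOn_mul (continuousOn_const.add c1))⟩

/-- The boundary form at `r = 0` of the radial Dirac operator is the symplectic form in the
short-distance coefficients; the boundary form at infinity vanishes because it has a limit and is
integrable. -/
theorem green_identity (m q κ : ℝ) {f₁ g₁ x₁ y₁ f₂ g₂ x₂ y₂ : ℝ → ℂ} {p₁ n₁ p₂ n₂ : ℂ}
    (hf₁ : MemLp f₁ 2 halfLine) (hg₁ : MemLp g₁ 2 halfLine) (hx₁ : MemLp x₁ 2 halfLine)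
    (hy₁ : MemLp y₁ 2 halfLine) (hf₂ : MemLp f₂ 2 halfLine) (hg₂ : MemLp g₂ 2 halfLine)
    (hx₂ : MemLp x₂ 2 halfLine) (hy₂ : MemLp y₂ 2 halfLine)
    (u₁ : HalfRel M Q κ p₁ f₁ (srcU M Q m q g₁ y₁))
    (l₁ : HalfRel M Q (-κ) n₁ g₁ (srcL M Q m q f₁ x₁))
    (u₂ : HalfRel M Q κ p₂ f₂ (srcU M Q m q g₂ y₂))
    (l₂ : HalfRel M Q (-κ) n₂ g₂ (srcL M Q m q f₂ x₂)) :
    ∫ r, ((starRingEnd ℂ) (x₁ r) * f₂ r + (starRingEnd ℂ) (y₁ r) * g₂ r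
      - (starRingEnd ℂ) (f₁ r) * x₂ r - (starRingEnd ℂ) (g₁ r) * y₂ r) ∂halfLine
      = (starRingEnd ℂ) n₁ * p₂ - (starRingEnd ℂ) p₁ * n₂ := by
  have hmul : ∀ {a b : ℝ → ℂ}, MemLp a 2 halfLine → MemLp b 2 halfLine →
      Integrable (fun r => (starRingEnd ℂ) (a r) * b r) halfLine := by
    intro a b ha hb
    exact MemLp.integrable_mul ha.star hb
  have hβi : Integrable (fun r => (starRingEnd ℂ) (x₁ r) * f₂ r + (starRingEnd ℂ) (y₁ r) * g₂ r
      - (starRingEnd ℂ) (f₁ r) * x₂ r - (starRingEnd ℂ) (g₁ r) * y₂ r) halfLine :=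
    (((hmul hx₁ hf₂).add (hmul hy₁ hg₂)).sub (hmul hf₁ hx₂)).sub (hmul hg₁ hy₂)
  have mU₁ := memLp_srcU M Q m q hg₁ hy₁
  have mU₂ := memLp_srcU M Q m q hg₂ hy₂
  have mL₁ := memLp_srcL M Q m q hf₁ hx₁
  have mL₂ := memLp_srcL M Q m q hf₂ hx₂
  unfold HalfRel at u₁ l₁ u₂ l₂
  have E1 : ∀ {R : ℝ}, 0 ≤ R → _ := fun {R} hR => conj_mul_primit M Q κ p₁ n₂ mU₁ mL₂ hR
  have E2 : ∀ {R : ℝ}, 0 ≤ R → _ := fun {R} hR => conj_mul_primit M Q (-κ) n₁ p₂ mL₁ mU₂ hR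
  simp only [neg_neg, neg_mul] at E1 E2 l₁ l₂
  generalize primit M Q κ p₁ (srcU M Q m q g₁ y₁) = U₁ at *
  generalize primit M Q κ p₂ (srcU M Q m q g₂ y₂) = U₂ at *
  generalize primit M Q (-κ) n₁ (srcL M Q m q f₁ x₁) = V₁ at *
  generalize primit M Q (-κ) n₂ (srcL M Q m q f₂ x₂) = V₂ at *
  -- the boundary form at `R` equals the one at `0` plus the integral over `(0, R)`
  have hBR : ∀ R, 0 ≤ R → (starRingEnd ℂ) (U₁ R) * V₂ R - (starRingEnd ℂ) (V₁ R) * U₂ R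
      = ((starRingEnd ℂ) p₁ * n₂ - (starRingEnd ℂ) n₁ * p₂) + ∫ r in 0..R,
        ((starRingEnd ℂ) (x₁ r) * f₂ r + (starRingEnd ℂ) (y₁ r) * g₂ r
      - (starRingEnd ℂ) (f₁ r) * x₂ r - (starRingEnd ℂ) (g₁ r) * y₂ r) := by
    intro R hR
    obtain ⟨e1, k1⟩ := E1 hR
    obtain ⟨e2, k2⟩ := E2 hR
    rw [e1, e2, add_sub_add_comm, ← intervalIntegral.integral_sub k1 k2]
    congr 1
    refine intervalIntegral.integral_congr_ae_restrict ?_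
    rw [Set.uIoc_of_le hR]
    have hr : volume.restrict (Set.Ioc 0 R) ≤ halfLine :=
      Measure.restrict_mono Set.Ioc_subset_Ioi_self le_rfl
    filter_upwards [ae_mono hr u₁, ae_mono hr u₂, ae_mono hr l₁, ae_mono hr l₂] with r a1 a2 a3 a4
    simp only [srcU, srcL, map_add, map_sub, map_mul, Complex.conj_ofReal]
    rw [a1, a2, a3, a4]
    simp only [map_mul, Complex.conj_ofReal]
    ring
  have hlim := ((intervalIntegral_tendsto_integral_Ioi 0 hβi Filter.tendsto_id).const_add
    ((starRingEnd ℂ) p₁ * n₂ - (starRingEnd ℂ) n₁ * p₂))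
  have hlim2 : Filter.Tendsto (fun r => (bfun M Q r : ℂ) ^ 2
      * ((starRingEnd ℂ) (U₁ r) * V₂ r - (starRingEnd ℂ) (V₁ r) * U₂ r)) Filter.atTop _ :=
    (((Complex.continuous_ofReal.tendsto _).comp (tendsto_bfun M Q)).pow 2).mul
      (hlim.congr' (by
        filter_upwards [Filter.eventually_ge_atTop 0] with R hR using (hBR R hR).symm))
  have hint : Integrable (fun r => (bfun M Q r : ℂ) ^ 2
      * ((starRingEnd ℂ) (U₁ r) * V₂ r - (starRingEnd ℂ) (V₁ r) * U₂ r)) halfLine := by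
    refine ((hmul hf₁ hg₂).sub (hmul hg₁ hf₂)).congr ?_
    filter_upwards [u₁, u₂, l₁, l₂] with r a1 a2 a3 a4
    have hexp : (Real.exp (κ * tau M Q r) : ℂ) * Real.exp (-(κ * tau M Q r)) = 1 := by
      rw [← Complex.ofReal_mul, ← Real.exp_add, add_neg_cancel, Real.exp_zero, Complex.ofReal_one]
    simp only [Pi.sub_apply]
    rw [a1, a2, a3, a4]
    simp only [map_mul, Complex.conj_ofReal]
    linear_combination (bfun M Q r : ℂ) ^ 2
      * ((starRingEnd ℂ) (U₁ r) * V₂ r - (starRingEnd ℂ) (V₁ r) * U₂ r) * hexp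
  -- an integrable function that has a limit at infinity has limit zero
  have hzero := IntegrableAtFilter.eq_zero_of_tendsto (μ := volume)
    ⟨Set.Ioi 0, Filter.Ioi_mem_atTop 0, hint⟩ (fun s hs => by
      obtain ⟨a, ha⟩ := Filter.mem_atTop_sets.mp hs
      exact measure_mono_top (fun x hx => ha x hx) (Real.volume_Ici (a := a))) hlim2
  simp only [Complex.ofReal_one, one_pow, one_mul] at hzero
  linear_combination hzero

end radial

/-! ### The weak form of the radial equations -/

/-- Real test functions on the half-line. -/
structure RadialTest (h : ℝ → ℝ) : Prop where
  smooth : ContDiff ℝ (⊤ : ℕ∞) h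
  compact : HasCompactSupport h
  pos : tsupport h ⊆ Set.Ioi 0

/-- The primitive of `h` vanishing at infinity. -/
def testPrim (h : ℝ → ℝ) (r : ℝ) : ℝ := (-∫ t, h t) + ∫ t in (0 : ℝ)..r, h t

namespace RadialTest

variable {h : ℝ → ℝ} (T : RadialTest h)

include T

theorem exists_bound : ∃ R : ℝ, 0 < R ∧ tsupport h ⊆ Set.Ioc 0 R := by
  obtain ⟨R, hR⟩ := T.compact.isCompact.isBounded.subset_closedBall 0
  refine ⟨max R 1, by positivity, fun r hr => ⟨T.pos hr, ?_⟩⟩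
  have := hR hr
  rw [mem_closedBall_zero_iff, Real.norm_eq_abs] at this
  exact (le_abs_self r).trans (this.trans (le_max_left _ _))

theorem continuous : Continuous h := T.smooth.continuous

theorem continuous_testPrim : Continuous (testPrim h) :=
  continuous_const.add (intervalIntegral.continuous_primitive
    (fun _ _ => T.continuous.intervalIntegrable _ _) 0)

omit T in
theorem testPrim_eq_zero {R : ℝ} (hR : tsupport h ⊆ Set.Ioc 0 R) {r : ℝ} (hr0 : 0 ≤ r)
    (hr : R ≤ r) : testPrim h r = 0 := by
  unfold testPrim
  rw [intervalIntegral.integral_of_le hr0, setIntegral_eq_integral_of_forall_compl_eq_zero]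
  · ring
  · intro x hx
    refine image_eq_zero_of_notMem_tsupport fun hx' => hx ?_
    exact ⟨(hR hx').1, (hR hx').2.trans hr⟩

theorem memLp_mul {φ : ℝ → ℂ} (hφ : ContinuousOn φ (Set.Ioi 0)) :
    MemLp (fun r => (h r : ℂ) * φ r) 2 halfLine := by
  have hsub : tsupport (fun r => (h r : ℂ) * φ r) ⊆ tsupport h := by
    refine closure_mono fun r hr => ?_
    rw [Function.mem_support] at hr ⊢
    intro h0
    exact hr (by rw [h0]; simp)
  have hc : Continuous fun r => (h r : ℂ) * φ r := by
    refine continuous_of_tsupport fun r hr => ?_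
    exact (Complex.continuous_ofReal.comp T.continuous).continuousAt.mul
      (hφ.continuousAt (Ioi_mem_nhds (T.pos (hsub hr))))
  exact (hc.memLp_of_hasCompactSupport
    (T.compact.mono' (subset_closure.trans hsub))).restrict _

theorem memLp_testPrim_mul {φ : ℝ → ℂ} (hφ : Continuous φ) :
    MemLp (fun r => (testPrim h r : ℂ) * φ r) 2 halfLine := by
  obtain ⟨R, hR0, hR⟩ := T.exists_bound
  have hc : Continuous fun r => (testPrim h r : ℂ) * φ r :=
    (Complex.continuous_ofReal.comp T.continuous_testPrim).mul hφ
  obtain ⟨C, hC⟩ := (isCompact_Icc (a := 0) (b := R)).exists_bound_of_continuousOn hc.continuousOn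
  have h1 : MemLp (fun r => (testPrim h r : ℂ) * φ r) 2 (volume.restrict (Set.Ioc 0 R)) := by
    refine MemLp.of_bound hc.aestronglyMeasurable C ?_
    filter_upwards [ae_restrict_mem measurableSet_Ioc] with r hr using hC r ⟨hr.1.le, hr.2⟩
  have h2 := (memLp_indicator_iff_restrict measurableSet_Ioc).mpr h1
  refine (memLp_congr_ae ?_).mp (h2.restrict (Set.Ioi 0))
  filter_upwards [ae_halfLine_pos] with r hr
  by_cases hrR : r ≤ R
  · rw [Set.indicator_of_mem (Set.mem_Ioc.mpr ⟨hr, hrR⟩)]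
  · rw [Set.indicator_of_notMem fun h => hrR h.2, testPrim_eq_zero hR hr.le (not_le.mp hrR).le]
    simp

theorem integrable_mul {G : ℝ → ℂ} (hG : LocallyIntegrableOn G (Set.Ioi 0)) :
    Integrable (fun r => (h r : ℂ) * G r) := by
  have h1 : IntegrableOn G (tsupport h) := hG.integrableOn_compact_subset T.pos T.compact
  have h2 : IntegrableOn (fun r => (h r : ℂ) * G r) (tsupport h) :=
    h1.continuousOn_mul (Complex.continuous_ofReal.comp T.continuous).continuousOn T.compact
  rw [integrableOn_iff_integrable_of_support_subset] at h2
  · exact h2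
  · intro r hr
    refine subset_closure ?_
    rw [Function.mem_support] at hr ⊢
    intro h0
    exact hr (by rw [h0]; simp)

theorem integral_halfLine (G : ℝ → ℂ) :
    ∫ r, (h r : ℂ) * G r ∂halfLine = ∫ r, (h r : ℂ) * G r := by
  refine setIntegral_eq_integral_of_forall_compl_eq_zero fun r hr => ?_
  rw [image_eq_zero_of_notMem_tsupport fun h => hr (T.pos h)]
  simp

end RadialTest

/-- The fundamental lemma of the calculus of variations, for a known constant. -/
theorem ae_eq_const_of_weak {W : ℝ → ℂ} (hW : LocallyIntegrableOn W (Set.Ioi 0)) (c : ℂ)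
    (h : ∀ h : ℝ → ℝ, RadialTest h → ∫ r, (h r : ℂ) * W r = (∫ r, h r : ℝ) * c) :
    ∀ᵐ r ∂halfLine, W r = c := by
  have hc : LocallyIntegrableOn (fun _ : ℝ => c) (Set.Ioi 0) := locallyIntegrableOn_const c
  have := isOpen_Ioi.ae_eq_zero_of_integral_contDiff_smul_eq_zero (μ := volume)
    (f := fun r => W r - c) (hW.sub hc) (fun g g1 g2 g3 => by
      have T : RadialTest g := ⟨g1, g2, g3⟩
      have e := h g T
      have e' : ((∫ r, g r : ℝ) : ℂ) = ∫ r, (g r : ℂ) := integral_ofReal.symm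
      rw [e', ← integral_mul_const] at e
      simp only [Complex.real_smul, mul_sub]
      rw [integral_sub (T.integrable_mul hW) (T.integrable_mul hc)]
      exact sub_eq_zero.mpr e)
  rw [ae_restrict_iff' measurableSet_Ioi]
  filter_upwards [this] with r hr hr0 using sub_eq_zero.mp (hr hr0)

theorem exists_radialTest : ∃ h : ℝ → ℝ, RadialTest h ∧ ∫ r, h r = 1 := by
  let b : ContDiffBump (1 : ℝ) := ⟨1 / 4, 1 / 2, by norm_num, by norm_num⟩
  refine ⟨b.normed volume, ⟨b.contDiff_normed, b.hasCompactSupport_normed, ?_⟩, b.integral_normed⟩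
  rw [b.tsupport_normed_eq, Real.closedBall_eq_Icc]
  intro r hr
  have h1 : (1 : ℝ) - 1 / 2 ≤ r := hr.1
  rw [Set.mem_Ioi]
  linarith

/-- The lemma of du Bois-Reymond: a function orthogonal to all test functions of integral zero is
constant. -/
theorem exists_ae_eq_const_of_weak {W : ℝ → ℂ} (hW : LocallyIntegrableOn W (Set.Ioi 0))
    (h : ∀ h : ℝ → ℝ, RadialTest h → ∫ r, h r = 0 → ∫ r, (h r : ℂ) * W r = 0) :
    ∃ c, ∀ᵐ r ∂halfLine, W r = c := by
  obtain ⟨h₀, T₀, i₀⟩ := exists_radialTest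
  refine ⟨∫ r, (h₀ r : ℂ) * W r, ae_eq_const_of_weak hW _ fun h' T => ?_⟩
  set s := ∫ r, h' r with hs
  have T₁ : RadialTest fun r => h' r - s * h₀ r := by
    have hsub : tsupport (fun r => h' r - s * h₀ r) ⊆ tsupport h' ∪ tsupport h₀ := by
      refine (tsupport_sub _ _).trans (Set.union_subset_union_right _ ?_)
      exact tsupport_mul_subset_right
    exact ⟨T.smooth.sub (contDiff_const.mul T₀.smooth),
      T.compact.sub T₀.compact.mul_left, hsub.trans (Set.union_subset T.pos T₀.pos)⟩
  have hi : ∫ r, (h' r - s * h₀ r) = 0 := by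
    rw [integral_sub (T.continuous.integrable_of_hasCompactSupport T.compact)
      ((T₀.continuous.integrable_of_hasCompactSupport T₀.compact).const_mul s),
      integral_const_mul, i₀, ← hs]
    ring
  have e := h _ T₁ hi
  have e2 : ∫ r, ((h' r - s * h₀ r : ℝ) : ℂ) * W r
      = (∫ r, (h' r : ℂ) * W r) - s * ∫ r, (h₀ r : ℂ) * W r := by
    rw [← integral_const_mul, ← integral_sub (T.integrable_mul hW)
      ((T₀.integrable_mul hW).const_mul _)]
    congr 1
    funext r
    push_cast
    ring
  rw [e2] at e
  exact sub_eq_zero.mp e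

section radial

variable (M Q : ℝ)

/-- The test channel function with primitive `testPrim h`. -/
def testF (κ : ℝ) (h : ℝ → ℝ) (r : ℝ) : ℂ :=
  (testPrim h r : ℂ) * (bfun M Q r * Real.exp (-(κ * tau M Q r)) : ℝ)

/-- The value of the radial operator that makes `testF` solve the first equation with the other
component equal to zero. -/
def testY (κ : ℝ) (h : ℝ → ℝ) (r : ℝ) : ℂ :=
  (h r : ℂ) * ((bfun M Q r)⁻¹ * Real.exp (-(κ * tau M Q r)) : ℝ)

/-- The value of the radial operator for which the second equation holds with zero source. -/
def testX (m q κ : ℝ) (h : ℝ → ℝ) (r : ℝ) : ℂ :=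
  (testPrim h r : ℂ) * ((m + q * Q / rho M Q r) * Real.exp (-(κ * tau M Q r)) : ℝ)

variable [hMQ : Fact (M ^ 2 < Q ^ 2)]

variable {h : ℝ → ℝ} (T : RadialTest h)

include T

theorem memLp_testF (κ : ℝ) : MemLp (testF M Q κ h) 2 halfLine := by
  have h1 := continuous_bfun M Q
  have h2 := continuous_tau M Q
  exact T.memLp_testPrim_mul (by fun_prop)

theorem memLp_testX (m q κ : ℝ) : MemLp (testX M Q m q κ h) 2 halfLine := by
  have h1 := continuous_coef M Q m q
  have h2 := continuous_tau M Q
  exact T.memLp_testPrim_mul (by fun_prop)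

theorem memLp_testY (κ : ℝ) : MemLp (testY M Q κ h) 2 halfLine := by
  have h1 := continuous_bfun M Q
  have h2 := continuous_tau M Q
  refine T.memLp_mul (Complex.continuous_ofReal.comp_continuousOn ?_)
  refine ContinuousOn.mul (h1.continuousOn.inv₀ fun r hr => (bfun_pos M Q hr).ne') ?_
  fun_prop

omit T in
/-- The test function `testF` solves the first radial equation with source `b · testY`; its
short-distance coefficient is `-∫ h`. -/
theorem halfRel_testF (h : ℝ → ℝ) (κ : ℝ) : HalfRel M Q κ ((-∫ t, h t : ℝ) : ℂ) (testF M Q κ h)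
    (fun r => bfun M Q r * testY M Q κ h r) := by
  unfold HalfRel
  filter_upwards [ae_halfLine_pos] with r hr
  have e : primit M Q κ ((-∫ t, h t : ℝ) : ℂ) (fun r => bfun M Q r * testY M Q κ h r) r
      = testPrim h r := by
    unfold primit testPrim
    rw [Complex.ofReal_add, ← intervalIntegral.integral_ofReal]
    congr 1
    refine intervalIntegral.integral_congr_ae (Filter.Eventually.of_forall fun t ht => ?_)
    rw [Set.uIoc_of_le hr.le] at ht
    have hb := (bfun_pos M Q ht.1).ne'
    have he : Real.exp (κ * tau M Q t) * Real.exp (-(κ * tau M Q t)) = 1 := by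
      rw [← Real.exp_add, add_neg_cancel, Real.exp_zero]
    unfold testY
    beta_reduce
    rw [← Complex.ofReal_mul, ← Complex.ofReal_mul, ← Complex.ofReal_mul]
    congr 1
    field_simp
    linear_combination h t * he
  rw [e, testF]
  push_cast
  ring

omit T in
theorem locallyIntegrableOn_of_memLp {f : ℝ → ℂ} (hf : MemLp f 2 halfLine) :
    LocallyIntegrableOn f (Set.Ioi 0) := by
  rw [locallyIntegrableOn_iff isOpen_Ioi.isLocallyClosed]
  intro k hk hk'
  obtain ⟨R, hR⟩ := hk'.bddAbove
  exact (integrableOn_Ioc_of_memLp hf R).mono_set fun r hr => ⟨hk hr, hR hr⟩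

omit T in
theorem continuousOn_primit (κ : ℝ) (c : ℂ) {k : ℝ → ℂ} (hk : MemLp k 2 halfLine) :
    ContinuousOn (primit M Q κ c k) (Set.Ici 0) := by
  intro r hr
  have hr' : (0 : ℝ) ≤ r + 1 := by linarith [Set.mem_Ici.mp hr]
  have h1 := (absolutelyContinuousOnInterval_primitive
    (intervalIntegrable_exp_mul M Q κ hk hr')).continuousOn
  rw [Set.uIcc_of_le hr'] at h1
  have h2 := (continuousOn_const (c := c)).add h1 r ⟨hr, by linarith⟩
  refine h2.mono_of_mem_nhdsWithin ?_
  rw [← Set.Ici_inter_Iic]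
  exact Filter.inter_mem self_mem_nhdsWithin
    (mem_nhdsWithin_of_mem_nhds (Iic_mem_nhds (by linarith)))

/-- The function which is a.e. constant if and only if `f` satisfies its radial equation with
source `k`. -/
def weakFn (κ : ℝ) (f k : ℝ → ℂ) (r : ℝ) : ℂ :=
  ((bfun M Q r)⁻¹ * Real.exp (κ * tau M Q r) : ℝ) * f r - primit M Q κ 0 k r

omit T in
theorem locallyIntegrableOn_weakFn (κ : ℝ) {f k : ℝ → ℂ} (hf : MemLp f 2 halfLine)
    (hk : MemLp k 2 halfLine) : LocallyIntegrableOn (weakFn M Q κ f k) (Set.Ioi 0) := by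
  refine LocallyIntegrableOn.sub ?_ (((continuousOn_primit M Q κ 0 hk).mono
    Set.Ioi_subset_Ici_self).locallyIntegrableOn measurableSet_Ioi)
  have h1 := continuous_bfun M Q
  have h2 := continuous_tau M Q
  refine (locallyIntegrableOn_of_memLp hf).continuousOn_mul
    (Complex.continuous_ofReal.comp_continuousOn ?_) isOpen_Ioi.isLocallyClosed
  refine ContinuousOn.mul (h1.continuousOn.inv₀ fun r hr => (bfun_pos M Q hr).ne') ?_
  fun_prop

omit T in
/-- The integrated radial equation says that `weakFn` is constant. -/
theorem halfRel_of_weakFn (κ : ℝ) {f k : ℝ → ℂ} {c : ℂ}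
    (h : ∀ᵐ r ∂halfLine, weakFn M Q κ f k r = c) : HalfRel M Q κ c f k := by
  unfold HalfRel
  filter_upwards [h, ae_halfLine_pos] with r h1 hr
  have hb := Complex.ofReal_ne_zero.mpr (bfun_pos M Q hr).ne'
  have he : (Real.exp (κ * tau M Q r) : ℂ) * Real.exp (-(κ * tau M Q r)) = 1 := by
    rw [← Complex.ofReal_mul, ← Real.exp_add, add_neg_cancel, Real.exp_zero, Complex.ofReal_one]
  have e : primit M Q κ c k r = c + primit M Q κ 0 k r := by simp [primit]
  rw [e, ← h1, weakFn, sub_add_cancel, Complex.ofReal_mul, Complex.ofReal_inv]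
  field_simp
  linear_combination -f r * he

/-- The boundary form of a test pair against a general pair. -/
theorem integral_test_pairing (m q κ : ℝ) {f g x : ℝ → ℂ} (hf : MemLp f 2 halfLine)
    (hg : MemLp g 2 halfLine) (hx : MemLp x 2 halfLine) :
    ∫ r, ((starRingEnd ℂ) (testX M Q m q κ h r) * f r + (starRingEnd ℂ) (testY M Q κ h r) * g r
      - (starRingEnd ℂ) (testF M Q κ h r) * x r) ∂halfLine
      = ∫ r, (h r : ℂ) * weakFn M Q (-κ) g (srcL M Q m q f x) r := by
  have hmul : ∀ {a b : ℝ → ℂ}, MemLp a 2 halfLine → MemLp b 2 halfLine →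
      Integrable (fun r => (starRingEnd ℂ) (a r) * b r) halfLine := by
    intro a b ha hb
    exact MemLp.integrable_mul ha.star hb
  have hk := memLp_srcL M Q m q hf hx
  obtain ⟨R, hR0, hR⟩ := T.exists_bound
  set s : ℝ → ℂ := fun t => (Real.exp (-κ * tau M Q t) : ℂ) * srcL M Q m q f x t with hs
  have i1 : IntervalIntegrable s volume 0 R := intervalIntegrable_exp_mul M Q (-κ) hk hR0.le
  have i2 : IntervalIntegrable (fun t => (h t : ℂ)) volume 0 R :=
    (Complex.continuous_ofReal.comp T.continuous).intervalIntegrable _ _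
  -- integration by parts for `testPrim h` and the primitive of the source
  have ibp := primitive_mul_primitive ((-∫ t, h t : ℝ) : ℂ) 0 i2 i1
  have eu : ∀ r, ((-∫ t, h t : ℝ) : ℂ) + ∫ t in (0 : ℝ)..r, (h t : ℂ) = testPrim h r := by
    intro r
    rw [testPrim, Complex.ofReal_add, intervalIntegral.integral_ofReal]
  have ek : ∀ r, 0 + ∫ t in (0 : ℝ)..r, s t = primit M Q (-κ) 0 (srcL M Q m q f x) r := fun r => rfl
  simp only [eu, ek] at ibp
  rw [RadialTest.testPrim_eq_zero hR hR0.le le_rfl, Complex.ofReal_zero, zero_mul, mul_zero,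
    zero_add] at ibp
  have lK : LocallyIntegrableOn (primit M Q (-κ) 0 (srcL M Q m q f x)) (Set.Ioi 0) :=
    ((continuousOn_primit M Q (-κ) 0 hk).mono
    Set.Ioi_subset_Ici_self).locallyIntegrableOn measurableSet_Ioi
  have lG : LocallyIntegrableOn
      (fun r => ((bfun M Q r)⁻¹ * Real.exp (-κ * tau M Q r) : ℝ) * g r : ℝ → ℂ)
      (Set.Ioi 0) := by
    have := (locallyIntegrableOn_weakFn M Q (-κ) hg hk).add lK
    simpa [weakFn, Pi.add_def] using this
  have iS : Integrable (fun r => (testPrim h r : ℂ) * s r) halfLine := by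
    refine ((hmul (memLp_testX M Q T m q κ) hf).sub (hmul (memLp_testF M Q T κ) hx)).congr ?_
    refine Filter.Eventually.of_forall fun r => ?_
    simp only [testX, testF, Pi.sub_apply, map_mul, Complex.conj_ofReal, hs, srcL, neg_mul]
    push_cast
    ring
  have e1 : ∫ r, (testPrim h r : ℂ) * s r ∂halfLine
      = -∫ r, (h r : ℂ) * primit M Q (-κ) 0 (srcL M Q m q f x) r := by
    have a1 : ∫ r, (testPrim h r : ℂ) * s r ∂halfLine = ∫ r in 0..R, (testPrim h r : ℂ) * s r := by
      rw [intervalIntegral.integral_of_le hR0.le]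
      refine setIntegral_eq_of_subset_of_forall_sdiff_eq_zero measurableSet_Ioi
        Set.Ioc_subset_Ioi_self fun r hr => ?_
      have : R ≤ r := by
        by_contra hlt
        exact hr.2 ⟨hr.1, (not_le.mp hlt).le⟩
      rw [RadialTest.testPrim_eq_zero hR (le_of_lt hr.1) this]
      simp
    have a2 : ∫ r, (h r : ℂ) * primit M Q (-κ) 0 (srcL M Q m q f x) r
        = ∫ r in 0..R, (h r : ℂ) * primit M Q (-κ) 0 (srcL M Q m q f x) r := by
      rw [intervalIntegral.integral_of_le hR0.le]
      refine (setIntegral_eq_integral_of_forall_compl_eq_zero fun r hr => ?_).symm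
      rw [image_eq_zero_of_notMem_tsupport fun h => hr (hR h)]
      simp
    have j1 : IntervalIntegrable (fun r => (h r : ℂ) * primit M Q (-κ) 0 (srcL M Q m q f x) r)
        volume 0 R := (T.integrable_mul lK).intervalIntegrable
    have j2 : IntervalIntegrable (fun r => (testPrim h r : ℂ) * s r) volume 0 R :=
      i1.continuousOn_mul (Complex.continuous_ofReal.comp T.continuous_testPrim).continuousOn
    rw [intervalIntegral.integral_add j1 j2, ← a1, ← a2] at ibp
    linear_combination -ibp
  have e2 : ∀ r, (starRingEnd ℂ) (testX M Q m q κ h r) * f r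
      + (starRingEnd ℂ) (testY M Q κ h r) * g r - (starRingEnd ℂ) (testF M Q κ h r) * x r
      = (testPrim h r : ℂ) * s r
        + (h r : ℂ) * (((bfun M Q r)⁻¹ * Real.exp (-κ * tau M Q r) : ℝ) * g r) := by
    intro r
    simp only [testX, testY, testF, map_mul, Complex.conj_ofReal, hs, srcL, neg_mul]
    push_cast
    ring
  simp only [e2]
  rw [integral_add iS ((T.integrable_mul lG).mono_measure Measure.restrict_le_self), e1,
    T.integral_halfLine, neg_add_eq_sub, ← integral_sub (T.integrable_mul lG) (T.integrable_mul lK)]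
  congr 1
  funext r
  rw [weakFn]
  ring

end radial

/-! ### Estimates near the origin, uniform in the angular momentum -/

section radial

variable (M Q : ℝ)

/-- The amplitude `e^{-κτ} (c + ∫₀^r e^{κτ} h)`, with value `c` at `r = 0`. -/
def amp (κ : ℝ) (c : ℂ) (h : ℝ → ℂ) (r : ℝ) : ℂ :=
  Real.exp (-(κ * tau M Q r)) * primit M Q κ c h r

/-- The `L¹` norm on `(0, 3)`, an interval that contains `[r + 1/|κ|, r + 2/|κ|]` for all
`r ∈ (0, 1)` and `|κ| ≥ 1`. -/
def nearNorm (f : ℝ → ℂ) : ℝ := ∫ t in Set.Ioc (0 : ℝ) 3, ‖f t‖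

theorem nearNorm_nonneg (f : ℝ → ℂ) : 0 ≤ nearNorm f := integral_nonneg fun _ => norm_nonneg _

theorem amp_zero (κ : ℝ) (c : ℂ) (h : ℝ → ℂ) : amp M Q κ c h 0 = c := by
  simp [amp, primit, tau_zero]

theorem HalfRel.eq_amp {M Q κ : ℝ} {c : ℂ} {f h : ℝ → ℂ} (H : HalfRel M Q κ c f h) :
    ∀ᵐ r ∂halfLine, f r = bfun M Q r * amp M Q κ c h r := by
  filter_upwards [H] with r hr
  rw [hr, amp, mul_assoc]

variable [hMQ : Fact (M ^ 2 < Q ^ 2)]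

/-- The two consequences of the lower bound of `ρ` used in the estimates: `τ` is Lipschitz, and `b`
vanishes linearly at the origin. -/
theorem exists_tau_lipschitz : ∃ L : ℝ, 0 < L ∧ (∀ s t, |tau M Q s - tau M Q t| ≤ L * |s - t|) ∧
    ∀ r, 0 ≤ r → bfun M Q r ≤ L * r := by
  obtain ⟨c, hc, h⟩ := exists_rho_lower M Q
  have hL : ∀ r, (rho M Q r)⁻¹ ≤ c⁻¹ := fun r => inv_anti₀ hc (h r)
  refine ⟨c⁻¹, inv_pos.mpr hc, fun s t => ?_, fun r hr => ?_⟩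
  · unfold tau
    rw [intervalIntegral.integral_interval_sub_left
      ((continuous_rho_inv M Q).intervalIntegrable _ _)
      ((continuous_rho_inv M Q).intervalIntegrable _ _)]
    rw [← Real.norm_eq_abs]
    refine intervalIntegral.norm_integral_le_of_norm_le_const fun r _ => ?_
    rw [Real.norm_of_nonneg (inv_nonneg.mpr (rho_pos M Q r).le)]
    exact hL r
  · rw [bfun, div_eq_inv_mul]
    exact mul_le_mul_of_nonneg_right (hL r) hr

omit hMQ in
theorem abs_exp_sub_one_le (x : ℝ) : |Real.exp x - 1| ≤ |x| * Real.exp |x| := by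
  have h1 := Real.add_one_le_exp x
  have h2 := Real.add_one_le_exp (-x)
  have h3 : Real.exp x * Real.exp (-x) = 1 := by rw [← Real.exp_add, add_neg_cancel, Real.exp_zero]
  have h4 := Real.exp_pos x
  have h5 : 1 ≤ Real.exp |x| := Real.one_le_exp (abs_nonneg x)
  have h6 : Real.exp x ≤ Real.exp |x| := Real.exp_le_exp.mpr (le_abs_self x)
  have h7 : |x| ≤ |x| * Real.exp |x| := le_mul_of_one_le_right (abs_nonneg x) h5
  have h8 : x * Real.exp x ≤ |x| * Real.exp |x| :=
    mul_le_mul (le_abs_self x) h6 h4.le (abs_nonneg x)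
  rw [abs_le]
  constructor
  · linarith [neg_abs_le x]
  · nlinarith

theorem intervalIntegral_norm_le {h : ℝ → ℂ} (hh : MemLp h 2 halfLine) {a b : ℝ} (ha : 0 ≤ a)
    (hab : a ≤ b) (hb : b ≤ 3) : ∫ t in a..b, ‖h t‖ ≤ nearNorm h := by
  rw [intervalIntegral.integral_of_le hab]
  exact setIntegral_mono_set (integrableOn_Ioc_of_memLp hh 3).norm
    (Filter.Eventually.of_forall fun _ => norm_nonneg _)
    (Set.Ioc_subset_Ioc ha hb).eventuallyLE

/-- The amplitude at `r` is controlled by the amplitude at a later point at distance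
`O(1/|κ|)`. -/
theorem norm_amp_le_amp {L : ℝ} (hL0 : 0 < L)
    (hL : ∀ s t, |tau M Q s - tau M Q t| ≤ L * |s - t|) (κ : ℝ) (c : ℂ) {h : ℝ → ℂ}
    (hh : MemLp h 2 halfLine) {r r' : ℝ} (hr : 0 ≤ r) (hrr : r ≤ r') (hr' : r' ≤ 3)
    (hk : |κ| * (r' - r) ≤ 2) :
    ‖amp M Q κ c h r‖ ≤ Real.exp (2 * L) * (‖amp M Q κ c h r'‖ + nearNorm h) := by
  have hexp : ∀ t ∈ Set.Icc r r', Real.exp (κ * tau M Q t) * Real.exp (-(κ * tau M Q r))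
      ≤ Real.exp (2 * L) := by
    intro t ht
    rw [← Real.exp_add, Real.exp_le_exp]
    calc κ * tau M Q t + -(κ * tau M Q r) = κ * (tau M Q t - tau M Q r) := by ring
      _ ≤ |κ| * |tau M Q t - tau M Q r| := by rw [← abs_mul]; exact le_abs_self _
      _ ≤ |κ| * (L * (r' - r)) := by
          gcongr
          refine (hL t r).trans ?_
          gcongr
          rw [abs_of_nonneg (by linarith [ht.1])]
          linarith [ht.2]
      _ = L * (|κ| * (r' - r)) := by ring
      _ ≤ 2 * L := by nlinarith
  have i1 := intervalIntegrable_exp_mul M Q κ hh hr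
  have i2 := intervalIntegrable_exp_mul M Q κ hh (hr.trans hrr)
  have e1 : primit M Q κ c h r = primit M Q κ c h r'
      - ∫ t in r..r', (Real.exp (κ * tau M Q t) : ℂ) * h t := by
    rw [← intervalIntegral.integral_interval_sub_left i2 i1]
    unfold primit
    ring
  have he : (Real.exp (-(κ * tau M Q r')) : ℂ) * Real.exp (κ * tau M Q r') = 1 := by
    rw [← Complex.ofReal_mul, ← Real.exp_add, neg_add_cancel, Real.exp_zero, Complex.ofReal_one]
  have e2 : amp M Q κ c h r = (Real.exp (κ * tau M Q r') * Real.exp (-(κ * tau M Q r)) : ℝ)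
      * amp M Q κ c h r' - ∫ t in r..r',
        ((Real.exp (κ * tau M Q t) * Real.exp (-(κ * tau M Q r)) : ℝ) : ℂ) * h t := by
    have e3 : ∀ t, ((Real.exp (κ * tau M Q t) * Real.exp (-(κ * tau M Q r)) : ℝ) : ℂ) * h t
        = Real.exp (-(κ * tau M Q r)) * ((Real.exp (κ * tau M Q t) : ℂ) * h t) := by
      intro t
      rw [Complex.ofReal_mul]
      ring
    simp only [e3]
    rw [intervalIntegral.integral_const_mul, amp, e1, amp, Complex.ofReal_mul]
    linear_combination (-Real.exp (-(κ * tau M Q r)) * primit M Q κ c h r') * he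
  rw [e2]
  have hhi : IntervalIntegrable h volume r r' := by
    rw [intervalIntegrable_iff_integrableOn_Ioc_of_le hrr]
    exact (integrableOn_Ioc_of_memLp hh r').mono_set (Set.Ioc_subset_Ioc_left hr)
  refine (norm_sub_le _ _).trans ?_
  rw [mul_add]
  refine add_le_add ?_ ?_
  · rw [norm_mul, Complex.norm_real, Real.norm_of_nonneg (by positivity)]
    exact mul_le_mul_of_nonneg_right (hexp r' ⟨hrr, le_rfl⟩) (norm_nonneg _)
  · calc ‖∫ t in r..r', ((Real.exp (κ * tau M Q t) * Real.exp (-(κ * tau M Q r)) : ℝ) : ℂ) * h t‖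
        ≤ ∫ t in r..r', Real.exp (2 * L) * ‖h t‖ := by
          refine intervalIntegral.norm_integral_le_of_norm_le hrr
            (Filter.Eventually.of_forall fun t ht => ?_) (hhi.norm.const_mul _)
          rw [norm_mul, Complex.norm_real, Real.norm_of_nonneg (by positivity)]
          exact mul_le_mul_of_nonneg_right (hexp t ⟨ht.1.le, ht.2⟩) (norm_nonneg _)
      _ ≤ Real.exp (2 * L) * nearNorm h := by
          rw [intervalIntegral.integral_const_mul]
          gcongr
          exact intervalIntegral_norm_le hh hr hrr hr'

/-- The amplitude is bounded polynomially in `κ`, by averaging over an interval of length `1/|κ|`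
at distance `1/|κ|`. -/
theorem exists_amp_bound : ∃ C : ℝ, 0 < C ∧ ∀ (κ : ℝ), 1 ≤ |κ| → ∀ (c : ℂ) (f h : ℝ → ℂ),
    MemLp f 2 halfLine → MemLp h 2 halfLine → HalfRel M Q κ c f h →
      ∀ r ∈ Set.Icc (0 : ℝ) 1, ‖amp M Q κ c h r‖ ≤ C * |κ| ^ 2 * (nearNorm f + nearNorm h) := by
  obtain ⟨L, hL0, hL, -⟩ := exists_tau_lipschitz M Q
  obtain ⟨D, hD⟩ := (isCompact_Icc (a := (0 : ℝ)) (b := 3)).exists_bound_of_continuousOn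
    (continuous_rho M Q).continuousOn
  have hD0 : 0 < D := by
    have := hD 0 ⟨le_rfl, by norm_num⟩
    rw [Real.norm_of_nonneg (rho_pos M Q 0).le] at this
    exact (rho_pos M Q 0).trans_le this
  refine ⟨Real.exp (2 * L) * (D + 1), by positivity, ?_⟩
  intro κ hκ c f h hf hh H r hr
  have hκ0 : 0 < |κ| := by linarith
  have hκi : |κ|⁻¹ ≤ 1 := inv_le_one_of_one_le₀ hκ
  have hκi0 : 0 < |κ|⁻¹ := inv_pos.mpr hκ0
  set S := Set.Ioc (r + |κ|⁻¹) (r + 2 * |κ|⁻¹) with hS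
  have hS3 : S ⊆ Set.Ioc 0 3 := by
    intro t ht
    exact ⟨by linarith [hr.1, ht.1], by linarith [hr.2, ht.2]⟩
  have hvol : volume.real S = |κ|⁻¹ := by
    rw [hS, Real.volume_real_Ioc_of_le (by linarith)]
    ring
  have hpt : ∀ᵐ t ∂volume.restrict S, ‖amp M Q κ c h r‖
      ≤ Real.exp (2 * L) * (D * |κ| * ‖f t‖ + nearNorm h) := by
    have hle : volume.restrict S ≤ halfLine :=
      Measure.restrict_mono (hS3.trans Set.Ioc_subset_Ioi_self) le_rfl
    filter_upwards [ae_mono hle H.eq_amp, ae_restrict_mem measurableSet_Ioc] with t h1 ht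
    have ht3 := hS3 ht
    have h2 := norm_amp_le_amp M Q hL0 hL κ c hh hr.1 (r' := t) (by linarith [ht.1]) ht3.2 (by
      have : t - r ≤ 2 * |κ|⁻¹ := by linarith [ht.2]
      calc |κ| * (t - r) ≤ |κ| * (2 * |κ|⁻¹) := by gcongr
        _ = 2 := by field_simp)
    refine h2.trans ?_
    gcongr
    have hb := bfun_pos M Q ht3.1
    have h3 : ‖amp M Q κ c h t‖ = ‖f t‖ / bfun M Q t := by
      rw [h1, norm_mul, Complex.norm_real, Real.norm_of_nonneg hb.le]
      field_simp
    rw [h3, div_le_iff₀ hb]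
    have h4 : 1 ≤ D * |κ| * bfun M Q t := by
      have h5 := hD t ⟨ht3.1.le, ht3.2⟩
      rw [Real.norm_of_nonneg (rho_pos M Q t).le] at h5
      have h6 : 1 ≤ |κ| * t := by
        calc 1 = |κ| * |κ|⁻¹ := by field_simp
          _ ≤ |κ| * t := by gcongr; linarith [ht.1, hr.1]
      rw [bfun, mul_div_assoc', le_div_iff₀ (rho_pos M Q t)]
      nlinarith
    nlinarith [norm_nonneg (f t)]
  have hfi : IntegrableOn f S := (integrableOn_Ioc_of_memLp hf 3).mono_set hS3
  have hfin : volume S ≠ ⊤ := by rw [hS, Real.volume_Ioc]; exact ENNReal.ofReal_ne_top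
  have hint : ∫ _ in S, ‖amp M Q κ c h r‖
      ≤ ∫ t in S, Real.exp (2 * L) * (D * |κ| * ‖f t‖ + nearNorm h) := by
    refine integral_mono_ae (integrableOn_const hfin) ?_ hpt
    exact ((hfi.norm.const_mul _).add (integrableOn_const hfin)).const_mul _
  rw [setIntegral_const, hvol, integral_const_mul, integral_add (hfi.norm.const_mul _)
    (integrableOn_const hfin), integral_const_mul, setIntegral_const, hvol, smul_eq_mul,
    smul_eq_mul] at hint
  have hf3 : ∫ t in S, ‖f t‖ ≤ nearNorm f := setIntegral_mono_set
    (integrableOn_Ioc_of_memLp hf 3).norm (Filter.Eventually.of_forall fun _ => norm_nonneg _)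
    hS3.eventuallyLE
  have nf := nearNorm_nonneg f
  have nh := nearNorm_nonneg h
  calc ‖amp M Q κ c h r‖ = |κ| * (|κ|⁻¹ * ‖amp M Q κ c h r‖) := by field_simp
    _ ≤ |κ| * (Real.exp (2 * L) * (D * |κ| * (∫ t in S, ‖f t‖) + |κ|⁻¹ * nearNorm h)) := by gcongr
    _ ≤ |κ| * (Real.exp (2 * L) * (D * |κ| * nearNorm f + |κ|⁻¹ * nearNorm h)) := by gcongr
    _ = Real.exp (2 * L) * (D * |κ| ^ 2 * nearNorm f + nearNorm h) := by field_simp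
    _ ≤ Real.exp (2 * L) * ((D + 1) * |κ| ^ 2 * (nearNorm f + nearNorm h)) := by
        gcongr
        have hk2 : 1 ≤ |κ| ^ 2 := one_le_pow₀ hκ
        have : 0 ≤ D * |κ| ^ 2 * nearNorm h := by positivity
        nlinarith
    _ = _ := by ring

/-- Linear vanishing of `amp - c` at the origin, given bounds of both amplitudes. -/
theorem exists_amp_sub_bound (m q : ℝ) : ∃ C : ℝ, 0 < C ∧ ∀ (κ : ℝ), 1 ≤ |κ| →
    ∀ (c : ℂ) (g x G : ℝ → ℂ) (B : ℝ), MemLp g 2 halfLine → MemLp x 2 halfLine →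
      (∀ᵐ r ∂halfLine, g r = bfun M Q r * G r) → (∀ r ∈ Set.Icc (0 : ℝ) 1, ‖G r‖ ≤ B) →
      (∀ r ∈ Set.Icc (0 : ℝ) 1, ‖amp M Q κ c (srcL M Q m q g x) r‖ ≤ B) →
      ∀ r ∈ Set.Icc (0 : ℝ) 1, ‖amp M Q κ c (srcL M Q m q g x) r - c‖
        ≤ C * |κ| * (B + nearNorm x) * r := by
  obtain ⟨L, hL0, hL, hbL⟩ := exists_tau_lipschitz M Q
  obtain ⟨K, hK⟩ := exists_coef_bound M Q m q
  have hK0 : 0 ≤ K := (abs_nonneg _).trans (hK 0)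
  refine ⟨L * Real.exp L + Real.exp (2 * L) * (K * L + L) + 2, by positivity, ?_⟩
  intro κ hκ c g x G B hg hx hG hGB hB r hr
  have hκ0 : 0 < |κ| := by linarith
  have nx := nearNorm_nonneg x
  have hc : ‖c‖ ≤ B := by
    have := hB 0 ⟨le_rfl, zero_le_one⟩
    rwa [amp_zero] at this
  have hB0 : 0 ≤ B := (norm_nonneg c).trans hc
  have hk := memLp_srcL M Q m q hg hx
  rcases le_or_gt (|κ| * r) 1 with hkr | hkr
  · -- close to the origin
    have hτ : |κ * tau M Q r| ≤ |κ| * (L * r) := by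
      rw [abs_mul]
      gcongr
      have := hL r 0
      rwa [tau_zero, sub_zero, sub_zero, abs_of_nonneg hr.1] at this
    have hτL : |κ| * (L * r) ≤ L := by nlinarith
    have h1 : |Real.exp (-(κ * tau M Q r)) - 1| ≤ |κ| * (L * r) * Real.exp L := by
      have h2 := abs_exp_sub_one_le (-(κ * tau M Q r))
      rw [abs_neg] at h2
      refine h2.trans ?_
      gcongr
      · have := hr.1
        positivity
      · exact hτ.trans hτL
    have hsrc : ∫ t in (0 : ℝ)..r, ‖srcL M Q m q g x t‖ ≤ r * ((K * L) * B + L * nearNorm x) := by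
      have hxi : IntervalIntegrable x volume 0 r :=
        (intervalIntegrable_iff_integrableOn_Ioc_of_le hr.1).mpr (integrableOn_Ioc_of_memLp hx r)
      have hle : volume.restrict (Set.Ioc 0 r) ≤ halfLine :=
        Measure.restrict_mono Set.Ioc_subset_Ioi_self le_rfl
      have h3 : ∫ t in (0 : ℝ)..r, ‖srcL M Q m q g x t‖
          ≤ ∫ t in (0 : ℝ)..r, (K * (L * r * B) + L * r * ‖x t‖) := by
        refine intervalIntegral.integral_mono_ae_restrict hr.1
          ((intervalIntegrable_iff_integrableOn_Ioc_of_le hr.1).mpr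
            (integrableOn_Ioc_of_memLp hk r)).norm
          (intervalIntegrable_const.add (hxi.norm.const_mul _)) ?_
        rw [restrict_Ioc_eq_restrict_Icc.symm]
        filter_upwards [ae_mono hle hG, ae_restrict_mem measurableSet_Ioc] with t h4 ht
        have hb0 := (bfun_pos M Q ht.1).le
        have hb1 : bfun M Q t ≤ L * r := (hbL t ht.1.le).trans (by gcongr; exact ht.2)
        unfold srcL
        refine (norm_sub_le _ _).trans (add_le_add ?_ ?_)
        · rw [norm_mul, Complex.norm_real, h4, norm_mul, Complex.norm_real,
            Real.norm_of_nonneg hb0]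
          have := hGB t ⟨ht.1.le, ht.2.trans hr.2⟩
          have hrL : 0 ≤ L * r := mul_nonneg hL0.le hr.1
          gcongr
          exact hK t
        · rw [norm_mul, Complex.norm_real, Real.norm_of_nonneg hb0]
          gcongr
      refine h3.trans ?_
      rw [intervalIntegral.integral_add intervalIntegrable_const (hxi.norm.const_mul _),
        intervalIntegral.integral_const, intervalIntegral.integral_const_mul, sub_zero,
        smul_eq_mul]
      have h5 := intervalIntegral_norm_le hx le_rfl hr.1 (hr.2.trans (by norm_num))
      have hrL : 0 ≤ L * r := mul_nonneg hL0.le hr.1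
      have h6 : L * r * ∫ t in (0 : ℝ)..r, ‖x t‖ ≤ L * r * nearNorm x := by gcongr
      have h7 : r * (K * (L * r * B)) ≤ r * (K * L * B) := by
        have h8 : 0 ≤ K * L * B := by positivity
        have h9 : K * L * B * r ≤ K * L * B * 1 := mul_le_mul_of_nonneg_left hr.2 h8
        have := mul_le_mul_of_nonneg_left h9 hr.1
        linarith
      linarith
    have e : amp M Q κ c (srcL M Q m q g x) r - c
        = ((Real.exp (-(κ * tau M Q r)) - 1 : ℝ) : ℂ) * c + ∫ t in (0 : ℝ)..r,
          ((Real.exp (-(κ * tau M Q r)) * Real.exp (κ * tau M Q t) : ℝ) : ℂ)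
            * srcL M Q m q g x t := by
      have e3 : ∀ t, ((Real.exp (-(κ * tau M Q r)) * Real.exp (κ * tau M Q t) : ℝ) : ℂ)
          * srcL M Q m q g x t = Real.exp (-(κ * tau M Q r))
            * ((Real.exp (κ * tau M Q t) : ℂ) * srcL M Q m q g x t) := by
        intro t
        rw [Complex.ofReal_mul]
        ring
      simp only [e3]
      rw [intervalIntegral.integral_const_mul, amp, primit]
      push_cast
      ring
    rw [e]
    have h6 : ‖∫ t in (0 : ℝ)..r, ((Real.exp (-(κ * tau M Q r)) * Real.exp (κ * tau M Q t) : ℝ) : ℂ)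
        * srcL M Q m q g x t‖ ≤ Real.exp (2 * L) * (r * ((K * L) * B + L * nearNorm x)) := by
      calc _ ≤ ∫ t in (0 : ℝ)..r, Real.exp (2 * L) * ‖srcL M Q m q g x t‖ := by
            refine intervalIntegral.norm_integral_le_of_norm_le hr.1
              (Filter.Eventually.of_forall fun t ht => ?_)
              (((intervalIntegrable_iff_integrableOn_Ioc_of_le hr.1).mpr
                (integrableOn_Ioc_of_memLp hk r)).norm.const_mul _)
            rw [norm_mul, Complex.norm_real, Real.norm_of_nonneg (by positivity)]
            refine mul_le_mul_of_nonneg_right ?_ (norm_nonneg _)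
            rw [← Real.exp_add, Real.exp_le_exp]
            have h7 : |κ * tau M Q t| ≤ |κ| * (L * t) := by
              rw [abs_mul]
              gcongr
              have := hL t 0
              rwa [tau_zero, sub_zero, sub_zero, abs_of_nonneg ht.1.le] at this
            have h8 : |κ| * (L * t) ≤ |κ| * (L * r) := by
              have := ht.2
              gcongr
            linarith [neg_abs_le (κ * tau M Q r), le_abs_self (κ * tau M Q t)]
        _ ≤ _ := by
            rw [intervalIntegral.integral_const_mul]
            gcongr
    refine (norm_add_le _ _).trans
      ((add_le_add (b := |κ| * (L * r) * Real.exp L * B) ?_ h6).trans ?_)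
    · rw [norm_mul, Complex.norm_real]
      exact mul_le_mul h1 hc (norm_nonneg _) (by have := hr.1; positivity)
    · have hr0 := hr.1
      have a1 : Real.exp (2 * L) * (r * ((K * L) * B + L * nearNorm x))
          ≤ Real.exp (2 * L) * ((K * L + L) * |κ| * (B + nearNorm x) * r) := by
        have b1 : (K * L) * B + L * nearNorm x ≤ (K * L + L) * (B + nearNorm x) := by
          have : 0 ≤ K * L * nearNorm x := by positivity
          have : 0 ≤ L * B := by positivity
          linarith
        have b2 : (K * L + L) * (B + nearNorm x) ≤ (K * L + L) * |κ| * (B + nearNorm x) := by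
          have : 0 ≤ (K * L + L) * (B + nearNorm x) := by positivity
          nlinarith
        have b3 := mul_le_mul_of_nonneg_left (b1.trans b2) hr0
        exact (mul_le_mul_of_nonneg_left b3 (Real.exp_pos _).le).trans (le_of_eq (by ring))
      have a2 : |κ| * (L * r) * Real.exp L * B
          ≤ L * Real.exp L * |κ| * (B + nearNorm x) * r := by
        have : 0 ≤ L * Real.exp L * |κ| * nearNorm x * r := by positivity
        linarith
      have a3 : 0 ≤ 2 * |κ| * (B + nearNorm x) * r := by positivity
      linarith
  · -- at distance at least `1/|κ|` the linear bound follows from boundedness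
    have h1 := hB r hr
    have hr0 := hr.1
    have h2 : ‖amp M Q κ c (srcL M Q m q g x) r - c‖ ≤ 2 * B :=
      (norm_sub_le _ _).trans (by linarith)
    have h3 : 2 * (B + nearNorm x) ≤ 2 * (B + nearNorm x) * (|κ| * r) :=
      le_mul_of_one_le_right (by positivity) hkr.le
    have h4 : 0 ≤ (L * Real.exp L + Real.exp (2 * L) * (K * L + L)) * |κ|
        * (B + nearNorm x) * r := by
      positivity
    linarith

theorem exists_nearNorm_srcL (m q : ℝ) : ∃ C : ℝ, 0 < C ∧ ∀ g x : ℝ → ℂ, MemLp g 2 halfLine →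
    MemLp x 2 halfLine → nearNorm (srcL M Q m q g x) ≤ C * (nearNorm g + nearNorm x) := by
  obtain ⟨K, hK⟩ := exists_coef_bound M Q m q
  obtain ⟨D, hD⟩ := exists_bfun_bound M Q
  have hK0 : 0 ≤ K := (abs_nonneg _).trans (hK 0)
  have hD0 : 0 ≤ D := (abs_nonneg _).trans (hD 1 one_pos)
  refine ⟨K + D + 1, by positivity, fun g x hg hx => ?_⟩
  have ig := (integrableOn_Ioc_of_memLp hg 3).norm
  have ix := (integrableOn_Ioc_of_memLp hx 3).norm
  have h1 : nearNorm (srcL M Q m q g x) ≤ ∫ t in Set.Ioc (0 : ℝ) 3, (K * ‖g t‖ + D * ‖x t‖) := by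
    refine setIntegral_mono_on (integrableOn_Ioc_of_memLp (memLp_srcL M Q m q hg hx) 3).norm
      ((ig.const_mul _).add (ix.const_mul _)) measurableSet_Ioc fun t ht => ?_
    unfold srcL
    refine (norm_sub_le _ _).trans ?_
    rw [norm_mul, norm_mul, Complex.norm_real, Complex.norm_real]
    exact add_le_add (mul_le_mul_of_nonneg_right (hK t) (norm_nonneg _))
      (mul_le_mul_of_nonneg_right (hD t ht.1) (norm_nonneg _))
  rw [integral_add (ig.const_mul _) (ix.const_mul _), integral_const_mul, integral_const_mul] at h1
  have ng := nearNorm_nonneg g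
  have nx := nearNorm_nonneg x
  have e : nearNorm (srcL M Q m q g x) ≤ K * nearNorm g + D * nearNorm x := h1
  nlinarith [mul_nonneg hK0 nx, mul_nonneg hD0 ng]

theorem nearNorm_neg (f : ℝ → ℂ) : nearNorm (fun r => -f r) = nearNorm f := by
  simp [nearNorm]

/-- Both amplitudes of a solution of the radial equations equal their values at the origin up to
`O(r)`, with constants polynomial in `κ`. -/
theorem exists_amp_estimate (m q : ℝ) : ∃ C : ℝ, 0 < C ∧ ∀ (κ : ℝ), 1 ≤ |κ| →
    ∀ (f g x y : ℝ → ℂ) (p n : ℂ), MemLp f 2 halfLine → MemLp g 2 halfLine →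
      MemLp x 2 halfLine → MemLp y 2 halfLine →
      HalfRel M Q κ p f (srcU M Q m q g y) → HalfRel M Q (-κ) n g (srcL M Q m q f x) →
      ‖p‖ ≤ C * |κ| ^ 3 * (nearNorm f + nearNorm g + nearNorm x + nearNorm y) ∧
      ‖n‖ ≤ C * |κ| ^ 3 * (nearNorm f + nearNorm g + nearNorm x + nearNorm y) ∧
      ∀ r ∈ Set.Icc (0 : ℝ) 1,
        ‖amp M Q κ p (srcU M Q m q g y) r - p‖
          ≤ C * |κ| ^ 3 * (nearNorm f + nearNorm g + nearNorm x + nearNorm y) * r ∧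
        ‖amp M Q (-κ) n (srcL M Q m q f x) r - n‖
          ≤ C * |κ| ^ 3 * (nearNorm f + nearNorm g + nearNorm x + nearNorm y) * r := by
  obtain ⟨C₀, hC₀, H₀⟩ := exists_amp_bound M Q
  obtain ⟨C₁, hC₁, H₁⟩ := exists_amp_sub_bound M Q m q
  obtain ⟨C₂, hC₂, H₂⟩ := exists_amp_sub_bound M Q m (-q)
  obtain ⟨C₃, hC₃, H₃⟩ := exists_nearNorm_srcL M Q m q
  obtain ⟨C₄, hC₄, H₄⟩ := exists_nearNorm_srcL M Q m (-q)
  set E := C₀ * (1 + C₃ + C₄) with hE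
  have hE0 : 0 < E := by positivity
  refine ⟨E + (C₁ + C₂) * (E + 1), by positivity, ?_⟩
  intro κ hκ f g x y p n hf hg hx hy hu hl
  rw [srcU_eq] at hu ⊢
  have nf := nearNorm_nonneg f
  have ng := nearNorm_nonneg g
  have nx := nearNorm_nonneg x
  have ny := nearNorm_nonneg y
  set N := nearNorm f + nearNorm g + nearNorm x + nearNorm y with hN
  have hN0 : 0 ≤ N := by positivity
  have hκ2 : 1 ≤ |κ| ^ 2 := one_le_pow₀ hκ
  have hκ23 : |κ| ^ 2 ≤ |κ| ^ 3 := pow_le_pow_right₀ hκ (by norm_num)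
  have mu := memLp_srcL M Q m (-q) hg hy.neg
  have ml := memLp_srcL M Q m q hf hx
  have b1 : ∀ r ∈ Set.Icc (0 : ℝ) 1, ‖amp M Q κ p (srcL M Q m (-q) g fun r => -y r) r‖
      ≤ E * |κ| ^ 2 * N := by
    intro r hr
    refine (H₀ κ hκ p f _ hf mu hu r hr).trans ?_
    have h1 := H₄ g (fun r => -y r) hg hy.neg
    rw [nearNorm_neg] at h1
    have h2 : nearNorm f + nearNorm (srcL M Q m (-q) g fun r => -y r) ≤ (1 + C₃ + C₄) * N := by
      nlinarith [mul_nonneg hC₃.le hN0, mul_nonneg hC₄.le nf, mul_nonneg hC₄.le nx]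
    calc _ ≤ C₀ * |κ| ^ 2 * ((1 + C₃ + C₄) * N) :=
          mul_le_mul_of_nonneg_left h2 (by positivity)
      _ = _ := by rw [hE]; ring
  have b2 : ∀ r ∈ Set.Icc (0 : ℝ) 1, ‖amp M Q (-κ) n (srcL M Q m q f x) r‖
      ≤ E * |κ| ^ 2 * N := by
    intro r hr
    have h0 := H₀ (-κ) (by rwa [abs_neg]) n g _ hg ml hl r hr
    rw [abs_neg] at h0
    refine h0.trans ?_
    have h1 := H₃ f x hf hx
    have h2 : nearNorm g + nearNorm (srcL M Q m q f x) ≤ (1 + C₃ + C₄) * N := by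
      nlinarith [mul_nonneg hC₄.le hN0, mul_nonneg hC₃.le ng, mul_nonneg hC₃.le ny]
    calc _ ≤ C₀ * |κ| ^ 2 * ((1 + C₃ + C₄) * N) :=
          mul_le_mul_of_nonneg_left h2 (by positivity)
      _ = _ := by rw [hE]; ring
  have hsum : E * |κ| ^ 2 * N + N ≤ (E + 1) * |κ| ^ 2 * N := by nlinarith
  have hEle : E * |κ| ^ 2 * N ≤ (E + (C₁ + C₂) * (E + 1)) * |κ| ^ 3 * N := by
    have : E ≤ E + (C₁ + C₂) * (E + 1) := le_add_of_nonneg_right (by positivity)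
    gcongr
  refine ⟨?_, ?_, fun r hr => ⟨?_, ?_⟩⟩
  · have := b1 0 ⟨le_rfl, zero_le_one⟩
    rw [amp_zero] at this
    exact this.trans hEle
  · have := b2 0 ⟨le_rfl, zero_le_one⟩
    rw [amp_zero] at this
    exact this.trans hEle
  · have h := H₂ κ hκ p g (fun r => -y r) _ (E * |κ| ^ 2 * N) hg hy.neg hl.eq_amp b2 b1 r hr
    rw [nearNorm_neg] at h
    refine h.trans (mul_le_mul_of_nonneg_right ?_ hr.1)
    calc C₂ * |κ| * (E * |κ| ^ 2 * N + nearNorm y) ≤ C₂ * |κ| * ((E + 1) * |κ| ^ 2 * N) := by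
          gcongr
          linarith
      _ = C₂ * (E + 1) * |κ| ^ 3 * N := by ring
      _ ≤ _ := by
          have h0 : 0 ≤ C₁ * (E + 1) := by positivity
          gcongr
          linarith
  · have h := H₁ (-κ) (by rwa [abs_neg]) n f x _ (E * |κ| ^ 2 * N) hf hx hu.eq_amp b1 b2 r hr
    rw [abs_neg] at h
    refine h.trans (mul_le_mul_of_nonneg_right ?_ hr.1)
    calc C₁ * |κ| * (E * |κ| ^ 2 * N + nearNorm x) ≤ C₁ * |κ| * ((E + 1) * |κ| ^ 2 * N) := by
          gcongr
          linarith
      _ = C₁ * (E + 1) * |κ| ^ 3 * N := by ring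
      _ ≤ _ := by
          have h0 : 0 ≤ C₂ * (E + 1) := by positivity
          gcongr
          linarith

/-- `nearNorm` is bounded by the `L²` norm. -/
theorem nearNorm_le (u : Radial) : nearNorm u ≤ 2 * ‖u‖ := by
  have hm : MemLp u 2 (volume.restrict (Set.Ioc 0 3)) := by
    have := (Lp.memLp u).restrict (Set.Ioc 0 3)
    rwa [Measure.restrict_restrict measurableSet_Ioc,
      Set.inter_eq_left.mpr Set.Ioc_subset_Ioi_self] at this
  have h1 := eLpNorm_le_eLpNorm_mul_rpow_measure_univ (one_le_two : (1 : ENNReal) ≤ 2)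
    hm.aestronglyMeasurable
  have h2 : eLpNorm u 2 (volume.restrict (Set.Ioc 0 3)) ≤ eLpNorm u 2 halfLine :=
    eLpNorm_mono_measure _ (Measure.restrict_mono Set.Ioc_subset_Ioi_self le_rfl)
  have h3 : nearNorm u = (eLpNorm u 1 (volume.restrict (Set.Ioc 0 3))).toReal := by
    rw [nearNorm, integral_norm_eq_lintegral_enorm hm.aestronglyMeasurable,
      eLpNorm_one_eq_lintegral_enorm]
  rw [Measure.restrict_apply_univ, Real.volume_Ioc] at h1
  have h4 : ENNReal.ofReal (3 - 0) ^ (1 / (1 : ENNReal).toReal - 1 / (2 : ENNReal).toReal)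
      ≤ 2 := by
    rw [ENNReal.ofReal_rpow_of_pos (by norm_num)]
    refine ENNReal.ofReal_le_of_le_toReal ?_
    norm_num
    rw [← Real.sqrt_eq_rpow, Real.sqrt_le_left (by norm_num)]
    norm_num
  rw [h3, Lp.norm_def, ← ENNReal.toReal_ofNat 2, ← ENNReal.toReal_mul]
  refine ENNReal.toReal_mono (ENNReal.mul_ne_top (by norm_num) (Lp.memLp u).eLpNorm_ne_top) ?_
  refine h1.trans ?_
  rw [mul_comm]
  exact mul_le_mul' h4 h2

end radial

/-! ### Linearity and single-valuedness of the radial equations -/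

section radial

variable {M Q : ℝ}

theorem primit_congr {κ : ℝ} (c : ℂ) {h k : ℝ → ℂ} (hk : h =ᵐ[halfLine] k) {r : ℝ} (hr : 0 < r) :
    primit M Q κ c h r = primit M Q κ c k r := by
  unfold primit
  congr 1
  refine intervalIntegral.integral_congr_ae_restrict ?_
  rw [Set.uIoc_of_le hr.le]
  have hle : volume.restrict (Set.Ioc 0 r) ≤ halfLine :=
    Measure.restrict_mono Set.Ioc_subset_Ioi_self le_rfl
  filter_upwards [ae_mono hle hk] with t ht
  rw [ht]

theorem HalfRel.congr {κ : ℝ} {c : ℂ} {f f' h h' : ℝ → ℂ} (H : HalfRel M Q κ c f h)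
    (hf : f =ᵐ[halfLine] f') (hh : h =ᵐ[halfLine] h') : HalfRel M Q κ c f' h' := by
  unfold HalfRel at *
  filter_upwards [H, hf, ae_halfLine_pos] with r h1 h2 hr
  rw [← h2, h1, primit_congr c hh hr]

theorem HalfRel.zero (κ : ℝ) : HalfRel M Q κ 0 (fun _ => 0) (fun _ => 0) := by
  refine Filter.Eventually.of_forall fun r => ?_
  simp [primit]

theorem HalfRel.smul {κ : ℝ} {c : ℂ} {f h : ℝ → ℂ} (H : HalfRel M Q κ c f h) (a : ℂ) :
    HalfRel M Q κ (a * c) (fun r => a * f r) (fun r => a * h r) := by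
  unfold HalfRel at *
  filter_upwards [H] with r h1
  have e : ∀ t, (Real.exp (κ * tau M Q t) : ℂ) * (a * h t)
      = a * ((Real.exp (κ * tau M Q t) : ℂ) * h t) := fun t => by ring
  rw [h1]
  simp only [primit, e, intervalIntegral.integral_const_mul]
  ring

variable [hMQ : Fact (M ^ 2 < Q ^ 2)]

theorem HalfRel.add {κ : ℝ} {c c' : ℂ} {f f' h h' : ℝ → ℂ} (H : HalfRel M Q κ c f h)
    (H' : HalfRel M Q κ c' f' h') (hh : MemLp h 2 halfLine) (hh' : MemLp h' 2 halfLine) :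
    HalfRel M Q κ (c + c') (fun r => f r + f' r) (fun r => h r + h' r) := by
  unfold HalfRel at *
  filter_upwards [H, H', ae_halfLine_pos] with r h1 h2 hr
  rw [h1, h2]
  simp only [primit, mul_add]
  rw [intervalIntegral.integral_add (intervalIntegrable_exp_mul M Q κ hh hr.le)
    (intervalIntegrable_exp_mul M Q κ hh' hr.le)]
  ring

/-- If the function in a radial equation vanishes, so do the source and the constant. -/
theorem HalfRel.eq_zero {κ : ℝ} {c : ℂ} {h : ℝ → ℂ} (H : HalfRel M Q κ c (fun _ => 0) h)
    (hh : MemLp h 2 halfLine) : c = 0 ∧ h =ᵐ[halfLine] 0 := by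
  have h1 : primit M Q κ c h =ᵐ[halfLine] fun _ => 0 := by
    unfold HalfRel at H
    filter_upwards [H, ae_halfLine_pos] with r h1 hr
    have hb := Complex.ofReal_ne_zero.mpr (bfun_pos M Q hr).ne'
    have he := Complex.ofReal_ne_zero.mpr (Real.exp_pos (-(κ * tau M Q r))).ne'
    exact (mul_eq_zero.mp h1.symm).resolve_left (mul_ne_zero hb he)
  have hcont := continuousOn_primit M Q κ c hh
  have h2 : Set.EqOn (primit M Q κ c h) (fun _ => 0) (Set.Ioi 0) :=
    Measure.eqOn_open_of_ae_eq h1 isOpen_Ioi (hcont.mono Set.Ioi_subset_Ici_self) continuousOn_const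
  have hc : c = 0 := by
    have h3 : Filter.Tendsto (primit M Q κ c h) (nhdsWithin 0 (Set.Ioi 0)) (nhds c) := by
      have := (hcont 0 Set.self_mem_Ici).mono Set.Ioi_subset_Ici_self
      unfold ContinuousWithinAt at this
      rwa [show primit M Q κ c h 0 = c by simp [primit]] at this
    exact tendsto_nhds_unique h3 (tendsto_const_nhds.congr' (by
      filter_upwards [self_mem_nhdsWithin] with r hr using (h2 hr).symm))
  refine ⟨hc, ?_⟩
  have hR : ∀ n : ℕ, ∀ᵐ r, r ∈ Set.Ioo (0 : ℝ) n → h r = 0 := by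
    intro n
    have hi := intervalIntegrable_exp_mul M Q κ hh (Nat.cast_nonneg n : (0 : ℝ) ≤ n)
    filter_upwards [hi.ae_hasDerivAt_integral] with r h3 hr
    have h4 := h3 (by rw [Set.uIcc_of_le (Nat.cast_nonneg n)]; exact ⟨hr.1.le, hr.2.le⟩) 0
      Set.left_mem_uIcc
    have h5 : (fun x => ∫ t in (0 : ℝ)..x, (Real.exp (κ * tau M Q t) : ℂ) * h t)
        =ᶠ[nhds r] fun _ => -c := by
      filter_upwards [Ioi_mem_nhds hr.1] with x hx
      have := h2 hx
      simp only [primit] at this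
      linear_combination this
    have h6 := h4.unique ((hasDerivAt_const r (-c)).congr_of_eventuallyEq h5)
    have he := Complex.ofReal_ne_zero.mpr (Real.exp_pos (κ * tau M Q r)).ne'
    exact (mul_eq_zero.mp h6).resolve_left he
  have h7 := ae_all_iff.mpr hR
  rw [Filter.EventuallyEq, ae_restrict_iff' measurableSet_Ioi]
  filter_upwards [h7] with r hr hr0
  obtain ⟨n, hn⟩ := exists_nat_gt r
  exact hr n ⟨hr0, hn⟩

/-! ### The graph of the Hamiltonian -/

variable (M Q)

/-- The relation between the functions `f, g` of a field in the channels `Φ⁺_σ, Φ⁻_σ` and those,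
`x, y`, of its image under the Dirac Hamiltonian, with short-distance coefficients `p` and `n`. -/
structure ChanRel (m q κ : ℝ) (f g x y : ℝ → ℂ) (p n : ℂ) : Prop where
  upper : HalfRel M Q κ p f (srcU M Q m q g y)
  lower : HalfRel M Q (-κ) n g (srcL M Q m q f x)

theorem ChanRel.congr {M Q m q κ : ℝ} {f g x y f' g' x' y' : ℝ → ℂ} {p n : ℂ}
    (H : ChanRel M Q m q κ f g x y p n) (hf : f =ᵐ[halfLine] f') (hg : g =ᵐ[halfLine] g')
    (hx : x =ᵐ[halfLine] x') (hy : y =ᵐ[halfLine] y') : ChanRel M Q m q κ f' g' x' y' p n := by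
  refine ⟨H.upper.congr hf ?_, H.lower.congr hg ?_⟩
  · filter_upwards [hg, hy] with r h1 h2
    rw [srcU, srcU, h1, h2]
  · filter_upwards [hf, hx] with r h1 h2
    rw [srcL, srcL, h1, h2]

omit hMQ in
theorem ChanRel.zero (m q κ : ℝ) :
    ChanRel M Q m q κ (fun _ => 0) (fun _ => 0) (fun _ => 0) (fun _ => 0) 0 0 := by
  refine ⟨(HalfRel.zero κ).congr Filter.EventuallyEq.rfl ?_,
    (HalfRel.zero (-κ)).congr Filter.EventuallyEq.rfl ?_⟩ <;>
  · refine Filter.Eventually.of_forall fun r => ?_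
    simp [srcU, srcL]

theorem ChanRel.smul {M Q m q κ : ℝ} {f g x y : ℝ → ℂ} {p n : ℂ}
    (H : ChanRel M Q m q κ f g x y p n) (a : ℂ) :
    ChanRel M Q m q κ (fun r => a * f r) (fun r => a * g r) (fun r => a * x r) (fun r => a * y r)
      (a * p) (a * n) := by
  refine ⟨(H.upper.smul a).congr Filter.EventuallyEq.rfl ?_,
    (H.lower.smul a).congr Filter.EventuallyEq.rfl ?_⟩ <;>
  · refine Filter.Eventually.of_forall fun r => ?_
    simp only [srcU, srcL]
    ring

theorem ChanRel.add {M Q : ℝ} [Fact (M ^ 2 < Q ^ 2)] {m q κ : ℝ} {f g x y f' g' x' y' : ℝ → ℂ}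
    {p n p' n' : ℂ}
    (H : ChanRel M Q m q κ f g x y p n) (H' : ChanRel M Q m q κ f' g' x' y' p' n')
    (hf : MemLp f 2 halfLine) (hg : MemLp g 2 halfLine) (hx : MemLp x 2 halfLine)
    (hy : MemLp y 2 halfLine) (hf' : MemLp f' 2 halfLine) (hg' : MemLp g' 2 halfLine)
    (hx' : MemLp x' 2 halfLine) (hy' : MemLp y' 2 halfLine) :
    ChanRel M Q m q κ (fun r => f r + f' r) (fun r => g r + g' r) (fun r => x r + x' r)
      (fun r => y r + y' r) (p + p') (n + n') := by
  refine ⟨(H.upper.add H'.upper (memLp_srcU M Q m q hg hy)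
    (memLp_srcU M Q m q hg' hy')).congr Filter.EventuallyEq.rfl ?_,
    (H.lower.add H'.lower (memLp_srcL M Q m q hf hx)
    (memLp_srcL M Q m q hf' hx')).congr Filter.EventuallyEq.rfl ?_⟩ <;>
  · refine Filter.Eventually.of_forall fun r => ?_
    simp only [srcU, srcL]
    ring

/-- The conditions at the origin: in the channel `σ₀` the short-distance coefficients `p` (of
`Φ⁺`) and `n` (of `Φ⁻`) are coupled to the zero-particle amplitude `z` and its image `z'`; in all
other channels `n` vanishes. -/
def Boundary (σ₀ : AngIndex) (g : ℂ) (a₁ a₂ a₃ a₄ : ℝ) (σ : AngIndex) (z z' p n : ℂ) : Prop :=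
  (σ ≠ σ₀ → n = 0) ∧
    (σ = σ₀ → a₁ * n + a₂ * p = g * z ∧ z' = (starRingEnd ℂ) g * (a₃ * n + a₄ * p))

variable (m q : ℝ) (σ₀ : AngIndex) (g : ℂ) (a₁ a₂ a₃ a₄ : ℝ)

/-- The graph of the Hamiltonian with interior-boundary condition. -/
def ibcGraph : Submodule ℂ (Fock M Q × Fock M Q) where
  carrier := {X | ∀ σ : AngIndex, ∃ p n : ℂ,
    ChanRel M Q m q σ.kappa (chan M Q (σ, true) X.1.snd) (chan M Q (σ, false) X.1.snd)
      (chan M Q (σ, true) X.2.snd) (chan M Q (σ, false) X.2.snd) p n ∧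
    Boundary σ₀ g a₁ a₂ a₃ a₄ σ X.1.fst X.2.fst p n}
  zero_mem' := by
    intro σ
    refine ⟨0, 0, ?_, ?_, ?_⟩
    · have h : ∀ i, (0 : ℝ → ℂ) =ᵐ[halfLine] chan M Q i (0 : OneParticle M Q) := by
        intro i
        rw [map_zero]
        exact (Lp.coeFn_zero _ _ _).symm
      exact (ChanRel.zero M Q m q _).congr (h _) (h _) (h _) (h _)
    · simp
    · intro
      simp
  add_mem' := by
    intro X Y hX hY σ
    obtain ⟨p, n, h1, h2, h3⟩ := hX σ
    obtain ⟨p', n', h1', h2', h3'⟩ := hY σ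
    refine ⟨p + p', n + n', ?_, ?_, ?_⟩
    · have h : ∀ i (ψ φ : OneParticle M Q), (fun r => chan M Q i ψ r + chan M Q i φ r)
          =ᵐ[halfLine] chan M Q i (ψ + φ) := by
        intro i ψ φ
        rw [map_add]
        exact (Lp.coeFn_add _ _).symm
      exact (h1.add h1' (Lp.memLp _) (Lp.memLp _) (Lp.memLp _) (Lp.memLp _) (Lp.memLp _)
        (Lp.memLp _) (Lp.memLp _) (Lp.memLp _)).congr (h _ _ _) (h _ _ _) (h _ _ _) (h _ _ _)
    · intro hσ
      rw [h2 hσ, h2' hσ, add_zero]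
    · intro hσ
      obtain ⟨k1, k2⟩ := h3 hσ
      obtain ⟨k1', k2'⟩ := h3' hσ
      simp only [Prod.fst_add, Prod.snd_add, WithLp.add_fst]
      constructor
      · linear_combination k1 + k1'
      · linear_combination k2 + k2'
  smul_mem' := by
    intro a X hX σ
    obtain ⟨p, n, h1, h2, h3⟩ := hX σ
    refine ⟨a * p, a * n, ?_, ?_, ?_⟩
    · have h : ∀ i (ψ : OneParticle M Q), (fun r => a * chan M Q i ψ r)
          =ᵐ[halfLine] chan M Q i (a • ψ) := by
        intro i ψ
        rw [(chan M Q i).map_smul]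
        exact (Lp.coeFn_smul a (chan M Q i ψ)).symm
      exact (h1.smul a).congr (h _ _) (h _ _) (h _ _) (h _ _)
    · intro hσ
      rw [h2 hσ, mul_zero]
    · intro hσ
      obtain ⟨k1, k2⟩ := h3 hσ
      simp only [Prod.smul_fst, Prod.smul_snd, WithLp.smul_fst, smul_eq_mul]
      constructor
      · linear_combination a * k1
      · linear_combination a * k2

theorem inner_radial (u w : Radial) : inner ℂ u w = ∫ r, (starRingEnd ℂ) (u r) * w r ∂halfLine := by
  rw [L2.inner_def]
  simp only [RCLike.inner_apply, mul_comm]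

theorem integrable_conj_mul_radial {u w : ℝ → ℂ} (hu : MemLp u 2 halfLine)
    (hw : MemLp w 2 halfLine) : Integrable (fun r => (starRingEnd ℂ) (u r) * w r) halfLine :=
  MemLp.integrable_mul hu.star hw

omit hMQ in
theorem fock_inner (X Y : Fock M Q) :
    inner ℂ X Y = (starRingEnd ℂ) X.fst * Y.fst + inner ℂ X.snd Y.snd := by
  rw [mul_comm]
  rfl

omit hMQ in
theorem integral_add_sub {a b c : ℝ → ℂ} (ha : Integrable a halfLine) (hb : Integrable b halfLine)
    (hc : Integrable c halfLine) : ∫ r, (a r + b r - c r) ∂halfLine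
      = ∫ r, a r ∂halfLine + ∫ r, b r ∂halfLine - ∫ r, c r ∂halfLine := by
  have h : ∫ r, ((a r + b r) - c r) ∂halfLine = ∫ r, (a r + b r) ∂halfLine - ∫ r, c r ∂halfLine :=
    integral_sub (ha.add hb) hc
  rw [h, integral_add ha hb]

omit hMQ in
theorem integral_add_sub_sub {a b c d : ℝ → ℂ} (ha : Integrable a halfLine)
    (hb : Integrable b halfLine) (hc : Integrable c halfLine) (hd : Integrable d halfLine) :
    ∫ r, (a r + b r - c r - d r) ∂halfLine
      = ∫ r, a r ∂halfLine + ∫ r, b r ∂halfLine - ∫ r, c r ∂halfLine - ∫ r, d r ∂halfLine := by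
  have h : ∫ r, ((a r + b r - c r) - d r) ∂halfLine
      = ∫ r, (a r + b r - c r) ∂halfLine - ∫ r, d r ∂halfLine :=
    integral_sub ((ha.add hb).sub hc) hd
  rw [h, integral_add_sub ha hb hc]

/-- The operator with graph `ibcGraph` is symmetric. -/
theorem ibcGraph_le_adjoint (ha : a₁ * a₄ - a₂ * a₃ = 1) :
    ibcGraph M Q m q σ₀ g a₁ a₂ a₃ a₄ ≤ (ibcGraph M Q m q σ₀ g a₁ a₂ a₃ a₄).adjoint := by
  classical
  rintro ⟨Ψ₂, Θ₂⟩ h₂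
  rw [Submodule.mem_adjoint_iff]
  intro Ψ₁ Θ₁ h₁
  change inner ℂ Θ₁ Ψ₂ - inner ℂ Ψ₁ Θ₂ = 0
  choose p₂ n₂ r₂ b₂ using h₂
  choose p₁ n₁ r₁ b₁ using h₁
  have hs := (hasSum_inner_chan M Q Θ₁.snd Ψ₂.snd).sub (hasSum_inner_chan M Q Ψ₁.snd Θ₂.snd)
  have hf : ∀ σ : AngIndex, HasSum (fun s : Bool =>
      inner ℂ (chan M Q (σ, s) Θ₁.snd) (chan M Q (σ, s) Ψ₂.snd)
        - inner ℂ (chan M Q (σ, s) Ψ₁.snd) (chan M Q (σ, s) Θ₂.snd))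
      (if σ = σ₀ then (starRingEnd ℂ) (n₁ σ₀) * p₂ σ₀ - (starRingEnd ℂ) (p₁ σ₀) * n₂ σ₀
        else 0) := by
    intro σ
    have h := hasSum_fintype (fun s : Bool =>
      inner ℂ (chan M Q (σ, s) Θ₁.snd) (chan M Q (σ, s) Ψ₂.snd)
        - inner ℂ (chan M Q (σ, s) Ψ₁.snd) (chan M Q (σ, s) Θ₂.snd))
    convert h using 1
    rw [Fintype.sum_bool]
    simp only [inner_radial]
    have G := green_identity M Q m q σ.kappa (Lp.memLp _) (Lp.memLp _) (Lp.memLp _) (Lp.memLp _)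
      (Lp.memLp _) (Lp.memLp _) (Lp.memLp _) (Lp.memLp _) (r₁ σ).upper (r₁ σ).lower
      (r₂ σ).upper (r₂ σ).lower
    have j1 := integrable_conj_mul_radial (Lp.memLp (chan M Q (σ, true) Θ₁.snd))
      (Lp.memLp (chan M Q (σ, true) Ψ₂.snd))
    have j2 := integrable_conj_mul_radial (Lp.memLp (chan M Q (σ, false) Θ₁.snd))
      (Lp.memLp (chan M Q (σ, false) Ψ₂.snd))
    have j3 := integrable_conj_mul_radial (Lp.memLp (chan M Q (σ, true) Ψ₁.snd))
      (Lp.memLp (chan M Q (σ, true) Θ₂.snd))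
    have j4 := integrable_conj_mul_radial (Lp.memLp (chan M Q (σ, false) Ψ₁.snd))
      (Lp.memLp (chan M Q (σ, false) Θ₂.snd))
    dsimp only at G
    rw [integral_add_sub_sub j1 j2 j3 j4] at G
    have e : (starRingEnd ℂ) (n₁ σ) * p₂ σ - (starRingEnd ℂ) (p₁ σ) * n₂ σ
        = if σ = σ₀ then (starRingEnd ℂ) (n₁ σ₀) * p₂ σ₀ - (starRingEnd ℂ) (p₁ σ₀) * n₂ σ₀
          else 0 := by
      split_ifs with hσ
      · rw [hσ]
      · rw [(b₁ σ).1 hσ, (b₂ σ).1 hσ]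
        simp
    rw [← e, ← G]
    ring
  have hu := (hs.prod_fiberwise hf).unique (hasSum_ite_eq σ₀ _)
  obtain ⟨c1, c2⟩ := (b₁ σ₀).2 rfl
  obtain ⟨d1, d2⟩ := (b₂ σ₀).2 rfl
  dsimp only at c1 c2 d1 d2
  rw [fock_inner, fock_inner]
  have c1' := congrArg (starRingEnd ℂ) c1
  have c2' := congrArg (starRingEnd ℂ) c2
  simp only [map_add, map_mul, Complex.conj_ofReal, Complex.conj_conj] at c1' c2'
  have ha' : (a₁ : ℂ) * a₄ - a₂ * a₃ = 1 := by exact_mod_cast ha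
  linear_combination hu + Ψ₂.fst * c2' - (starRingEnd ℂ) Ψ₁.fst * d2
    - (a₃ * (starRingEnd ℂ) (n₁ σ₀) + a₄ * (starRingEnd ℂ) (p₁ σ₀)) * d1
    + (a₃ * n₂ σ₀ + a₄ * p₂ σ₀) * c1'
    - ((starRingEnd ℂ) (n₁ σ₀) * p₂ σ₀ - (starRingEnd ℂ) (p₁ σ₀) * n₂ σ₀) * ha'

/-- Testing an element of the adjoint against elements of the graph supported in one channel. -/
theorem pairing_of_mem_adjoint {Ψ Θ : Fock M Q}
    (hX : (Ψ, Θ) ∈ (ibcGraph M Q m q σ₀ g a₁ a₂ a₃ a₄).adjoint) (σ : AngIndex)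
    {f₁ g₁ x₁ y₁ : ℝ → ℂ} {p n z z' : ℂ} (hf : MemLp f₁ 2 halfLine) (hg : MemLp g₁ 2 halfLine)
    (hx : MemLp x₁ 2 halfLine) (hy : MemLp y₁ 2 halfLine)
    (H : ChanRel M Q m q σ.kappa f₁ g₁ x₁ y₁ p n) (hB : Boundary σ₀ g a₁ a₂ a₃ a₄ σ z z' p n)
    (hz : σ ≠ σ₀ → z = 0 ∧ z' = 0) :
    ∫ r, (starRingEnd ℂ) (x₁ r) * chan M Q (σ, true) Ψ.snd r ∂halfLine
      + ∫ r, (starRingEnd ℂ) (y₁ r) * chan M Q (σ, false) Ψ.snd r ∂halfLine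
      - ∫ r, (starRingEnd ℂ) (f₁ r) * chan M Q (σ, true) Θ.snd r ∂halfLine
      - ∫ r, (starRingEnd ℂ) (g₁ r) * chan M Q (σ, false) Θ.snd r ∂halfLine
      = (starRingEnd ℂ) z * Θ.fst - (starRingEnd ℂ) z' * Ψ.fst := by
  classical
  rw [Submodule.mem_adjoint_iff] at hX
  set Ψ₁ : Fock M Q := WithLp.toLp 2 (z, embed M Q (σ, true) (hf.toLp f₁)
    + embed M Q (σ, false) (hg.toLp g₁)) with hΨ₁
  set Θ₁ : Fock M Q := WithLp.toLp 2 (z', embed M Q (σ, true) (hx.toLp x₁)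
    + embed M Q (σ, false) (hy.toLp y₁)) with hΘ₁
  have hmem : (Ψ₁, Θ₁) ∈ ibcGraph M Q m q σ₀ g a₁ a₂ a₃ a₄ := by
    intro τ
    have ht : ∀ u w : Radial, chan M Q (τ, true) (embed M Q (σ, true) u + embed M Q (σ, false) w)
        = if τ = σ then u else 0 := by
      intro u w
      rw [map_add, chan_embed, chan_embed]
      simp
    have hfa : ∀ u w : Radial,
        chan M Q (τ, false) (embed M Q (σ, true) u + embed M Q (σ, false) w)
        = if τ = σ then w else 0 := by
      intro u w
      rw [map_add, chan_embed, chan_embed]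
      simp
    change ∃ p n : ℂ, ChanRel M Q m q τ.kappa
      (chan M Q (τ, true) (embed M Q (σ, true) (hf.toLp f₁) + embed M Q (σ, false) (hg.toLp g₁)))
      (chan M Q (τ, false) (embed M Q (σ, true) (hf.toLp f₁) + embed M Q (σ, false) (hg.toLp g₁)))
      (chan M Q (τ, true) (embed M Q (σ, true) (hx.toLp x₁) + embed M Q (σ, false) (hy.toLp y₁)))
      (chan M Q (τ, false) (embed M Q (σ, true) (hx.toLp x₁) + embed M Q (σ, false) (hy.toLp y₁)))
      p n ∧ Boundary σ₀ g a₁ a₂ a₃ a₄ τ z z' p n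
    rw [ht, hfa, ht, hfa]
    by_cases hτ : τ = σ
    · subst hτ
      simp only [if_true]
      exact ⟨p, n, H.congr hf.coeFn_toLp.symm hg.coeFn_toLp.symm hx.coeFn_toLp.symm
        hy.coeFn_toLp.symm, hB⟩
    · simp only [if_neg hτ]
      have h0 : (fun _ => 0 : ℝ → ℂ) =ᵐ[halfLine] (0 : Radial) := (Lp.coeFn_zero _ _ _).symm
      refine ⟨0, 0, (ChanRel.zero M Q m q _).congr h0 h0 h0 h0, fun _ => rfl, fun hτ₀ => ?_⟩
      obtain ⟨rfl, rfl⟩ := hz fun hσ => hτ (hτ₀.trans hσ.symm)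
      simp
  have h := hX Ψ₁ Θ₁ hmem
  have hin : ∀ {u : ℝ → ℂ} (hu : MemLp u 2 halfLine) (w : Radial),
      inner ℂ (hu.toLp u) w = ∫ r, (starRingEnd ℂ) (u r) * w r ∂halfLine := by
    intro u hu w
    rw [inner_radial]
    refine integral_congr_ae ?_
    filter_upwards [hu.coeFn_toLp] with r hr
    rw [hr]
  change inner ℂ Θ₁ Ψ - inner ℂ Ψ₁ Θ = 0 at h
  rw [fock_inner, fock_inner] at h
  change (starRingEnd ℂ) z' * Ψ.fst + inner ℂ (embed M Q (σ, true) (hx.toLp x₁)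
    + embed M Q (σ, false) (hy.toLp y₁)) Ψ.snd - ((starRingEnd ℂ) z * Θ.fst
    + inner ℂ (embed M Q (σ, true) (hf.toLp f₁) + embed M Q (σ, false) (hg.toLp g₁)) Θ.snd) = 0 at h
  rw [inner_add_left, inner_add_left, ← inner_chan, ← inner_chan, ← inner_chan, ← inner_chan,
    hin, hin, hin, hin] at h
  linear_combination h

variable {M Q m q σ₀ g a₁ a₂ a₃ a₄}

/-- An element of the adjoint, tested with `testF` in the channel of `Φ⁺_σ`: a weak form of the
lower radial equation, with the contribution of the zero-particle sector on the right-hand side. -/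
theorem upper_test_of_mem_adjoint {Ψ Θ : Fock M Q}
    (hX : (Ψ, Θ) ∈ (ibcGraph M Q m q σ₀ g a₁ a₂ a₃ a₄).adjoint) (σ : AngIndex)
    {h : ℝ → ℝ} (T : RadialTest h) {z z' : ℂ}
    (hB : Boundary σ₀ g a₁ a₂ a₃ a₄ σ z z' ((-∫ t, h t : ℝ) : ℂ) 0)
    (hz : σ ≠ σ₀ → z = 0 ∧ z' = 0) :
    ∫ r, (h r : ℂ) * weakFn M Q (-σ.kappa) (chan M Q (σ, false) Ψ.snd)
        (srcL M Q m q (chan M Q (σ, true) Ψ.snd) (chan M Q (σ, true) Θ.snd)) r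
      = (starRingEnd ℂ) z * Θ.fst - (starRingEnd ℂ) z' * Ψ.fst := by
  have mF := memLp_testF M Q T σ.kappa
  have mX := memLp_testX M Q T m q σ.kappa
  have mY := memLp_testY M Q T σ.kappa
  have m0 : MemLp (fun _ : ℝ => (0 : ℂ)) 2 halfLine := MemLp.zero'
  have H : ChanRel M Q m q σ.kappa (testF M Q σ.kappa h) (fun _ => 0) (testX M Q m q σ.kappa h)
      (testY M Q σ.kappa h) ((-∫ t, h t : ℝ) : ℂ) 0 := by
    refine ⟨(halfRel_testF M Q h σ.kappa).congr Filter.EventuallyEq.rfl ?_,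
      (HalfRel.zero _).congr Filter.EventuallyEq.rfl ?_⟩
    · refine Filter.Eventually.of_forall fun r => ?_
      simp [srcU]
    · refine Filter.Eventually.of_forall fun r => ?_
      simp only [srcL, testF, testX]
      push_cast
      ring
  have P := pairing_of_mem_adjoint M Q m q σ₀ g a₁ a₂ a₃ a₄ hX σ mF m0 mX mY H hB hz
  rw [← P, ← integral_test_pairing M Q T m q σ.kappa (Lp.memLp _) (Lp.memLp _) (Lp.memLp _)]
  have j1 := integrable_conj_mul_radial mX (Lp.memLp (chan M Q (σ, true) Ψ.snd))
  have j2 := integrable_conj_mul_radial mY (Lp.memLp (chan M Q (σ, false) Ψ.snd))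
  have j3 := integrable_conj_mul_radial mF (Lp.memLp (chan M Q (σ, true) Θ.snd))
  rw [integral_add_sub j1 j2 j3]
  simp

/-- An element of the adjoint, tested in the channel of `Φ⁻_σ`: a weak form of the upper radial
equation. -/
theorem lower_test_of_mem_adjoint {Ψ Θ : Fock M Q}
    (hX : (Ψ, Θ) ∈ (ibcGraph M Q m q σ₀ g a₁ a₂ a₃ a₄).adjoint) (σ : AngIndex)
    {h : ℝ → ℝ} (T : RadialTest h) {z z' : ℂ}
    (hB : Boundary σ₀ g a₁ a₂ a₃ a₄ σ z z' 0 ((-∫ t, h t : ℝ) : ℂ))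
    (hz : σ ≠ σ₀ → z = 0 ∧ z' = 0) :
    ∫ r, (h r : ℂ) * weakFn M Q σ.kappa (chan M Q (σ, true) Ψ.snd)
        (srcU M Q m q (chan M Q (σ, false) Ψ.snd) (chan M Q (σ, false) Θ.snd)) r
      = (starRingEnd ℂ) z' * Ψ.fst - (starRingEnd ℂ) z * Θ.fst := by
  have mF := memLp_testF M Q T (-σ.kappa)
  have mX := memLp_testX M Q T m (-q) (-σ.kappa)
  have mY := memLp_testY M Q T (-σ.kappa)
  have m0 : MemLp (fun _ : ℝ => (0 : ℂ)) 2 halfLine := MemLp.zero'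
  have H : ChanRel M Q m q σ.kappa (fun _ => 0) (testF M Q (-σ.kappa) h)
      (fun r => -testY M Q (-σ.kappa) h r) (fun r => -testX M Q m (-q) (-σ.kappa) h r) 0
      ((-∫ t, h t : ℝ) : ℂ) := by
    refine ⟨(HalfRel.zero _).congr Filter.EventuallyEq.rfl ?_,
      (halfRel_testF M Q h (-σ.kappa)).congr Filter.EventuallyEq.rfl ?_⟩
    · refine Filter.Eventually.of_forall fun r => ?_
      simp only [srcU, testF, testX]
      push_cast
      ring
    · refine Filter.Eventually.of_forall fun r => ?_
      simp [srcL]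
  have P := pairing_of_mem_adjoint M Q m q σ₀ g a₁ a₂ a₃ a₄ hX σ m0 mF mY.neg mX.neg H hB hz
  have I := integral_test_pairing M Q T m (-q) (-σ.kappa)
    (Lp.memLp (chan M Q (σ, false) Ψ.snd)) (Lp.memLp (chan M Q (σ, true) Ψ.snd))
    (Lp.memLp (chan M Q (σ, false) Θ.snd)).neg
  have j1 := integrable_conj_mul_radial mX (Lp.memLp (chan M Q (σ, false) Ψ.snd))
  have j2 := integrable_conj_mul_radial mY (Lp.memLp (chan M Q (σ, true) Ψ.snd))
  have j3 := integrable_conj_mul_radial mF (Lp.memLp (chan M Q (σ, false) Θ.snd)).neg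
  simp only [Pi.neg_apply] at I j3
  rw [integral_add_sub j1 j2 j3] at I
  rw [srcU_eq]
  simp only [neg_neg, Pi.neg_apply, mul_neg, integral_neg, map_neg, neg_mul, map_zero, zero_mul,
    integral_zero, Pi.neg_def] at I P
  rw [← I]
  linear_combination -P

/-- The graph of the Hamiltonian contains its adjoint. -/
theorem adjoint_le_ibcGraph (hg : g ≠ 0) (ha : a₁ * a₄ - a₂ * a₃ = 1) :
    (ibcGraph M Q m q σ₀ g a₁ a₂ a₃ a₄).adjoint ≤ ibcGraph M Q m q σ₀ g a₁ a₂ a₃ a₄ := by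
  rintro ⟨Ψ, Θ⟩ hX σ
  have ha' : (a₁ : ℂ) * a₄ - a₂ * a₃ = 1 := by exact_mod_cast ha
  have hg' : (starRingEnd ℂ) g ≠ 0 := (map_ne_zero _).mpr hg
  have mL := memLp_srcL M Q m q (Lp.memLp (chan M Q (σ, true) Ψ.snd))
    (Lp.memLp (chan M Q (σ, true) Θ.snd))
  have mU := memLp_srcU M Q m q (Lp.memLp (chan M Q (σ, false) Ψ.snd))
    (Lp.memLp (chan M Q (σ, false) Θ.snd))
  have lL := locallyIntegrableOn_weakFn M Q (-σ.kappa) (Lp.memLp (chan M Q (σ, false) Ψ.snd)) mL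
  have lU := locallyIntegrableOn_weakFn M Q σ.kappa (Lp.memLp (chan M Q (σ, true) Ψ.snd)) mU
  by_cases hσ : σ = σ₀
  · -- the solution `(p, n)` of the two boundary equations, the determinant being `1`
    refine ⟨-(a₃ * (g * Ψ.fst)) + a₁ * (Θ.fst / (starRingEnd ℂ) g),
      a₄ * (g * Ψ.fst) - a₂ * (Θ.fst / (starRingEnd ℂ) g), ⟨?_, ?_⟩, ?_, ?_⟩
    · refine halfRel_of_weakFn M Q _ (ae_eq_const_of_weak lU _ fun h T => ?_)
      have := lower_test_of_mem_adjoint hX σ T (z := a₁ * ((-∫ t, h t : ℝ) : ℂ) / g)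
        (z' := (starRingEnd ℂ) g * (a₃ * ((-∫ t, h t : ℝ) : ℂ)))
        ⟨fun h => (h hσ).elim, fun _ => ⟨by field_simp; ring, by ring⟩⟩ (fun h => (h hσ).elim)
      rw [this]
      simp only [map_mul, map_div₀, Complex.conj_ofReal, Complex.conj_conj]
      push_cast
      ring
    · refine halfRel_of_weakFn M Q _ (ae_eq_const_of_weak lL _ fun h T => ?_)
      have := upper_test_of_mem_adjoint hX σ T (z := a₂ * ((-∫ t, h t : ℝ) : ℂ) / g)
        (z' := (starRingEnd ℂ) g * (a₄ * ((-∫ t, h t : ℝ) : ℂ)))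
        ⟨fun h => (h hσ).elim, fun _ => ⟨by field_simp; ring, by ring⟩⟩ (fun h => (h hσ).elim)
      rw [this]
      simp only [map_mul, map_div₀, Complex.conj_ofReal, Complex.conj_conj]
      push_cast
      ring
    · exact fun h => (h hσ).elim
    · intro _
      constructor
      · linear_combination g * Ψ.fst * ha'
      · have e : Θ.fst = (starRingEnd ℂ) g * (Θ.fst / (starRingEnd ℂ) g) := by field_simp
        dsimp only
        generalize Θ.fst / (starRingEnd ℂ) g = w at *
        rw [e]
        linear_combination -(starRingEnd ℂ) g * w * ha'
  · obtain ⟨p, hp⟩ := exists_ae_eq_const_of_weak lU (fun h T h0 => by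
      have := lower_test_of_mem_adjoint hX σ T (z := 0) (z' := 0)
        ⟨fun _ => by rw [h0]; simp, fun h => (hσ h).elim⟩ (fun _ => ⟨rfl, rfl⟩)
      rw [this]
      simp)
    refine ⟨p, 0, ⟨halfRel_of_weakFn M Q _ hp, ?_⟩, fun _ => rfl, fun h => (hσ h).elim⟩
    refine halfRel_of_weakFn M Q _ (ae_eq_const_of_weak lL _ fun h T => ?_)
    have := upper_test_of_mem_adjoint hX σ T (z := 0) (z' := 0)
        ⟨fun _ => rfl, fun h => (hσ h).elim⟩ (fun _ => ⟨rfl, rfl⟩)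
    rw [this]
    simp

theorem ibcGraph_adjoint (hg : g ≠ 0) (ha : a₁ * a₄ - a₂ * a₃ = 1) :
    (ibcGraph M Q m q σ₀ g a₁ a₂ a₃ a₄).adjoint = ibcGraph M Q m q σ₀ g a₁ a₂ a₃ a₄ :=
  le_antisymm (adjoint_le_ibcGraph hg ha) (ibcGraph_le_adjoint M Q m q σ₀ g a₁ a₂ a₃ a₄ ha)

/-- The graph is that of an operator: the radial equations with zero field force zero image and zero
coefficients, and then the formula for the zero-particle component gives zero. -/
theorem ibcGraph_singleValued (X : Fock M Q × Fock M Q)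
    (hX : X ∈ ibcGraph M Q m q σ₀ g a₁ a₂ a₃ a₄) (h0 : X.1 = 0) : X.2 = 0 := by
  have hsnd : X.1.snd = 0 := by rw [h0]; rfl
  have key : ∀ σ, ∃ p n : ℂ, p = 0 ∧ n = 0 ∧ chan M Q (σ, true) X.2.snd = 0 ∧
      chan M Q (σ, false) X.2.snd = 0 ∧ Boundary σ₀ g a₁ a₂ a₃ a₄ σ X.1.fst X.2.fst p n := by
    intro σ
    obtain ⟨p, n, h1, h2⟩ := hX σ
    have hz : ∀ i, chan M Q i X.1.snd =ᵐ[halfLine] fun _ => (0 : ℂ) := by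
      intro i
      rw [hsnd, map_zero]
      exact Lp.coeFn_zero _ _ _
    have h3 := h1.congr (hz _) (hz _) Filter.EventuallyEq.rfl Filter.EventuallyEq.rfl
    have m0 : MemLp (fun _ : ℝ => (0 : ℂ)) 2 halfLine := MemLp.zero'
    obtain ⟨e1, k1⟩ := h3.upper.eq_zero (memLp_srcU M Q m q m0 (Lp.memLp _))
    obtain ⟨e2, k2⟩ := h3.lower.eq_zero (memLp_srcL M Q m q m0 (Lp.memLp _))
    refine ⟨p, n, e1, e2, ?_, ?_, h2⟩
    · rw [Lp.eq_zero_iff_ae_eq_zero]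
      filter_upwards [k2, ae_halfLine_pos] with r hr hr0
      simp only [srcL, mul_zero, zero_sub, Pi.zero_apply, neg_eq_zero] at hr
      exact (mul_eq_zero.mp hr).resolve_left (Complex.ofReal_ne_zero.mpr (bfun_pos M Q hr0).ne')
    · rw [Lp.eq_zero_iff_ae_eq_zero]
      filter_upwards [k1, ae_halfLine_pos] with r hr hr0
      simp only [srcU, mul_zero, add_zero, Pi.zero_apply] at hr
      exact (mul_eq_zero.mp hr).resolve_left (Complex.ofReal_ne_zero.mpr (bfun_pos M Q hr0).ne')
  have hs : X.2.snd = 0 := by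
    refine eq_zero_of_chan_eq_zero M Q _ ?_
    rintro ⟨σ, s⟩
    obtain ⟨p, n, -, -, k1, k2, -⟩ := key σ
    cases s
    · exact k2
    · exact k1
  have hf : X.2.fst = 0 := by
    obtain ⟨p, n, rfl, rfl, -, -, hB⟩ := key σ₀
    rw [(hB.2 rfl).2]
    simp
  exact WithLp.ofLp_injective 2 (Prod.ext hf hs)

variable (M Q m q σ₀ g a₁ a₂ a₃ a₄)

/-- The Hamiltonian with interior-boundary condition. -/
def ibcHamiltonian : Fock M Q →ₗ.[ℂ] Fock M Q :=
  (ibcGraph M Q m q σ₀ g a₁ a₂ a₃ a₄).toLinearPMap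

theorem ibcHamiltonian_graph :
    (ibcHamiltonian M Q m q σ₀ g a₁ a₂ a₃ a₄).graph = ibcGraph M Q m q σ₀ g a₁ a₂ a₃ a₄ :=
  Submodule.toLinearPMap_graph_eq _ ibcGraph_singleValued

/-- A vector orthogonal to the domain is a value of the adjoint relation, hence of the graph, at
zero. -/
theorem dense_domain_ibcHamiltonian (hg : g ≠ 0) (ha : a₁ * a₄ - a₂ * a₃ = 1) :
    Dense ((ibcHamiltonian M Q m q σ₀ g a₁ a₂ a₃ a₄).domain : Set (Fock M Q)) := by
  rw [Submodule.dense_iff_topologicalClosure_eq_top, Submodule.topologicalClosure_eq_top_iff,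
    Submodule.eq_bot_iff]
  intro Ψ hΨ
  have h1 : ((0 : Fock M Q), Ψ) ∈ (ibcGraph M Q m q σ₀ g a₁ a₂ a₃ a₄).adjoint := by
    rw [Submodule.mem_adjoint_iff]
    intro X Y hXY
    have : X ∈ (ibcHamiltonian M Q m q σ₀ g a₁ a₂ a₃ a₄).domain :=
      Submodule.mem_map.mpr ⟨(X, Y), hXY, rfl⟩
    rw [inner_zero_right, (Submodule.mem_orthogonal _ _).mp hΨ X this, sub_zero]
  rw [ibcGraph_adjoint hg ha] at h1
  exact ibcGraph_singleValued _ h1 rfl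

theorem isSelfAdjoint_ibcHamiltonian (hg : g ≠ 0) (ha : a₁ * a₄ - a₂ * a₃ = 1) :
    IsSelfAdjoint (ibcHamiltonian M Q m q σ₀ g a₁ a₂ a₃ a₄) := by
  rw [LinearPMap.isSelfAdjoint_def]
  refine LinearPMap.eq_of_eq_graph ?_
  rw [LinearPMap.adjoint_graph_eq_graph_adjoint
    (dense_domain_ibcHamiltonian M Q m q σ₀ g a₁ a₂ a₃ a₄ hg ha), ibcHamiltonian_graph,
    ibcGraph_adjoint hg ha]

end radial

/-! ### Short-distance asymptotics -/

section radial

variable (M Q : ℝ)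

theorem rho_zero : rho M Q 0 = |Q| := by
  simp [rho, Real.sqrt_sq_eq_abs]

variable [hMQ : Fact (M ^ 2 < Q ^ 2)]

include M hMQ in
theorem abs_Q_pos : 0 < |Q| := by
  rw [← rho_zero M Q]
  exact rho_pos M Q 0

/-- The Lipschitz bound for `ρ^{-1/2}` at the origin. -/
theorem exists_rho_rpow_lipschitz : ∃ K : ℝ, 0 < K ∧ ∀ r ∈ Set.Icc (0 : ℝ) 1,
    |(Real.sqrt (rho M Q r))⁻¹ - (Real.sqrt |Q|)⁻¹| ≤ K * r := by
  have hc : ContDiff ℝ 1 fun r => (Real.sqrt (rho M Q r))⁻¹ :=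
    ((contDiff_rho M Q).sqrt fun r => (rho_pos M Q r).ne').inv
      fun r => (Real.sqrt_pos.mpr (rho_pos M Q r)).ne'
  obtain ⟨K, hK⟩ := (isCompact_Icc (a := (0 : ℝ)) (b := 1)).exists_bound_of_continuousOn
    (hc.continuous_deriv le_rfl).continuousOn
  refine ⟨max K 1, by positivity, fun r hr => ?_⟩
  have h := (convex_Icc (0 : ℝ) 1).norm_image_sub_le_of_norm_deriv_le
    (fun x _ => (hc.differentiable one_ne_zero).differentiableAt) hK
    (Set.left_mem_Icc.mpr zero_le_one) hr
  rw [rho_zero, sub_zero, Real.norm_eq_abs, Real.norm_of_nonneg hr.1] at h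
  exact h.trans (mul_le_mul_of_nonneg_right (le_max_left _ _) hr.1)

theorem bfun_div_rwt {r : ℝ} (hr : 0 < r) :
    bfun M Q r / rwt M Q r = (Real.sqrt (rho M Q r))⁻¹ * (Real.sqrt r)⁻¹ := by
  have hρ := rho_pos M Q r
  have h1 : rwt M Q r = r * Real.sqrt r / Real.sqrt (rho M Q r) := by
    rw [rwt, A_eq M Q hr, inv_div, show r / rho M Q r * r ^ 2 = r ^ 2 * (r / rho M Q r) by ring,
      Real.sqrt_mul (sq_nonneg r), Real.sqrt_sq hr.le, Real.sqrt_div hr.le]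
    ring
  have h2 := Real.sqrt_pos.mpr hρ
  have h3 := Real.sqrt_pos.mpr hr
  have h4 := Real.sq_sqrt hρ.le
  rw [h1, bfun, div_div_eq_mul_div, div_eq_iff (by positivity)]
  rw [div_mul_eq_mul_div, div_eq_iff hρ.ne', ← h4]
  simp only [Real.sqrt_sq h2.le]
  field_simp

/-- The angular coefficient expressed through the amplitude. -/
theorem angCoeff_ae_eq {κ : ℝ} {c : ℂ} {h : ℝ → ℂ} (i : AngIndex × Bool) (ψ : OneParticle M Q)
    (H : HalfRel M Q κ c (chan M Q i ψ) h) :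
    ∀ᵐ r ∂halfLine, angCoeff (basisField i) ψ r
      = ((Real.sqrt (rho M Q r))⁻¹ * (Real.sqrt r)⁻¹ : ℝ) * amp M Q κ c h r := by
  filter_upwards [chan_ae M Q i ψ, H.eq_amp, ae_halfLine_pos] with r h1 h2 hr
  have hw := Complex.ofReal_ne_zero.mpr (rwt_pos M Q hr).ne'
  rw [← bfun_div_rwt M Q hr, Complex.ofReal_div, div_mul_eq_mul_div, eq_div_iff hw, ← h2, h1]
  ring

/-- Linear closeness of the amplitude `a` to `c` turns into a remainder of order `r^{1/2}` for the
angular coefficient. -/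
theorem exists_remainder_bound : ∃ K : ℝ, 0 < K ∧ ∀ (r B : ℝ) (a c : ℂ), r ∈ Set.Ioo (0 : ℝ) 1 →
    ‖c‖ ≤ B → ‖a - c‖ ≤ B * r →
    ‖((Real.sqrt (rho M Q r))⁻¹ * (Real.sqrt r)⁻¹ : ℝ) * a
      - c / ((Real.sqrt |Q| * Real.sqrt r : ℝ) : ℂ)‖ ^ 2 ≤ K * B ^ 2 * r := by
  obtain ⟨K, hK0, hK⟩ := exists_rho_rpow_lipschitz M Q
  obtain ⟨d, hd0, hd⟩ := exists_rho_lower M Q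
  have hsd : 0 < Real.sqrt d := Real.sqrt_pos.mpr hd0
  refine ⟨((Real.sqrt d)⁻¹ + K) ^ 2, by positivity, ?_⟩
  intro r B a c hr hc ha
  have hr0 := hr.1
  have hsr : 0 < Real.sqrt r := Real.sqrt_pos.mpr hr0
  have hB : 0 ≤ B := (norm_nonneg c).trans hc
  have e : ((Real.sqrt (rho M Q r))⁻¹ * (Real.sqrt r)⁻¹ : ℝ) * a
      - c / ((Real.sqrt |Q| * Real.sqrt r : ℝ) : ℂ)
      = (((Real.sqrt r)⁻¹ : ℝ) : ℂ) * ((((Real.sqrt (rho M Q r))⁻¹ : ℝ) : ℂ) * (a - c)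
        + (((Real.sqrt (rho M Q r))⁻¹ - (Real.sqrt |Q|)⁻¹ : ℝ) : ℂ) * c) := by
    rw [div_eq_mul_inv, ← Complex.ofReal_inv, mul_inv]
    push_cast
    ring
  have h1 : ‖(((Real.sqrt (rho M Q r))⁻¹ : ℝ) : ℂ) * (a - c)
        + (((Real.sqrt (rho M Q r))⁻¹ - (Real.sqrt |Q|)⁻¹ : ℝ) : ℂ) * c‖
        ≤ ((Real.sqrt d)⁻¹ + K) * (B * r) := by
    refine (norm_add_le _ _).trans ?_
    rw [norm_mul, norm_mul, Complex.norm_real, Complex.norm_real, Real.norm_eq_abs,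
      Real.norm_eq_abs, abs_of_nonneg (inv_nonneg.mpr (Real.sqrt_nonneg _)), add_mul]
    refine add_le_add ?_ ?_
    · have : (Real.sqrt (rho M Q r))⁻¹ ≤ (Real.sqrt d)⁻¹ :=
        inv_anti₀ hsd (Real.sqrt_le_sqrt (hd r))
      gcongr
    · calc _ ≤ K * r * B := by
            gcongr
            exact hK r ⟨hr0.le, hr.2.le⟩
        _ = _ := by ring
  rw [e, norm_mul, Complex.norm_real, Real.norm_of_nonneg (inv_nonneg.mpr hsr.le), mul_pow]
  calc _ ≤ (Real.sqrt r)⁻¹ ^ 2 * (((Real.sqrt d)⁻¹ + K) * (B * r)) ^ 2 := by gcongr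
    _ = ((Real.sqrt d)⁻¹ + K) ^ 2 * B ^ 2 * r := by
      rw [inv_pow, Real.sq_sqrt hr0.le]
      field_simp

/-- Fields satisfying the radial equations in all channels have short-distance asymptotics. -/
theorem hasShortDistance_of_chanRel (m q : ℝ) (σ₀ : AngIndex) (ψ η : OneParticle M Q)
    (p n : AngIndex → ℂ)
    (H : ∀ σ : AngIndex, ChanRel M Q m q σ.kappa (chan M Q (σ, true) ψ) (chan M Q (σ, false) ψ)
      (chan M Q (σ, true) η) (chan M Q (σ, false) η) (p σ) (n σ))
    (hn : ∀ σ, σ ≠ σ₀ → n σ = 0) : HasShortDistance M Q σ₀ ψ (n σ₀) p := by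
  classical
  obtain ⟨C, hC0, hC⟩ := exists_amp_estimate M Q m q
  obtain ⟨K, hK0, hK⟩ := exists_remainder_bound M Q
  set T : AngIndex → ℝ := fun σ => ‖chan M Q (σ, true) ψ‖ ^ 2 + ‖chan M Q (σ, false) ψ‖ ^ 2
    + (‖chan M Q (σ, true) η‖ ^ 2 + ‖chan M Q (σ, false) η‖ ^ 2) with hT
  have hTsum : ∀ s : Finset AngIndex, ∑ σ ∈ s, T σ ≤ ‖ψ‖ ^ 2 + ‖η‖ ^ 2 := by
    intro s
    have h : ∀ φ : OneParticle M Q, ∑ σ ∈ s, (‖chan M Q (σ, true) φ‖ ^ 2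
        + ‖chan M Q (σ, false) φ‖ ^ 2) ≤ ‖φ‖ ^ 2 := by
      intro φ
      have h1 := sum_le_hasSum (s ×ˢ (Finset.univ : Finset Bool)) (fun i _ => by positivity)
        (hasSum_norm_chan M Q φ)
      rw [Finset.sum_product] at h1
      simpa only [Fintype.sum_bool] using h1
    rw [hT, Finset.sum_add_distrib]
    exact add_le_add (h ψ) (h η)
  -- `N = 3` because the amplitudes are bounded by `|κ|³`; the `32` is `2 · 16`, for the two signs
  -- and for `(2 (w₁ + w₂ + w₃ + w₄))² ≤ 16 (w₁² + w₂² + w₃² + w₄²)`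
  refine ⟨3, 32 * K * C ^ 2 * (‖ψ‖ ^ 2 + ‖η‖ ^ 2), 1, one_pos, ?_⟩
  have hle : volume.restrict (Set.Ioo (0 : ℝ) 1) ≤ halfLine :=
    Measure.restrict_mono Set.Ioo_subset_Ioi_self le_rfl
  have hp := ae_all_iff.mpr fun σ => angCoeff_ae_eq M Q (σ, true) ψ (H σ).upper
  have hm := ae_all_iff.mpr fun σ => angCoeff_ae_eq M Q (σ, false) ψ (H σ).lower
  filter_upwards [ae_mono hle hp, ae_mono hle hm, ae_restrict_mem measurableSet_Ioo]
    with r h1 h2 hr s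
  have hr01 : r ∈ Set.Icc (0 : ℝ) 1 := ⟨hr.1.le, hr.2.le⟩
  have hterm : ∀ σ ∈ s, (‖angCoeff (PhiPlus σ) ψ r
            - p σ / ((Real.sqrt |Q| * Real.sqrt r : ℝ) : ℂ)‖ ^ 2
          + ‖angCoeff (PhiMinus σ) ψ r
            - (if σ = σ₀ then n σ₀ else 0) / ((Real.sqrt |Q| * Real.sqrt r : ℝ) : ℂ)‖ ^ 2)
        / |(σ.kappa : ℝ)| ^ (2 * 3) ≤ 32 * K * C ^ 2 * r * T σ := by
    intro σ _
    have hκ : 1 ≤ |(σ.kappa : ℝ)| := by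
      exact_mod_cast Int.one_le_abs σ.kappa_ne
    have hκ0 : 0 < |(σ.kappa : ℝ)| := by linarith
    obtain ⟨b1, b2, b3⟩ := hC σ.kappa hκ _ _ _ _ (p σ) (n σ) (Lp.memLp (chan M Q (σ, true) ψ))
      (Lp.memLp (chan M Q (σ, false) ψ)) (Lp.memLp (chan M Q (σ, true) η))
      (Lp.memLp (chan M Q (σ, false) η)) (H σ).upper (H σ).lower
    obtain ⟨b4, b5⟩ := b3 r hr01
    have e1 : angCoeff (PhiPlus σ) ψ r = _ := h1 σ
    have e2 : angCoeff (PhiMinus σ) ψ r = _ := h2 σ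
    have e3 : (if σ = σ₀ then n σ₀ else 0) = n σ := by
      split_ifs with hσ
      · rw [hσ]
      · exact (hn σ hσ).symm
    rw [e1, e2, e3]
    have c1 := hK r _ _ _ hr b1 b4
    have c2 := hK r _ _ _ hr b2 b5
    have n1 := nearNorm_le (chan M Q (σ, true) ψ)
    have n2 := nearNorm_le (chan M Q (σ, false) ψ)
    have n3 := nearNorm_le (chan M Q (σ, true) η)
    have n4 := nearNorm_le (chan M Q (σ, false) η)
    set N := nearNorm (chan M Q (σ, true) ψ) + nearNorm (chan M Q (σ, false) ψ)
      + nearNorm (chan M Q (σ, true) η) + nearNorm (chan M Q (σ, false) η) with hN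
    have hN0 : 0 ≤ N := by
      have := nearNorm_nonneg (chan M Q (σ, true) ψ)
      have := nearNorm_nonneg (chan M Q (σ, false) ψ)
      have := nearNorm_nonneg (chan M Q (σ, true) η)
      have := nearNorm_nonneg (chan M Q (σ, false) η)
      positivity
    have hNT : N ^ 2 ≤ 16 * T σ := by
      have h3 : N ≤ 2 * (‖chan M Q (σ, true) ψ‖ + ‖chan M Q (σ, false) ψ‖
        + ‖chan M Q (σ, true) η‖ + ‖chan M Q (σ, false) η‖) := by linarith
      have h4 := pow_le_pow_left₀ hN0 h3 2
      refine h4.trans ?_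
      simp only [hT]
      generalize ‖chan M Q (σ, true) ψ‖ = w1
      generalize ‖chan M Q (σ, false) ψ‖ = w2
      generalize ‖chan M Q (σ, true) η‖ = w3
      generalize ‖chan M Q (σ, false) η‖ = w4
      nlinarith [sq_nonneg (w1 - w2), sq_nonneg (w1 - w3), sq_nonneg (w1 - w4),
        sq_nonneg (w2 - w3), sq_nonneg (w2 - w4), sq_nonneg (w3 - w4)]
    rw [div_le_iff₀ (by positivity)]
    calc _ ≤ K * (C * |(σ.kappa : ℝ)| ^ 3 * N) ^ 2 * r
          + K * (C * |(σ.kappa : ℝ)| ^ 3 * N) ^ 2 * r := add_le_add c1 c2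
      _ = 2 * K * C ^ 2 * r * |(σ.kappa : ℝ)| ^ (2 * 3) * N ^ 2 := by ring
      _ ≤ 2 * K * C ^ 2 * r * |(σ.kappa : ℝ)| ^ (2 * 3) * (16 * T σ) := by
          have := hr.1
          gcongr
      _ = _ := by ring
  calc _ ≤ ∑ σ ∈ s, 32 * K * C ^ 2 * r * T σ := Finset.sum_le_sum hterm
    _ = 32 * K * C ^ 2 * r * ∑ σ ∈ s, T σ := by rw [Finset.mul_sum]
    _ ≤ 32 * K * C ^ 2 * r * (‖ψ‖ ^ 2 + ‖η‖ ^ 2) := by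
        have := hr.1
        gcongr
        exact hTsum s
    _ = _ := by ring

end radial

theorem nonpos_of_ae_le_mul {a C r₀ : ℝ} (hr₀ : 0 < r₀)
    (h : ∀ᵐ r ∂volume.restrict (Set.Ioo (0 : ℝ) r₀), a ≤ C * r) : a ≤ 0 := by
  by_contra! ha
  have hε : 0 < min r₀ (a / (|C| + 1)) := by positivity
  have hle : volume.restrict (Set.Ioo (0 : ℝ) (min r₀ (a / (|C| + 1))))
      ≤ volume.restrict (Set.Ioo (0 : ℝ) r₀) :=
    Measure.restrict_mono (Set.Ioo_subset_Ioo_right (min_le_left _ _)) le_rfl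
  have hne : (ae (volume.restrict (Set.Ioo (0 : ℝ) (min r₀ (a / (|C| + 1)))))).NeBot := by
    rw [ae_neBot, Ne, Measure.restrict_eq_zero, Real.volume_Ioo]
    simpa using hε
  have h' : ∀ᵐ r ∂volume.restrict (Set.Ioo (0 : ℝ) (min r₀ (a / (|C| + 1)))), a ≤ C * r :=
    ae_mono hle h
  obtain ⟨r, h1, h2⟩ := (h'.and (ae_restrict_mem measurableSet_Ioo)).exists
  have h3 : r < a / (|C| + 1) := h2.2.trans_le (min_le_right _ _)
  rw [lt_div_iff₀ (by positivity)] at h3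
  nlinarith [h2.1, le_abs_self C]

/-- A coefficient of `r^{-1/2}` is determined by the function up to a remainder of order `r^{1/2}`.
-/
theorem eq_of_remainders {M Q r₀ C C' : ℝ} [Fact (M ^ 2 < Q ^ 2)] (hr₀ : 0 < r₀) {F : ℝ → ℂ}
    {c c' : ℂ}
    (h : ∀ᵐ r ∂volume.restrict (Set.Ioo (0 : ℝ) r₀),
      ‖F r - c / ((Real.sqrt |Q| * Real.sqrt r : ℝ) : ℂ)‖ ^ 2 ≤ C * r)
    (h' : ∀ᵐ r ∂volume.restrict (Set.Ioo (0 : ℝ) r₀),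
      ‖F r - c' / ((Real.sqrt |Q| * Real.sqrt r : ℝ) : ℂ)‖ ^ 2 ≤ C' * r) : c = c' := by
  have hQ := abs_Q_pos M Q
  have hk : ∀ᵐ r ∂volume.restrict (Set.Ioo (0 : ℝ) r₀),
      ‖c - c'‖ ^ 2 ≤ |Q| * (2 * (|C| + |C'|)) * r₀ * r := by
    filter_upwards [h, h', ae_restrict_mem measurableSet_Ioo] with r h1 h2 hr
    have hr0 := hr.1
    have hs : 0 < Real.sqrt |Q| * Real.sqrt r :=
      mul_pos (Real.sqrt_pos.mpr hQ) (Real.sqrt_pos.mpr hr0)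
    have e : c - c' = ((Real.sqrt |Q| * Real.sqrt r : ℝ) : ℂ)
        * ((F r - c' / ((Real.sqrt |Q| * Real.sqrt r : ℝ) : ℂ))
          - (F r - c / ((Real.sqrt |Q| * Real.sqrt r : ℝ) : ℂ))) := by
      have := Complex.ofReal_ne_zero.mpr hs.ne'
      field_simp
      ring
    have h3 := norm_sub_le (F r - c' / ((Real.sqrt |Q| * Real.sqrt r : ℝ) : ℂ))
      (F r - c / ((Real.sqrt |Q| * Real.sqrt r : ℝ) : ℂ))
    have h4 : ‖(F r - c' / ((Real.sqrt |Q| * Real.sqrt r : ℝ) : ℂ))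
        - (F r - c / ((Real.sqrt |Q| * Real.sqrt r : ℝ) : ℂ))‖ ^ 2 ≤ 2 * (|C| + |C'|) * r := by
      refine (pow_le_pow_left₀ (norm_nonneg _) h3 2).trans ?_
      have k1 : C * r ≤ |C| * r := mul_le_mul_of_nonneg_right (le_abs_self C) hr0.le
      have k2 : C' * r ≤ |C'| * r := mul_le_mul_of_nonneg_right (le_abs_self C') hr0.le
      generalize ‖F r - c' / ((Real.sqrt |Q| * Real.sqrt r : ℝ) : ℂ)‖ = w1 at *
      generalize ‖F r - c / ((Real.sqrt |Q| * Real.sqrt r : ℝ) : ℂ)‖ = w2 at *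
      nlinarith [sq_nonneg (w1 - w2)]
    rw [e, norm_mul, Complex.norm_real, Real.norm_of_nonneg hs.le, mul_pow, mul_pow,
      Real.sq_sqrt hQ.le, Real.sq_sqrt hr0.le]
    calc _ ≤ |Q| * r * (2 * (|C| + |C'|) * r) := by gcongr
      _ ≤ |Q| * r₀ * (2 * (|C| + |C'|) * r) := by
          have := hr.2.le
          gcongr
      _ = _ := by ring
  have h5 := nonpos_of_ae_le_mul hr₀ hk
  have h6 : ‖c - c'‖ = 0 := by
    have := norm_nonneg (c - c')
    nlinarith
  exact sub_eq_zero.mp (norm_eq_zero.mp h6)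

/-- The short-distance coefficients are uniquely determined. -/
theorem HasShortDistance.unique {M Q : ℝ} [Fact (M ^ 2 < Q ^ 2)] {σ₀ : AngIndex}
    {ψ : OneParticle M Q} {c c' : ℂ} {p p' : AngIndex → ℂ}
    (h : HasShortDistance M Q σ₀ ψ c p) (h' : HasShortDistance M Q σ₀ ψ c' p') :
    c' = c ∧ p' = p := by
  classical
  obtain ⟨N, C, r₀, hr₀, H⟩ := h
  obtain ⟨N', C', r₀', hr₀', H'⟩ := h'
  have key : ∀ {N : ℕ} {C r₀ : ℝ} {c : ℂ} {p : AngIndex → ℂ},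
      (∀ᵐ r ∂(volume.restrict (Set.Ioo (0 : ℝ) r₀)), ∀ s : Finset AngIndex, ∑ σ ∈ s,
        (‖angCoeff (PhiPlus σ) ψ r - p σ / ((Real.sqrt |Q| * Real.sqrt r : ℝ) : ℂ)‖ ^ 2
          + ‖angCoeff (PhiMinus σ) ψ r
            - (if σ = σ₀ then c else 0) / ((Real.sqrt |Q| * Real.sqrt r : ℝ) : ℂ)‖ ^ 2)
        / |(σ.kappa : ℝ)| ^ (2 * N) ≤ C * r) →
      ∀ R ≤ r₀, ∀ σ : AngIndex, (∀ᵐ r ∂(volume.restrict (Set.Ioo (0 : ℝ) R)),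
        ‖angCoeff (PhiPlus σ) ψ r - p σ / ((Real.sqrt |Q| * Real.sqrt r : ℝ) : ℂ)‖ ^ 2
          ≤ C * |(σ.kappa : ℝ)| ^ (2 * N) * r) ∧
        (∀ᵐ r ∂(volume.restrict (Set.Ioo (0 : ℝ) R)),
        ‖angCoeff (PhiMinus σ) ψ r
            - (if σ = σ₀ then c else 0) / ((Real.sqrt |Q| * Real.sqrt r : ℝ) : ℂ)‖ ^ 2
          ≤ C * |(σ.kappa : ℝ)| ^ (2 * N) * r) := by
    intro N C r₀ c p H R hR σ
    have hle : volume.restrict (Set.Ioo (0 : ℝ) R) ≤ volume.restrict (Set.Ioo (0 : ℝ) r₀) :=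
      Measure.restrict_mono (Set.Ioo_subset_Ioo_right hR) le_rfl
    have hκ0 : 0 < |(σ.kappa : ℝ)| := abs_pos.mpr (Int.cast_ne_zero.mpr σ.kappa_ne)
    have h1 : ∀ᵐ r ∂(volume.restrict (Set.Ioo (0 : ℝ) R)),
        ‖angCoeff (PhiPlus σ) ψ r - p σ / ((Real.sqrt |Q| * Real.sqrt r : ℝ) : ℂ)‖ ^ 2
          + ‖angCoeff (PhiMinus σ) ψ r
            - (if σ = σ₀ then c else 0) / ((Real.sqrt |Q| * Real.sqrt r : ℝ) : ℂ)‖ ^ 2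
          ≤ C * |(σ.kappa : ℝ)| ^ (2 * N) * r := by
      filter_upwards [ae_mono hle H] with r hr
      have := hr {σ}
      rw [Finset.sum_singleton, div_le_iff₀ (by positivity)] at this
      linarith
    constructor
    · filter_upwards [h1] with r hr
      exact (le_add_of_nonneg_right (by positivity)).trans hr
    · filter_upwards [h1] with r hr
      exact (le_add_of_nonneg_left (by positivity)).trans hr
  have hR : 0 < min r₀ r₀' := lt_min hr₀ hr₀'
  constructor
  · have h1 := (key H _ (min_le_left r₀ r₀') σ₀).2
    have h2 := (key H' _ (min_le_right r₀ r₀') σ₀).2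
    simp only [if_true] at h1 h2
    exact eq_of_remainders (M := M) hR h2 h1
  · funext σ
    exact eq_of_remainders (M := M) hR (key H' _ (min_le_right r₀ r₀') σ).1
      (key H _ (min_le_left r₀ r₀') σ).1

/-! ### The Dirac operator in Cartesian spin components -/

/-- The radial unit vector of the spherical frame. -/
def frameR (ω : ℝ × ℝ) : EuclideanSpace ℝ (Fin 3) :=
  !₂[Real.sin ω.1 * Real.cos ω.2, Real.sin ω.1 * Real.sin ω.2, Real.cos ω.1]

/-- The polar unit vector of the spherical frame. -/
def frameTheta (ω : ℝ × ℝ) : EuclideanSpace ℝ (Fin 3) :=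
  !₂[Real.cos ω.1 * Real.cos ω.2, Real.cos ω.1 * Real.sin ω.2, -Real.sin ω.1]

/-- The azimuthal unit vector of the spherical frame. -/
def framePhi (ω : ℝ × ℝ) : EuclideanSpace ℝ (Fin 3) :=
  !₂[-Real.sin ω.2, Real.cos ω.2, 0]

theorem hasDerivAt_prod_fst {v : ℝ → ℂ × ℂ} {v' : ℂ × ℂ} {s : ℝ} (hv : HasDerivAt v v' s) :
    HasDerivAt (fun s => (v s).1) v'.1 s :=
  (ContinuousLinearMap.fst ℝ ℂ ℂ).hasFDerivAt.comp_hasDerivAt s hv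

theorem hasDerivAt_prod_snd {v : ℝ → ℂ × ℂ} {v' : ℂ × ℂ} {s : ℝ} (hv : HasDerivAt v v' s) :
    HasDerivAt (fun s => (v s).2) v'.2 s :=
  (ContinuousLinearMap.snd ℝ ℂ ℂ).hasFDerivAt.comp_hasDerivAt s hv

theorem hasDerivAt_vec3 {a b c : ℝ → ℝ} {a' b' c' s : ℝ} (ha : HasDerivAt a a' s)
    (hb : HasDerivAt b b' s) (hc : HasDerivAt c c' s) :
    HasDerivAt (fun s => (!₂[a s, b s, c s] : EuclideanSpace ℝ (Fin 3))) !₂[a', b', c'] s := by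
  have h : HasDerivAt (fun s => ![a s, b s, c s]) ![a', b', c'] s := by
    rw [hasDerivAt_pi]
    intro i
    fin_cases i
    · exact ha
    · exact hb
    · exact hc
  exact (PiLp.continuousLinearEquiv 2 ℝ fun _ : Fin 3 => ℝ).symm.toContinuousLinearMap.hasFDerivAt
    |>.comp_hasDerivAt s h

theorem hasDerivAt_vec4 {a b c d : ℝ → ℂ} {a' b' c' d' : ℂ} {s : ℝ} (ha : HasDerivAt a a' s)
    (hb : HasDerivAt b b' s) (hc : HasDerivAt c c' s) (hd : HasDerivAt d d' s) :
    HasDerivAt (fun s => (!₂[a s, b s, c s, d s] : Spinor)) !₂[a', b', c', d'] s := by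
  have h : HasDerivAt (fun s => ![a s, b s, c s, d s]) ![a', b', c', d'] s := by
    rw [hasDerivAt_pi]
    intro i
    fin_cases i
    · exact ha
    · exact hb
    · exact hc
    · exact hd
  exact (PiLp.continuousLinearEquiv 2 ℝ fun _ : Fin 4 => ℂ).symm.toContinuousLinearMap.hasFDerivAt
    |>.comp_hasDerivAt s h

theorem hasDerivAt_cartesian_r (r : ℝ) (ω : ℝ × ℝ) :
    HasDerivAt (fun s => cartesian (s, ω)) (frameR ω) r := by
  refine hasDerivAt_vec3 ?_ ?_ ?_
  · simpa using ((hasDerivAt_id r).mul_const (Real.sin ω.1)).mul_const (Real.cos ω.2)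
  · simpa using ((hasDerivAt_id r).mul_const (Real.sin ω.1)).mul_const (Real.sin ω.2)
  · simpa using (hasDerivAt_id r).mul_const (Real.cos ω.1)

theorem hasDerivAt_cartesian_theta (r : ℝ) (ω : ℝ × ℝ) :
    HasDerivAt (fun s => cartesian (r, (s, ω.2))) (r • frameTheta ω) ω.1 := by
  have e : r • frameTheta ω = !₂[r * Real.cos ω.1 * Real.cos ω.2, r * Real.cos ω.1 * Real.sin ω.2,
      r * -Real.sin ω.1] := by
    ext i
    fin_cases i <;> simp [frameTheta] <;> ring
  rw [e]
  refine hasDerivAt_vec3 ?_ ?_ ?_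
  · exact ((Real.hasDerivAt_sin ω.1).const_mul r).mul_const (Real.cos ω.2)
  · exact ((Real.hasDerivAt_sin ω.1).const_mul r).mul_const (Real.sin ω.2)
  · exact (Real.hasDerivAt_cos ω.1).const_mul r

theorem hasDerivAt_cartesian_phi (r : ℝ) (ω : ℝ × ℝ) :
    HasDerivAt (fun s => cartesian (r, (ω.1, s))) ((r * Real.sin ω.1) • framePhi ω) ω.2 := by
  have e : (r * Real.sin ω.1) • framePhi ω = !₂[r * Real.sin ω.1 * -Real.sin ω.2,
      r * Real.sin ω.1 * Real.cos ω.2, 0] := by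
    ext i
    fin_cases i <;> simp [framePhi]
  rw [e]
  refine hasDerivAt_vec3 ?_ ?_ ?_
  · exact (Real.hasDerivAt_cos ω.2).const_mul (r * Real.sin ω.1)
  · exact (Real.hasDerivAt_sin ω.2).const_mul (r * Real.sin ω.1)
  · exact hasDerivAt_const ω.2 (r * Real.cos ω.1)

section pullback

variable {E : Type*} [NormedAddCommGroup E] [NormedSpace ℝ E] {u : EuclideanSpace ℝ (Fin 3) → E}

theorem hasDerivAt_pullback_r (hu : ContDiff ℝ 1 u) (r : ℝ) (ω : ℝ × ℝ) :
    HasDerivAt (fun s => u (cartesian (s, ω))) (fderiv ℝ u (cartesian (r, ω)) (frameR ω)) r :=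
  (hu.differentiable one_ne_zero _).hasFDerivAt.comp_hasDerivAt r (hasDerivAt_cartesian_r r ω)

theorem hasDerivAt_pullback_theta (hu : ContDiff ℝ 1 u) (r : ℝ) (ω : ℝ × ℝ) :
    HasDerivAt (fun s => u (cartesian (r, (s, ω.2))))
      (r • fderiv ℝ u (cartesian (r, ω)) (frameTheta ω)) ω.1 := by
  rw [← map_smul]
  exact (hu.differentiable one_ne_zero _).hasFDerivAt.comp_hasDerivAt ω.1
    (hasDerivAt_cartesian_theta r ω)

theorem hasDerivAt_pullback_phi (hu : ContDiff ℝ 1 u) (r : ℝ) (ω : ℝ × ℝ) :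
    HasDerivAt (fun s => u (cartesian (r, (ω.1, s))))
      ((r * Real.sin ω.1) • fderiv ℝ u (cartesian (r, ω)) (framePhi ω)) ω.2 := by
  rw [← map_smul]
  exact (hu.differentiable one_ne_zero _).hasFDerivAt.comp_hasDerivAt ω.2
    (hasDerivAt_cartesian_phi r ω)

end pullback

/-- One two-component block of `toSpherical`. -/
def spinBlock (ω : ℝ × ℝ) (v : ℂ × ℂ) : ℂ × ℂ :=
  let s : ℂ := ((Real.sqrt 2)⁻¹ : ℝ)
  (s * (I * exp (I * (ω.1 + ω.2) / 2)) * v.1 + s * exp (I * (ω.1 - ω.2) / 2) * v.2,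
   s * (I * exp (I * (-ω.1 + ω.2) / 2)) * v.1 + -(s * exp (I * (-ω.1 - ω.2) / 2)) * v.2)

/-- The spinor with upper components `u` and lower components `l`. -/
def ofParts (u l : ℂ × ℂ) : Spinor := !₂[u.1, u.2, l.1, l.2]

/-- The upper two components of a spinor. -/
def upperPart (v : Spinor) : ℂ × ℂ := (v 0, v 1)

/-- The lower two components of a spinor. -/
def lowerPart (v : Spinor) : ℂ × ℂ := (v 2, v 3)

theorem toSpherical_ofParts (ω : ℝ × ℝ) (u l : ℂ × ℂ) :
    toSpherical ω (ofParts u l) = ofParts (spinBlock ω u) (spinBlock ω l) := rfl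

theorem act_alpha1 (u l : ℂ × ℂ) : act alpha1 (ofParts u l) = ofParts (l.2, l.1) (u.2, u.1) := by
  ext i
  fin_cases i <;>
    simp [act, alpha1, ofParts, Matrix.toLpLin_apply]

theorem act_alpha2 (u l : ℂ × ℂ) : act alpha2 (ofParts u l)
    = ofParts (-I * l.2, I * l.1) (-I * u.2, I * u.1) := by
  ext i
  fin_cases i <;>
    simp [act, alpha2, ofParts, Matrix.toLpLin_apply, mul_comm]

theorem act_alpha3 (u l : ℂ × ℂ) : act alpha3 (ofParts u l) = ofParts (l.1, -l.2) (u.1, -u.2) := by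
  ext i
  fin_cases i <;>
    simp [act, alpha3, ofParts, Matrix.toLpLin_apply]

theorem act_beta (u l : ℂ × ℂ) : act beta (ofParts u l) = ofParts u (-l) := by
  ext i
  fin_cases i <;>
    simp [act, beta, ofParts, Matrix.toLpLin_apply]

theorem ofParts_add (u l u' l' : ℂ × ℂ) :
    ofParts u l + ofParts u' l' = ofParts (u + u') (l + l') := by
  ext i
  fin_cases i <;> simp [ofParts]

theorem smul_ofParts (c : ℂ) (u l : ℂ × ℂ) : c • ofParts u l = ofParts (c • u) (c • l) := by
  ext i
  fin_cases i <;> simp [ofParts]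

theorem real_smul_ofParts (c : ℝ) (u l : ℂ × ℂ) :
    c • ofParts u l = ofParts ((c : ℂ) • u) ((c : ℂ) • l) := by
  rw [← smul_ofParts]
  rfl

theorem hasDerivAt_ofParts {u l : ℝ → ℂ × ℂ} {u' l' : ℂ × ℂ} {s : ℝ} (hu : HasDerivAt u u' s)
    (hl : HasDerivAt l l' s) : HasDerivAt (fun s => ofParts (u s) (l s)) (ofParts u' l') s :=
  hasDerivAt_vec4 (hasDerivAt_prod_fst hu) (hasDerivAt_prod_snd hu)
    (hasDerivAt_prod_fst hl) (hasDerivAt_prod_snd hl)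

theorem hasDerivAt_spinBlock_r {v : ℝ → ℂ × ℂ} {v' : ℂ × ℂ} {s : ℝ} (ω : ℝ × ℝ)
    (hv : HasDerivAt v v' s) :
    HasDerivAt (fun s => spinBlock ω (v s)) (spinBlock ω v') s := by
  have h1 : HasDerivAt (fun s => (v s).1) v'.1 s := hasDerivAt_prod_fst hv
  have h2 : HasDerivAt (fun s => (v s).2) v'.2 s := hasDerivAt_prod_snd hv
  exact ((h1.const_mul _).add (h2.const_mul _)).prodMk ((h1.const_mul _).add (h2.const_mul _))

theorem hasDerivAt_exp_I_mul {f : ℝ → ℂ} {f' : ℂ} {s : ℝ} (hf : HasDerivAt f f' s) :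
    HasDerivAt (fun s => exp (I * f s / 2)) (I / 2 * f' * exp (I * f s / 2)) s := by
  have := ((hf.const_mul I).div_const 2).cexp
  convert this using 1
  ring

theorem hasDerivAt_ofReal (s : ℝ) : HasDerivAt (fun s : ℝ => (s : ℂ)) 1 s :=
  Complex.ofRealCLM.hasDerivAt

theorem hasDerivAt_spinBlock_theta {v : ℝ → ℂ × ℂ} {v' : ℂ × ℂ} (ω : ℝ × ℝ)
    (hv : HasDerivAt v v' ω.1) :
    HasDerivAt (fun s => spinBlock (s, ω.2) (v s))
      (I / 2 * (spinBlock ω (v ω.1)).1 + (spinBlock ω v').1,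
        -(I / 2) * (spinBlock ω (v ω.1)).2 + (spinBlock ω v').2) ω.1 := by
  have h1 : HasDerivAt (fun s => (v s).1) v'.1 ω.1 := hasDerivAt_prod_fst hv
  have h2 : HasDerivAt (fun s => (v s).2) v'.2 ω.1 := hasDerivAt_prod_snd hv
  have e := hasDerivAt_ofReal ω.1
  have k1 := (((hasDerivAt_exp_I_mul (e.add_const (ω.2 : ℂ))).const_mul I).const_mul
    (((Real.sqrt 2)⁻¹ : ℝ) : ℂ)).fun_mul h1
  have k2 := ((hasDerivAt_exp_I_mul (e.sub_const (ω.2 : ℂ))).const_mul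
    (((Real.sqrt 2)⁻¹ : ℝ) : ℂ)).fun_mul h2
  have k3 := (((hasDerivAt_exp_I_mul (e.fun_neg.add_const (ω.2 : ℂ))).const_mul I).const_mul
    (((Real.sqrt 2)⁻¹ : ℝ) : ℂ)).fun_mul h1
  have k4 := ((hasDerivAt_exp_I_mul (e.fun_neg.sub_const (ω.2 : ℂ))).const_mul
    (((Real.sqrt 2)⁻¹ : ℝ) : ℂ)).fun_neg.fun_mul h2
  refine ((k1.fun_add k2).prodMk (k3.fun_add k4)).congr_deriv ?_
  ext <;> simp only [spinBlock] <;> ring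

theorem hasDerivAt_spinBlock_phi {v : ℝ → ℂ × ℂ} {v' : ℂ × ℂ} (ω : ℝ × ℝ)
    (hv : HasDerivAt v v' ω.2) :
    HasDerivAt (fun s => spinBlock (ω.1, s) (v s))
      (spinBlock ω (I / 2 * (v ω.2).1 + v'.1, -(I / 2) * (v ω.2).2 + v'.2)) ω.2 := by
  have h1 : HasDerivAt (fun s => (v s).1) v'.1 ω.2 := hasDerivAt_prod_fst hv
  have h2 : HasDerivAt (fun s => (v s).2) v'.2 ω.2 := hasDerivAt_prod_snd hv
  have e := hasDerivAt_ofReal ω.2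
  have k1 := (((hasDerivAt_exp_I_mul (e.const_add (ω.1 : ℂ))).const_mul I).const_mul
    (((Real.sqrt 2)⁻¹ : ℝ) : ℂ)).fun_mul h1
  have k2 := ((hasDerivAt_exp_I_mul (e.const_sub (ω.1 : ℂ))).const_mul
    (((Real.sqrt 2)⁻¹ : ℝ) : ℂ)).fun_mul h2
  have k3 := (((hasDerivAt_exp_I_mul (e.const_add (-ω.1 : ℂ))).const_mul I).const_mul
    (((Real.sqrt 2)⁻¹ : ℝ) : ℂ)).fun_mul h1
  have k4 := ((hasDerivAt_exp_I_mul (e.const_sub (-ω.1 : ℂ))).const_mul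
    (((Real.sqrt 2)⁻¹ : ℝ) : ℂ)).fun_neg.fun_mul h2
  refine ((k1.fun_add k2).prodMk (k3.fun_add k4)).congr_deriv ?_
  ext <;> simp only [spinBlock] <;> ring

theorem spinBlock_add (ω : ℝ × ℝ) (v w : ℂ × ℂ) :
    spinBlock ω (v + w) = spinBlock ω v + spinBlock ω w := by
  ext <;> simp only [spinBlock, Prod.fst_add, Prod.snd_add] <;> ring

theorem spinBlock_smul (ω : ℝ × ℝ) (c : ℂ) (v : ℂ × ℂ) :
    spinBlock ω (c • v) = c • spinBlock ω v := by
  ext <;> simp only [spinBlock, Prod.smul_fst, Prod.smul_snd, smul_eq_mul] <;> ring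

/-- All exponentials in the change of spin basis, expressed through `d = e^{-i(ϑ+φ)/2}` and `P =
e^{iφ}`, so that identities between them become polynomial. -/
theorem exists_halfAngles (ω : ℝ × ℝ) : ∃ d P P' : ℂ, P' * P = 1 ∧
    exp (I * ω.2) = P ∧ exp (-(I * ω.2)) = P' ∧
    exp (I * (ω.1 + ω.2) / 2) = P * d * (Real.cos ω.1 + Real.sin ω.1 * I) ∧
    exp (I * (ω.1 - ω.2) / 2) = d * (Real.cos ω.1 + Real.sin ω.1 * I) ∧
    exp (I * (-ω.1 + ω.2) / 2) = P * d ∧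
    exp (I * (-ω.1 - ω.2) / 2) = d := by
  refine ⟨exp (I * (-ω.1 - ω.2) / 2), exp (I * ω.2), exp (-(I * ω.2)), ?_, rfl, rfl, ?_, ?_, ?_,
    rfl⟩
  · rw [← Complex.exp_add]; simp
  · rw [Complex.ofReal_cos, Complex.ofReal_sin, ← Complex.exp_mul_I, ← Complex.exp_add,
      ← Complex.exp_add]
    ring_nf
  · rw [Complex.ofReal_cos, Complex.ofReal_sin, ← Complex.exp_mul_I, ← Complex.exp_add]
    ring_nf
  · rw [← Complex.exp_add]
    ring_nf

/-- The spherical spin basis diagonalizes `x̂ · σ` to `σ₁`. -/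
theorem spinBlock_sigmaR (ω : ℝ × ℝ) (v : ℂ × ℂ) :
    spinBlock ω (sigmaR ω v) = ((spinBlock ω v).2, (spinBlock ω v).1) := by
  obtain ⟨d, P, P', hP, e1, e2, e3, e4, e5, e6⟩ := exists_halfAngles ω
  have hcs : (Real.sin ω.1 : ℂ) ^ 2 + (Real.cos ω.1 : ℂ) ^ 2 = 1 := by
    exact_mod_cast Real.sin_sq_add_cos_sq ω.1
  have hI := Complex.I_sq
  ext
  · simp only [spinBlock, sigmaR, e1, e2, e3, e4, e5, e6]
    generalize (((Real.sqrt 2)⁻¹ : ℝ) : ℂ) = s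
    generalize (Real.sin ω.1 : ℂ) = S at *
    generalize (Real.cos ω.1 : ℂ) = C at *
    linear_combination s * P * d * v.1 * (I * hcs + C * S * hI)
      + s * d * v.2 * (I * (C + S * I) * S * hP + S ^ 2 * hI - hcs)
  · simp only [spinBlock, sigmaR, e1, e2, e3, e4, e5, e6]
    generalize (((Real.sqrt 2)⁻¹ : ℝ) : ℂ) = s
    generalize (Real.sin ω.1 : ℂ) = S at *
    generalize (Real.cos ω.1 : ℂ) = C at *
    linear_combination -(s * P * d * v.1 * S * hI) + s * d * v.2 * I * S * hP

/-- The operator `1 + σ · L` on the restriction of a two-component field to spheres. -/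
def angTerm (u : EuclideanSpace ℝ (Fin 3) → ℂ × ℂ) (p : ℝ × (ℝ × ℝ)) : ℂ × ℂ :=
  let v := u (cartesian p)
  let t := fderiv ℝ u (cartesian p) (frameTheta p.2)
  let f := fderiv ℝ u (cartesian p) (framePhi p.2)
  (v.1 - I * (p.1 * Real.sin p.2.1) * f.1
      + exp (-(I * p.2.2)) * p.1 * (-t.2 + I * Real.cos p.2.1 * f.2),
   v.2 + I * (p.1 * Real.sin p.2.1) * f.2
      + exp (I * p.2.2) * p.1 * (t.1 + I * Real.cos p.2.1 * f.1))

theorem angK_pullback {u : EuclideanSpace ℝ (Fin 3) → ℂ × ℂ} (hu : ContDiff ℝ 1 u) (r : ℝ)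
    {ω : ℝ × ℝ} (hω : Real.sin ω.1 ≠ 0) :
    angK (fun ω => u (cartesian (r, ω))) ω = angTerm u (r, ω) := by
  have ht := hasDerivAt_pullback_theta hu r ω
  have hf := hasDerivAt_pullback_phi hu r ω
  have t1 := (hasDerivAt_prod_fst ht).deriv
  have t2 := (hasDerivAt_prod_snd ht).deriv
  have f1 := (hasDerivAt_prod_fst hf).deriv
  have f2 := (hasDerivAt_prod_snd hf).deriv
  have hs := Complex.ofReal_ne_zero.mpr hω
  simp only [Prod.smul_fst, Prod.smul_snd, Complex.real_smul] at t1 t2 f1 f2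
  ext
  · simp only [angK, angTerm, lowering, dPhi, dTheta, t2, f1, f2]
    push_cast
    push_cast at hs
    field_simp
  · simp only [angK, angTerm, raising, dPhi, dTheta, t1, f1, f2]
    push_cast
    push_cast at hs
    field_simp

/-- The angular part of the Dirac operator in the spherical spin basis is `i (x̂·σ)(1 + σ·L)` in the
Cartesian one. Here `t` and `f` are the derivatives of the field `v` along the frame. -/
theorem spinBlock_angular {r : ℝ} {ω : ℝ × ℝ} (hω : Real.sin ω.1 ≠ 0) (v t f : ℂ × ℂ) :
    let X : ℂ × ℂ := (v.1 - I * (r * Real.sin ω.1) * f.1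
        + exp (-(I * ω.2)) * r * (-t.2 + I * Real.cos ω.1 * f.2),
      v.2 + I * (r * Real.sin ω.1) * f.2 + exp (I * ω.2) * r * (t.1 + I * Real.cos ω.1 * f.1))
    let ψ := spinBlock ω v
    let ψf := spinBlock ω (I / 2 * v.1 + r * Real.sin ω.1 * f.1,
      -(I / 2) * v.2 + r * Real.sin ω.1 * f.2)
    (I / 2 * ψ.1 + r * (spinBlock ω t).1 + (Real.cot ω.1 / 2 : ℝ) * ψ.1
        + I / Real.sin ω.1 * ψf.2 = I * (spinBlock ω X).1) ∧
      (-(I / 2 * ψ.2) + r * (spinBlock ω t).2 + (Real.cot ω.1 / 2 : ℝ) * ψ.2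
        + I / Real.sin ω.1 * ψf.1 = -I * (spinBlock ω X).2) := by
  obtain ⟨d, P, P', hP, e1, e2, e3, e4, e5, e6⟩ := exists_halfAngles ω
  have hcs : (Real.sin ω.1 : ℂ) ^ 2 + (Real.cos ω.1 : ℂ) ^ 2 = 1 := by
    exact_mod_cast Real.sin_sq_add_cos_sq ω.1
  have hI := Complex.I_sq
  have hs := Complex.ofReal_ne_zero.mpr hω
  intro X ψ ψf
  simp only [X, ψ, ψf, spinBlock, e1, e2, e3, e4, e5, e6, Real.cot_eq_cos_div_sin]
  push_cast at hcs hs ⊢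
  generalize (((Real.sqrt 2 : ℝ) : ℂ)⁻¹ : ℂ) = s
  generalize (Complex.sin ω.1 : ℂ) = S at *
  generalize (Complex.cos ω.1 : ℂ) = C at *
  have hT : S⁻¹ * S = 1 := inv_mul_cancel₀ hs
  rw [div_eq_mul_inv C S, div_eq_mul_inv I S]
  generalize S⁻¹ = T at *
  clear e1 e2 e3 e4 e5 e6 X ψ ψf
  generalize I = J at *
  constructor
  · grind
  · grind

/-- The coefficient `1/r + A'/(2A)` of the radial derivative. -/
def radCoeff (M Q r : ℝ) : ℝ := r⁻¹ + deriv (A M Q) r / (2 * A M Q r)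

/-- Two components of `-i (x̂·σ) [A² (∂_r + 1/r + A'/(2A)) - (A/r)(1 + σ·L)] l`, without the factor
`x̂·σ`. -/
def innerTerm (M Q : ℝ) (l : EuclideanSpace ℝ (Fin 3) → ℂ × ℂ) (p : ℝ × (ℝ × ℝ)) : ℂ × ℂ :=
  (-I * (A M Q p.1 : ℂ) ^ 2) • (fderiv ℝ l (cartesian p) (frameR p.2)
    + (radCoeff M Q p.1 : ℂ) • l (cartesian p)) + (I * (A M Q p.1 / p.1 : ℝ)) • angTerm l p

/-- Two components of the Dirac Hamiltonian in the Cartesian spin basis; `w` is the value of the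
potential, `u` the field they belong to and `l` the field of the other two components. -/
def halfDirac (M Q w : ℝ) (u l : EuclideanSpace ℝ (Fin 3) → ℂ × ℂ) (p : ℝ × (ℝ × ℝ)) : ℂ × ℂ :=
  sigmaR p.2 (innerTerm M Q l p) + (w : ℂ) • u (cartesian p)

theorem contDiff_component {χ : EuclideanSpace ℝ (Fin 3) → Spinor} (h : ContDiff ℝ 1 χ)
    (i : Fin 4) : ContDiff ℝ 1 fun x => χ x i :=
  ((EuclideanSpace.proj i : Spinor →L[ℂ] ℂ).restrictScalars ℝ).contDiff.comp h

theorem contDiff_upperPart {χ : EuclideanSpace ℝ (Fin 3) → Spinor} (h : ContDiff ℝ 1 χ) :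
    ContDiff ℝ 1 fun x => upperPart (χ x) :=
  (contDiff_component h 0).prodMk (contDiff_component h 1)

theorem contDiff_lowerPart {χ : EuclideanSpace ℝ (Fin 3) → Spinor} (h : ContDiff ℝ 1 χ) :
    ContDiff ℝ 1 fun x => lowerPart (χ x) :=
  (contDiff_component h 2).prodMk (contDiff_component h 3)

theorem real_smul_prod (c : ℝ) (v : ℂ × ℂ) : c • v = (c : ℂ) • v := by
  ext <;> simp

/-- The Dirac Hamiltonian in the Cartesian spin basis. -/
theorem diracH_sphericalField (M Q m q : ℝ) {χ : EuclideanSpace ℝ (Fin 3) → Spinor}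
    (hχ : ContDiff ℝ 1 χ) (r : ℝ) {ω : ℝ × ℝ} (hω : Real.sin ω.1 ≠ 0) :
    diracH M Q m q (sphericalField χ) (r, ω) = toSpherical ω (ofParts
      (halfDirac M Q (m * A M Q r + q * Q / r) (fun x => upperPart (χ x))
        (fun x => lowerPart (χ x)) (r, ω))
      (halfDirac M Q (-(m * A M Q r) + q * Q / r) (fun x => lowerPart (χ x))
        (fun x => upperPart (χ x)) (r, ω))) := by
  have hu := contDiff_upperPart hχ
  have hl := contDiff_lowerPart hχ
  have h1 := (hasDerivAt_ofParts (hasDerivAt_spinBlock_r ω (hasDerivAt_pullback_r hu r ω))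
    (hasDerivAt_spinBlock_r ω (hasDerivAt_pullback_r hl r ω))).deriv
  have h2 := (hasDerivAt_ofParts (hasDerivAt_spinBlock_theta ω (hasDerivAt_pullback_theta hu r ω))
    (hasDerivAt_spinBlock_theta ω (hasDerivAt_pullback_theta hl r ω))).deriv
  have h3 := (hasDerivAt_ofParts (hasDerivAt_spinBlock_phi ω (hasDerivAt_pullback_phi hu r ω))
    (hasDerivAt_spinBlock_phi ω (hasDerivAt_pullback_phi hl r ω))).deriv
  obtain ⟨au1, au2⟩ := spinBlock_angular (r := r) hω (upperPart (χ (cartesian (r, ω))))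
    (fderiv ℝ (fun x => upperPart (χ x)) (cartesian (r, ω)) (frameTheta ω))
    (fderiv ℝ (fun x => upperPart (χ x)) (cartesian (r, ω)) (framePhi ω))
  obtain ⟨al1, al2⟩ := spinBlock_angular (r := r) hω (lowerPart (χ (cartesian (r, ω))))
    (fderiv ℝ (fun x => lowerPart (χ x)) (cartesian (r, ω)) (frameTheta ω))
    (fderiv ℝ (fun x => lowerPart (χ x)) (cartesian (r, ω)) (framePhi ω))
  have e0 : ∀ p, sphericalField χ p = ofParts (spinBlock p.2 (upperPart (χ (cartesian p))))
      (spinBlock p.2 (lowerPart (χ (cartesian p)))) := fun p => rfl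
  have hdiv : ((A M Q r / (r * Real.sin ω.1) : ℝ) : ℂ)
      = (A M Q r / r : ℝ) * (Real.sin ω.1 : ℂ)⁻¹ := by
    push_cast
    rw [div_mul_eq_div_div]
    rfl
  have eu : (_, _) = angTerm (fun x => upperPart (χ x)) (r, ω) := rfl
  have el : (_, _) = angTerm (fun x => lowerPart (χ x)) (r, ω) := rfl
  dsimp only at eu el au1 au2 al1 al2
  rw [eu] at au1 au2
  rw [el] at al1 al2
  simp only [real_smul_prod, spinBlock_smul, Prod.smul_fst, Prod.smul_snd, smul_eq_mul,
    Complex.ofReal_mul] at h2 h3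
  simp only [diracH, e0, hdiv]
  rw [h1, h2, h3]
  simp only [real_smul_ofParts, smul_ofParts, ofParts_add, act_alpha1, act_alpha2, act_alpha3,
    act_beta, toSpherical_ofParts, halfDirac, innerTerm, spinBlock_add, spinBlock_sigmaR,
    spinBlock_smul, radCoeff]
  clear eu el h1 h2 h3 e0 hdiv hu hl
  have hI := Complex.I_sq
  simp only [Prod.mk.eta]
  generalize spinBlock ω (angTerm (fun x => upperPart (χ x)) (r, ω)) = uX at *
  generalize spinBlock ω (angTerm (fun x => lowerPart (χ x)) (r, ω)) = lX at *
  generalize spinBlock ω (fderiv ℝ (fun x => upperPart (χ x)) (cartesian (r, ω)) (frameTheta ω))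
    = ut at *
  generalize spinBlock ω (fderiv ℝ (fun x => lowerPart (χ x)) (cartesian (r, ω)) (frameTheta ω))
    = lt at *
  generalize spinBlock ω (fderiv ℝ (fun x => upperPart (χ x)) (cartesian (r, ω)) (frameR ω))
    = ur at *
  generalize spinBlock ω (fderiv ℝ (fun x => lowerPart (χ x)) (cartesian (r, ω)) (frameR ω))
    = lr at *
  generalize spinBlock ω (I / 2 * (upperPart _).1 + _, _) = uf at *
  generalize spinBlock ω (I / 2 * (lowerPart _).1 + _, _) = lf at *
  generalize spinBlock ω (upperPart _) = u at *
  generalize spinBlock ω (lowerPart _) = l at *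
  generalize A M Q r / r = a at *
  congr 1
  · ext
    · simp only [Prod.fst_add, Prod.snd_add, Prod.smul_fst, Prod.smul_snd, smul_eq_mul]
      push_cast at al2 ⊢
      linear_combination (-a : ℂ) * al2
        + (a : ℂ) * (-(I / 2) * l.2 + r * lt.2 + Complex.cot ω.1 / 2 * l.2) * hI
    · simp only [Prod.fst_add, Prod.snd_add, Prod.smul_fst, Prod.smul_snd, smul_eq_mul]
      push_cast at al1 ⊢
      linear_combination (a : ℂ) * al1
        - (a : ℂ) * (I / 2 * l.1 + r * lt.1 + Complex.cot ω.1 / 2 * l.1) * hI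
  · ext
    · simp only [Prod.fst_add, Prod.snd_add, Prod.smul_fst, Prod.smul_snd, smul_eq_mul,
        Prod.fst_neg]
      push_cast at au2 ⊢
      linear_combination (-a : ℂ) * au2
        + (a : ℂ) * (-(I / 2) * u.2 + r * ut.2 + Complex.cot ω.1 / 2 * u.2) * hI
    · simp only [Prod.fst_add, Prod.snd_add, Prod.smul_fst, Prod.smul_snd, smul_eq_mul,
        Prod.snd_neg]
      push_cast at au1 ⊢
      linear_combination (a : ℂ) * au1
        - (a : ℂ) * (I / 2 * u.1 + r * ut.1 + Complex.cot ω.1 / 2 * u.1) * hI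

/-! ### Angular integrals of test spinors -/

theorem integrable_conj_spinHarm (σ : AngIndex) {f : ℝ × ℝ → ℂ} (hf : Continuous f) :
    Integrable (fun ω => (starRingEnd ℂ) (spinHarm σ ω).1 * f ω) sphereMeasure ∧
      Integrable (fun ω => (starRingEnd ℂ) (spinHarm σ ω).2 * f ω) sphereMeasure := by
  obtain ⟨u, h1, h2, hu⟩ := exists_angSmooth_spinHarm σ
  constructor
  · refine (integrable_conj_mul h1.contDiff.continuous hf).congr ?_
    filter_upwards [ae_mem_angRect] with ω hω
    rw [hu ω (sin_pos_of_mem_angRect hω).ne']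
  · refine (integrable_conj_mul h2.contDiff.continuous hf).congr ?_
    filter_upwards [ae_mem_angRect] with ω hω
    rw [hu ω (sin_pos_of_mem_angRect hω).ne']

theorem spinPair_eq_integral (σ : AngIndex) {v : ℝ × ℝ → ℂ × ℂ} (hv : Continuous v) :
    spinPair (spinHarm σ) v = ∫ ω, ((starRingEnd ℂ) (spinHarm σ ω).1 * (v ω).1
      + (starRingEnd ℂ) (spinHarm σ ω).2 * (v ω).2) ∂sphereMeasure :=
  (integral_add (integrable_conj_spinHarm σ hv.fst).1 (integrable_conj_spinHarm σ hv.snd).2).symm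

theorem integrable_spinPair (σ : AngIndex) {v : ℝ × ℝ → ℂ × ℂ} (hv : Continuous v) :
    Integrable (fun ω => (starRingEnd ℂ) (spinHarm σ ω).1 * (v ω).1
      + (starRingEnd ℂ) (spinHarm σ ω).2 * (v ω).2) sphereMeasure :=
  (integrable_conj_spinHarm σ hv.fst).1.add (integrable_conj_spinHarm σ hv.snd).2

theorem continuous_smul_add_smul {v w : ℝ × ℝ → ℂ × ℂ} (hv : Continuous v) (hw : Continuous w)
    (a b : ℂ) : Continuous fun ω => a • v ω + b • w ω := by fun_prop

theorem spinPair_smul_add_smul (σ : AngIndex) {v w : ℝ × ℝ → ℂ × ℂ} (hv : Continuous v)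
    (hw : Continuous w) (a b : ℂ) :
    spinPair (spinHarm σ) (fun ω => a • v ω + b • w ω)
      = a * spinPair (spinHarm σ) v + b * spinPair (spinHarm σ) w := by
  have hvw := continuous_smul_add_smul hv hw a b
  rw [spinPair_eq_integral σ hv, spinPair_eq_integral σ hw, spinPair_eq_integral σ hvw,
    ← integral_const_mul,
    ← integral_const_mul, ← integral_add ((integrable_spinPair σ hv).const_mul a)
      ((integrable_spinPair σ hw).const_mul b)]
  congr 1
  funext ω
  simp only [Prod.fst_add, Prod.snd_add, Prod.smul_fst, Prod.smul_snd, smul_eq_mul]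
  ring

theorem spinPair_congr (σ : AngIndex) {v w : ℝ × ℝ → ℂ × ℂ}
    (h : ∀ ω : ℝ × ℝ, Real.sin ω.1 ≠ 0 → v ω = w ω) :
    spinPair (spinHarm σ) v = spinPair (spinHarm σ) w := by
  unfold spinPair
  rw [spherePair_congr (fun _ _ => rfl) fun ω hω => by
      rw [h ω (sin_pos_of_mem_angRect hω).ne'],
    spherePair_congr (y := fun ω => (spinHarm σ ω).2) (fun _ _ => rfl) fun ω hω => by
      rw [h ω (sin_pos_of_mem_angRect hω).ne']]

theorem continuous_sigmaR {v : ℝ × ℝ → ℂ × ℂ} (hv : Continuous v) :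
    Continuous fun ω => sigmaR ω (v ω) := by
  have h1 := hv.fst
  have h2 := hv.snd
  unfold sigmaR
  fun_prop

/-- `x̂ · σ` is symmetric and maps spinor harmonics to spinor harmonics. -/
theorem spinPair_sigmaR (σ : AngIndex) {v : ℝ × ℝ → ℂ × ℂ} (hv : Continuous v) :
    spinPair (spinHarm σ) (fun ω => sigmaR ω (v ω)) = spinPair (spinHarm σ.neg) v := by
  rw [spinPair_eq_integral σ.neg hv, spinPair_eq_integral σ (continuous_sigmaR hv)]
  refine integral_congr_ae ?_
  filter_upwards [ae_mem_angRect] with ω hω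
  rw [← sigmaR_spinHarm σ ω (sin_pos_of_mem_angRect hω).ne']
  have e : (starRingEnd ℂ) (exp (I * ω.2)) = exp (-(I * ω.2)) := by
    rw [← Complex.exp_conj]
    simp
  have e' : (starRingEnd ℂ) (exp (-(I * ω.2))) = exp (I * ω.2) := by
    rw [← Complex.exp_conj]
    simp
  simp only [sigmaR, map_add, map_sub, map_mul, Complex.conj_ofReal, e, e']
  ring

/-- Differentiation under the angular integral. -/
theorem hasDerivAt_spinPair (σ : AngIndex) {F F' : ℝ × (ℝ × ℝ) → ℂ × ℂ} (hF : Continuous F)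
    (hF' : Continuous F') (h : ∀ r ω, HasDerivAt (fun s => F (s, ω)) (F' (r, ω)) r) (r : ℝ) :
    HasDerivAt (fun r => spinPair (spinHarm σ) fun ω => F (r, ω))
      (spinPair (spinHarm σ) fun ω => F' (r, ω)) r := by
  have c1 : ∀ r, Continuous fun ω => F (r, ω) := fun r => by fun_prop
  have c2 : ∀ r, Continuous fun ω => F' (r, ω) := fun r => by fun_prop
  rw [spinPair_eq_integral σ (c2 r), funext fun r => spinPair_eq_integral σ (c1 r)]
  obtain ⟨C, hC⟩ := exists_bound_spinHarm σ
  have hi : ∀ {v : ℝ × ℝ → ℂ × ℂ}, Continuous v → Integrable (fun ω =>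
      (starRingEnd ℂ) (spinHarm σ ω).1 * (v ω).1
        + (starRingEnd ℂ) (spinHarm σ ω).2 * (v ω).2) sphereMeasure := integrable_spinPair σ
  generalize spinHarm σ = y at *
  obtain ⟨D, hD⟩ := (isCompact_Icc.prod (isCompact_Icc.prod isCompact_Icc) : IsCompact
    (Set.Icc (r - 1) (r + 1) ×ˢ (Set.Icc 0 Real.pi ×ˢ Set.Icc 0 (2 * Real.pi)))
    ).exists_bound_of_continuousOn hF'.continuousOn
  have hbound : ∀ᵐ ω ∂sphereMeasure, ∀ s ∈ Metric.ball r 1,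
      ‖(starRingEnd ℂ) (y ω).1 * (F' (s, ω)).1 + (starRingEnd ℂ) (y ω).2 * (F' (s, ω)).2‖
        ≤ C * D + C * D := by
    filter_upwards [ae_mem_angRect] with ω hω s hs
    rw [Metric.mem_ball, Real.dist_eq, abs_lt] at hs
    have hb : ‖F' (s, ω)‖ ≤ D := hD (s, ω) ⟨⟨by linarith [hs.1], by linarith [hs.2]⟩,
      Set.Ioo_subset_Icc_self hω.1, Set.Ioo_subset_Icc_self hω.2⟩
    have hs := hC ω hω
    have hC0 : 0 ≤ C := (norm_nonneg _).trans hs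
    have k1 : ‖(y ω).1‖ ≤ C := (norm_fst_le _).trans hs
    have k2 : ‖(y ω).2‖ ≤ C := (norm_snd_le _).trans hs
    have k3 : ‖(F' (s, ω)).1‖ ≤ D := (norm_fst_le _).trans hb
    have k4 : ‖(F' (s, ω)).2‖ ≤ D := (norm_snd_le _).trans hb
    refine (norm_add_le _ _).trans (add_le_add ?_ ?_)
    · rw [norm_mul, RCLike.norm_conj]
      exact mul_le_mul k1 k3 (norm_nonneg _) hC0
    · rw [norm_mul, RCLike.norm_conj]
      exact mul_le_mul k2 k4 (norm_nonneg _) hC0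
  have hderiv : ∀ᵐ ω ∂sphereMeasure, ∀ s ∈ Metric.ball r 1,
      HasDerivAt (fun s => (starRingEnd ℂ) (y ω).1 * (F (s, ω)).1
          + (starRingEnd ℂ) (y ω).2 * (F (s, ω)).2)
        ((starRingEnd ℂ) (y ω).1 * (F' (s, ω)).1 + (starRingEnd ℂ) (y ω).2 * (F' (s, ω)).2) s := by
    refine Filter.Eventually.of_forall fun ω s _ => ?_
    exact ((hasDerivAt_prod_fst (h s ω)).const_mul _).add
      ((hasDerivAt_prod_snd (h s ω)).const_mul _)
  have hm : ∀ᶠ s in nhds r, AEStronglyMeasurable (fun ω => (starRingEnd ℂ) (y ω).1 * (F (s, ω)).1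
      + (starRingEnd ℂ) (y ω).2 * (F (s, ω)).2) sphereMeasure :=
    Filter.Eventually.of_forall fun s => (hi (c1 s)).aestronglyMeasurable
  exact (hasDerivAt_integral_of_dominated_loc_of_deriv_le
    (F := fun s ω => (starRingEnd ℂ) (y ω).1 * (F (s, ω)).1
      + (starRingEnd ℂ) (y ω).2 * (F (s, ω)).2)
    (F' := fun s ω => (starRingEnd ℂ) (y ω).1 * (F' (s, ω)).1
      + (starRingEnd ℂ) (y ω).2 * (F' (s, ω)).2)
    (s := Metric.ball r 1) (bound := fun _ => C * D + C * D) (Metric.ball_mem_nhds r one_pos)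
    hm (hi (c1 r)) (hi (c2 r)).aestronglyMeasurable hbound (integrable_const _) hderiv).2

theorem continuous_cartesian : Continuous cartesian := by
  unfold cartesian
  refine (PiLp.continuous_toLp 2 _).comp (continuous_pi fun i => ?_)
  fin_cases i <;> simp <;> fun_prop

theorem continuous_frameR : Continuous frameR := by
  unfold frameR
  refine (PiLp.continuous_toLp 2 _).comp (continuous_pi fun i => ?_)
  fin_cases i <;> simp <;> fun_prop

theorem continuous_frameTheta : Continuous frameTheta := by
  unfold frameTheta
  refine (PiLp.continuous_toLp 2 _).comp (continuous_pi fun i => ?_)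
  fin_cases i <;> simp <;> fun_prop

theorem continuous_framePhi : Continuous framePhi := by
  unfold framePhi
  refine (PiLp.continuous_toLp 2 _).comp (continuous_pi fun i => ?_)
  fin_cases i <;> simp <;> fun_prop

theorem contDiff_cartesian_sphere (r : ℝ) : ContDiff ℝ 1 fun ω => cartesian (r, ω) := by
  rw [contDiff_euclidean]
  intro i
  fin_cases i <;> simp [cartesian] <;> fun_prop

theorem cartesian_periodic (r θ φ : ℝ) :
    cartesian (r, (θ, φ + 2 * Real.pi)) = cartesian (r, (θ, φ)) := by
  simp only [cartesian, Real.cos_add_two_pi, Real.sin_add_two_pi]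

section field

variable {u l : EuclideanSpace ℝ (Fin 3) → ℂ × ℂ}

theorem continuous_pullback (hu : ContDiff ℝ 1 u) : Continuous fun p => u (cartesian p) :=
  hu.continuous.comp continuous_cartesian

theorem continuous_fderiv_pullback (hu : ContDiff ℝ 1 u) {e : ℝ × ℝ → EuclideanSpace ℝ (Fin 3)}
    (he : Continuous e) : Continuous fun p : ℝ × (ℝ × ℝ) => fderiv ℝ u (cartesian p) (e p.2) :=
  ((hu.continuous_fderiv one_ne_zero).comp continuous_cartesian).clm_apply (he.comp continuous_snd)

theorem continuous_angTerm (hu : ContDiff ℝ 1 u) : Continuous (angTerm u) := by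
  have h1 := continuous_pullback hu
  have h2 := continuous_fderiv_pullback hu continuous_frameTheta
  have h3 := continuous_fderiv_pullback hu continuous_framePhi
  have a1 := h1.fst
  have a2 := h1.snd
  have b1 := h2.fst
  have b2 := h2.snd
  have d1 := h3.fst
  have d2 := h3.snd
  have e1 : Continuous fun p : ℝ × (ℝ × ℝ) => exp (-(I * p.2.2)) := by fun_prop
  have e2 : Continuous fun p : ℝ × (ℝ × ℝ) => exp (I * p.2.2) := by fun_prop
  have e3 : Continuous fun p : ℝ × (ℝ × ℝ) => (p.1 : ℂ) := by fun_prop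
  have e4 : Continuous fun p : ℝ × (ℝ × ℝ) => (Real.sin p.2.1 : ℂ) := by fun_prop
  have e5 : Continuous fun p : ℝ × (ℝ × ℝ) => (Real.cos p.2.1 : ℂ) := by fun_prop
  exact ((a1.sub ((continuous_const.mul (e3.mul e4)).mul d1)).add
      ((e1.mul e3).mul (b2.neg.add ((continuous_const.mul e5).mul d2)))).prodMk
    ((a2.add ((continuous_const.mul (e3.mul e4)).mul d2)).add
      ((e2.mul e3).mul (b1.add ((continuous_const.mul e5).mul d1))))

theorem spinPair_angTerm (σ : AngIndex) (hu : ContDiff ℝ 1 u) (r : ℝ) :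
    spinPair (spinHarm σ) (fun ω => angTerm u (r, ω))
      = -σ.kappa * spinPair (spinHarm σ) (fun ω => u (cartesian (r, ω))) := by
  have hc := hu.comp (contDiff_cartesian_sphere r)
  rw [← spinPair_spinHarm_angK σ]
  · exact spinPair_congr σ fun ω hω => (angK_pullback hu r hω).symm
  · exact ⟨contDiff_fst.comp hc, fun θ φ => by rw [cartesian_periodic]⟩
  · exact ⟨contDiff_snd.comp hc, fun θ φ => by rw [cartesian_periodic]⟩

theorem spinPair_halfDirac (M Q w : ℝ) (σ : AngIndex) (hu : ContDiff ℝ 1 u) (hl : ContDiff ℝ 1 l)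
    (r : ℝ) : spinPair (spinHarm σ) (fun ω => halfDirac M Q w u l (r, ω))
      = -I * (A M Q r : ℂ) ^ 2 * (spinPair (spinHarm σ.neg)
            (fun ω => fderiv ℝ l (cartesian (r, ω)) (frameR ω))
          + radCoeff M Q r * spinPair (spinHarm σ.neg) (fun ω => l (cartesian (r, ω))))
        + I * (A M Q r / r : ℝ) * (σ.kappa * spinPair (spinHarm σ.neg)
            (fun ω => l (cartesian (r, ω))))
        + w * spinPair (spinHarm σ) (fun ω => u (cartesian (r, ω))) := by
  have hr : Continuous fun ω : ℝ × ℝ => (r, ω) := by fun_prop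
  have c1 : Continuous fun ω => fderiv ℝ l (cartesian (r, ω)) (frameR ω) :=
    (continuous_fderiv_pullback hl continuous_frameR).comp hr
  have c2 : Continuous fun ω => l (cartesian (r, ω)) := (continuous_pullback hl).comp hr
  have c3 : Continuous fun ω => u (cartesian (r, ω)) := (continuous_pullback hu).comp hr
  have c4 : Continuous fun ω => angTerm l (r, ω) := (continuous_angTerm hl).comp hr
  have c5 : Continuous fun ω => fderiv ℝ l (cartesian (r, ω)) (frameR ω)
    + (radCoeff M Q r : ℂ) • l (cartesian (r, ω)) := by
    simpa only [one_smul] using continuous_smul_add_smul c1 c2 1 (radCoeff M Q r)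
  have c6 : Continuous fun ω => innerTerm M Q l (r, ω) :=
    continuous_smul_add_smul c5 c4 (-I * (A M Q r : ℂ) ^ 2) (I * (A M Q r / r : ℝ))
  have k1 := spinPair_smul_add_smul σ (continuous_sigmaR c6) c3 1 w
  have k2 := spinPair_smul_add_smul σ.neg c5 c4 (-I * (A M Q r : ℂ) ^ 2) (I * (A M Q r / r : ℝ))
  have k3 := spinPair_smul_add_smul σ.neg c1 c2 1 (radCoeff M Q r)
  simp only [one_smul, one_mul] at k1 k3
  rw [spinPair_sigmaR σ c6] at k1
  rw [k3, spinPair_angTerm σ.neg hl] at k2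
  refine k1.trans ?_
  congr 1
  refine k2.trans ?_
  simp only [AngIndex.neg, AngIndex.mk']
  push_cast
  ring

end field

/-! ### Test spinors in the angular channels -/

section radial

variable (M Q : ℝ) [hMQ : Fact (M ^ 2 < Q ^ 2)]

theorem deriv_A {r : ℝ} (hr : 0 < r) :
    deriv (A M Q) r = (deriv (rho M Q) r * r - rho M Q r * 1) / r ^ 2 := by
  have hd : HasDerivAt (rho M Q) (deriv (rho M Q) r) r :=
    ((contDiff_rho M Q).differentiable one_ne_zero r).hasDerivAt
  refine HasDerivAt.deriv ((hd.div (hasDerivAt_id r) hr.ne').congr_of_eventuallyEq ?_)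
  filter_upwards [Ioi_mem_nhds hr] with s hs using A_eq M Q hs

/-- The weight `(ρ r)^{1/2}` removes the zeroth-order part of the radial derivative. -/
theorem hasDerivAt_sqrt_rho_mul {r : ℝ} (hr : 0 < r) :
    HasDerivAt (fun r => Real.sqrt (rho M Q r * r))
      (radCoeff M Q r * Real.sqrt (rho M Q r * r)) r := by
  have hρ := rho_pos M Q r
  have hd : HasDerivAt (rho M Q) (deriv (rho M Q) r) r :=
    ((contDiff_rho M Q).differentiable one_ne_zero r).hasDerivAt
  have h1 := (hd.fun_mul (hasDerivAt_id' r)).sqrt (mul_pos hρ hr).ne'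
  refine h1.congr_deriv ?_
  have hs : 0 < Real.sqrt (rho M Q r * r) := Real.sqrt_pos.mpr (mul_pos hρ hr)
  have hs2 := Real.sq_sqrt (mul_pos hρ hr).le
  rw [radCoeff, deriv_A M Q hr, A_eq M Q hr, div_eq_iff (by positivity),
    show ∀ x : ℝ, x * Real.sqrt (rho M Q r * r) * (2 * Real.sqrt (rho M Q r * r))
      = 2 * x * Real.sqrt (rho M Q r * r) ^ 2 from fun x => by ring, hs2]
  field_simp
  ring

theorem rwt_eq {r : ℝ} (hr : 0 < r) :
    rwt M Q r = bfun M Q r * Real.sqrt (rho M Q r * r) := by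
  have h := bfun_div_rwt M Q hr
  have hw := rwt_pos M Q hr
  have h2 := Real.sqrt_pos.mpr (rho_pos M Q r)
  have h3 := Real.sqrt_pos.mpr hr
  rw [div_eq_iff hw.ne'] at h
  rw [h, Real.sqrt_mul (rho_pos M Q r).le]
  field_simp

/-- A regular solution of a radial differential equation satisfies its integrated form, with
vanishing short-distance coefficient. -/
theorem halfRel_of_hasDerivAt {κ : ℝ} {f h v v' : ℝ → ℂ} (hv : ∀ r, HasDerivAt v (v' r) r)
    (hh : MemLp h 2 halfLine) (hf : f =ᵐ[halfLine] fun r => rwt M Q r * v r)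
    (he : h =ᵐ[halfLine] fun r => Real.sqrt (rho M Q r * r)
      * (v' r + radCoeff M Q r * v r + (κ / rho M Q r : ℝ) * v r)) : HalfRel M Q κ 0 f h := by
  set P : ℝ → ℂ := fun r => (Real.exp (κ * tau M Q r) * Real.sqrt (rho M Q r * r) : ℝ) * v r
    with hP
  have hvc : Continuous v := continuous_iff_continuousAt.mpr fun r => (hv r).continuousAt
  have hPc : Continuous P := by
    have h1 := continuous_tau M Q
    have h2 := continuous_rho M Q
    have h3 : Continuous fun r => Real.exp (κ * tau M Q r) * Real.sqrt (rho M Q r * r) := by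
      fun_prop
    exact (Complex.continuous_ofReal.comp h3).mul hvc
  have hPd : ∀ r, 0 < r → HasDerivAt P (Real.exp (κ * tau M Q r) * (Real.sqrt (rho M Q r * r)
      * (v' r + radCoeff M Q r * v r + (κ / rho M Q r : ℝ) * v r))) r := by
    intro r hr
    have h1 := (((hasDerivAt_tau M Q r).const_mul κ).exp.fun_mul
      (hasDerivAt_sqrt_rho_mul M Q hr)).ofReal_comp.fun_mul (hv r)
    refine h1.congr_deriv ?_
    push_cast
    ring
  unfold HalfRel
  filter_upwards [hf, ae_halfLine_pos] with r h1 hr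
  have hle : volume.restrict (Set.Ioc 0 r) ≤ halfLine :=
    Measure.restrict_mono Set.Ioc_subset_Ioi_self le_rfl
  have hae : (fun t => (Real.exp (κ * tau M Q t) : ℂ) * h t) =ᵐ[volume.restrict (Set.Ioc 0 r)]
      fun t => Real.exp (κ * tau M Q t) * (Real.sqrt (rho M Q t * t)
        * (v' t + radCoeff M Q t * v t + (κ / rho M Q t : ℝ) * v t)) := by
    filter_upwards [ae_mono hle he] with t ht
    rw [ht]
  have hi := intervalIntegrable_exp_mul M Q κ hh hr.le
  have hint : primit M Q κ 0 h r = P r := by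
    unfold primit
    rw [zero_add]
    have h2 : ∫ t in (0 : ℝ)..r, (Real.exp (κ * tau M Q t) : ℂ) * h t
        = ∫ t in (0 : ℝ)..r, Real.exp (κ * tau M Q t) * (Real.sqrt (rho M Q t * t)
        * (v' t + radCoeff M Q t * v t + (κ / rho M Q t : ℝ) * v t)) := by
      refine intervalIntegral.integral_congr_ae_restrict ?_
      rw [Set.uIoc_of_le hr.le]
      exact hae
    rw [h2, intervalIntegral.integral_eq_sub_of_hasDerivAt_of_le hr.le hPc.continuousOn
      (fun t ht => hPd t ht.1)]
    · simp [hP]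
    · rw [intervalIntegrable_iff_integrableOn_Ioc_of_le hr.le] at hi ⊢
      exact hi.congr hae
  have hexp : Real.exp (-(κ * tau M Q r)) * Real.exp (κ * tau M Q r) = 1 := by
    rw [← Real.exp_add, neg_add_cancel, Real.exp_zero]
  rw [hint, h1, rwt_eq M Q hr, hP]
  simp only
  rw [← mul_assoc, ← Complex.ofReal_mul, ← Complex.ofReal_mul]
  congr 2
  linear_combination -(bfun M Q r * Real.sqrt (rho M Q r * r)) * hexp

theorem radialMeasure_Icc_lt_top (δ R : ℝ) : radialMeasure M Q (Set.Icc δ R) < ⊤ := by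
  have h1 : Integrable ((Set.Icc δ R).indicator fun _ => (1 : ℝ)) (radialMeasure M Q) := by
    rw [integrable_radialMeasure_iff]
    have hc : ContinuousOn (fun r => r ^ 3 / rho M Q r) (Set.Icc δ R) :=
      (Continuous.div (by fun_prop) (continuous_rho M Q) fun r => (rho_pos M Q r).ne').continuousOn
    have h2 := (integrable_indicator_iff measurableSet_Icc).mpr
      ((hc.integrableOn_compact isCompact_Icc).mono_measure
        (Measure.restrict_le_self : halfLine ≤ volume))
    refine h2.congr ?_
    filter_upwards [ae_halfLine_pos] with r hr
    by_cases h : r ∈ Set.Icc δ R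
    · have := rho_pos M Q r
      rw [Set.indicator_of_mem h, Set.indicator_of_mem h, rwt_sq M Q hr, A_eq M Q hr, smul_eq_mul]
      field_simp
    · simp [h]
  rw [integrable_indicator_iff measurableSet_Icc] at h1
  exact ((integrableOn_const_iff (by finiteness)).mp h1).resolve_left (by simp)

/-- Fields that are continuous away from the origin and supported in an annulus are square
integrable. -/
theorem memLp_of_continuousOn {F : ℝ × (ℝ × ℝ) → Spinor} {δ R : ℝ} (hδ : 0 < δ)
    (hF : ContinuousOn F (Set.Ioi 0 ×ˢ Set.univ))
    (h0 : ∀ r ω, 0 < r → r ∉ Set.Icc δ R → F (r, ω) = 0) : MemLp F 2 (spaceMeasure M Q) := by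
  set S : Set (ℝ × (ℝ × ℝ)) := Set.Icc δ R ×ˢ angRect with hS
  have hSm : MeasurableSet S := measurableSet_Icc.prod measurableSet_angRect
  have hsub : S ⊆ Set.Ioi 0 ×ˢ Set.univ := fun p hp => ⟨hδ.trans_le hp.1.1, trivial⟩
  have hfin : spaceMeasure M Q S < ⊤ := by
    rw [spaceMeasure, hS, Measure.prod_prod]
    exact ENNReal.mul_lt_top (radialMeasure_Icc_lt_top M Q δ R) (measure_lt_top _ _)
  have : IsFiniteMeasure ((spaceMeasure M Q).restrict S) := ⟨by rwa [Measure.restrict_apply_univ]⟩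
  obtain ⟨C, hC⟩ := (isCompact_Icc.prod (isCompact_Icc.prod isCompact_Icc) : IsCompact
    (Set.Icc δ R ×ˢ (Set.Icc 0 Real.pi ×ˢ Set.Icc 0 (2 * Real.pi)))
    ).exists_bound_of_continuousOn (hF.mono fun p hp => ⟨hδ.trans_le hp.1.1, trivial⟩)
  have h1 : MemLp F 2 ((spaceMeasure M Q).restrict S) := by
    refine MemLp.of_bound ((hF.mono hsub).aestronglyMeasurable hSm) C ?_
    filter_upwards [ae_restrict_mem hSm] with p hp
    exact hC p ⟨hp.1, Set.Ioo_subset_Icc_self hp.2.1, Set.Ioo_subset_Icc_self hp.2.2⟩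
  rw [← memLp_indicator_iff_restrict hSm] at h1
  refine h1.ae_eq ?_
  have e1 := (Measure.quasiMeasurePreserving_fst (μ := radialMeasure M Q)
    (ν := sphereMeasure)).ae (radialMeasure_ac M Q ae_halfLine_pos)
  have e2 := (Measure.quasiMeasurePreserving_snd (μ := radialMeasure M Q)
    (ν := sphereMeasure)).ae ae_mem_angRect
  filter_upwards [e1, e2] with p hp hp2
  by_cases h : p ∈ S
  · rw [Set.indicator_of_mem h]
  · rw [Set.indicator_of_notMem h]
    exact (h0 p.1 p.2 hp fun hmem => h ⟨hmem, hp2⟩).symm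

end radial

section radial

theorem norm_cartesian (r : ℝ) (ω : ℝ × ℝ) : ‖cartesian (r, ω)‖ = |r| := by
  rw [EuclideanSpace.norm_eq, Fin.sum_univ_three, ← Real.sqrt_sq_eq_abs]
  congr 1
  simp only [cartesian, Real.norm_eq_abs, sq_abs, Matrix.cons_val]
  linear_combination r ^ 2 * Real.sin ω.1 ^ 2 * Real.sin_sq_add_cos_sq ω.2
    + r ^ 2 * Real.sin_sq_add_cos_sq ω.1

theorem IsTestSpinor.exists_annulus {χ : EuclideanSpace ℝ (Fin 3) → Spinor}
    (h : IsTestSpinor χ) : ∃ δ R : ℝ, 0 < δ ∧ ∀ (r : ℝ) (ω : ℝ × ℝ), 0 < r → r ∉ Set.Icc δ R →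
      cartesian (r, ω) ∉ tsupport χ := by
  obtain ⟨δ, hδ, hδ'⟩ := Metric.isOpen_iff.mp (isClosed_tsupport χ).isOpen_compl 0 h.away
  obtain ⟨R, hR⟩ := h.compact.isBounded.exists_norm_le
  refine ⟨δ, R, hδ, fun r ω hr hn hmem => hn ⟨?_, ?_⟩⟩
  · by_contra! hlt
    have hb : cartesian (r, ω) ∈ Metric.ball 0 δ := by
      rwa [mem_ball_zero_iff, norm_cartesian, abs_of_pos hr]
    exact hδ' hb hmem
  · have := hR _ hmem
    rwa [norm_cartesian, abs_of_pos hr] at this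

variable (M Q : ℝ) [hMQ : Fact (M ^ 2 < Q ^ 2)]

theorem continuousOn_A : ContinuousOn (A M Q) (Set.Ioi 0) := by
  refine ContinuousOn.congr (f := fun r => rho M Q r / r) ?_ fun r hr => A_eq M Q hr
  exact (continuous_rho M Q).continuousOn.div continuousOn_id fun r hr => ne_of_gt hr

theorem continuousOn_radCoeff : ContinuousOn (radCoeff M Q) (Set.Ioi 0) := by
  have hd := (contDiff_rho M Q).continuous_deriv le_rfl
  have hρ := continuous_rho M Q
  have hs : ContinuousOn (fun r : ℝ => r⁻¹ + (deriv (rho M Q) r * r - rho M Q r * 1) / r ^ 2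
      / (2 * A M Q r)) (Set.Ioi 0) := by
    have hid : ContinuousOn (fun r : ℝ => r) (Set.Ioi 0) := continuousOn_id
    refine (hid.inv₀ fun r hr => ne_of_gt hr).add (ContinuousOn.div (ContinuousOn.div ?_ ?_ ?_)
      (continuousOn_const.mul (continuousOn_A M Q)) ?_)
    · exact ((hd.mul continuous_id).sub (hρ.mul continuous_const)).continuousOn
    · exact hid.pow 2
    · exact fun r hr => (pow_pos hr 2).ne'
    · exact fun r hr => (mul_pos two_pos (A_pos M Q hr)).ne'
  refine hs.congr fun r hr => ?_
  rw [radCoeff, deriv_A M Q hr]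

omit hMQ in
theorem continuousOn_smul_add_smul {X : Type*} [TopologicalSpace X] {a b : X → ℂ}
    {v w : X → ℂ × ℂ} {s : Set X} (ha : ContinuousOn a s) (hb : ContinuousOn b s)
    (hv : ContinuousOn v s) (hw : ContinuousOn w s) :
    ContinuousOn (fun x => a x • v x + b x • w x) s := by fun_prop

section field

variable {u l : EuclideanSpace ℝ (Fin 3) → ℂ × ℂ} {w : ℝ → ℝ}

theorem continuousOn_halfDirac (hu : ContDiff ℝ 1 u) (hl : ContDiff ℝ 1 l)
    (hw : ContinuousOn w (Set.Ioi 0)) :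
    ContinuousOn (fun p => halfDirac M Q (w p.1) u l p) (Set.Ioi 0 ×ˢ Set.univ) := by
  have hfst : Set.MapsTo (Prod.fst : ℝ × (ℝ × ℝ) → ℝ) (Set.Ioi 0 ×ˢ Set.univ) (Set.Ioi 0) :=
    fun p hp => hp.1
  have hA : ContinuousOn (fun p : ℝ × (ℝ × ℝ) => A M Q p.1) (Set.Ioi 0 ×ˢ Set.univ) :=
    (continuousOn_A M Q).comp continuousOn_fst hfst
  have hc : ContinuousOn (fun p : ℝ × (ℝ × ℝ) => radCoeff M Q p.1) (Set.Ioi 0 ×ˢ Set.univ) :=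
    (continuousOn_radCoeff M Q).comp continuousOn_fst hfst
  have hw' : ContinuousOn (fun p : ℝ × (ℝ × ℝ) => w p.1) (Set.Ioi 0 ×ˢ Set.univ) :=
    hw.comp continuousOn_fst hfst
  have hAr : ContinuousOn (fun p : ℝ × (ℝ × ℝ) => A M Q p.1 / p.1) (Set.Ioi 0 ×ˢ Set.univ) :=
    hA.div continuousOn_fst fun p hp => ne_of_gt hp.1
  have hI : ContinuousOn (innerTerm M Q l) (Set.Ioi 0 ×ˢ Set.univ) := by
    have hcc : ContinuousOn (fun p : ℝ × (ℝ × ℝ) => (radCoeff M Q p.1 : ℂ))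
        (Set.Ioi 0 ×ˢ Set.univ) := Complex.continuous_ofReal.comp_continuousOn hc
    have hA2 : ContinuousOn (fun p : ℝ × (ℝ × ℝ) => -I * (A M Q p.1 : ℂ) ^ 2)
        (Set.Ioi 0 ×ˢ Set.univ) :=
      continuousOn_const.mul ((Complex.continuous_ofReal.comp_continuousOn hA).pow 2)
    have hA1 : ContinuousOn (fun p : ℝ × (ℝ × ℝ) => I * (A M Q p.1 / p.1 : ℝ))
        (Set.Ioi 0 ×ˢ Set.univ) :=
      continuousOn_const.mul (Complex.continuous_ofReal.comp_continuousOn hAr)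
    have h1 := continuousOn_smul_add_smul (a := fun _ => 1) continuousOn_const hcc
      (continuous_fderiv_pullback hl continuous_frameR).continuousOn
      (continuous_pullback hl).continuousOn
    simp only [one_smul] at h1
    exact continuousOn_smul_add_smul hA2 hA1 h1 (continuous_angTerm hl).continuousOn
  have hσ : Continuous fun x : (ℝ × ℝ) × (ℂ × ℂ) => sigmaR x.1 x.2 := by
    unfold sigmaR
    fun_prop
  have hσI : ContinuousOn (fun p : ℝ × (ℝ × ℝ) => sigmaR p.2 (innerTerm M Q l p))
      (Set.Ioi 0 ×ˢ Set.univ) := Continuous.comp_continuousOn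
        (g := fun x : (ℝ × ℝ) × (ℂ × ℂ) => sigmaR x.1 x.2)
        (f := fun p : ℝ × (ℝ × ℝ) => (p.2, innerTerm M Q l p)) hσ (continuousOn_snd.prodMk hI)
  have hwc : ContinuousOn (fun p : ℝ × (ℝ × ℝ) => (w p.1 : ℂ)) (Set.Ioi 0 ×ˢ Set.univ) :=
    Complex.continuous_ofReal.comp_continuousOn hw'
  have h2 := continuousOn_smul_add_smul (a := fun _ => 1) continuousOn_const hwc hσI
    (continuous_pullback hu).continuousOn
  simp only [one_smul] at h2
  exact h2

omit hMQ in
theorem halfDirac_eq_zero {w : ℝ} {p : ℝ × (ℝ × ℝ)} (hu : cartesian p ∉ tsupport u)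
    (hl : cartesian p ∉ tsupport l) : halfDirac M Q w u l p = 0 := by
  have h1 : u (cartesian p) = 0 := image_eq_zero_of_notMem_tsupport hu
  have h2 : l (cartesian p) = 0 := image_eq_zero_of_notMem_tsupport hl
  have h3 : fderiv ℝ l (cartesian p) = 0 :=
    image_eq_zero_of_notMem_tsupport fun h => hl (tsupport_fderiv_subset ℝ h)
  ext <;> simp [halfDirac, innerTerm, angTerm, sigmaR, h1, h2, h3]

end field

variable {χ : EuclideanSpace ℝ (Fin 3) → Spinor}

theorem IsTestSpinor.contDiff_one (h : IsTestSpinor χ) : ContDiff ℝ 1 χ :=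
  h.smooth.of_le (by exact_mod_cast le_top)

theorem upperPart_notMem {x : EuclideanSpace ℝ (Fin 3)} (h : x ∉ tsupport χ) :
    x ∉ tsupport fun x => upperPart (χ x) :=
  fun hx => h (closure_mono (Function.support_subset_iff'.mpr fun y hy => by
    rw [Function.notMem_support.mp hy]; rfl) hx)

theorem lowerPart_notMem {x : EuclideanSpace ℝ (Fin 3)} (h : x ∉ tsupport χ) :
    x ∉ tsupport fun x => lowerPart (χ x) :=
  fun hx => h (closure_mono (Function.support_subset_iff'.mpr fun y hy => by
    rw [Function.notMem_support.mp hy]; rfl) hx)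

theorem continuous_ofParts : Continuous fun x : (ℂ × ℂ) × (ℂ × ℂ) => ofParts x.1 x.2 := by
  unfold ofParts
  refine (PiLp.continuous_toLp 2 _).comp (continuous_pi fun i => ?_)
  fin_cases i <;> simp <;> fun_prop

/-- The Dirac Hamiltonian applied to a field, in the Cartesian spin basis. -/
def cartDirac (m q : ℝ) (χ : EuclideanSpace ℝ (Fin 3) → Spinor) (p : ℝ × (ℝ × ℝ)) : Spinor :=
  ofParts
    (halfDirac M Q (m * A M Q p.1 + q * Q / p.1) (fun x => upperPart (χ x))
      (fun x => lowerPart (χ x)) p)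
    (halfDirac M Q (-(m * A M Q p.1) + q * Q / p.1) (fun x => lowerPart (χ x))
      (fun x => upperPart (χ x)) p)

theorem continuousOn_cartDirac (m q : ℝ) (hχ : ContDiff ℝ 1 χ) :
    ContinuousOn (cartDirac M Q m q χ) (Set.Ioi 0 ×ˢ Set.univ) := by
  have hu := contDiff_upperPart hχ
  have hl := contDiff_lowerPart hχ
  have hA : ContinuousOn (fun r => m * A M Q r) (Set.Ioi 0) :=
    continuousOn_const.mul (continuousOn_A M Q)
  have hq : ContinuousOn (fun r : ℝ => q * Q / r) (Set.Ioi 0) :=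
    continuousOn_const.div continuousOn_id fun r hr => ne_of_gt hr
  exact continuous_ofParts.comp_continuousOn
    ((continuousOn_halfDirac M Q hu hl (hA.add hq)).prodMk
      (continuousOn_halfDirac M Q hl hu (hA.neg.add hq)))

omit hMQ in
theorem ae_diracH_eq (m q : ℝ) (hχ : ContDiff ℝ 1 χ) :
    diracH M Q m q (sphericalField χ)
      =ᵐ[spaceMeasure M Q] fun p => toSpherical p.2 (cartDirac M Q m q χ p) := by
  have e2 := (Measure.quasiMeasurePreserving_snd (μ := radialMeasure M Q)
    (ν := sphereMeasure)).ae ae_mem_angRect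
  filter_upwards [e2] with p hp
  exact diracH_sphericalField M Q m q hχ p.1 (sin_pos_of_mem_angRect hp).ne'

omit hMQ in
theorem toSpherical_zero (ω : ℝ × ℝ) : toSpherical ω 0 = 0 := by
  rw [← norm_eq_zero, norm_toSpherical, norm_zero]

omit hMQ in
theorem continuousOn_toSpherical {X : Type*} [TopologicalSpace X] {f : X → ℝ × ℝ} {v : X → Spinor}
    {s : Set X} (hf : ContinuousOn f s) (hv : ContinuousOn v s) :
    ContinuousOn (fun x => toSpherical (f x) (v x)) s :=
  Continuous.comp_continuousOn (g := fun p : (ℝ × ℝ) × Spinor => toSpherical p.1 p.2)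
    (f := fun x => (f x, v x)) continuous_toSpherical (hf.prodMk hv)

theorem memLp_sphericalField (hχ : IsTestSpinor χ) :
    MemLp (sphericalField χ) 2 (spaceMeasure M Q) := by
  obtain ⟨δ, R, hδ, h⟩ := hχ.exists_annulus
  have hc : ContinuousOn (sphericalField χ) (Set.Ioi 0 ×ˢ Set.univ) :=
    continuousOn_toSpherical continuousOn_snd
      (hχ.contDiff_one.continuous.comp continuous_cartesian).continuousOn
  refine memLp_of_continuousOn M Q (R := R) hδ hc fun r ω hr hn => ?_
  rw [sphericalField, image_eq_zero_of_notMem_tsupport (h r ω hr hn), toSpherical_zero]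

theorem memLp_diracH (m q : ℝ) (hχ : IsTestSpinor χ) :
    MemLp (diracH M Q m q (sphericalField χ)) 2 (spaceMeasure M Q) := by
  obtain ⟨δ, R, hδ, h⟩ := hχ.exists_annulus
  refine (MemLp.ae_eq (ae_diracH_eq M Q m q hχ.contDiff_one).symm ?_)
  have hc := continuousOn_toSpherical continuousOn_snd
    (continuousOn_cartDirac M Q m q hχ.contDiff_one)
  refine memLp_of_continuousOn M Q (R := R) hδ hc fun r ω hr hn => ?_
  have hs := h r ω hr hn
  have h0 : cartDirac M Q m q χ (r, ω) = 0 := by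
    rw [cartDirac, halfDirac_eq_zero M Q (upperPart_notMem hs) (lowerPart_notMem hs),
      halfDirac_eq_zero M Q (lowerPart_notMem hs) (upperPart_notMem hs)]
    ext i
    fin_cases i <;> rfl
  simp only [h0, toSpherical_zero]

/-- The angular coefficients of a field given by its Cartesian components. -/
theorem integral_inner_toSpherical (i : AngIndex × Bool) {v : ℝ × ℝ → Spinor} (hv : Continuous v) :
    ∫ ω, inner ℂ (basisField i ω) (toSpherical ω (v ω)) ∂sphereMeasure =
      if i.2 then -I * spinPair (spinHarm i.1) (fun ω => upperPart (v ω))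
      else spinPair (spinHarm i.1.neg) (fun ω => lowerPart (v ω)) := by
  have h := integral_inner_basisField i (fun ω => toSpherical ω (v ω)) fun j => by
    simp only [fromSpherical_toSpherical]
    refine integrable_sphereMeasure (integrableOn_angRect_of_continuous ?_)
    have : Continuous fun ω => v ω j := (EuclideanSpace.proj j : Spinor →L[ℂ] ℂ).continuous.comp hv
    fun_prop
  simp only [fromSpherical_toSpherical] at h
  exact h

/-- The channel functions of a field given by its Cartesian components. -/
theorem chan_ae_of_cartesian (i : AngIndex × Bool) {v : ℝ × (ℝ × ℝ) → Spinor}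
    (hv : ∀ r, 0 < r → Continuous fun ω => v (r, ω)) {ψ : OneParticle M Q}
    (hψ : ψ =ᵐ[spaceMeasure M Q] fun p => toSpherical p.2 (v p)) :
    chan M Q i ψ =ᵐ[halfLine] fun r => rwt M Q r *
      (if i.2 then -I * spinPair (spinHarm i.1) (fun ω => upperPart (v (r, ω)))
      else spinPair (spinHarm i.1.neg) (fun ω => lowerPart (v (r, ω)))) := by
  have h1 : ∀ᵐ r ∂halfLine, ∀ᵐ ω ∂sphereMeasure, ψ (r, ω) = toSpherical ω (v (r, ω)) :=
    halfLine_ac M Q (Measure.ae_ae_of_ae_prod hψ)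
  filter_upwards [chan_ae M Q i ψ, h1, ae_halfLine_pos] with r h2 h3 hr
  rw [h2, angCoeff, ← integral_inner_toSpherical i (hv r hr)]
  congr 1
  refine integral_congr_ae ?_
  filter_upwards [h3] with ω hω
  rw [hω]

end radial

section radial

variable (M Q : ℝ) [hMQ : Fact (M ^ 2 < Q ^ 2)]

/-- Test spinors satisfy the radial equations in each channel, with vanishing short-distance
coefficients. -/
theorem chanRel_of_isTestSpinor (m q : ℝ) {χ : EuclideanSpace ℝ (Fin 3) → Spinor}
    (hχ : IsTestSpinor χ) (σ : AngIndex) {ψ η : OneParticle M Q}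
    (hψ : ψ =ᵐ[spaceMeasure M Q] sphericalField χ)
    (hη : η =ᵐ[spaceMeasure M Q] diracH M Q m q (sphericalField χ)) :
    ChanRel M Q m q σ.kappa (chan M Q (σ, true) ψ) (chan M Q (σ, false) ψ)
      (chan M Q (σ, true) η) (chan M Q (σ, false) η) 0 0 := by
  have hc1 := hχ.contDiff_one
  have hu := contDiff_upperPart hc1
  have hl := contDiff_lowerPart hc1
  have hη' := hη.trans (ae_diracH_eq M Q m q hc1)
  have hcψ : ∀ r, 0 < r → Continuous fun ω => χ (cartesian (r, ω)) := fun r _ =>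
    hc1.continuous.comp (continuous_cartesian.comp (by fun_prop))
  have hcη : ∀ r, 0 < r → Continuous fun ω => cartDirac M Q m q χ (r, ω) := fun r hr =>
    (continuousOn_cartDirac M Q m q hc1).comp_continuous (by fun_prop) fun ω => ⟨hr, trivial⟩
  have cf := chan_ae_of_cartesian M Q (σ, true) (v := fun p => χ (cartesian p)) hcψ hψ
  have cg := chan_ae_of_cartesian M Q (σ, false) (v := fun p => χ (cartesian p)) hcψ hψ
  have cx := chan_ae_of_cartesian M Q (σ, true) hcη hη'
  have cy := chan_ae_of_cartesian M Q (σ, false) hcη hη'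
  have ex : ∀ r, (fun ω => upperPart (cartDirac M Q m q χ (r, ω)))
      = fun ω => halfDirac M Q (m * A M Q r + q * Q / r) (fun x => upperPart (χ x))
        (fun x => lowerPart (χ x)) (r, ω) := fun r => rfl
  have ey : ∀ r, (fun ω => lowerPart (cartDirac M Q m q χ (r, ω)))
      = fun ω => halfDirac M Q (-(m * A M Q r) + q * Q / r) (fun x => lowerPart (χ x))
        (fun x => upperPart (χ x)) (r, ω) := fun r => rfl
  have hκ : σ.neg.kappa = -σ.kappa := rfl
  simp only [if_true, Bool.false_eq_true, if_false, ex, ey, spinPair_halfDirac M Q _ _ hu hl,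
    spinPair_halfDirac M Q _ _ hl hu, AngIndex.neg_neg, hκ] at cf cg cx cy
  have da := hasDerivAt_spinPair σ (continuous_pullback hu)
    (continuous_fderiv_pullback hu continuous_frameR) (hasDerivAt_pullback_r hu)
  have db := hasDerivAt_spinPair σ.neg (continuous_pullback hl)
    (continuous_fderiv_pullback hl continuous_frameR) (hasDerivAt_pullback_r hl)
  obtain ⟨a, ha⟩ : ∃ a : ℝ → ℂ, ∀ r, spinPair (spinHarm σ)
      (fun ω => upperPart (χ (cartesian (r, ω)))) = a r := ⟨_, fun _ => rfl⟩
  obtain ⟨a', ha'⟩ : ∃ a' : ℝ → ℂ, ∀ r, spinPair (spinHarm σ)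
      (fun ω => fderiv ℝ (fun x => upperPart (χ x)) (cartesian (r, ω)) (frameR ω)) = a' r :=
    ⟨_, fun _ => rfl⟩
  obtain ⟨b, hb⟩ : ∃ b : ℝ → ℂ, ∀ r, spinPair (spinHarm σ.neg)
      (fun ω => lowerPart (χ (cartesian (r, ω)))) = b r := ⟨_, fun _ => rfl⟩
  obtain ⟨b', hb'⟩ : ∃ b' : ℝ → ℂ, ∀ r, spinPair (spinHarm σ.neg)
      (fun ω => fderiv ℝ (fun x => lowerPart (χ x)) (cartesian (r, ω)) (frameR ω)) = b' r :=
    ⟨_, fun _ => rfl⟩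
  simp only [ha, ha', hb, hb'] at cf cg cx cy da db
  have hI := Complex.I_sq
  constructor
  · refine halfRel_of_hasDerivAt M Q (v := fun r => -I * a r) (v' := fun r => -I * a' r)
      (fun r => (da r).const_mul (-I)) (memLp_srcU M Q m q (Lp.memLp _) (Lp.memLp _)) cf ?_
    filter_upwards [cg, cy, ae_halfLine_pos] with r h1 h2 hr
    have hρ := Complex.ofReal_ne_zero.mpr (rho_pos M Q r).ne'
    have hr' := Complex.ofReal_ne_zero.mpr hr.ne'
    rw [srcU, h1, h2, rwt_eq M Q hr, A_eq M Q hr, bfun]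
    push_cast
    field_simp
    ring
  · refine halfRel_of_hasDerivAt M Q (v := b) (v' := b') db
      (memLp_srcL M Q m q (Lp.memLp _) (Lp.memLp _)) cg ?_
    filter_upwards [cf, cx, ae_halfLine_pos] with r h1 h2 hr
    have hρ := Complex.ofReal_ne_zero.mpr (rho_pos M Q r).ne'
    have hr' := Complex.ofReal_ne_zero.mpr hr.ne'
    rw [srcL, h1, h2, rwt_eq M Q hr, A_eq M Q hr, bfun]
    push_cast
    field_simp
    ring_nf
    simp only [hI]
    ring

theorem not_isBlockDiagonal_ibcHamiltonian (m q : ℝ) (σ₀ : AngIndex) (g : ℂ) (a₁ a₂ a₃ a₄ : ℝ)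
    (hg : g ≠ 0) (ha : a₁ * a₄ - a₂ * a₃ = 1) :
    ¬ IsBlockDiagonal (ibcHamiltonian M Q m q σ₀ g a₁ a₂ a₃ a₄) := by
  rintro ⟨F₀, F₁, hdom, -⟩
  have hopen : IsOpen {Ψ : Fock M Q | Ψ.fst ≠ 0} := by
    have hc : Continuous fun Ψ : Fock M Q => Ψ.fst := by fun_prop
    exact isOpen_ne_fun hc continuous_const
  obtain ⟨Ψ, h1, hΨ⟩ := (dense_domain_ibcHamiltonian M Q m q σ₀ g a₁ a₂ a₃ a₄ hg ha
    ).exists_mem_open hopen ⟨WithLp.toLp 2 (1, 0), one_ne_zero⟩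
  -- If the domain were a product, the vector `(Ψ⁰, 0)` would lie in it; but its short-distance
  -- coefficients vanish, contrary to the interior-boundary condition.
  have hX : WithLp.toLp 2 (Ψ.fst, 0) ∈ (ibcHamiltonian M Q m q σ₀ g a₁ a₂ a₃ a₄).domain :=
    (hdom _).mpr ⟨((hdom Ψ).mp h1).1, F₁.domain.zero_mem⟩
  have hG := LinearPMap.mem_graph _ (⟨_, hX⟩ : (ibcHamiltonian M Q m q σ₀ g a₁ a₂ a₃ a₄).domain)
  rw [ibcHamiltonian_graph] at hG
  obtain ⟨p, n, hrel, -, hB⟩ := hG σ₀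
  have hz : ∀ i, chan M Q i (0 : OneParticle M Q) =ᵐ[halfLine] fun _ => (0 : ℂ) := by
    intro i
    rw [map_zero]
    exact Lp.coeFn_zero _ _ _
  have h3 := hrel.congr (hz _) (hz _) Filter.EventuallyEq.rfl Filter.EventuallyEq.rfl
  have m0 : MemLp (fun _ : ℝ => (0 : ℂ)) 2 halfLine := MemLp.zero'
  have hp := (h3.upper.eq_zero (memLp_srcU M Q m q m0 (Lp.memLp _))).1
  have hn := (h3.lower.eq_zero (memLp_srcL M Q m q m0 (Lp.memLp _))).1
  have h4 := (hB rfl).1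
  rw [hp, hn, mul_zero, mul_zero, add_zero] at h4
  exact mul_ne_zero hg hΨ h4.symm

end radial

end

end SRN

theorem mainTheorem2 (M Q m q : ℝ) (hM : 0 ≤ M) (hQ : M < |Q|) (hm : 0 ≤ m)
    (σ₀ : SRN.AngIndex) (g : ℂ) (hg : g ≠ 0)
    (a₁ a₂ a₃ a₄ : ℝ) (ha : a₁ * a₄ - a₂ * a₃ = 1) :
    ∃ H : SRN.Fock M Q →ₗ.[ℂ] SRN.Fock M Q,
      IsSelfAdjoint H ∧
      (∀ Ψ : H.domain, ∃ (cMinus : ℂ) (cPlus : SRN.AngIndex → ℂ),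
        SRN.HasShortDistance M Q σ₀ (Ψ : SRN.Fock M Q).snd cMinus cPlus ∧
        (∀ (dMinus : ℂ) (dPlus : SRN.AngIndex → ℂ),
          SRN.HasShortDistance M Q σ₀ (Ψ : SRN.Fock M Q).snd dMinus dPlus →
            dMinus = cMinus ∧ dPlus = cPlus) ∧
        (a₁ : ℂ) * cMinus + (a₂ : ℂ) * cPlus σ₀ = g * (Ψ : SRN.Fock M Q).fst ∧
        (H Ψ).fst = (starRingEnd ℂ) g * ((a₃ : ℂ) * cMinus + (a₄ : ℂ) * cPlus σ₀)) ∧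
      (∀ χ : EuclideanSpace ℝ (Fin 3) → SRN.Spinor, SRN.IsTestSpinor χ →
        ∃ Ψ : H.domain,
          (Ψ : SRN.Fock M Q).fst = 0 ∧
          (Ψ : SRN.Fock M Q).snd =ᵐ[SRN.spaceMeasure M Q] SRN.sphericalField χ ∧
          (H Ψ).fst = 0 ∧
          (H Ψ).snd =ᵐ[SRN.spaceMeasure M Q]
            SRN.diracH M Q m q (SRN.sphericalField χ)) ∧
      ¬ SRN.IsBlockDiagonal H := by
  have : Fact (M ^ 2 < Q ^ 2) := ⟨sq_lt_sq.mpr (by rwa [abs_of_nonneg hM])⟩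
  refine ⟨SRN.ibcHamiltonian M Q m q σ₀ g a₁ a₂ a₃ a₄,
    SRN.isSelfAdjoint_ibcHamiltonian M Q m q σ₀ g a₁ a₂ a₃ a₄ hg ha, fun Ψ => ?_, fun χ hχ => ?_,
    SRN.not_isBlockDiagonal_ibcHamiltonian M Q m q σ₀ g a₁ a₂ a₃ a₄ hg ha⟩
  · have hG := LinearPMap.mem_graph _ Ψ
    rw [SRN.ibcHamiltonian_graph] at hG
    choose p n hrel hB using hG
    have hS := SRN.hasShortDistance_of_chanRel M Q m q σ₀ _ _ p n hrel fun σ hσ => (hB σ).1 hσ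
    exact ⟨n σ₀, p, hS, fun d dp hd => hS.unique hd, (hB σ₀).2 rfl⟩
  · have mψ := SRN.memLp_sphericalField M Q hχ
    have mη := SRN.memLp_diracH M Q m q hχ
    have hG : ((WithLp.toLp 2 (0, mψ.toLp _), WithLp.toLp 2 (0, mη.toLp _)) :
        SRN.Fock M Q × SRN.Fock M Q) ∈ (SRN.ibcHamiltonian M Q m q σ₀ g a₁ a₂ a₃ a₄).graph := by
      rw [SRN.ibcHamiltonian_graph]
      exact fun σ => ⟨0, 0, SRN.chanRel_of_isTestSpinor M Q m q hχ σ mψ.coeFn_toLp mη.coeFn_toLp,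
        fun _ => rfl, fun _ => ⟨by simp, by simp⟩⟩
    obtain ⟨Ψ, h1, h2⟩ := LinearPMap.mem_graph_iff _ |>.mp hG
    refine ⟨Ψ, ?_, ?_, ?_, ?_⟩
    · exact congrArg WithLp.fst h1
    · rw [h1]
      exact mψ.coeFn_toLp
    · exact congrArg WithLp.fst h2
    · rw [h2]
      exact mη.coeFn_toLp
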